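/- **Conventions.** $L$ is a relational language with countably many symbols, numbered injectively by natural numbers; all relations are symmetric. For a finite structure $A$ put $\delta(A)=|A|-\sum_{R\in L}\#R(A)$, where $\#R(A)$ is the number of occurrences of $R$ on $A$ (tuples up to permutation); for finite $A\subseteq C$ write $A\le C$ if $\delta(A)\le\delta(D)$ for all finite $D$ with $A\subseteq D\subseteq C$, and $d_C(A)=\min\{\delta(D): A\subseteq D\subseteq C,\ D\text{ finite}\}$. $\mathcal C_0$ is the class of structures all of whose finite subsets have $\delta\ge 0$. A nonempty finite set $B$ disjoint from the finite set $A$ is *simply algebraic* over $A$ if $A\le A\cup B$, $\delta(A\cup B)=\delta(A)$ and $\delta(A\cup B')\neq\delta(A)$ for every nonempty proper $B'\subset B$; *minimally* so if moreover it is not simply algebraic over any proper subset of $A$. The relative type of $B$ over $A$ is the set of relations holding on tuples of $A\cup B$ not contained in $A$. $B'/A'$ is *of the form of* $B/A$ if, under a bijection taking $A$ to $A'$ and $B$ to $B'$, $A'$ is isomorphic to $A$ and the relative type of $B'/A'$ contains that of $B/A$. $g_C(A)$ is the least $m$ such that some $X$ with $A\subseteq X\subseteq C$, $|X|\le|A|+m$,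 has smaller predimension than $A$ when only the first $m$ relations (those numbered below $m$) are counted, and $\infty$ if there is none. Let $\mu$ assign to each minimally simply algebraic extension $B$ of $A$ and each $m\in\omega\cup\{\infty\}$ a natural number $\mu(A,B,m)\ge\delta(A)$, such that for each relative type there is a finite sublanguage $L'$ for which $\mu$ depends only on the relative type, the $L'$-type of $A$, and $m$; and such that $\mu(A,B,m)=\mu(A,B,\infty)$ for all large $m<\infty$. Let $\zeta$ be a property axiomatized by universal sentences and preserved by free joins. $\mathcal C^\zeta_\mu$ is the class of finite $C\in\mathcal C_0$ satisfying $\zeta$ such that whenever $A,B^1,\dots,B^r\subseteq C$ are disjoint and all $B^i/A$ are of the form of $Y/X$, with one common identification of $A$ with $X$, then $r\le\mu(X,Y,g_C(A))$. A *generic model* $M$ for $\mathcal C^\zeta_\mu$ is a countable structure in $\mathcal C_0$ such that every finite $A\le M$ is in $\mathcal C^\zeta_\mu$, and whenever $B\le M$ is finite and $B\le C\in\mathcal C^\zeta_\mu$, there is an embedding $f:C\to M$ over $B$ with $f(C)\le M$. For a closure operator $\mathrm{cl}$, $\dim S$ is the least size of a finite generating subset of $S$. $\mathrm{cl}$ is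 *flat* if for every finite family $(E_i)_{i\in I}$ of finite-dimensional closed sets $\sum_{s\subseteq I}(-1)^{|s|}\dim E_s\le0$, where $E_s=\bigcap_{i\in s}E_i$ for $s\ne\emptyset$ and $E_\emptyset=\bigcup_{i\in I} E_i$. It is *disintegrated* if $\mathrm{cl}(A)=\bigcup_{a\in A}\mathrm{cl}(\{a\})$ for all nonempty $A$. A theory is flat (disintegrated) if $\mathrm{acl}$ is so in every model. **(1) Generic models.** Let $M$ be a generic model for $\mathcal C_\mu^\zeta$. The acl-geometry of $M$ is given by $d=d_M$: for finite $A\subseteq M$ and $x\in M$, $x\in\mathrm{acl}(A)$ iff $d(A\cup\{x\})=d(A)$, and $\dim A=d(A)$. The acl-geometry of $M$ is flat. If $L$ is finite or $\zeta$ is axiomatized by a single universal sentence, then $\mathrm{Th}(M)$ is flat. If $L$ has a ternary symbol $R$ such that the three-element structure with a single occurrence of $R$ and no other relation lies in $\mathcal C^\zeta_\mu$, then the acl-geometry of $M$, and hence $\mathrm{Th}(M)$, is not disintegrated. **(2) The theory $T$.** Let $n\ge0$, and let $e:\mathbb N\to\mathbb N$ be a computable injective enumeration of a set $S_1$ all of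 whose columns $S_1^{[i]}=\{j:\langle i,j\rangle\in S_1\}$ have at least two elements. $S_0^{[i]}$ consists of the elements of $S_1^{[i]}$ after which at least two more elements of the column are enumerated. Let $\hat L=\{R\}\cup\{R_i: S_0^{[i]}\ne S_1^{[i]}\}$ with $R$ ternary and $R_i$ $(n+2)$-ary, the symbols being numbered compatibly with the order $R,R_0,R_1,\dots$. For $R_i\in\hat L$ let $j_0,j_1$ be the two elements of $S_1^{[i]}\setminus S_0^{[i]}$, $j_0$ enumerated first. Let $\zeta$ say that relations hold only on tuples of distinct elements and that no relation holds on a subtuple of a tuple on which another relation holds. Fix distinct integers $t_k\ge\max(4,n+3)$, $k\in\mathbb N$, and let $\Omega_k$ be the following relative type, over a base of size $n+2$, in the relation $R$ only. If $n\ge1$: the base is $a_1,\dots,a_{n+1},g$, the new points are $b_1,\dots,b_{2t}$ with $t=t_k$, and the edges are $\{b_i,a_i,b_{i+1}\}$ for $1\le i<2t$ (the index of $a_i$ read modulo $n+1$) and $\{b_{2t},g,b_1\}$. If $n=0$: the points are $a_1,\dots,a_t$ with $t=t_k$, the base is $\{a_1,a_t\}$ and the edges are $\{a_i,a_{i+1},a_{i+2}\}$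 for $1\le i\le t-2$. Let $\mu(A,B,m)=|A|+4$ if, for some $i$, - $B/A$ is an $\Omega_{\langle i,j_0\rangle}$-extension and $R_i(A)$; or - $B/A$ is an $\Omega_{\langle i,j_1\rangle}$-extension, $R_i(A)$, and $m\ge\langle i,j_1\rangle$; or - $B/A$ is an $\Omega_{\langle i,j\rangle}$-extension with $j\in S_0^{[i]}$; and $\mu(A,B,m)=|A|+3$ otherwise. Let $\hat M$ be the generic model for $\mathcal C^\zeta_\mu$ in the language $\hat L$, $M$ its reduct to $\{R\}$, and $T=\mathrm{Th}(M)$. Then $\hat M$ is a definitional expansion of $M$ (each $R_i$ is definable in $M$ without parameters); the acl-geometry of $M$ is given, as in (1), by the function $d$ of $\hat M$; it is flat and not disintegrated; $T$ is not disintegrated; and if $n\ge1$ or $\hat L$ is finite, then $T$ is flat. -/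

import Mathlib

open FirstOrder FirstOrder.Language

namespace HrushovskiGeneric

/-! ### Geometry of algebraic closure -/

/-- Model-theoretic algebraic closure: `x` lies in a finite set definable with parameters in `A`. -/
def acl (L : FirstOrder.Language.{0, 0}) {N : Type*} [L.Structure N] (A : Set N) : Set N :=
  {x | ∃ S : Set N, A.Definable₁ L S ∧ S.Finite ∧ x ∈ S}

/-- `S` has a finite generating subset. -/
def FinDim {N : Type*} (cl : Set N → Set N) (S : Set N) : Prop :=
  ∃ A : Set N, A.Finite ∧ A ⊆ S ∧ S ⊆ cl A

/-- The dimension of `S` (for `S` with `FinDim cl S`): the least size of a finite subset of `S`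
generating all of `S`; in a pregeometry this is the size of any basis of `S`. -/
noncomputable def dim {N : Type*} (cl : Set N → Set N) (S : Set N) : ℕ :=
  sInf {n | ∃ A : Set N, A.Finite ∧ A ⊆ S ∧ S ⊆ cl A ∧ A.ncard = n}

/-- `E_s`: the intersection of the `E i`, `i ∈ s`, for nonempty `s`, and the union of all `E i`
for `s = ∅`. -/
def flatPart {N : Type*} {k : ℕ} (E : Fin k → Set N) (s : Finset (Fin k)) : Set N :=
  {x | (∀ i ∈ s, x ∈ E i) ∧ (s = ∅ → ∃ i, x ∈ E i)}

/-- Flatness: for every finite family of finite-dimensional closed sets,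
`∑_s (-1)^|s| dim E_s ≤ 0`. -/
def Flat {N : Type*} (cl : Set N → Set N) : Prop :=
  ∀ (k : ℕ) (E : Fin k → Set N), (∀ i, cl (E i) = E i ∧ FinDim cl (E i)) →
    ∑ s : Finset (Fin k), (-1 : ℤ) ^ s.card * (dim cl (flatPart E s) : ℤ) ≤ 0

/-- Disintegrated: `cl A = ⋃_{a ∈ A} cl {a}` for every nonempty `A`. -/
def Disintegrated {N : Type*} (cl : Set N → Set N) : Prop :=
  ∀ A : Set N, A.Nonempty → cl A = ⋃ a ∈ A, cl {a}

/-- A theory is flat if the acl-geometry of each of its models is flat. -/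
def FlatTheory.{w} {L : FirstOrder.Language.{0, 0}} (T : L.Theory) : Prop :=
  ∀ (N : Type w) [L.Structure N], N ⊨ T → Flat (acl L (N := N))

/-- A theory is disintegrated if the acl-geometry of each of its models is disintegrated. -/
def DisintegratedTheory.{w} {L : FirstOrder.Language.{0, 0}} (T : L.Theory) : Prop :=
  ∀ (N : Type w) [L.Structure N], N ⊨ T → Disintegrated (acl L (N := N))

/-! ### Predimension -/

/-- The relation symbols of a language. -/
abbrev RelSym (L : FirstOrder.Language.{0, 0}) : Type := Σ k, L.Relations k

section Predim

variable {L : FirstOrder.Language.{0, 0}} {V : Type*} [L.Structure V]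

/-- The occurrences on `A` of the relations in `P`; an occurrence is a symbol together with a
tuple up to permutation. -/
def occ (P : Set (RelSym L)) (A : Set V) : Set (RelSym L × Multiset V) :=
  {p | p.1 ∈ P ∧ ∃ x : Fin p.1.1 → V, Structure.RelMap p.1.2 x ∧ (∀ i, x i ∈ A) ∧
    p.2 = Finset.univ.val.map x}

/-- The predimension of the finite set `A`, counting only relations in `P`
(meaningful when `occ P A` is finite). -/
noncomputable def predim (P : Set (RelSym L)) (A : Set V) : ℤ :=
  (A.ncard : ℤ) - ((occ P A).ncard : ℤ)

variable (L)

/-- The predimension `δ(A)` of a finite set `A`. -/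
noncomputable def delta (A : Set V) : ℤ := predim (Set.univ : Set (RelSym L)) A

/-- The finite set `A` is strong (self-sufficient) in the ambient structure. -/
def Strong (A : Set V) : Prop :=
  ∀ D : Set V, D.Finite → A ⊆ D → delta L A ≤ delta L D

/-- `d(A)`: the least predimension of a finite set containing `A`. -/
noncomputable def dfun (A : Set V) : ℤ :=
  sInf {z : ℤ | ∃ D : Set V, D.Finite ∧ A ⊆ D ∧ delta L D = z}

variable (V)

/-- All relations are symmetric. -/
def Symmetric : Prop :=
  ∀ (r : RelSym L) (x : Fin r.1 → V) (σ : Equiv.Perm (Fin r.1)),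
    Structure.RelMap r.2 x → Structure.RelMap r.2 (x ∘ σ)

/-- The class `C₀` : every finite subset has nonnegative predimension (so, in particular, only
finitely many occurrences of relations). -/
def InC0 : Prop :=
  Symmetric L V ∧ ∀ A : Set V, A.Finite →
    (occ (Set.univ : Set (RelSym L)) A).Finite ∧ 0 ≤ delta L A

variable {V}

/-- `B` is simply algebraic over `A`, for finite sets `A`, `B`. -/
def SimplyAlgebraic (A B : Set V) : Prop :=
  B.Nonempty ∧ Disjoint A B ∧
  (∀ D, A ⊆ D → D ⊆ A ∪ B → delta L A ≤ delta L D) ∧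
  delta L (A ∪ B) = delta L A ∧
  ∀ B' ⊂ B, B'.Nonempty → delta L (A ∪ B') ≠ delta L A

/-- `B` is minimally simply algebraic over `A`. -/
def MinSimplyAlgebraic (A B : Set V) : Prop :=
  SimplyAlgebraic L A B ∧ ∀ A' ⊂ A, ¬ SimplyAlgebraic L A' B

end Predim

/-- The structure induced on a subset. -/
instance inducedOn {L : FirstOrder.Language.{0, 0}} [L.IsRelational] {V : Type*} [L.Structure V]
    (S : Set V) : L.Structure S where
  funMap f := isEmptyElim f
  RelMap r x := Structure.RelMap r (fun i => (x i : V))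

/-! ### Extensions and the function `μ` -/

/-- A pair `A ⊆ B` of finite structures; every such pair is isomorphic to one on some `Fin size`. -/
structure Ext (L : FirstOrder.Language.{0, 0}) where
  size : ℕ
  str : L.Structure (Fin size)
  base : Set (Fin size)

namespace Ext

variable {L : FirstOrder.Language.{0, 0}}

/-- `r` holds of `x` in the larger structure of the pair. -/
def Rel (E : Ext L) (r : RelSym L) (x : Fin r.1 → Fin E.size) : Prop :=
  @Structure.RelMap L (Fin E.size) E.str r.1 r.2 x

/-- `A ⊆ B` is a minimally simply algebraic extension. -/
def IsMSA (E : Ext L) : Prop :=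
  letI := E.str
  Symmetric L (Fin E.size) ∧
  (occ (Set.univ : Set (RelSym L)) (Set.univ : Set (Fin E.size))).Finite ∧
  MinSimplyAlgebraic L E.base E.baseᶜ

/-- `δ(A)` for the pair `A ⊆ B`. -/
noncomputable def deltaBase (E : Ext L) : ℤ :=
  letI := E.str
  delta L E.base

/-- Along the bijection `σ`, the two pairs have the same relative quantifier-free type:
the same relations hold on tuples not contained in the base. -/
def SameRelType (E E' : Ext L) (σ : Fin E.size ≃ Fin E'.size) : Prop :=
  (∀ v, v ∈ E.base ↔ σ v ∈ E'.base) ∧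
  ∀ (r : RelSym L) (x : Fin r.1 → Fin E.size), (¬ ∀ i, x i ∈ E.base) →
    (E.Rel r x ↔ E'.Rel r (σ ∘ x))

end Ext

/-- The requirements on the function `μ(A, B, m)`. -/
structure IsMu {L : FirstOrder.Language.{0, 0}} (μ : Ext L → ℕ∞ → ℕ) : Prop where
  lower : ∀ E : Ext L, E.IsMSA → ∀ m, E.deltaBase ≤ (μ E m : ℤ)
  /-- For each relative type there is a finite sublanguage `P` such that `μ` depends only on the
  relative type and on the `P`-type of the base. -/
  uniform : ∀ E₀ : Ext L, E₀.IsMSA → ∃ P : Set (RelSym L), P.Finite ∧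
    ∀ E₁ E₂ : Ext L, E₁.IsMSA → E₂.IsMSA →
      ∀ (σ₁ : Fin E₀.size ≃ Fin E₁.size) (σ₂ : Fin E₀.size ≃ Fin E₂.size),
        E₀.SameRelType E₁ σ₁ → E₀.SameRelType E₂ σ₂ →
        (∀ r ∈ P, ∀ x : Fin r.1 → Fin E₀.size, (∀ i, x i ∈ E₀.base) →
          (E₁.Rel r (σ₁ ∘ x) ↔ E₂.Rel r (σ₂ ∘ x))) →
        ∀ m, μ E₁ m = μ E₂ m
  limit : ∀ E : Ext L, E.IsMSA → ∀ᶠ m : ℕ in Filter.atTop, μ E m = μ E ⊤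

/-- `g(A)`: the least `m` such that some `X ⊇ A` of size at most `|A| + m` has smaller predimension
than `A` when only the first `m` relations (those `r` with `idx r < m`) are counted; `⊤` if there is
no such `m`. -/
noncomputable def gfun {L : FirstOrder.Language.{0, 0}} (idx : RelSym L → ℕ) {V : Type*} [L.Structure V]
    (A : Set V) : ℕ∞ :=
  sInf {n : ℕ∞ | ∃ m : ℕ, n = (m : ℕ∞) ∧ ∃ X : Set V, X.Finite ∧ A ⊆ X ∧
    X.ncard ≤ A.ncard + m ∧ predim {r | idx r < m} X < predim {r | idx r < m} A}

/-- `F 0, …, F (r-1)` exhibit disjoint sets `B¹, …, Bʳ` such that each `Bⁱ` over `A` is of the form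
of the extension `E`, where `A` is the common image of the base: on the base the full
quantifier-free type is preserved, and every relation of the relative type of `E` is preserved. -/
def OfForm {L : FirstOrder.Language.{0, 0}} {V : Type*} [L.Structure V] (E : Ext L) (a : Fin E.size → V)
    {r : ℕ} (F : Fin r → Fin E.size → V) : Prop :=
  Set.InjOn a E.base ∧
  (∀ (s : RelSym L) (x : Fin s.1 → Fin E.size), (∀ i, x i ∈ E.base) →
    (Structure.RelMap s.2 (a ∘ x) ↔ E.Rel s x)) ∧
  (∀ j, Function.Injective (F j)) ∧
  (∀ j, ∀ v ∈ E.base, F j v = a v) ∧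
  (∀ j (s : RelSym L) (x : Fin s.1 → Fin E.size), (¬ ∀ i, x i ∈ E.base) →
    E.Rel s x → Structure.RelMap s.2 (F j ∘ x)) ∧
  (∀ j j', j ≠ j' → ∀ v ∉ E.base, ∀ v' ∉ E.base, F j v ≠ F j' v')

/-- A property of structures. -/
abbrev StrProp (L : FirstOrder.Language.{0, 0}) : Type 1 := ∀ (V : Type) [L.Structure V], Prop

/-- The amalgamation class `C_μ^ζ`, for a property `Z` in the role of `ζ`. -/
structure InClass {L : FirstOrder.Language.{0, 0}} (idx : RelSym L → ℕ) (μ : Ext L → ℕ∞ → ℕ) (Z : StrProp L)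
    (V : Type) [L.Structure V] : Prop where
  finite : Finite V
  inC0 : InC0 L V
  bound : ∀ E : Ext L, E.IsMSA → ∀ (a : Fin E.size → V) (r : ℕ) (F : Fin r → Fin E.size → V),
    OfForm E a F → r ≤ μ E (gfun idx (a '' E.base))
  zeta : Z V

/-- `Z` is axiomatized by universal sentences. -/
def UniversallyAxiomatizable {L : FirstOrder.Language.{0, 0}} (Z : StrProp L) : Prop :=
  ∃ T : L.Theory, T.IsUniversal ∧ ∀ (V : Type) [L.Structure V], Z V ↔ V ⊨ T

/-- `Z` is axiomatized by a single universal sentence. -/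
def UniversalSentence {L : FirstOrder.Language.{0, 0}} (Z : StrProp L) : Prop :=
  ∃ σ : L.Sentence, BoundedFormula.IsUniversal σ ∧
    ∀ (V : Type) [L.Structure V], Z V ↔ V ⊨ σ

/-- `Z` is preserved by free joins: if `V` is the union of `B₁` and `B₂` and every relation holding
in `V` holds inside `B₁` or inside `B₂`, then `Z` passes from `B₁` and `B₂` to `V`. -/
def PreservedByFreeJoins {L : FirstOrder.Language.{0, 0}} [L.IsRelational] (Z : StrProp L) : Prop :=
  ∀ (V : Type) [L.Structure V] [Finite V], Symmetric L V → ∀ B₁ B₂ : Set V, B₁ ∪ B₂ = Set.univ →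
    (∀ (r : RelSym L) (x : Fin r.1 → V), Structure.RelMap r.2 x →
      (∀ i, x i ∈ B₁) ∨ (∀ i, x i ∈ B₂)) →
    Z B₁ → Z B₂ → Z V

/-- `M` is a generic model for the class `C_μ^ζ`; these properties determine `M` up to
isomorphism. -/
structure IsGeneric {L : FirstOrder.Language.{0, 0}} [L.IsRelational] (idx : RelSym L → ℕ)
    (μ : Ext L → ℕ∞ → ℕ) (Z : StrProp L) (M : Type) [L.Structure M] : Prop where
  countable : Countable M
  inC0 : InC0 L M
  mem : ∀ A : Set M, A.Finite → Strong L A → InClass idx μ Z A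
  extend : ∀ B : Set M, B.Finite → Strong L B →
    ∀ (C : Type) [L.Structure C], InClass idx μ Z C →
    ∀ j : B ↪[L] C, Strong L (Set.range j) →
      ∃ f : C ↪[L] M, (∀ b : B, f (j b) = b) ∧ Strong L (Set.range f)

/-- The three-element structure on which the only relation is one occurrence of the ternary
relation `R`. -/
abbrev singleEdge {L : FirstOrder.Language.{0, 0}} [L.IsRelational] (R : L.Relations 3) :
    L.Structure (Fin 3) where
  funMap f := isEmptyElim f
  RelMap {k} s x := (⟨k, s⟩ : RelSym L) = ⟨3, R⟩ ∧ Function.Injective x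

/-- In `M`, the geometry of the closure operator `cl` is given by the function `d` of the
`L`-structure `M`: the closure is determined by `d`, and `d` is the dimension. -/
def GeometryGivenByD (L : FirstOrder.Language.{0, 0}) {M : Type} [L.Structure M]
    (cl : Set M → Set M) : Prop :=
  (∀ (A : Set M) (x : M), A.Finite → (x ∈ cl A ↔ dfun L (insert x A) = dfun L A)) ∧
  ∀ A : Set M, A.Finite → (dim cl A : ℤ) = dfun L A

/-! ### The particular theory `T` -/

/-- The columns `S₁^{[i]}` of the set `S₁` enumerated by `e`. -/
def S1 (e : ℕ → ℕ) (i : ℕ) : Set ℕ := {j | ∃ s, e s = Nat.pair i j}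

/-- The columns `S₀^{[i]}`: everything in `S₁^{[i]}` but the last two elements enumerated,
that is, the elements after which at least two more elements enter the column. -/
def S0 (e : ℕ → ℕ) (i : ℕ) : Set ℕ :=
  {j | ∃ s t u j' j'', s < t ∧ t < u ∧
    e s = Nat.pair i j ∧ e t = Nat.pair i j' ∧ e u = Nat.pair i j''}

/-- `R_i` is limited away. -/
def LimitedAway (e : ℕ → ℕ) (i : ℕ) : Prop := S0 e i = S1 e i

/-- `j₀` and `j₁` are the two elements of `S₁^{[i]} ∖ S₀^{[i]}`, and `j₀` is enumerated first. -/
def LastTwo (e : ℕ → ℕ) (i j₀ j₁ : ℕ) : Prop :=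
  j₀ ∉ S0 e i ∧ j₁ ∉ S0 e i ∧
    ∃ s t, s < t ∧ e s = Nat.pair i j₀ ∧ e t = Nat.pair i j₁

/-- The arities in `{R} ∪ {R_i | i ∈ ℕ}`; `none` stands for `R` and `some i` for `R_i`. -/
def hatArity (n : ℕ) : Option ℕ → ℕ
  | none => 3
  | some _ => n + 2

/-- The language `{R} ∪ {R_i | R_i is not limited away}`. -/
def hatLang (n : ℕ) (e : ℕ → ℕ) : FirstOrder.Language.{0, 0} where
  Functions _ := Empty
  Relations k := {s : Option ℕ // hatArity n s = k ∧ ∀ i, s = some i → ¬ LimitedAway e i}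

instance (n : ℕ) (e : ℕ → ℕ) : (hatLang n e).IsRelational :=
  fun _ => inferInstanceAs (IsEmpty Empty)

/-- The language `{R}`, with `R` ternary. -/
def rLang : FirstOrder.Language.{0, 0} where
  Functions _ := Empty
  Relations k := PLift (3 = k)

instance : rLang.IsRelational := fun _ => inferInstanceAs (IsEmpty Empty)

/-- The inclusion of `{R}` in the larger language. -/
def rIncl (n : ℕ) (e : ℕ → ℕ) : rLang →ᴸ hatLang n e where
  onFunction {_} f := Empty.elim f
  onRelation {_} h := ⟨none, h.down, fun _ h' => by cases h'⟩

/-- The position of a symbol in the list `R, R_0, R_1, …`. -/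
def hatPos {n : ℕ} {e : ℕ → ℕ} (r : RelSym (hatLang n e)) : ℕ :=
  match r.2.1 with
  | none => 0
  | some i => i + 1

/-- No relation holds on a subtuple of a tuple on which another relation holds; and relations hold
only on tuples of distinct elements. -/
def hatZeta (n : ℕ) (e : ℕ → ℕ) : StrProp (hatLang n e) := fun V _ =>
  (∀ (u v : RelSym (hatLang n e)) (x : Fin u.1 → V) (y : Fin v.1 → V), u ≠ v →
    Structure.RelMap u.2 x → Set.range y ⊆ Set.range x → ¬ Structure.RelMap v.2 y) ∧
  ∀ (u : RelSym (hatLang n e)) (x : Fin u.1 → V), Structure.RelMap u.2 x → Function.Injective x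

/-- Edges of the extension with base `a_1, …, a_{n+1}, g` (`Sum.inl`, with `g` the last) and new
points `b_1, …, b_{2t}` (`Sum.inr`): the edges are `{b_i, a_i, b_{i+1}}`, the index of `a_i` being
read modulo `n + 1`, and `{b_{2t}, g, b_1}`. -/
def cycleEdge (n t : ℕ) (s : Set (Fin (n + 2) ⊕ Fin (2 * t))) : Prop :=
  (∃ (i : ℕ) (h : i + 1 < 2 * t),
    s = {Sum.inr ⟨i, by omega⟩,
      Sum.inl ⟨i % (n + 1), (Nat.mod_lt i n.succ_pos).trans (Nat.lt_succ_self _)⟩,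
      Sum.inr ⟨i + 1, h⟩}) ∨
  ∃ h : 0 < 2 * t,
    s = {Sum.inr ⟨2 * t - 1, by omega⟩, Sum.inl (Fin.last (n + 1)), Sum.inr ⟨0, h⟩}

/-- The position of a vertex in the path `a_1, …, a_t`, whose end points are `Sum.inl 0` and
`Sum.inl 1`. -/
def pathPos (t : ℕ) : Fin 2 ⊕ Fin (t - 2) → ℕ
  | Sum.inl i => if i = 0 then 0 else t - 1
  | Sum.inr j => j + 1

/-- Edges of the ternary `t`-path over its end points: any three consecutive vertices. -/
def pathEdge (t : ℕ) (s : Set (Fin 2 ⊕ Fin (t - 2))) : Prop :=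
  ∃ i : ℕ, i + 2 < t ∧
    s = {v | pathPos t v = i ∨ pathPos t v = i + 1 ∨ pathPos t v = i + 2}

/-- The relative quantifier-free type of the pair `E` over its base says exactly that `R` holds on
the edges of the given hypergraph on `P ⊕ Q`, whose base is `P`. -/
def HasRType {n : ℕ} {e : ℕ → ℕ} (E : Ext (hatLang n e)) {P Q : Type}
    (edge : Set (P ⊕ Q) → Prop) : Prop :=
  ∃ σ : Fin E.size ≃ P ⊕ Q, (∀ v, v ∈ E.base ↔ σ v ∈ Set.range Sum.inl) ∧
    ∀ (r : RelSym (hatLang n e)) (x : Fin r.1 → Fin E.size), (¬ ∀ i, x i ∈ E.base) →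
      (E.Rel r x ↔ r.2.1 = none ∧ Function.Injective x ∧ edge (Set.range (σ ∘ x)))

/-- `E` is an extension of the type with parameter `t` over a base of size `n + 2`: one of the
3-unblockable extensions on a cyclic pattern of `2t` new points if `n ≥ 1`, a ternary `t`-path
over its two end points if `n = 0`. -/
def IsOmega {n : ℕ} {e : ℕ → ℕ} (t : ℕ) (E : Ext (hatLang n e)) : Prop :=
  (n ≠ 0 ∧ HasRType E (cycleEdge n t)) ∨ (n = 0 ∧ HasRType E (pathEdge t))

/-- `R_i` belongs to the language and holds on the base of `E`. -/
def RiOnBase {n : ℕ} {e : ℕ → ℕ} (i : ℕ) (E : Ext (hatLang n e)) : Prop :=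
  ∃ (h : hatArity n (some i) = n + 2 ∧ ∀ i', some i = some i' → ¬ LimitedAway e i')
    (x : Fin (n + 2) → Fin E.size), Set.range x = E.base ∧
    E.Rel ⟨n + 2, ⟨some i, h⟩⟩ x

open scoped Classical in
/-- The function `μ` of the construction; `Ω_k` is the type with parameter `τ k`. -/
noncomputable def hatMu (n : ℕ) (e τ : ℕ → ℕ) (E : Ext (hatLang n e)) (m : ℕ∞) : ℕ :=
  if (∃ i j₀ j₁, LastTwo e i j₀ j₁ ∧ IsOmega (τ (Nat.pair i j₀)) E ∧ RiOnBase i E) ∨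
     (∃ i j₀ j₁, LastTwo e i j₀ j₁ ∧ IsOmega (τ (Nat.pair i j₁)) E ∧ RiOnBase i E ∧
        ((Nat.pair i j₁ : ℕ) : ℕ∞) ≤ m) ∨
     (∃ i j, j ∈ S0 e i ∧ IsOmega (τ (Nat.pair i j)) E)
  then E.base.ncard + 4 else E.base.ncard + 3

/-- The reduct of a structure to the language `{R}`. -/
abbrev rReduct (n : ℕ) (e : ℕ → ℕ) (M : Type) [(hatLang n e).Structure M] : rLang.Structure M :=
  (rIncl n e).reduct M

/-- The algebraic closure in the reduct to the language `{R}`. -/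
def aclReduct (n : ℕ) (e : ℕ → ℕ) (M : Type) [(hatLang n e).Structure M] : Set M → Set M :=
  letI := rReduct n e M
  acl rLang

/-- The theory `T` of the reduct to the language `{R}`. -/
def theoryReduct (n : ℕ) (e : ℕ → ℕ) (M : Type) [(hatLang n e).Structure M] : rLang.Theory :=
  letI := rReduct n e M
  rLang.completeTheory M

/-- `M` is a definitional expansion of its reduct to `{R}`: every relation of `M` is defined,
without parameters, by a formula in the language `{R}`. -/
def DefinitionalExpansion (n : ℕ) (e : ℕ → ℕ) (M : Type) [(hatLang n e).Structure M] : Prop :=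
  letI := rReduct n e M
  ∀ r : RelSym (hatLang n e), ∃ φ : rLang.Formula (Fin r.1),
    ∀ x : Fin r.1 → M, Structure.RelMap r.2 x ↔ φ.Realize x

end HrushovskiGeneric

universe w

/-! Everything reduces to one statement: algebraic closure is the closure given by `d`
(`StrongClass.givenByD`).

If `d(Ax) = d(A)`, then `x` is algebraic. Otherwise some finite `B` outside the algebraic closure,
minimal with `δ(K ∪ B) ≤ δ(K)` over a finite set `K` of algebraic points, has arbitrarily many
disjoint positive copies over `K`. If `δ` drops, enough copies make the predimension negative. If it
does not, `B` is minimally simply algebraic over a subset of `K`, and `μ` bounds the number of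
copies (`exists_mem_acl_of_delta_le`, `mem_acl_of_dfun_eq`).

If `x` raises `d`, it is not algebraic. A second copy of `x` can be joined freely to a strong hull
of any candidate finite definable set; the join stays in the class because the copy is one point
that raises `δ`. A new point then has the same type as `x` (`StrongClass.dfun_eq_of_mem_acl`).
Sameness of types comes from back and forth along finite strong subsets (`StrongClass.realize_iff`).

Given this, flatness is inclusion–exclusion. Finite-dimensional closed sets are replaced by finite
strong sets; for intersections `d` equals the number of points minus the number of occurrences, and
both alternating sums vanish. Only the union may carry additional occurrences, which lowers its
dimension (`GivenByD.flat`). A single edge on a strong triple gives three pairwise independent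
points of dimension 2, so the geometry is not disintegrated.

To reach all models of the theory, strong extensions must be realized in elementary extensions.
Strongness is not elementary, so it is approximated by `Nice p`, which sees finitely many relations
and boundedly many further points. For each `m` there is a `p` such that every `p`-nice map of the
base extends to an `m`-nice map of the extension (`Rich.exists_nice`). For primitive extensions,
either the free join is in the class and is realized, or it violates the bound, and then a positive
copy is already present and is nice by counting. For fixed `m` and `p` this is elementary, and an
ultrapower turns ever better approximations into a strong embedding (`exists_strong_of_nice`,
`Rich.strongClass_models`). The property `ζ` must pass to joins over bases that agree only
approximately (`JoinDetermined`); this holds if only finitely many symbols matter, and for the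
concrete `ζ` if `n ≥ 1`, by comparing arities.

In the concrete theory, `R_i(x)` holds exactly if there are `n + 6` disjoint copies over `x` of the
extension with index `⟨i, j₀⟩`. Without `R_i` the bound is `n + 5`. With `R_i`, a further copy can
be adjoined freely as long as there are fewer than `n + 6`: a violation over a base not inside the
old part would need more than three edges through a new point, and any other violation concerns the
adjoined extension itself, whose bound is `n + 6`. So each `R_i` is definable from `R`; a model of
`T` expands to a model of the theory of `M̂` with the same algebraic closure, and the general
results apply. -/

set_option linter.unusedSectionVars false
universe u

namespace HrushovskiGeneric

/-! ### Predimension, embeddings and strong sets. -/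

section Predimension

variable {L : FirstOrder.Language.{0, 0}} {V W : Type*} [L.Structure V] [L.Structure W]

/-- `p` is an occurrence of a relation. -/
def Holds (p : RelSym L × Multiset V) : Prop :=
  ∃ x : Fin p.1.1 → V, Structure.RelMap p.1.2 x ∧ p.2 = Finset.univ.val.map x

lemma mem_occ {P : Set (RelSym L)} {A : Set V} {p : RelSym L × Multiset V} :
    p ∈ occ P A ↔ p.1 ∈ P ∧ Holds p ∧ ∀ v ∈ p.2, v ∈ A := by
  unfold occ Holds
  constructor
  · rintro ⟨h, x, hx, hA, hp⟩
    refine ⟨h, ⟨x, hx, hp⟩, ?_⟩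
    rw [hp]
    simpa using hA
  · rintro ⟨h, ⟨x, hx, hp⟩, hA⟩
    refine ⟨h, x, hx, ?_, hp⟩
    rw [hp] at hA
    simpa using hA

lemma mem_occ_of_relMap {P : Set (RelSym L)} {A : Set V} {r : RelSym L} (hr : r ∈ P)
    {x : Fin r.1 → V} (h : Structure.RelMap r.2 x) (hA : ∀ i, x i ∈ A) :
    (r, Finset.univ.val.map x) ∈ occ P A :=
  ⟨hr, x, h, hA, rfl⟩

lemma occ_mono {P Q : Set (RelSym L)} (h : P ⊆ Q) {A B : Set V} (hAB : A ⊆ B) :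
    occ P A ⊆ occ Q B := by
  intro p
  simp only [mem_occ]
  exact fun ⟨h1, h2, h3⟩ => ⟨h h1, h2, fun v hv => hAB (h3 v hv)⟩

lemma occ_inter (P : Set (RelSym L)) (A B : Set V) : occ P (A ∩ B) = occ P A ∩ occ P B := by
  ext p
  simp only [mem_occ, Set.mem_inter_iff]
  constructor
  · exact fun ⟨h1, h2, h3⟩ => ⟨⟨h1, h2, fun v hv => (h3 v hv).1⟩, h1, h2, fun v hv => (h3 v hv).2⟩
  · exact fun ⟨⟨h1, h2, h3⟩, _, _, h4⟩ => ⟨h1, h2, fun v hv => ⟨h3 v hv, h4 v hv⟩⟩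

/-- A finite set carries only finitely many occurrences. -/
def OccFin (L : FirstOrder.Language.{0, 0}) (V : Type*) [L.Structure V] : Prop :=
  ∀ A : Set V, A.Finite → (occ (Set.univ : Set (RelSym L)) A).Finite

lemma InC0.occFin (h : InC0 L V) : OccFin L V := fun A hA => (h.2 A hA).1

lemma OccFin.fin (h : OccFin L V) (P : Set (RelSym L)) {A : Set V} (hA : A.Finite) :
    (occ P A).Finite :=
  (h A hA).subset (occ_mono (Set.subset_univ _) subset_rfl)

lemma predim_sub (h : OccFin L V) (P : Set (RelSym L)) {A B : Set V} (hB : B.Finite) (hAB : A ⊆ B) :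
    predim P B - predim P A = ((B \ A).ncard : ℤ) - ((occ P B \ occ P A).ncard : ℤ) := by
  have h1 := Set.ncard_sdiff_add_ncard_of_subset hAB hB
  have h2 := Set.ncard_sdiff_add_ncard_of_subset (occ_mono (le_refl P) hAB) (h.fin P hB)
  unfold predim
  omega

/-- Submodularity for two languages at once: a `P`-occurrence on `A` that is not inside `A ∩ B` is a
`Q`-occurrence on `A ∪ B` that is not inside `B`. The freedom to enlarge the language on the left
lets strongness, which counts all relations, control predimensions in finite sublanguages. -/
lemma predim_diff_le (h : OccFin L V) {P Q : Set (RelSym L)} (hPQ : P ⊆ Q) {A B : Set V}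
    (hA : A.Finite) (hB : B.Finite) :
    predim Q (A ∪ B) - predim Q B ≤ predim P A - predim P (A ∩ B) := by
  rw [predim_sub h Q (hA.union hB) Set.subset_union_right, predim_sub h P hA Set.inter_subset_left,
    Set.union_sdiff_right, Set.sdiff_self_inter, occ_inter, Set.sdiff_self_inter]
  have : (occ P A \ occ P B).ncard ≤ (occ Q (A ∪ B) \ occ Q B).ncard := by
    refine Set.ncard_le_ncard ?_ ((h.fin Q (hA.union hB)).sdiff)
    intro p
    simp only [Set.mem_sdiff, mem_occ]
    exact fun ⟨⟨h1, h2, h3⟩, h4⟩ => ⟨⟨hPQ h1, h2, fun v hv => .inl (h3 v hv)⟩,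
      fun h5 => h4 ⟨h1, h5.2⟩⟩
  omega

lemma predim_mono_sub (h : OccFin L V) {P Q : Set (RelSym L)} (hPQ : P ⊆ Q) {A B : Set V}
    (hB : B.Finite) (hAB : A ⊆ B) : predim Q B - predim Q A ≤ predim P B - predim P A := by
  have := predim_diff_le h hPQ hB (hB.subset hAB)
  rwa [Set.union_eq_left.2 hAB, Set.inter_eq_right.2 hAB] at this

lemma predim_union_add_inter (h : OccFin L V) (P : Set (RelSym L)) {A B : Set V}
    (hA : A.Finite) (hB : B.Finite) :
    predim P (A ∪ B) + predim P (A ∩ B) ≤ predim P A + predim P B := by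
  have := predim_diff_le h (le_refl P) hA hB
  linarith

lemma predim_empty_le (P : Set (RelSym L)) : predim P (∅ : Set V) ≤ 0 := by
  simp [predim]

lemma predim_le_ncard (P : Set (RelSym L)) (A : Set V) : predim P A ≤ A.ncard := by
  simp [predim]

/-! ### Maps -/

/-- `f` is injective on `A` and preserves and reflects the relations in `P` there. -/
def PEmbOn (P : Set (RelSym L)) (f : V → W) (A : Set V) : Prop :=
  Set.InjOn f A ∧ ∀ r ∈ P, ∀ x : Fin r.1 → V, (∀ i, x i ∈ A) →
    (Structure.RelMap r.2 x ↔ Structure.RelMap r.2 (f ∘ x))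

/-- `f` is an embedding. -/
def IsEmb (L : FirstOrder.Language.{0, 0}) {V W : Type*} [L.Structure V] [L.Structure W]
    (f : V → W) : Prop :=
  Function.Injective f ∧ ∀ (r : RelSym L) (x : Fin r.1 → V),
    Structure.RelMap r.2 x ↔ Structure.RelMap r.2 (f ∘ x)

lemma IsEmb.pEmbOn {f : V → W} (h : IsEmb L f) (P : Set (RelSym L)) (A : Set V) : PEmbOn P f A :=
  ⟨h.1.injOn, fun r _ x _ => h.2 r x⟩

lemma PEmbOn.mono {P Q : Set (RelSym L)} {f : V → W} {A B : Set V} (h : PEmbOn Q f B)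
    (hP : P ⊆ Q) (hA : A ⊆ B) : PEmbOn P f A :=
  ⟨h.1.mono hA, fun r hr x hx => h.2 r (hP hr) x fun i => hA (hx i)⟩

lemma IsEmb.comp {U : Type*} [L.Structure U] {g : W → U} {f : V → W} (hg : IsEmb L g)
    (hf : IsEmb L f) : IsEmb L (g ∘ f) :=
  ⟨hg.1.comp hf.1, fun r x => (hf.2 r x).trans (hg.2 r _)⟩

/-- The image of an occurrence. -/
def occMap (f : V → W) (p : RelSym L × Multiset V) : RelSym L × Multiset W := (p.1, p.2.map f)

lemma occMap_injOn {f : V → W} {A : Set V} (hf : Set.InjOn f A) {T : Set (RelSym L × Multiset V)}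
    (hT : ∀ p ∈ T, ∀ v ∈ p.2, v ∈ A) : Set.InjOn (occMap (L := L) f) T := by
  rcases isEmpty_or_nonempty V with hV | hV
  · rintro ⟨r, s⟩ _ ⟨r', s'⟩ _ h
    have : Subsingleton (Multiset V) := ⟨fun a b =>
      (Multiset.eq_zero_of_forall_notMem fun v => hV.elim v).trans
        (Multiset.eq_zero_of_forall_notMem fun v => hV.elim v).symm⟩
    rw [occMap, occMap, Prod.mk.injEq] at h
    rw [Prod.mk.injEq]
    exact ⟨h.1, Subsingleton.elim _ _⟩
  · rintro ⟨r, s⟩ hp ⟨r', s'⟩ hp' h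
    simp only [occMap, Prod.mk.injEq] at h ⊢
    refine ⟨h.1, ?_⟩
    have key : ∀ s : Multiset V, (∀ v ∈ s, v ∈ A) →
        (s.map f).map (Function.invFunOn f A) = s := by
      intro s hs
      rw [Multiset.map_map]
      conv_rhs => rw [← Multiset.map_id s]
      exact Multiset.map_congr rfl fun v hv => hf.leftInvOn_invFunOn (hs v hv)
    rw [← key s (hT _ hp), h.2, key s' (hT _ hp')]

lemma mem_of_mem_occ {P : Set (RelSym L)} {A : Set V} {p : RelSym L × Multiset V}
    (hp : p ∈ occ P A) : ∀ v ∈ p.2, v ∈ A := (mem_occ.1 hp).2.2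

lemma PEmbOn.occ_image {P : Set (RelSym L)} {f : V → W} {A B : Set V} (h : PEmbOn P f A)
    (hB : B ⊆ A) : occ P (f '' B) = occMap f '' occ P B := by
  ext p
  constructor
  · rintro ⟨hr, y, hy, hyB, hp⟩
    choose x hx hxy using hyB
    have : y = f ∘ x := funext fun i => (hxy i).symm
    refine ⟨(p.1, Finset.univ.val.map x), ⟨hr, x, ?_, hx, rfl⟩, ?_⟩
    · exact (h.2 _ hr x fun i => hB (hx i)).2 (this ▸ hy)
    · refine Prod.ext rfl ?_
      simp only [occMap, Multiset.map_map]
      rw [← this, ← hp]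
  · rintro ⟨q, ⟨hr, x, hx, hxB, hq⟩, rfl⟩
    refine ⟨hr, f ∘ x, (h.2 _ hr x fun i => hB (hxB i)).1 hx, fun i => ⟨x i, hxB i, rfl⟩, ?_⟩
    simp only [occMap, hq, Multiset.map_map]
    rfl

lemma PEmbOn.predim_image {P : Set (RelSym L)} {f : V → W} {A B : Set V} (h : PEmbOn P f A)
    (hB : B ⊆ A) : predim P (f '' B) = predim P B := by
  unfold predim
  rw [h.occ_image hB, (h.1.mono hB).ncard_image, Set.InjOn.ncard_image
    (occMap_injOn (h.1.mono hB) fun p hp => mem_of_mem_occ hp)]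

lemma IsEmb.predim_image {f : V → W} (h : IsEmb L f) (P : Set (RelSym L)) (B : Set V) :
    predim P (f '' B) = predim P B := (h.pEmbOn P B).predim_image subset_rfl

lemma IsEmb.delta_image {f : V → W} (h : IsEmb L f) (B : Set V) :
    delta L (f '' B) = delta L B := h.predim_image _ B

lemma IsEmb.predim_preimage {f : V → W} (h : IsEmb L f) (P : Set (RelSym L)) (X : Set W) :
    predim P (f ⁻¹' X) = predim P (X ∩ Set.range f) := by
  rw [← h.predim_image P, Set.image_preimage_eq_inter_range]

/-- An injection under which the occurrences on `S` but not on `S'` persist. -/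
lemma ncard_occ_diff_le (h : OccFin L W) {P Q : Set (RelSym L)} {f : V → W} {S S' : Set V}
    (hS : S.Finite) (hf : Set.InjOn f S) (hS' : S' ⊆ S)
    (hrel : ∀ r ∈ P, ∀ x : Fin r.1 → V, (∀ i, x i ∈ S) → (¬ ∀ i, x i ∈ S') →
      Structure.RelMap r.2 x → r ∈ Q ∧ Structure.RelMap r.2 (f ∘ x)) :
    occMap f '' (occ P S \ occ P S') ⊆ occ Q (f '' S) \ occ Q (f '' S') ∧
      (occ P S \ occ P S').ncard ≤ (occ Q (f '' S) \ occ Q (f '' S')).ncard := by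
  have key : occMap f '' (occ P S \ occ P S') ⊆ occ Q (f '' S) \ occ Q (f '' S') := by
    rintro _ ⟨p, ⟨⟨hr, x, hx, hxS, hp⟩, hp'⟩, rfl⟩
    have hx' : ¬ ∀ i, x i ∈ S' := fun hx' => hp' ⟨hr, x, hx, hx', hp⟩
    obtain ⟨hQ, hfx⟩ := hrel _ hr x hxS hx' hx
    refine ⟨⟨hQ, f ∘ x, hfx, fun i => ⟨x i, hxS i, rfl⟩, ?_⟩, fun h' => hx' fun i => ?_⟩
    · simp only [occMap, hp, Multiset.map_map]
      rfl
    · have := mem_of_mem_occ h' (f (x i)) (by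
        simp only [occMap, hp]
        exact Multiset.mem_map_of_mem f (Multiset.mem_map_of_mem x (Finset.mem_univ_val i)))
      obtain ⟨s, hs, hsx⟩ := this
      rwa [← hf (hS' hs) (hxS i) hsx]
  refine ⟨key, ?_⟩
  rw [← Set.InjOn.ncard_image (s := occ P S \ occ P S')
    (occMap_injOn hf fun p hp => mem_of_mem_occ hp.1)]
  exact Set.ncard_le_ncard key ((h.fin _ (hS.image f)).sdiff)

/-! ### Strong sets and the function `d` -/

/-- Strongness counts all relations, yet it has consequences for every `P`: the increment from `D ∩
A` to `D` counted in `P` is at least the full increment from `A` to `D ∪ A`, which is nonnegative.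
-/
lemma Strong.predim_inter_le (h : OccFin L V) {A : Set V} (hA : A.Finite) (hs : Strong L A)
    (P : Set (RelSym L)) {D : Set V} (hD : D.Finite) : predim P (D ∩ A) ≤ predim P D := by
  have h1 := predim_diff_le h (Set.subset_univ P) hD hA
  have h2 := hs (D ∪ A) (hD.union hA) Set.subset_union_right
  unfold delta at h2
  linarith

lemma Strong.delta_inter_le (h : OccFin L V) {A : Set V} (hA : A.Finite) (hs : Strong L A)
    {D : Set V} (hD : D.Finite) : delta L (D ∩ A) ≤ delta L D :=
  hs.predim_inter_le h hA _ hD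

lemma Strong.inter (h : OccFin L V) {A B : Set V} (hA : A.Finite) (hB : B.Finite)
    (hsA : Strong L A) (hsB : Strong L B) : Strong L (A ∩ B) := by
  intro D hD hAB
  have h1 := hsA.delta_inter_le h hA hD
  have h2 := hsB.delta_inter_le h hB (hD.inter_of_left A)
  have : D ∩ A ∩ B = A ∩ B := by
    rw [Set.inter_assoc]; exact Set.inter_eq_right.2 hAB
  rw [this] at h2
  exact h2.trans h1

lemma InC0.delta_nonneg (h : InC0 L V) {A : Set V} (hA : A.Finite) : 0 ≤ delta L A := (h.2 A hA).2

lemma InC0.dfun_bddBelow (h : InC0 L V) (A : Set V) :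
    BddBelow {z : ℤ | ∃ D : Set V, D.Finite ∧ A ⊆ D ∧ delta L D = z} :=
  ⟨0, by rintro _ ⟨D, hD, _, rfl⟩; exact h.delta_nonneg hD⟩

lemma InC0.dfun_le (h : InC0 L V) {A D : Set V} (hD : D.Finite) (hAD : A ⊆ D) :
    dfun L A ≤ delta L D :=
  csInf_le (h.dfun_bddBelow A) ⟨D, hD, hAD, rfl⟩

lemma InC0.exists_delta_eq_dfun (h : InC0 L V) {A : Set V} (hA : A.Finite) :
    ∃ D : Set V, D.Finite ∧ A ⊆ D ∧ delta L D = dfun L A :=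
  Int.csInf_mem (s := {z : ℤ | ∃ D : Set V, D.Finite ∧ A ⊆ D ∧ delta L D = z})
    ⟨delta L A, A, hA, subset_rfl, rfl⟩ (h.dfun_bddBelow A)

lemma InC0.dfun_mono (h : InC0 L V) {A B : Set V} (hB : B.Finite) (hAB : A ⊆ B) :
    dfun L A ≤ dfun L B := by
  obtain ⟨D, hD, hBD, hd⟩ := h.exists_delta_eq_dfun hB
  exact hd ▸ h.dfun_le hD (hAB.trans hBD)

lemma InC0.strong_iff (h : InC0 L V) {A : Set V} (hA : A.Finite) :
    Strong L A ↔ delta L A = dfun L A := by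
  constructor
  · intro hs
    obtain ⟨D, hD, hAD, hd⟩ := h.exists_delta_eq_dfun hA
    exact le_antisymm (hd ▸ hs D hD hAD) (h.dfun_le hA subset_rfl)
  · intro hd D hD hAD
    exact hd ▸ h.dfun_le hD hAD

lemma InC0.strong_of_delta_eq (h : InC0 L V) {A D : Set V} (hD : D.Finite) (hAD : A ⊆ D)
    (hd : delta L D = dfun L A) : Strong L D ∧ dfun L D = dfun L A := by
  have h1 : delta L D = dfun L D :=
    le_antisymm (hd.trans_le (h.dfun_mono hD hAD)) (h.dfun_le hD subset_rfl)
  exact ⟨(h.strong_iff hD).2 h1, h1.symm.trans hd⟩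

lemma InC0.exists_strong (h : InC0 L V) {A : Set V} (hA : A.Finite) :
    ∃ D : Set V, D.Finite ∧ A ⊆ D ∧ Strong L D ∧ delta L D = dfun L A := by
  obtain ⟨D, hD, hAD, hd⟩ := h.exists_delta_eq_dfun hA
  exact ⟨D, hD, hAD, (h.strong_of_delta_eq hD hAD hd).1, hd⟩

/-- The union and the intersection of optimal supersets of `A` and `B` are competitors for `A ∪ B`
and `A ∩ B`. -/
lemma InC0.dfun_submod (h : InC0 L V) {A B : Set V} (hA : A.Finite) (hB : B.Finite) :
    dfun L (A ∪ B) + dfun L (A ∩ B) ≤ dfun L A + dfun L B := by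
  obtain ⟨D, hD, hAD, hd⟩ := h.exists_delta_eq_dfun hA
  obtain ⟨E, hE, hBE, he⟩ := h.exists_delta_eq_dfun hB
  have h1 := predim_union_add_inter h.occFin Set.univ hD hE
  have h2 := h.dfun_le (hD.union hE) (Set.union_subset_union hAD hBE)
  have h3 := h.dfun_le (hD.inter_of_left E) (Set.inter_subset_inter hAD hBE)
  unfold delta at *
  linarith

lemma InC0.delta_empty (h : InC0 L V) : delta L (∅ : Set V) = 0 :=
  le_antisymm (predim_empty_le _) (h.delta_nonneg Set.finite_empty)

lemma InC0.strong_empty (h : InC0 L V) : Strong L (∅ : Set V) :=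
  fun _ hD _ => h.delta_empty ▸ h.delta_nonneg hD

lemma InC0.dfun_empty (h : InC0 L V) : dfun L (∅ : Set V) = 0 :=
  ((h.strong_iff Set.finite_empty).1 h.strong_empty).symm.trans h.delta_empty

lemma InC0.dfun_singleton_le (h : InC0 L V) (x : V) : dfun L ({x} : Set V) ≤ 1 :=
  (h.dfun_le (Set.finite_singleton x) subset_rfl).trans <| by
    simpa [delta] using predim_le_ncard (Set.univ : Set (RelSym L)) ({x} : Set V)

lemma InC0.dfun_nonneg (h : InC0 L V) {A : Set V} (hA : A.Finite) : 0 ≤ dfun L A := by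
  obtain ⟨D, hD, _, hd⟩ := h.exists_delta_eq_dfun hA
  exact hd ▸ h.delta_nonneg hD

lemma InC0.dfun_insert_le (h : InC0 L V) {A : Set V} (hA : A.Finite) (x : V) :
    dfun L (insert x A) ≤ dfun L A + 1 := by
  have h1 := h.dfun_submod (Set.finite_singleton x) hA
  have h2 := h.dfun_singleton_le x
  have h3 := h.dfun_nonneg ((Set.finite_singleton x).inter_of_left A)
  rw [Set.singleton_union] at h1
  linarith

lemma IsEmb.symmetric {f : V → W} (hf : IsEmb L f) (h : Symmetric L W) : Symmetric L V :=
  fun r x σ hx => (hf.2 r _).2 (h r (f ∘ x) σ ((hf.2 r x).1 hx))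

lemma IsEmb.inC0 {f : V → W} (hf : IsEmb L f) (h : InC0 L W) : InC0 L V := by
  refine ⟨hf.symmetric h.1, fun A hA => ⟨?_, ?_⟩⟩
  · have := (h.2 _ (hA.image f)).1
    rw [(hf.pEmbOn _ A).occ_image subset_rfl] at this
    exact this.of_finite_image (occMap_injOn hf.1.injOn (A := Set.univ) (by simp))
  · exact hf.delta_image A ▸ h.delta_nonneg (hA.image f)

/-- Strong sets correspond under a strong embedding. -/
lemma IsEmb.strong_image {f : V → W} [Finite V] (hf : IsEmb L f) (h : OccFin L W)
    (hs : Strong L (Set.range f)) {A : Set V} : Strong L (f '' A) ↔ Strong L A := by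
  constructor
  · intro hA D hD hAD
    rw [← hf.delta_image, ← hf.delta_image]
    exact hA _ (hD.image f) (Set.image_mono hAD)
  · intro hA D hD hAD
    refine le_trans ?_ (hs.delta_inter_le h (Set.finite_range f) hD)
    rw [hf.delta_image, delta, delta, ← hf.predim_preimage]
    exact hA _ (hD.preimage hf.1.injOn) (Set.image_subset_iff.1 hAD)

lemma IsEmb.strong_range_comp {X U : Type*} [L.Structure U] {f : X → W} [Finite W] {g : W → U}
    (hf : Strong L (Set.range f))
    (hg : IsEmb L g) (h : OccFin L U) (hs : Strong L (Set.range g)) :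
    Strong L (Set.range (g ∘ f)) := by
  rw [Set.range_comp]
  exact (hg.strong_image h hs).2 hf

end Predimension

/-! ### Dimension and flatness of a closure operator given by `d`. -/

section Pregeometry

variable {L : FirstOrder.Language.{0, 0}} {V : Type*} [L.Structure V]

/-- The closure operator `cl` is finitary and given by `d` on finite sets. -/
structure GivenByD (L : FirstOrder.Language.{0, 0}) {V : Type*} [L.Structure V]
    (cl : Set V → Set V) : Prop where
  finitary : ∀ (A : Set V) (x : V), x ∈ cl A ↔ ∃ A₀ ⊆ A, A₀.Finite ∧ x ∈ cl A₀
  mem_iff : ∀ (A : Set V) (x : V), A.Finite → (x ∈ cl A ↔ dfun L (insert x A) = dfun L A)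

lemma InC0.dfun_union_eq (h : InC0 L V) {A X : Set V} (hA : A.Finite) (hX : X.Finite)
    (hx : ∀ x ∈ X, dfun L (insert x A) = dfun L A) : dfun L (A ∪ X) = dfun L A := by
  induction X, hX using Set.Finite.induction_on with
  | empty => simp
  | @insert x X _ hX ih =>
    have h1 := ih fun y hy => hx y (Set.mem_insert_of_mem x hy)
    have h2 := hx x (Set.mem_insert x X)
    have h3 := h.dfun_submod (hA.insert x) (hA.union hX)
    have h4 : dfun L A ≤ dfun L (insert x A ∩ (A ∪ X)) :=
      h.dfun_mono ((hA.insert x).inter_of_left _)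
        (Set.subset_inter (Set.subset_insert x A) Set.subset_union_left)
    have h5 : insert x A ∪ (A ∪ X) = A ∪ insert x X := by
      ext; simp only [Set.mem_union, Set.mem_insert_iff]; tauto
    have h6 : dfun L A ≤ dfun L (A ∪ insert x X) :=
      h.dfun_mono (hA.union (hX.insert x)) Set.subset_union_left
    rw [h5] at h3
    linarith

lemma InC0.dfun_le_ncard (h : InC0 L V) {A : Set V} (hA : A.Finite) : dfun L A ≤ A.ncard :=
  (h.dfun_le hA subset_rfl).trans (predim_le_ncard _ _)

/-- Adding a point raises `d` by 0 or 1, so a greedy choice that keeps the points raising `d` yields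
a set with as many elements as its dimension. -/
lemma InC0.exists_basis (h : InC0 L V) {X : Set V} (hX : X.Finite) :
    ∃ I ⊆ X, (I.ncard : ℤ) = dfun L X ∧ dfun L I = dfun L X := by
  induction X, hX using Set.Finite.induction_on with
  | empty => exact ⟨∅, subset_rfl, by simp [h.dfun_empty], rfl⟩
  | @insert x X hx hX ih =>
    obtain ⟨I, hI, hc, hd⟩ := ih
    have hIf := hX.subset hI
    by_cases he : dfun L (insert x X) = dfun L X
    · exact ⟨I, hI.trans (Set.subset_insert x X), by rw [hc, he], by rw [hd, he]⟩
    · have h1 := h.dfun_insert_le hX x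
      have h2 := h.dfun_mono (hX.insert x) (Set.subset_insert x X)
      have h3 : dfun L (insert x X) = dfun L X + 1 := by omega
      refine ⟨insert x I, Set.insert_subset_insert hI, ?_, ?_⟩
      · rw [Set.ncard_insert_of_notMem (fun h => hx (hI h)) hIf, h3]
        push_cast; omega
      · refine le_antisymm (h.dfun_mono (hX.insert x) (Set.insert_subset_insert hI)) ?_
        have h4 := h.dfun_submod hX (hIf.insert x)
        have h5 : dfun L I ≤ dfun L (X ∩ insert x I) :=
          h.dfun_mono (hX.inter_of_left _) (Set.subset_inter hI (Set.subset_insert x I))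
        have h6 : X ∪ insert x I = insert x X := by
          ext y
          simp only [Set.mem_union, Set.mem_insert_iff]
          constructor
          · rintro (hy | hy | hy)
            exacts [.inr hy, .inl hy, .inr (hI hy)]
          · tauto
        rw [h6] at h4
        linarith

variable {cl : Set V → Set V}

lemma GivenByD.mono (hc : GivenByD L cl) {A B : Set V} (hAB : A ⊆ B) : cl A ⊆ cl B := by
  intro x hx
  obtain ⟨A₀, h1, h2, h3⟩ := (hc.finitary A x).1 hx
  exact (hc.finitary B x).2 ⟨A₀, h1.trans hAB, h2, h3⟩

lemma GivenByD.subset (hc : GivenByD L cl) (A : Set V) : A ⊆ cl A := fun x hx =>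
  (hc.finitary A x).2 ⟨{x}, by simpa, Set.finite_singleton x,
    (hc.mem_iff _ x (Set.finite_singleton x)).2 (by simp)⟩

lemma GivenByD.dfun_eq_of_subset_cl (hc : GivenByD L cl) (h : InC0 L V) {A X : Set V}
    (hA : A.Finite) (hX : X.Finite) (hXA : X ⊆ cl A) : dfun L (A ∪ X) = dfun L A :=
  h.dfun_union_eq hA hX fun x hx => (hc.mem_iff A x hA).1 (hXA hx)

/-- A basis of `X` generates `S`, and any finite generating set `A` satisfies `|A| ≥ d(A) = d(A ∪ X)
≥ d(X)`. -/
lemma GivenByD.dim_eq (hc : GivenByD L cl) (h : InC0 L V) {S X : Set V} (hX : X.Finite)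
    (hXS : X ⊆ S) (hS : S ⊆ cl X) : (dim cl S : ℤ) = dfun L X := by
  obtain ⟨I, hI, hcard, hd⟩ := h.exists_basis hX
  have hIf := hX.subset hI
  have hcl : cl X ⊆ cl I := by
    intro y hy
    rw [hc.mem_iff X y hX] at hy
    rw [hc.mem_iff I y hIf]
    refine le_antisymm ?_ (h.dfun_mono (hIf.insert y) (Set.subset_insert y I))
    rw [hd, ← hy]
    exact h.dfun_mono (hX.insert y) (Set.insert_subset_insert hI)
  have hmem : I.ncard ∈ {n | ∃ A : Set V, A.Finite ∧ A ⊆ S ∧ S ⊆ cl A ∧ A.ncard = n} :=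
    ⟨I, hIf, hI.trans hXS, hS.trans hcl, rfl⟩
  have hdim : dim cl S = I.ncard := by
    refine le_antisymm (Nat.sInf_le hmem) (le_csInf ⟨_, hmem⟩ ?_)
    rintro n ⟨A, hA, _, hSA, rfl⟩
    have h1 := hc.dfun_eq_of_subset_cl h hA hX (hXS.trans hSA)
    have h2 := h.dfun_mono (hA.union hX) (Set.subset_union_right (s := A))
    have h3 := h.dfun_le_ncard hA
    omega
  rw [hdim, hcard]

lemma GivenByD.geometryGivenByD {M : Type} [L.Structure M] {cl : Set M → Set M}
    (hc : GivenByD L cl) (h : InC0 L M) : GeometryGivenByD L cl :=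
  ⟨fun A x hA => hc.mem_iff A x hA, fun A hA => hc.dim_eq h hA subset_rfl (hc.subset A)⟩

/-- A finite subset of `S` with the largest possible `d` generates `S`, because no further point can
raise `d`. The maximum exists since `d` is bounded by `d(A)` on finite subsets of `cl A`. -/
lemma GivenByD.exists_generating (hc : GivenByD L cl) (h : InC0 L V) {S A : Set V} (hA : A.Finite)
    (hS : S ⊆ cl A) : ∃ X : Set V, X.Finite ∧ X ⊆ S ∧ S ⊆ cl X := by
  have hb : BddAbove {z : ℤ | ∃ X : Set V, X.Finite ∧ X ⊆ S ∧ dfun L X = z} := by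
    refine ⟨dfun L A, ?_⟩
    rintro _ ⟨X, hX, hXS, rfl⟩
    rw [← hc.dfun_eq_of_subset_cl h hA hX (hXS.trans hS)]
    exact h.dfun_mono (hA.union hX) Set.subset_union_right
  obtain ⟨X, hX, hXS, hm⟩ := Int.csSup_mem (s := {z : ℤ | ∃ X : Set V, X.Finite ∧ X ⊆ S ∧
    dfun L X = z}) ⟨_, ∅, Set.finite_empty, Set.empty_subset S, rfl⟩ hb
  refine ⟨X, hX, hXS, fun y hy => (hc.mem_iff X y hX).2 ?_⟩
  refine le_antisymm ?_ (h.dfun_mono (hX.insert y) (Set.subset_insert y X))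
  rw [hm]
  exact le_csSup hb ⟨insert y X, hX.insert y, Set.insert_subset hy hXS, rfl⟩

/-- The empty index set contributes the union, so this is the usual formula for the cardinality of a
union with all terms on one side. -/
lemma inclusion_exclusion_ncard {ι α : Type*} [Fintype ι] [DecidableEq ι] (F : ι → Set α)
    (hF : ∀ i, (F i).Finite) :
    ∑ s : Finset ι, (-1 : ℤ) ^ s.card *
      (Set.ncard {x | (∀ i ∈ s, x ∈ F i) ∧ (s = ∅ → ∃ i, x ∈ F i)} : ℤ) = 0 := by
  classical
  choose G hG using fun i => (hF i).exists_finset_coe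
  have h1 := Finset.inclusion_exclusion_card_biUnion (Finset.univ : Finset ι) G
  have h2 : ∀ s : Finset ι, ∀ hs : s.Nonempty,
      (Set.ncard {x | (∀ i ∈ s, x ∈ F i) ∧ (s = ∅ → ∃ i, x ∈ F i)} : ℤ) = ((s.inf' hs G).card : ℤ) := by
    intro s hs
    rw [← Set.ncard_coe_finset]
    congr 2
    ext x
    have : ∀ i, x ∈ F i ↔ x ∈ G i := fun i => by rw [← hG i]; simp
    simp [hs.ne_empty, this, Finset.mem_inf']
  have h0 : (Set.ncard {x | (∀ i ∈ (∅ : Finset ι), x ∈ F i) ∧ ((∅ : Finset ι) = ∅ → ∃ i, x ∈ F i)} : ℤ)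
      = ((Finset.univ.biUnion G).card : ℤ) := by
    rw [← Set.ncard_coe_finset]
    congr 2
    ext x
    have : ∀ i, x ∈ F i ↔ x ∈ G i := fun i => by rw [← hG i]; simp
    simp [this]
  rw [← Finset.sum_filter_add_sum_filter_not Finset.univ (fun s : Finset ι => s.Nonempty)]
  have h3 : Finset.univ.filter (fun s : Finset ι => ¬ s.Nonempty) = {∅} := by
    ext s; simp [Finset.not_nonempty_iff_eq_empty]
  rw [h3, Finset.sum_singleton, h0, h1]
  have h4 : (∑ t : (Finset.univ : Finset ι).powerset.filter (·.Nonempty),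
      (-1 : ℤ) ^ (t.1.card + 1) * ((t.1.inf' (Finset.mem_filter.1 t.2).2 G).card : ℤ)) =
      ∑ s ∈ (Finset.univ : Finset ι).powerset.filter (·.Nonempty), -((-1 : ℤ) ^ s.card *
        (Set.ncard {x | (∀ i ∈ s, x ∈ F i) ∧ (s = ∅ → ∃ i, x ∈ F i)} : ℤ)) := by
    rw [← Finset.sum_coe_sort ((Finset.univ : Finset ι).powerset.filter (·.Nonempty))]
    refine Finset.sum_congr rfl fun t _ => ?_
    rw [h2 t.1 (Finset.mem_filter.1 t.2).2, pow_succ]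
    ring
  rw [h4, Finset.sum_neg_distrib, Finset.powerset_univ]
  simp

/-- Finite strong sets `F i ⊆ E i` are chosen so large that `F_s` generates `E_s` for all `s`. For
nonempty `s` the intersection `F_s` is strong, so `d(F_s)` is its number of points minus the number
of occurrences common to the `F i`. Both alternating sums vanish by inclusion–exclusion. The
inequality comes from `s = ∅` alone: the union may carry occurrences that lie in no single `F i`, so
its `d` can only be smaller, and its sign is positive. -/
lemma GivenByD.flat (hc : GivenByD L cl) (h : InC0 L V) : Flat cl := by
  classical
  intro k E hE
  have hgen : ∀ s : Finset (Fin k), ∃ X : Set V, X.Finite ∧ X ⊆ flatPart E s ∧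
      flatPart E s ⊆ cl X := by
    intro s
    choose A hA hAE hEA using fun i => (hE i).2
    rcases s.eq_empty_or_nonempty with rfl | ⟨i, hi⟩
    · refine ⟨⋃ i, A i, Set.finite_iUnion hA, ?_, ?_⟩
      · intro x hx
        obtain ⟨i, hi⟩ := Set.mem_iUnion.1 hx
        exact ⟨by simp, fun _ => ⟨i, hAE i hi⟩⟩
      · rintro x ⟨_, hx⟩
        obtain ⟨i, hi⟩ := hx rfl
        exact hc.mono (Set.subset_iUnion A i) (hEA i hi)
    · exact hc.exists_generating h (hA i) fun x hx => hEA i (hx.1 i hi)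
  choose X hX hXs hsX using hgen
  -- `F i` is a strong set computing `d` of all the chosen generators that lie in `E i`. It stays
  -- inside the closed set `E i` because adding any of its points to these generators does not raise
  -- `d`.
  have hF : ∀ i, ∃ F : Set V, F.Finite ∧ F ⊆ E i ∧ Strong L F ∧ ∀ s : Finset (Fin k),
      (i ∈ s ∨ s = ∅) → X s ∩ E i ⊆ F := by
    intro i
    have hfin : (⋃ s : Finset (Fin k), X s ∩ E i).Finite :=
      Set.finite_iUnion fun s => (hX s).inter_of_left _
    obtain ⟨D, hD, hsub, hst, hd⟩ := h.exists_strong hfin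
    refine ⟨D, hD, ?_, hst, fun s _ => (Set.subset_iUnion (fun s => X s ∩ E i) s).trans hsub⟩
    intro y hy
    rw [← (hE i).1]
    refine (hc.finitary _ y).2 ⟨_, Set.iUnion_subset fun s => Set.inter_subset_right, hfin, ?_⟩
    refine (hc.mem_iff _ y hfin).2 (le_antisymm ?_ (h.dfun_mono (hfin.insert y) (Set.subset_insert _ _)))
    rw [← hd]
    exact h.dfun_le hD (Set.insert_subset hy hsub)
  choose F hFf hFE hFs hFX using hF
  have hfinF : ∀ s, (flatPart F s).Finite := by
    intro s
    refine (Set.finite_iUnion hFf).subset ?_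
    rcases s.eq_empty_or_nonempty with rfl | ⟨i, hi⟩
    · exact fun x hx => Set.mem_iUnion.2 (hx.2 rfl)
    · exact fun x hx => Set.mem_iUnion.2 ⟨i, hx.1 i hi⟩
  have hdim : ∀ s, (dim cl (flatPart E s) : ℤ) = dfun L (flatPart F s) := by
    intro s
    refine hc.dim_eq h (hfinF s) ?_ ?_
    · exact fun x hx => ⟨fun i hi => hFE i (hx.1 i hi), fun hs => (hx.2 hs).imp fun i hi => hFE i hi⟩
    · refine (hsX s).trans (hc.mono fun x hx => ?_)
      have hx' := hXs s hx
      exact ⟨fun i hi => hFX i s (.inl hi) ⟨hx, hx'.1 i hi⟩,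
        fun hs => (hx'.2 hs).imp fun i hi => hFX i s (.inr hs) ⟨hx, hi⟩⟩
  have hstrong : ∀ s : Finset (Fin k), s.Nonempty → Strong L (flatPart F s) := by
    intro s hs
    induction hs using Finset.Nonempty.cons_induction with
    | singleton i =>
      have : flatPart F {i} = F i := by ext x; simp [flatPart]
      exact this ▸ hFs i
    | cons i s his hs ih =>
      have : flatPart F (Finset.cons i s his) = F i ∩ flatPart F s := by
        ext x; simp [flatPart, hs.ne_empty]
      exact this ▸ (hFs i).inter h.occFin (hFf i) (hfinF s) ih
  set O : Finset (Fin k) → Set (RelSym L × Multiset V) := fun s =>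
    {p | (∀ i ∈ s, p ∈ occ Set.univ (F i)) ∧ (s = ∅ → ∃ i, p ∈ occ Set.univ (F i))} with hO
  have h1 := inclusion_exclusion_ncard F hFf
  have h2 := inclusion_exclusion_ncard (fun i => occ (Set.univ : Set (RelSym L)) (F i))
    fun i => h.occFin _ (hFf i)
  have hle : ∀ s : Finset (Fin k), (-1 : ℤ) ^ s.card * dfun L (flatPart F s) ≤
      (-1 : ℤ) ^ s.card * ((flatPart F s).ncard : ℤ) - (-1 : ℤ) ^ s.card * ((O s).ncard : ℤ) := by
    intro s
    rcases s.eq_empty_or_nonempty with rfl | hs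
    · simp only [Finset.card_empty, pow_zero, one_mul]
      refine (h.dfun_le (hfinF ∅) subset_rfl).trans ?_
      have : (O ∅).ncard ≤ (occ (Set.univ : Set (RelSym L)) (flatPart F ∅)).ncard := by
        refine Set.ncard_le_ncard ?_ (h.occFin _ (hfinF ∅))
        rintro p ⟨_, hp⟩
        obtain ⟨i, hi⟩ := hp rfl
        have hFi : F i ⊆ flatPart F ∅ := fun x hx => ⟨by simp, fun _ => ⟨i, hx⟩⟩
        exact occ_mono subset_rfl hFi hi
      simp only [delta, predim]
      omega
    · have : dfun L (flatPart F s) = ((flatPart F s).ncard : ℤ) - ((O s).ncard : ℤ) := by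
        rw [← (h.strong_iff (hfinF s)).1 (hstrong s hs), delta, predim]
        congr 3
        ext p
        simp only [mem_occ, hO, Set.mem_ofPred_eq, hs.ne_empty, false_implies, and_true, flatPart]
        constructor
        · exact fun hp i hi => ⟨hp.1, hp.2.1, fun v hv => hp.2.2 v hv i hi⟩
        · intro hp
          obtain ⟨i, hi⟩ := hs
          exact ⟨(hp i hi).1, (hp i hi).2.1, fun v hv j hj => (hp j hj).2.2 v hv⟩
      rw [this, mul_sub]
  calc _ = ∑ s : Finset (Fin k), (-1 : ℤ) ^ s.card * dfun L (flatPart F s) :=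
        Finset.sum_congr rfl fun s _ => by rw [hdim s]
    _ ≤ _ := Finset.sum_le_sum fun s _ => hle s
    _ = 0 := by
      rw [Finset.sum_sub_distrib]
      exact sub_eq_zero.2 (h1.trans h2.symm)

end Pregeometry

/-! ### Properties of tuples that are elementary uniformly in the structure. -/

section Elementary

variable {L : FirstOrder.Language.{0, 0}} {ι κ : Type*}

/-- The family `p` of properties of `ι`-tuples is expressed by a formula. -/
def Elem (p : ∀ (N : Type u) [L.Structure N], (ι → N) → Prop) : Prop :=
  ∃ φ : L.Formula ι, ∀ (N : Type u) [L.Structure N] (v : ι → N), p N v ↔ φ.Realize v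

variable {p q : ∀ (N : Type u) [L.Structure N], (ι → N) → Prop}

lemma Elem.congr (hp : Elem p) (h : ∀ (N : Type u) [L.Structure N] (v : ι → N), q N v ↔ p N v) :
    Elem q := by
  obtain ⟨φ, hφ⟩ := hp
  exact ⟨φ, fun N _ v => (h N v).trans (hφ N v)⟩

lemma Elem.of_formula (φ : L.Formula ι) :
    Elem (fun (N : Type u) [L.Structure N] (v : ι → N) => φ.Realize v) := ⟨φ, fun _ _ _ => Iff.rfl⟩

lemma Elem.not (hp : Elem p) : Elem (fun (N : Type u) [L.Structure N] v => ¬ p N v) := by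
  obtain ⟨φ, hφ⟩ := hp
  exact ⟨φ.not, fun N _ v => by simp only [Formula.realize_not, hφ]⟩

lemma Elem.and (hp : Elem p) (hq : Elem q) :
    Elem (fun (N : Type u) [L.Structure N] v => p N v ∧ q N v) := by
  obtain ⟨φ, hφ⟩ := hp
  obtain ⟨ψ, hψ⟩ := hq
  exact ⟨φ ⊓ ψ, fun N _ v => by simp only [Formula.realize_inf, hφ, hψ]⟩

lemma Elem.imp (hp : Elem p) (hq : Elem q) :
    Elem (fun (N : Type u) [L.Structure N] v => p N v → q N v) := by
  refine ((hp.and hq.not).not).congr fun N _ v => ?_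
  tauto

lemma Elem.comp {p : ∀ (N : Type u) [L.Structure N], (κ → N) → Prop} (hp : Elem p) (f : κ → ι) :
    Elem (fun (N : Type u) [L.Structure N] (v : ι → N) => p N (v ∘ f)) := by
  obtain ⟨φ, hφ⟩ := hp
  exact ⟨φ.relabel f, fun N _ v => by simp only [Formula.realize_relabel, hφ]⟩

lemma Elem.ex [Finite κ] {p : ∀ (N : Type u) [L.Structure N], (ι ⊕ κ → N) → Prop} (hp : Elem p) :
    Elem (fun (N : Type u) [L.Structure N] (v : ι → N) => ∃ w : κ → N, p N (Sum.elim v w)) := by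
  obtain ⟨φ, hφ⟩ := hp
  exact ⟨φ.iExs κ, fun N _ v => by simp only [Formula.realize_iExs, hφ]⟩

lemma Elem.all [Finite κ] {p : ∀ (N : Type u) [L.Structure N], (ι ⊕ κ → N) → Prop} (hp : Elem p) :
    Elem (fun (N : Type u) [L.Structure N] (v : ι → N) => ∀ w : κ → N, p N (Sum.elim v w)) := by
  refine (hp.not.ex.not).congr fun N _ v => ?_
  push Not
  rfl

lemma Elem.forall_finite {β : Type*} [Finite β]
    {p : β → ∀ (N : Type u) [L.Structure N], (ι → N) → Prop} (hp : ∀ b, Elem (p b)) :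
    Elem (fun (N : Type u) [L.Structure N] (v : ι → N) => ∀ b, p b N v) := by
  choose φ hφ using hp
  exact ⟨Formula.iInf φ, fun N _ v => by simp only [Formula.realize_iInf, hφ]⟩

/-- `u` and `v` satisfy the same equations and the same instances of relations in `P`. -/
def SamePat (P : Set (RelSym L)) {N N' : Type*} [L.Structure N] [L.Structure N'] (v : ι → N)
    (v' : ι → N') : Prop :=
  (∀ i j, v i = v j ↔ v' i = v' j) ∧
    ∀ r ∈ P, ∀ x : Fin r.1 → ι, Structure.RelMap r.2 (v ∘ x) ↔ Structure.RelMap r.2 (v' ∘ x)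

lemma SamePat.symm {P : Set (RelSym L)} {N N' : Type*} [L.Structure N] [L.Structure N'] {v : ι → N}
    {v' : ι → N'} (h : SamePat P v v') : SamePat P v' v :=
  ⟨fun i j => (h.1 i j).symm, fun r hr x => (h.2 r hr x).symm⟩

/-- A property depending only on finitely many atomic formulas is elementary. -/
lemma Elem.of_samePat [Finite ι] (P : Set (RelSym L)) (hP : P.Finite)
    (h : ∀ (N N' : Type u) [L.Structure N] [L.Structure N'] (v : ι → N) (v' : ι → N'),
      SamePat P v v' → p N v → p N' v') : Elem p := by
  classical
  have : Finite P := hP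
  let eqF : ι × ι → L.Formula ι := fun i => Term.equal (Term.var i.1) (Term.var i.2)
  let rlF : (Σ r : P, (Fin r.1.1 → ι)) → L.Formula ι := fun s =>
    Relations.formula s.1.1.2 fun k => Term.var (s.2 k)
  have heq : ∀ (N : Type u) [L.Structure N] (v : ι → N) i, (eqF i).Realize v ↔ v i.1 = v i.2 := by
    intro N _ v i
    simp [eqF]
  have hrl : ∀ (N : Type u) [L.Structure N] (v : ι → N) s, (rlF s).Realize v ↔
      Structure.RelMap s.1.1.2 (v ∘ s.2) := by
    intro N _ v s
    simp only [rlF, Formula.realize_rel, Term.realize_var]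
    rfl
  let Q := (ι × ι → Prop) × ((Σ r : P, (Fin r.1.1 → ι)) → Prop)
  let χ : Q → L.Formula ι := fun q =>
    Formula.iInf (fun i => if q.1 i then eqF i else (eqF i).not) ⊓
      Formula.iInf (fun s => if q.2 s then rlF s else (rlF s).not)
  have hχ : ∀ (N : Type u) [L.Structure N] (v : ι → N) (q : Q), (χ q).Realize v ↔
      (∀ i, v i.1 = v i.2 ↔ q.1 i) ∧ ∀ s, Structure.RelMap s.1.1.2 (v ∘ s.2) ↔ q.2 s := by
    intro N _ v q
    simp only [χ, Formula.realize_inf, Formula.realize_iInf]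
    refine and_congr (forall_congr' fun i => ?_) (forall_congr' fun s => ?_)
    · split_ifs with hq <;> simp [heq, hq]
    · split_ifs with hq <;> simp [hrl, hq]
  -- There are finitely many patterns; the formula is the disjunction of those realized by some
  -- tuple with the property, in any structure.
  let G : Set Q := {q | ∃ (N : Type u) (_ : L.Structure N) (v : ι → N), p N v ∧ (χ q).Realize v}
  refine ⟨Formula.iSup fun q : G => χ q, fun N _ v => ?_⟩
  rw [Formula.realize_iSup]
  constructor
  · intro hv
    have hq := (hχ N v ⟨fun i => v i.1 = v i.2, fun s => Structure.RelMap s.1.1.2 (v ∘ s.2)⟩).2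
      ⟨fun _ => Iff.rfl, fun _ => Iff.rfl⟩
    exact ⟨⟨_, N, _, v, hv, hq⟩, hq⟩
  · rintro ⟨⟨q, N', _, v', hv', hq'⟩, hq⟩
    have h1 := (hχ N v q).1 hq
    have h2 := (hχ N' v' q).1 hq'
    refine h N' N v' v ⟨fun i j => ?_, fun r hr x => ?_⟩ hv'
    · exact (h2.1 (i, j)).trans (h1.1 (i, j)).symm
    · exact (h2.2 ⟨⟨r, hr⟩, x⟩).trans (h1.2 ⟨⟨r, hr⟩, x⟩).symm

/-- Elementary statements transfer to models of the complete theory. -/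
lemma Elem.transfer {p : ∀ (N : Type u) [L.Structure N], (ι → N) → Prop} [Finite ι] (hp : Elem p)
    {M N : Type u} [L.Structure M] [L.Structure N] (hN : N ⊨ L.completeTheory M)
    (h : ∀ v : ι → M, p M v) (v : ι → N) : p N v := by
  have : Elem (L := L) (ι := Empty) fun (N : Type u) [L.Structure N] _ => ∀ w : ι → N, p N w :=
    (hp.comp (Sum.inr : ι → Empty ⊕ ι)).all.congr fun N _ v => by simp
  obtain ⟨φ, hφ⟩ := this
  have h1 : M ⊨ φ := (hφ M default).1 h
  have h2 : N ⊨ φ := hN.realize_of_mem φ ((L.mem_completeTheory).2 h1)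
  exact (hφ N default).2 h2 v

end Elementary

/-! ### Algebraic closure: finite character, transitivity, transversals. -/

section AlgebraicClosure

variable {L : FirstOrder.Language.{0, 0}} {N : Type u} [L.Structure N]

lemma mem_acl_of_formula {ι κ : Type*} [Unique κ] (φ : L.Formula (ι ⊕ κ)) {A : Set N} {a : ι → N}
    (ha : ∀ i, a i ∈ A) {x : N} (hx : φ.Realize (Sum.elim a fun _ => x))
    (hfin : {y | φ.Realize (Sum.elim a fun _ => y)}.Finite) : x ∈ acl L A := by
  refine ⟨_, ?_, hfin, hx⟩
  rw [Set.Definable₁, Set.definable_iff_exists_formula_sum]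
  refine ⟨φ.relabel (Sum.map (fun i => ⟨a i, ha i⟩) fun _ => 0), ?_⟩
  ext y
  simp only [Set.mem_ofPred_eq, Formula.realize_relabel]
  rw [iff_iff_eq]
  congr 1
  funext s
  rcases s with s | s <;> rfl

lemma mem_acl_of_elem {ι κ : Type*} [Unique κ]
    {p : ∀ (N : Type u) [L.Structure N], (ι ⊕ κ → N) → Prop}
    (hp : Elem p) {A : Set N} {a : ι → N}
    (ha : ∀ i, a i ∈ A) {x : N} (hx : p N (Sum.elim a fun _ => x))
    (hfin : {y | p N (Sum.elim a fun _ => y)}.Finite) : x ∈ acl L A := by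
  obtain ⟨φ, hφ⟩ := hp
  simp only [hφ] at hx hfin
  exact mem_acl_of_formula φ ha hx hfin

lemma exists_formula_of_mem_acl {A : Set N} {x : N} (hx : x ∈ acl L A) :
    ∃ (n : ℕ) (φ : L.Formula (Fin n ⊕ Unit)) (a : Fin n → N), (∀ i, a i ∈ A) ∧
      φ.Realize (Sum.elim a fun _ => x) ∧ {y | φ.Realize (Sum.elim a fun _ => y)}.Finite := by
  obtain ⟨S, hS, hfin, hx⟩ := hx
  rw [Set.Definable₁, Set.definable_iff_finitely_definable] at hS
  obtain ⟨A₀, hA₀, hS⟩ := hS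
  rw [Set.definable_iff_exists_formula_sum] at hS
  obtain ⟨φ, hφ⟩ := hS
  let e := A₀.equivFin
  have key : ∀ y, y ∈ S ↔ (φ.relabel (Sum.map e fun _ => ())).Realize
      (Sum.elim (fun i => (e.symm i : N)) fun _ => y) := by
    intro y
    have h1 : (fun _ : Fin 1 => y) ∈ {x : Fin 1 → N | x 0 ∈ S} ↔ y ∈ S := Iff.rfl
    rw [← h1, hφ, Formula.realize_relabel, Set.mem_ofPred_eq, iff_iff_eq]
    congr 1
    funext s
    rcases s with s | s
    · simp
    · rfl
  exact ⟨_, _, fun i => (e.symm i : N), fun i => hA₀ (e.symm i).2, (key x).1 hx,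
    hfin.subset fun y hy => (key y).2 hy⟩

lemma acl_finitary (A : Set N) (x : N) :
    x ∈ acl L A ↔ ∃ A₀ ⊆ A, A₀.Finite ∧ x ∈ acl L A₀ := by
  constructor
  · intro hx
    obtain ⟨n, φ, a, ha, hφ, hfin⟩ := exists_formula_of_mem_acl hx
    exact ⟨Set.range a, Set.range_subset_iff.2 ha, Set.finite_range a,
      mem_acl_of_formula φ (fun i => Set.mem_range_self i) hφ hfin⟩
  · rintro ⟨A₀, hA, _, S, hS, h⟩
    exact ⟨S, hS.mono hA, h⟩

lemma subset_acl (A : Set N) : A ⊆ acl L A := by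
  intro x hx
  let φ : L.Formula (Unit ⊕ Unit) := Term.equal (Term.var (Sum.inl ())) (Term.var (Sum.inr ()))
  have hφ : ∀ y : N, φ.Realize (Sum.elim (fun _ => x) fun _ => y) ↔ x = y := by
    intro y; simp [φ]
  exact mem_acl_of_formula φ (a := fun _ => x) (fun _ => hx) ((hφ x).2 rfl)
    ((Set.finite_singleton x).subset fun y hy => ((hφ y).1 hy).symm)

lemma finite_of_no_injective {S : Set N} {K : ℕ}
    (h : ¬ ∃ z : Fin (K + 1) → N, (∀ j, z j ∈ S) ∧ Function.Injective z) : S.Finite := by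
  by_contra hS
  have := Set.Infinite.to_subtype hS
  exact h ⟨fun j => ((Infinite.natEmbedding S) j : N), fun j => Subtype.coe_prop _,
    fun i j hij => Fin.ext ((Infinite.natEmbedding S).injective (Subtype.ext hij))⟩

lemma Elem.injective (ι : Type*) [Finite ι] :
    Elem (L := L) (fun (N : Type u) [L.Structure N] (v : ι → N) => Function.Injective v) :=
  Elem.of_samePat ∅ Set.finite_empty fun _ _ _ _ _ _ h hv _ _ hij => hv ((h.1 _ _).2 hij)

/-- Quantifying out the intermediate tuple is not enough, since `φ(b', ·)` is known to have finitely
many solutions only for `b' = b`. The formula also demands that `φ(b', ·)` have at most `K`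
solutions, which makes the defined set a finite union of finite sets. -/
lemma acl_trans {A X : Set N} (hX : X ⊆ acl L A) : acl L X ⊆ acl L A := by
  intro x hx
  obtain ⟨n, φ, b, hb, hφx, hφf⟩ := exists_formula_of_mem_acl hx
  choose m ψ a ha hψ hψf using fun i => exists_formula_of_mem_acl (hX (hb i))
  set S : Set N := {y | φ.Realize (Sum.elim b fun _ => y)} with hS
  let K := S.ncard
  let ι := Σ i : Fin n, Fin (m i)
  have hel : Elem (L := L) (fun (N : Type u) [L.Structure N] (v : ι ⊕ Unit → N) =>
      ∃ b' : Fin n → N, (∀ i, (ψ i).Realize (Sum.elim (fun j => v (.inl ⟨i, j⟩)) fun _ => b' i)) ∧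
        φ.Realize (Sum.elim b' fun _ => v (.inr ())) ∧
        ¬ ∃ z : Fin (K + 1) → N, (∀ j, φ.Realize (Sum.elim b' fun _ => z j)) ∧
          Function.Injective z) := by
    have h1 : Elem (L := L) (fun (N : Type u) [L.Structure N] (v : (ι ⊕ Unit) ⊕ Fin n → N) =>
        ∀ i, (ψ i).Realize (v ∘ (Sum.elim (fun j => .inl (.inl ⟨i, j⟩)) fun _ => .inr i))) :=
      Elem.forall_finite fun i => (Elem.of_formula (ψ i)).comp _
    have h2 : Elem (L := L) (fun (N : Type u) [L.Structure N] (v : (ι ⊕ Unit) ⊕ Fin n → N) =>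
        φ.Realize (v ∘ (Sum.elim (fun j => .inr j) fun _ => .inl (.inr ())))) :=
      (Elem.of_formula φ).comp _
    have h3 : Elem (L := L) (fun (N : Type u) [L.Structure N]
        (v : ((ι ⊕ Unit) ⊕ Fin n) ⊕ Fin (K + 1) → N) =>
        (∀ j, φ.Realize (v ∘ (Sum.elim (fun j => .inl (.inr j)) fun _ => .inr j))) ∧
          Function.Injective (v ∘ Sum.inr)) :=
      (Elem.forall_finite fun j => (Elem.of_formula φ).comp _).and
        ((Elem.injective (Fin (K + 1))).comp _)
    refine (h1.and (h2.and h3.ex.not)).ex.congr fun N _ v => exists_congr fun b' => ?_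
    refine and_congr (forall_congr' fun i => ?_) (and_congr ?_ (not_congr
      (exists_congr fun z => and_congr (forall_congr' fun j => ?_) ?_)))
    · rw [iff_iff_eq]; congr 1; funext s; rcases s with s | s <;> rfl
    · rw [iff_iff_eq]; congr 1; funext s; rcases s with s | s <;> rfl
    · rw [iff_iff_eq]; congr 1; funext s; rcases s with s | s <;> rfl
    · rfl
  refine mem_acl_of_elem hel (a := fun s : ι => a s.1 s.2) (fun s => ha s.1 s.2) ?_ ?_
  · refine ⟨b, hψ, hφx, ?_⟩
    rintro ⟨z, hz, hinj⟩
    have h1 : Set.range z ⊆ S := Set.range_subset_iff.2 hz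
    have h2 := Set.ncard_le_ncard h1 hφf
    rw [← Set.image_univ, Set.ncard_image_of_injective _ hinj, Set.ncard_univ, Nat.card_fin] at h2
    omega
  · have hfin : (Set.pi Set.univ fun i => {y | (ψ i).Realize (Sum.elim (a i) fun _ => y)}).Finite :=
      Set.Finite.pi' hψf |>.subset fun f hf i => hf i trivial
    refine (Set.Finite.biUnion (hfin.inter_of_left
      {b' | ¬ ∃ z : Fin (K + 1) → N, (∀ j, φ.Realize (Sum.elim b' fun _ => z j)) ∧
          Function.Injective z}) (t := fun b' => {y | φ.Realize (Sum.elim b' fun _ => y)})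
      fun b' hb' => finite_of_no_injective hb'.2).subset ?_
    rintro y ⟨b', h1, h2, h3⟩
    exact Set.mem_biUnion ⟨fun i _ => h1 i, h3⟩ h2

/-- A family of finite sets has only finitely many transversals of least size. -/
lemma finite_transversals {X : Type*} (K : ℕ) : ∀ H : Set (Set X), (∀ h ∈ H, h.Finite) →
    (∀ T : Set X, T.Finite → (∀ h ∈ H, (h ∩ T).Nonempty) → K ≤ T.ncard) →
    {T : Set X | T.Finite ∧ T.ncard = K ∧ ∀ h ∈ H, (h ∩ T).Nonempty}.Finite := by
  induction K with
  | zero =>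
    intro H _ _
    refine (Set.finite_singleton ∅).subset ?_
    rintro T ⟨hT, h0, _⟩
    exact (Set.ncard_eq_zero hT).1 h0
  | succ K ih =>
    intro H hH hmin
    have hne : H.Nonempty := by
      by_contra hne
      rw [Set.not_nonempty_iff_eq_empty] at hne
      have := hmin ∅ Set.finite_empty (by simp [hne])
      simp at this
    obtain ⟨h, hh⟩ := hne
    have key : ∀ x ∈ h, {T : Set X | T.Finite ∧ T.ncard = K ∧
        ∀ h' ∈ {h' ∈ H | x ∉ h'}, (h' ∩ T).Nonempty}.Finite := by
      intro x _
      refine ih _ (fun h' hh' => hH h' hh'.1) fun T hT hTr => ?_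
      have h1 := hmin (insert x T) (hT.insert x) fun h' hh' => by
        by_cases hx : x ∈ h'
        · exact ⟨x, hx, Set.mem_insert x T⟩
        · exact (hTr h' ⟨hh', hx⟩).mono (Set.inter_subset_inter_right _ (Set.subset_insert x T))
      have h2 := Set.ncard_insert_le x T
      omega
    -- A least transversal meets `h` in some `x`. Without `x` it is a least transversal of the
    -- members of `H` that miss `x`, and `h` has only finitely many points.
    refine ((hH h hh).biUnion fun x hx => (key x hx).image (insert x)).subset ?_
    rintro T ⟨hT, hcard, hTr⟩
    obtain ⟨x, hxh, hxT⟩ := hTr h hh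
    refine Set.mem_biUnion hxh ⟨T \ {x}, ⟨hT.sdiff, ?_, ?_⟩, ?_⟩
    · rw [Set.ncard_sdiff_singleton_of_mem hxT]; omega
    · rintro h' ⟨hh', hx⟩
      obtain ⟨y, hy, hyT⟩ := hTr h' hh'
      exact ⟨y, hy, hyT, fun hyx => hx (by rwa [← show y = x from hyx])⟩
    · rw [Set.insert_sdiff_singleton, Set.insert_eq_of_mem hxT]

/-- If the members of a definable family of tuples all meet a fixed finite set, then each of them
meets the algebraic closure of the parameters. -/
lemma exists_mem_acl_of_transversal {ι κ : Type*} [Finite κ]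
    {p : ∀ (N : Type u) [L.Structure N], (ι ⊕ κ → N) → Prop} (hp : Elem p) (a : ι → N)
    {F : Set N} (hF : F.Finite) (hFp : ∀ y : κ → N, p N (Sum.elim a y) → ∃ i, y i ∈ F)
    {b : κ → N} (hb : p N (Sum.elim a b)) : ∃ i, b i ∈ acl L (Set.range a) := by
  classical
  set H : Set (Set N) := {h | ∃ y : κ → N, p N (Sum.elim a y) ∧ h = Set.range y} with hH
  have hHf : ∀ h ∈ H, h.Finite := by rintro _ ⟨y, _, rfl⟩; exact Set.finite_range y
  have hex : ∃ K, ∃ T : Set N, T.Finite ∧ (∀ h ∈ H, (h ∩ T).Nonempty) ∧ T.ncard = K := by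
    refine ⟨_, F, hF, ?_, rfl⟩
    rintro _ ⟨y, hy, rfl⟩
    obtain ⟨i, hi⟩ := hFp y hy
    exact ⟨y i, ⟨i, rfl⟩, hi⟩
  set K := Nat.find hex with hK
  obtain ⟨T, hT, hTr, hTK⟩ := Nat.find_spec hex
  have hmin : ∀ T : Set N, T.Finite → (∀ h ∈ H, (h ∩ T).Nonempty) → K ≤ T.ncard :=
    fun T hT hTr => Nat.find_min' hex ⟨T, hT, hTr, rfl⟩
  -- The union of the least transversals is finite, definable over `a`, and meets every member of
  -- the family.
  have hfin := finite_transversals K H hHf hmin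
  have hel : Elem (L := L) (fun (N : Type u) [L.Structure N] (v : ι ⊕ Unit → N) =>
      ∃ z : Fin K → N, (∃ j, z j = v (.inr ())) ∧
        ∀ y : κ → N, p N (Sum.elim (fun i => v (.inl i)) y) → ∃ i j, y i = z j) := by
    have h1 : Elem (L := L) (fun (N : Type u) [L.Structure N] (v : (ι ⊕ Unit) ⊕ Fin K → N) =>
        ∃ j, (v ∘ (Sum.elim .inr fun _ => .inl (.inr ()) : Fin K ⊕ Unit → _)) (.inl j) =
          (v ∘ (Sum.elim .inr fun _ => .inl (.inr ()) : Fin K ⊕ Unit → _)) (.inr ())) :=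
      Elem.comp (p := fun (N : Type u) [L.Structure N] (v : Fin K ⊕ Unit → N) =>
        ∃ j, v (.inl j) = v (.inr ())) (Elem.of_samePat ∅ Set.finite_empty
          fun _ _ _ _ _ _ h ⟨j, hj⟩ => ⟨j, (h.1 _ _).1 hj⟩) _
    have h2 : Elem (L := L) (fun (N : Type u) [L.Structure N]
        (v : ((ι ⊕ Unit) ⊕ Fin K) ⊕ κ → N) =>
        p N (v ∘ Sum.elim (fun i => .inl (.inl (.inl i))) .inr)) := hp.comp _
    have h3 : Elem (L := L) (fun (N : Type u) [L.Structure N]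
        (v : ((ι ⊕ Unit) ⊕ Fin K) ⊕ κ → N) =>
        ∃ i j, (v ∘ (Sum.elim (fun i => .inl (.inr i)) .inr : Fin K ⊕ κ → _)) (.inr i) =
          (v ∘ (Sum.elim (fun i => .inl (.inr i)) .inr : Fin K ⊕ κ → _)) (.inl j)) :=
      Elem.comp (p := fun (N : Type u) [L.Structure N] (v : Fin K ⊕ κ → N) =>
        ∃ i j, v (.inr i) = v (.inl j)) (Elem.of_samePat ∅ Set.finite_empty
          fun _ _ _ _ _ _ h ⟨i, j, hj⟩ => ⟨i, j, (h.1 _ _).1 hj⟩) _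
    refine (h1.and (h2.imp h3).all).ex.congr fun N _ v => exists_congr fun z =>
      and_congr Iff.rfl (forall_congr' fun y => imp_congr ?_ Iff.rfl)
    rw [iff_iff_eq]; congr 1; funext s; rcases s with s | s <;> rfl
  obtain ⟨_, ⟨i, rfl⟩, hiT⟩ := hTr _ ⟨b, hb, rfl⟩
  refine ⟨i, mem_acl_of_elem hel (a := a) (fun i => Set.mem_range_self i) ?_ ?_⟩
  · have := hT.to_subtype
    have hc : Nat.card T = K := by rw [Nat.card_coe_set_eq, hTK]
    let e := (Finite.equivFinOfCardEq hc).symm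
    refine ⟨fun j => (e j : N), ⟨e.symm ⟨b i, hiT⟩, by simp⟩, fun y hy => ?_⟩
    obtain ⟨_, ⟨i', rfl⟩, hi'⟩ := hTr _ ⟨y, hy, rfl⟩
    exact ⟨i', e.symm ⟨y i', hi'⟩, by simp⟩
  · refine (hfin.biUnion fun T hT => hT.1).subset ?_
    rintro x ⟨z, ⟨j, hj⟩, hz⟩
    have hzr : ∀ h ∈ H, (h ∩ Set.range z).Nonempty := by
      rintro _ ⟨y, hy, rfl⟩
      obtain ⟨i, j, hij⟩ := hz y hy
      exact ⟨y i, ⟨i, rfl⟩, j, hij.symm⟩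
    have hzf := Set.finite_range z
    have hc : (Set.range z).ncard ≤ K := by
      rw [← Set.image_univ]
      exact (Set.ncard_image_le Set.finite_univ).trans (by rw [Set.ncard_univ, Nat.card_fin])
    exact Set.mem_biUnion (x := Set.range z) ⟨hzf, le_antisymm hc (hmin _ hzf hzr), hzr⟩ ⟨j, hj⟩

end AlgebraicClosure

/-! ### Simple algebraicity as a property of the relative type. -/

section Algebraic

variable {L : FirstOrder.Language.{0, 0}} {V W : Type*} [L.Structure V] [L.Structure W]

lemma occ_diff_image {P : Set (RelSym L)} {f : V → W} {S S' : Set V}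
    (hf : Set.InjOn f S) (hS' : S' ⊆ S)
    (hrel : ∀ r ∈ P, ∀ x : Fin r.1 → V, (∀ i, x i ∈ S) → (¬ ∀ i, x i ∈ S') →
      (Structure.RelMap r.2 x ↔ Structure.RelMap r.2 (f ∘ x))) :
    occ P (f '' S) \ occ P (f '' S') = occMap f '' (occ P S \ occ P S') := by
  apply Set.Subset.antisymm
  · rintro p ⟨⟨hr, y, hy, hyS, hp⟩, hp'⟩
    choose x hx hxy using hyS
    obtain rfl : y = f ∘ x := funext fun i => (hxy i).symm
    have hx' : ¬ ∀ i, x i ∈ S' := fun hx' => hp' ⟨hr, _, hy, fun i => ⟨x i, hx' i, rfl⟩, hp⟩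
    refine ⟨(p.1, Finset.univ.val.map x), ⟨⟨hr, x, (hrel _ hr x hx hx').2 hy, hx, rfl⟩, ?_⟩, ?_⟩
    · exact fun h => hx' fun i => mem_of_mem_occ h _ (Multiset.mem_map_of_mem x (Finset.mem_univ_val i))
    · refine Prod.ext rfl ?_
      simp only [occMap, Multiset.map_map]
      rw [hp]
  · rintro _ ⟨p, ⟨⟨hr, x, hx, hxS, hp⟩, hp'⟩, rfl⟩
    have hx' : ¬ ∀ i, x i ∈ S' := fun hx' => hp' ⟨hr, x, hx, hx', hp⟩
    refine ⟨⟨hr, f ∘ x, (hrel _ hr x hxS hx').1 hx, fun i => ⟨x i, hxS i, rfl⟩, ?_⟩, fun h' => hx' fun i => ?_⟩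
    · simp only [occMap, hp, Multiset.map_map]
      rfl
    · obtain ⟨s, hs, hsx⟩ := mem_of_mem_occ h' (f (x i)) (by
        simp only [occMap, hp]
        exact Multiset.mem_map_of_mem f (Multiset.mem_map_of_mem x (Finset.mem_univ_val i)))
      rwa [← hf (hS' hs) (hxS i) hsx]

/-- The number of occurrences on `S` that are not on `A`. -/
noncomputable def newOcc (L : FirstOrder.Language.{0, 0}) {V : Type*} [L.Structure V]
    (A S : Set V) : ℕ := (occ (Set.univ : Set (RelSym L)) S \ occ Set.univ A).ncard

lemma delta_union_eq (h : OccFin L V) {A B : Set V} (hA : A.Finite) (hB : B.Finite)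
    (hd : Disjoint A B) :
    delta L (A ∪ B) = delta L A + (B.ncard : ℤ) - (newOcc L A (A ∪ B) : ℤ) := by
  have := predim_sub h (Set.univ : Set (RelSym L)) (hA.union hB) (Set.subset_union_left (s := A) (t := B))
  rw [Set.union_sdiff_left, hd.symm.sdiff_eq_left] at this
  unfold delta newOcc
  linarith

/-- The predimension of the base cancels, and only occurrences not inside `A` are counted. Hence the
notion depends on the relative type alone and survives a change of the relations on the base. -/
lemma simplyAlgebraic_iff (h : OccFin L V) {A B : Set V} (hA : A.Finite) (hB : B.Finite) :
    SimplyAlgebraic L A B ↔ B.Nonempty ∧ Disjoint A B ∧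
      (∀ B' ⊆ B, newOcc L A (A ∪ B') ≤ B'.ncard) ∧ newOcc L A (A ∪ B) = B.ncard ∧
      ∀ B' ⊂ B, B'.Nonempty → newOcc L A (A ∪ B') ≠ B'.ncard := by
  unfold SimplyAlgebraic
  refine and_congr_right fun _ => and_congr_right fun hd => ?_
  have key : ∀ B' ⊆ B, delta L (A ∪ B') = delta L A + (B'.ncard : ℤ) - (newOcc L A (A ∪ B') : ℤ) :=
    fun B' hB' => delta_union_eq h hA (hB.subset hB') (hd.mono_right hB')
  refine and_congr ?_ (and_congr ?_ ?_)
  · constructor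
    · intro h1 B' hB'
      have := h1 (A ∪ B') Set.subset_union_left (Set.union_subset_union_right A hB')
      rw [key B' hB'] at this
      omega
    · intro h1 D hAD hD
      have hD' : D = A ∪ (D \ A) := (Set.union_sdiff_cancel hAD).symm
      have hs : D \ A ⊆ B := Set.sdiff_subset_iff.2 hD
      have := h1 _ hs
      rw [hD', key _ hs]
      omega
  · rw [key B subset_rfl]; omega
  · refine forall_congr' fun B' => forall_congr' fun hB' => forall_congr' fun _ => ?_
    rw [key B' hB'.subset]; omega

/-- `f` is injective on `S` and preserves and reflects relations on tuples in `S` not inside `A`. -/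
def RelEmbOn (L : FirstOrder.Language.{0, 0}) {V W : Type*} [L.Structure V] [L.Structure W]
    (f : V → W) (A S : Set V) : Prop :=
  Set.InjOn f S ∧ ∀ (r : RelSym L) (x : Fin r.1 → V), (∀ i, x i ∈ S) → (¬ ∀ i, x i ∈ A) →
    (Structure.RelMap r.2 x ↔ Structure.RelMap r.2 (f ∘ x))

lemma IsEmb.relEmbOn {f : V → W} (h : IsEmb L f) (A S : Set V) : RelEmbOn L f A S :=
  ⟨h.1.injOn, fun r x _ _ => h.2 r x⟩

lemma RelEmbOn.newOcc_eq {f : V → W} {A B A' B' : Set V} (hf : RelEmbOn L f A (A ∪ B))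
    (hd : Disjoint A B) (hA : A' ⊆ A) (hB : B' ⊆ B) :
    newOcc L (f '' A') (f '' A' ∪ f '' B') = newOcc L A' (A' ∪ B') := by
  have hs : A' ∪ B' ⊆ A ∪ B := Set.union_subset_union hA hB
  unfold newOcc
  rw [← Set.image_union, occ_diff_image (hf.1.mono hs) Set.subset_union_left]
  · exact Set.InjOn.ncard_image (occMap_injOn (hf.1.mono hs) fun p hp => mem_of_mem_occ hp.1)
  · intro r _ x hx hx'
    refine hf.2 r x (fun i => hs (hx i)) fun hxA => hx' fun i => ?_
    exact (hx i).resolve_right fun h => Set.disjoint_left.1 hd (hxA i) (hB h)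

lemma RelEmbOn.simplyAlgebraic_iff (hV : OccFin L V) (hW : OccFin L W) {f : V → W}
    {A B A' : Set V} (hA : A.Finite) (hB : B.Finite) (hf : RelEmbOn L f A (A ∪ B))
    (hd : Disjoint A B) (hA' : A' ⊆ A) :
    SimplyAlgebraic L (f '' A') (f '' B) ↔ SimplyAlgebraic L A' B := by
  rw [HrushovskiGeneric.simplyAlgebraic_iff hW ((hA.subset hA').image f) (hB.image f),
    HrushovskiGeneric.simplyAlgebraic_iff hV (hA.subset hA') hB]
  have hfB : Set.InjOn f B := hf.1.mono Set.subset_union_right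
  have hd' : Disjoint A' B := hd.mono_left hA'
  have hdi : Disjoint (f '' A') (f '' B) :=
    hd'.image hf.1 (hA'.trans Set.subset_union_left) Set.subset_union_right
  have hn : ∀ B' ⊆ B, newOcc L (f '' A') (f '' A' ∪ f '' B') = newOcc L A' (A' ∪ B') :=
    fun B' hB' => hf.newOcc_eq hd hA' hB'
  have hc : ∀ B' ⊆ B, (f '' B').ncard = B'.ncard := fun B' hB' => (hfB.mono hB').ncard_image
  refine and_congr Set.image_nonempty (and_congr (iff_of_true hdi hd') (and_congr ?_
    (and_congr (by rw [hn B subset_rfl, hc B subset_rfl]) ?_)))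
  · constructor
    · intro h B' hB'
      have := h (f '' B') (Set.image_mono hB')
      rwa [hn B' hB', hc B' hB'] at this
    · intro h D hD
      obtain ⟨B', hB', rfl⟩ := Set.subset_image_iff.1 hD
      rw [hn B' hB', hc B' hB']
      exact h B' hB'
  · constructor
    · intro h B' hB' hne
      have := h (f '' B') ⟨Set.image_mono hB'.1, fun hs => hB'.2 fun y hy => by
        obtain ⟨z, hz, hzy⟩ := hs ⟨y, hy, rfl⟩
        rwa [← hfB (hB'.1 hz) hy hzy]⟩ (hne.image f)
      rwa [hn B' hB'.1, hc B' hB'.1] at this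
    · intro h D hD hne
      obtain ⟨B', hB', rfl⟩ := Set.subset_image_iff.1 hD.1
      rw [hn B' hB', hc B' hB']
      exact h B' ⟨hB', fun hs => hD.2 (Set.image_mono hs)⟩ (Set.image_nonempty.1 hne)

lemma RelEmbOn.minSimplyAlgebraic_iff (hV : OccFin L V) (hW : OccFin L W) {f : V → W}
    {A B : Set V} (hA : A.Finite) (hB : B.Finite) (hf : RelEmbOn L f A (A ∪ B))
    (hd : Disjoint A B) :
    MinSimplyAlgebraic L (f '' A) (f '' B) ↔ MinSimplyAlgebraic L A B := by
  refine and_congr (hf.simplyAlgebraic_iff hV hW hA hB hd subset_rfl) ?_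
  have hfA : Set.InjOn f A := hf.1.mono Set.subset_union_left
  constructor
  · intro h A' hA' hs
    refine h (f '' A') ⟨Set.image_mono hA'.1, fun hs => hA'.2 fun y hy => by
        obtain ⟨z, hz, hzy⟩ := hs ⟨y, hy, rfl⟩
        rwa [← hfA (hA'.1 hz) hy hzy]⟩ ((hf.simplyAlgebraic_iff hV hW hA hB hd hA'.1).2 hs)
  · intro h D hD hs
    obtain ⟨A', hA', rfl⟩ := Set.subset_image_iff.1 hD.1
    exact h A' ⟨hA', fun hs => hD.2 (Set.image_mono hs)⟩
      ((hf.simplyAlgebraic_iff hV hW hA hB hd hA').1 hs)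

/-- Otherwise deleting `a` from the base would change none of the counts of new occurrences, and `B`
would be simply algebraic over a smaller base. -/
lemma MinSimplyAlgebraic.exists_rel (h : OccFin L V) {A B : Set V} (hA : A.Finite) (hB : B.Finite)
    (hm : MinSimplyAlgebraic L A B) {a : V} (ha : a ∈ A) :
    ∃ (r : RelSym L) (x : Fin r.1 → V), Structure.RelMap r.2 x ∧ (∀ i, x i ∈ A ∪ B) ∧
      (¬ ∀ i, x i ∈ A) ∧ ∃ i, x i = a := by
  by_contra hno
  push Not at hno
  have hn : ∀ B' ⊆ B, newOcc L (A \ {a}) (A \ {a} ∪ B') = newOcc L A (A ∪ B') := by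
    intro B' hB'
    unfold newOcc
    congr 1
    ext p
    constructor
    · rintro ⟨⟨hr, x, hx, hxS, hp⟩, hp'⟩
      refine ⟨⟨hr, x, hx, fun i => (hxS i).imp_left fun h => h.1, hp⟩, fun hpA => hp' ?_⟩
      refine ⟨hr, x, hx, fun i => (hxS i).elim id fun hi => ?_, hp⟩
      have := mem_of_mem_occ hpA (x i) (by rw [hp]; exact Multiset.mem_map_of_mem x (Finset.mem_univ_val i))
      exact absurd (hB' hi) (Set.disjoint_left.1 hm.1.2.1 this)
    · rintro ⟨⟨hr, x, hx, hxS, hp⟩, hp'⟩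
      have hxA : ¬ ∀ i, x i ∈ A := fun hxA => hp' ⟨hr, x, hx, hxA, hp⟩
      have := hno p.1 x hx (fun i => (hxS i).imp_right fun h => hB' h) (not_forall.1 hxA)
      refine ⟨⟨hr, x, hx, fun i => (hxS i).imp_left fun h => ⟨h, this i⟩, hp⟩, fun hpA => hp' ?_⟩
      exact occ_mono subset_rfl Set.sdiff_subset hpA
  refine hm.2 (A \ {a}) (Set.sdiff_singleton_ssubset.2 ha) ?_
  have h1 := (simplyAlgebraic_iff h hA hB).1 hm.1
  refine (simplyAlgebraic_iff h hA.sdiff hB).2 ⟨h1.1, h1.2.1.mono_left Set.sdiff_subset, ?_, ?_, ?_⟩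
  · exact fun B' hB' => (hn B' hB').trans_le (h1.2.2.1 B' hB')
  · exact (hn B subset_rfl).trans h1.2.2.2.1
  · exact fun B' hB' hne => (hn B' hB'.1).trans_ne (h1.2.2.2.2 B' hB' hne)

lemma exists_minSimplyAlgebraic {A B : Set V} (hA : A.Finite) (hs : SimplyAlgebraic L A B) :
    ∃ A' ⊆ A, MinSimplyAlgebraic L A' B := by
  obtain ⟨A', hA', hmin⟩ := (hA.finite_subsets.inter_of_left {A' | SimplyAlgebraic L A' B}).exists_minimal
    ⟨A, Set.Subset.refl A, hs⟩
  exact ⟨A', hA'.1, hA'.2, fun A'' h1 h2 => h1.2 (hmin ⟨h1.1.trans hA'.1, h2⟩ h1.1)⟩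

end Algebraic

/-! ### Minimally simply algebraic pairs and their positive copies. -/

section Extensions

variable {L : FirstOrder.Language.{0, 0}} {V : Type*} [L.Structure V]

instance extStructure (E : Ext L) : L.Structure (Fin E.size) := E.str

lemma occFin_of_finite [Finite V] (h : (occ (Set.univ : Set (RelSym L)) (Set.univ : Set V)).Finite) :
    OccFin L V := fun _ _ => h.subset (occ_mono subset_rfl (Set.subset_univ _))

lemma Ext.IsMSA.occFin {E : Ext L} (hE : E.IsMSA) : OccFin L (Fin E.size) :=
  occFin_of_finite hE.2.1

lemma Ext.IsMSA.msa {E : Ext L} (hE : E.IsMSA) : MinSimplyAlgebraic L E.base E.baseᶜ := hE.2.2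

lemma Ext.isMSA_iff {E : Ext L} : E.IsMSA ↔ Symmetric L (Fin E.size) ∧ OccFin L (Fin E.size) ∧
    MinSimplyAlgebraic L E.base E.baseᶜ :=
  ⟨fun h => ⟨h.1, h.occFin, h.msa⟩, fun h => ⟨h.1, h.2.1 _ Set.finite_univ, h.2.2⟩⟩

lemma Ext.SameRelType.relEmbOn {E E' : Ext L} {σ : Fin E.size ≃ Fin E'.size}
    (h : E.SameRelType E' σ) : RelEmbOn L σ E.base (E.base ∪ E.baseᶜ) :=
  ⟨σ.injective.injOn, fun r x _ hx => h.2 r x hx⟩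

lemma Ext.SameRelType.isMSA {E E' : Ext L} {σ : Fin E.size ≃ Fin E'.size}
    (h : E.SameRelType E' σ) (hE : E.IsMSA) (hs : Symmetric L (Fin E'.size))
    (ho : OccFin L (Fin E'.size)) : E'.IsMSA := by
  refine Ext.isMSA_iff.2 ⟨hs, ho, ?_⟩
  have hb : E'.base = σ '' E.base := by
    ext v
    obtain ⟨v, rfl⟩ := σ.surjective v
    rw [← h.1, σ.injective.mem_set_image]
  have hb' : E'.baseᶜ = σ '' E.baseᶜ := by rw [hb, Set.image_compl_eq σ.bijective]
  rw [hb', hb]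
  exact (h.relEmbOn.minSimplyAlgebraic_iff hE.occFin ho (Set.toFinite _) (Set.toFinite _)
    disjoint_compl_right).2 hE.msa

/-- An injection of the larger structure of `E` preserving the relative type. -/
def PosCopy (E : Ext L) (f : Fin E.size → V) : Prop :=
  Function.Injective f ∧ ∀ (r : RelSym L) (x : Fin r.1 → Fin E.size), (¬ ∀ i, x i ∈ E.base) →
    E.Rel r x → Structure.RelMap r.2 (f ∘ x)

lemma OfForm.posCopy {E : Ext L} {a : Fin E.size → V} {r : ℕ} {F : Fin r → Fin E.size → V}
    (h : OfForm E a F) (j : Fin r) : PosCopy E (F j) :=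
  ⟨h.2.2.1 j, fun s x => h.2.2.2.2.1 j s x⟩

lemma OfForm.image_base {E : Ext L} {a : Fin E.size → V} {r : ℕ} {F : Fin r → Fin E.size → V}
    (h : OfForm E a F) (j : Fin r) : F j '' E.base = a '' E.base :=
  Set.image_congr fun v hv => h.2.2.2.1 j v hv

/-- All symbols of the relative type of `E` belong to `P`. -/
def Ext.SymIn (E : Ext L) (P : Set (RelSym L)) : Prop :=
  ∀ (r : RelSym L) (x : Fin r.1 → Fin E.size), (¬ ∀ i, x i ∈ E.base) → E.Rel r x → r ∈ P

lemma Ext.symIn_univ (E : Ext L) : E.SymIn Set.univ := fun _ _ _ _ => trivial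

lemma Ext.IsMSA.exists_rel {E : Ext L} (hE : E.IsMSA) {v : Fin E.size} (hv : v ∈ E.base) :
    ∃ (r : RelSym L) (x : Fin r.1 → Fin E.size), E.Rel r x ∧ (¬ ∀ i, x i ∈ E.base) ∧
      ∃ i, x i = v := by
  obtain ⟨r, x, h1, _, h2, h3⟩ :=
    hE.msa.exists_rel hE.occFin (Set.toFinite _) (Set.toFinite _) hv
  exact ⟨r, x, h1, h2, h3⟩

lemma Ext.IsMSA.delta_univ {E : Ext L} (hE : E.IsMSA) :
    delta L (Set.univ : Set (Fin E.size)) = delta L E.base := by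
  have := hE.msa.1.2.2.2.1
  rwa [Set.union_compl_self] at this

/-- The occurrences of `E` not inside `E.base ∪ U` survive in a positive copy. Since `E` has the
predimension of its base, their number is that of the remaining points plus the predimension of
`E.base ∪ U` relative to the base. -/
lemma PosCopy.ncard_le (hV : OccFin L V) {E : Ext L} (hE : E.IsMSA) {f : Fin E.size → V}
    (hf : PosCopy E f) {P : Set (RelSym L)} (hP : E.SymIn P) (U : Set (Fin E.size)) :
    occMap f '' (occ (Set.univ : Set (RelSym L)) Set.univ \ occ Set.univ (E.base ∪ U)) ⊆
      occ P (Set.range f) \ occ P (f '' (E.base ∪ U)) ∧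
    delta L (E.base ∪ U) - delta L E.base + ((E.baseᶜ \ U).ncard : ℤ) ≤
      ((occ P (Set.range f) \ occ P (f '' (E.base ∪ U))).ncard : ℤ) := by
  obtain ⟨h0, h1⟩ := ncard_occ_diff_le hV (P := Set.univ) (Q := P) (f := f) (S := Set.univ)
    (S' := E.base ∪ U) Set.finite_univ hf.1.injOn (Set.subset_univ _) fun r _ x _ hx hr => by
      have hx' : ¬ ∀ i, x i ∈ E.base := fun h => hx fun i => .inl (h i)
      exact ⟨hP r x hx' hr, hf.2 r x hx' hr⟩
  rw [Set.image_univ] at h1 h0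
  refine ⟨h0, ?_⟩
  have h2 := predim_sub hE.occFin (Set.univ : Set (RelSym L)) (Set.finite_univ)
    (Set.subset_univ (E.base ∪ U))
  have h3 := hE.delta_univ
  have h4 : (Set.univ : Set (Fin E.size)) \ (E.base ∪ U) = E.baseᶜ \ U := by
    ext; simp
  rw [h4] at h2
  unfold delta at *
  omega

lemma PosCopy.ncard_base_le (hV : OccFin L V) {E : Ext L} (hE : E.IsMSA) {f : Fin E.size → V}
    (hf : PosCopy E f) {P : Set (RelSym L)} (hP : E.SymIn P) :
    E.baseᶜ.ncard ≤ (occ P (Set.range f) \ occ P (f '' E.base)).ncard := by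
  have := (hf.ncard_le hV hE hP ∅).2
  simp only [Set.union_empty, Set.sdiff_empty] at this
  omega

/-- Strict because a nonempty proper part of a simply algebraic extension has predimension strictly
above that of the base. Thus completing a partly present copy always lowers the predimension. -/
lemma PosCopy.ncard_lt (hV : OccFin L V) {E : Ext L} (hE : E.IsMSA) {f : Fin E.size → V}
    (hf : PosCopy E f) {P : Set (RelSym L)} (hP : E.SymIn P) {U : Set (Fin E.size)}
    (hU : U ⊂ E.baseᶜ) (hne : U.Nonempty) :
    (E.baseᶜ \ U).ncard < (occ P (Set.range f) \ occ P (f '' (E.base ∪ U))).ncard := by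
  have h1 := (hf.ncard_le hV hE hP U).2
  have h2 := hE.msa.1.2.2.1 (E.base ∪ U) Set.subset_union_left (Set.union_subset_union_right _ hU.1)
  have h3 := hE.msa.1.2.2.2.2 U hU hne
  omega

variable [L.IsRelational]

/-- The structure induced along a map. -/
abbrev pullStructure {X : Type*} (f : X → V) : L.Structure X where
  funMap f := isEmptyElim f
  RelMap r x := Structure.RelMap r (f ∘ x)

/-- `OfForm` and `μ` speak about pairs living on some `Fin size`; this is how concrete sets are
presented to them. -/
lemma exists_ext {A B : Set V} (hA : A.Finite) (hB : B.Finite) (hd : Disjoint A B) :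
    ∃ (E : Ext L) (f : Fin E.size → V), IsEmb L f ∧ f '' E.base = A ∧ f '' E.baseᶜ = B := by
  obtain ⟨n, f, hf, hr⟩ := (hA.union hB).fin_param
  refine ⟨⟨n, pullStructure f, f ⁻¹' A⟩, f, ⟨hf, fun r x => Iff.rfl⟩, ?_, ?_⟩
  · rw [Set.image_preimage_eq_inter_range, hr, Set.inter_eq_left]
    exact Set.subset_union_left
  · change f '' (f ⁻¹' A)ᶜ = B
    rw [← Set.preimage_compl, Set.image_preimage_eq_inter_range, hr]
    ext x
    simp only [Set.mem_inter_iff, Set.mem_compl_iff, Set.mem_union]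
    constructor
    · tauto
    · exact fun hx => ⟨fun h => Set.disjoint_left.1 hd h hx, .inr hx⟩

lemma IsEmb.isMSA {E : Ext L} {f : Fin E.size → V} (hf : IsEmb L f) (hs : Symmetric L V)
    (ho : OccFin L V) (hm : MinSimplyAlgebraic L (f '' E.base) (f '' E.baseᶜ)) : E.IsMSA := by
  have ho' : OccFin L (Fin E.size) := by
    intro A hA
    have := ho _ (hA.image f)
    rw [(hf.pEmbOn _ A).occ_image subset_rfl] at this
    exact this.of_finite_image (occMap_injOn hf.1.injOn (A := Set.univ) (by simp))
  refine Ext.isMSA_iff.2 ⟨hf.symmetric hs, ho', ?_⟩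
  exact ((hf.relEmbOn _ _).minSimplyAlgebraic_iff ho' ho (Set.toFinite _) (Set.toFinite _)
    disjoint_compl_right).1 hm

end Extensions

/-! ### Points that do not raise `d` are algebraic. -/

section ClosureAlgebraic

variable {L : FirstOrder.Language.{0, 0}} {N : Type u} [L.Structure N]

/-- The number of disjoint copies of any minimally simply algebraic extension is bounded. -/
def CopiesBounded (L : FirstOrder.Language.{0, 0}) (N : Type u) [L.Structure N] : Prop :=
  ∀ E : Ext L, E.IsMSA → ∃ K : ℕ, ∀ (a : Fin E.size → N) (r : ℕ) (F : Fin r → Fin E.size → N),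
    OfForm E a F → r ≤ K

/-- `y` realizes over `A` the relative type of `B`. -/
def RelCopy (L : FirstOrder.Language.{0, 0}) {N : Type u} [L.Structure N] (A B : Set N)
    (y : B → N) : Prop :=
  Function.Injective (Sum.elim (fun a : A => (a : N)) y) ∧
    ∀ (r : RelSym L) (x : Fin r.1 → A ⊕ B), (¬ ∀ i, (x i).isLeft) →
      Structure.RelMap r.2 (Sum.elim (fun a : A => (a : N)) (fun b : B => (b : N)) ∘ x) →
        Structure.RelMap r.2 (Sum.elim (fun a : A => (a : N)) y ∘ x)

/-- Finitely many symbols occur on `A ∪ B`, so the positive relative type is elementary over `A`. If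
all its realizations met one finite set, `exists_mem_acl_of_transversal` would put a point of `B`
into `acl A`. Disjoint realizations can therefore be chosen one after the other. -/
lemma exists_relCopies (h : OccFin L N) {A B : Set N} (hA : A.Finite) (hB : B.Finite)
    (hd : Disjoint A B) (hacl : ∀ b ∈ B, b ∉ acl L A) (r : ℕ) :
    ∃ G : Fin r → B → N, (∀ j, RelCopy L A B (G j)) ∧
      ∀ j j', j ≠ j' → ∀ v v', G j v ≠ G j' v' := by
  classical
  have := hA.to_subtype
  have := hB.to_subtype
  let P : Set (RelSym L) := Prod.fst '' occ (Set.univ : Set (RelSym L)) (A ∪ B)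
  have hP : P.Finite := (h _ (hA.union hB)).image _
  let c : A ⊕ B → N := Sum.elim (fun a : A => (a : N)) (fun b : B => (b : N))
  have hc : ∀ s, c s ∈ A ∪ B := by rintro (s | s); exacts [.inl s.2, .inr s.2]
  let p : ∀ (N' : Type u) [L.Structure N'], (A ⊕ B → N') → Prop := fun N' _ v =>
    Function.Injective v ∧ ∀ r ∈ P, ∀ x : Fin r.1 → A ⊕ B, (¬ ∀ i, (x i).isLeft) →
      Structure.RelMap r.2 (c ∘ x) → Structure.RelMap r.2 (v ∘ x)
  have hp : Elem p := by
    refine Elem.of_samePat P hP fun N₁ N₂ _ _ v v' hs hv => ⟨?_, ?_⟩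
    · exact fun i j hij => hv.1 ((hs.1 i j).2 hij)
    · exact fun r hr x hx hcx => (hs.2 r hr x).1 (hv.2 r hr x hx hcx)
  have hpr : ∀ y : B → N, p N (Sum.elim (fun a : A => (a : N)) y) → RelCopy L A B y := by
    refine fun y hy => ⟨hy.1, fun r x hx hcx => hy.2 r ?_ x hx hcx⟩
    exact ⟨_, mem_occ_of_relMap (Set.mem_univ _) hcx fun i => hc (x i), rfl⟩
  have hb : p N (Sum.elim (fun a : A => (a : N)) fun b : B => (b : N)) := by
    refine ⟨?_, fun _ _ _ _ hx => hx⟩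
    rintro (s | s) (t | t) hst
    · exact congrArg Sum.inl (Subtype.ext hst)
    · exact absurd t.2 (Set.disjoint_left.1 hd (show (t : N) ∈ A from (show (s : N) = t from hst) ▸ s.2))
    · exact absurd s.2 (Set.disjoint_left.1 hd (show (s : N) ∈ A from (show (s : N) = t from hst) ▸ t.2))
    · exact congrArg Sum.inr (Subtype.ext hst)
  have havoid : ∀ F : Set N, F.Finite → ∃ y : B → N, RelCopy L A B y ∧ ∀ i, y i ∉ F := by
    intro F hF
    by_contra hno
    push Not at hno
    obtain ⟨i, hi⟩ := exists_mem_acl_of_transversal hp (fun a : A => (a : N)) hF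
      (fun y hy => hno y (hpr y hy)) hb
    rw [Subtype.range_coe] at hi
    exact hacl i i.2 hi
  induction r with
  | zero => exact ⟨Fin.elim0, fun j => j.elim0, fun j => j.elim0⟩
  | succ r ih =>
    obtain ⟨G, hG, hGd⟩ := ih
    obtain ⟨y, hy, hyF⟩ := havoid (⋃ j, Set.range (G j)) (Set.finite_iUnion fun j => Set.finite_range _)
    have hyG : ∀ j v v', G j v ≠ y v' := fun j v v' he =>
      hyF v' (Set.mem_iUnion.2 ⟨j, v, he⟩)
    refine ⟨Fin.cons y G, fun j => ?_, fun j j' => ?_⟩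
    · refine Fin.cases ?_ (fun j => ?_) j
      · exact hy
      · exact hG j
    · refine Fin.cases ?_ (fun j => ?_) j <;> refine Fin.cases ?_ (fun j' => ?_) j'
      · exact fun h => absurd rfl h
      · exact fun _ v v' => (hyG j' v' v).symm
      · exact fun _ v v' => hyG j v v'
      · exact fun hne v v' => hGd j j' (fun h => hne (h ▸ rfl)) v v'

lemma RelCopy.newOcc_le (h : OccFin L N) {A B : Set N} (hA : A.Finite) (hB : B.Finite)
    (hd : Disjoint A B) {y : B → N} (hy : RelCopy L A B y) :
    Disjoint A (Set.range y) ∧ (Set.range y).ncard = B.ncard ∧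
      newOcc L A (A ∪ B) ≤ newOcc L A (A ∪ Set.range y) := by
  classical
  let f : N → N := fun v => if hv : v ∈ B then y ⟨v, hv⟩ else v
  have hfA : ∀ v ∈ A, f v = v := fun v hv => dif_neg (Set.disjoint_left.1 hd hv)
  have hfB : ∀ v : B, f v = y v := fun v => dif_pos v.2
  have hfA' : f '' A = A := by
    ext v; constructor
    · rintro ⟨w, hw, rfl⟩; rwa [hfA w hw]
    · exact fun hv => ⟨v, hv, hfA v hv⟩
  have hfB' : f '' B = Set.range y := by
    ext v; constructor
    · rintro ⟨w, hw, rfl⟩; exact ⟨⟨w, hw⟩, (hfB ⟨w, hw⟩).symm⟩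
    · rintro ⟨w, rfl⟩; exact ⟨w, w.2, hfB w⟩
  have hinj : Set.InjOn f (A ∪ B) := by
    have key : ∀ v, v ∈ A ∪ B → ∃ s : A ⊕ B,
        Sum.elim (fun a : A => (a : N)) (fun b : B => (b : N)) s = v ∧
        Sum.elim (fun a : A => (a : N)) y s = f v := by
      rintro v (hv | hv)
      · exact ⟨.inl ⟨v, hv⟩, rfl, (hfA v hv).symm⟩
      · exact ⟨.inr ⟨v, hv⟩, rfl, (hfB ⟨v, hv⟩).symm⟩
    intro v hv w hw hvw
    obtain ⟨s, rfl, hs⟩ := key v hv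
    obtain ⟨t, rfl, ht⟩ := key w hw
    rw [hy.1 (hs.trans (hvw.trans ht.symm))]
  refine ⟨?_, ?_, ?_⟩
  · rw [← hfB', ← hfA']
    exact hd.image hinj Set.subset_union_left Set.subset_union_right
  · rw [← hfB']
    exact (hinj.mono Set.subset_union_right).ncard_image
  · have := (ncard_occ_diff_le h (P := Set.univ) (Q := Set.univ) (f := f) (S := A ∪ B) (S' := A)
      (hA.union hB) hinj Set.subset_union_left fun r _ x hx hxA hr => ⟨trivial, ?_⟩).2
    · rwa [Set.image_union, hfA', hfB'] at this
    · have : ∀ i, ∃ s : A ⊕ B,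
          Sum.elim (fun a : A => (a : N)) (fun b : B => (b : N)) s = x i ∧
          Sum.elim (fun a : A => (a : N)) y s = f (x i) ∧ (s.isLeft → x i ∈ A) := by
        intro i
        rcases hx i with hv | hv
        · exact ⟨.inl ⟨_, hv⟩, rfl, (hfA _ hv).symm, fun _ => hv⟩
        · exact ⟨.inr ⟨_, hv⟩, rfl, (hfB ⟨_, hv⟩).symm, by simp⟩
      choose s hs hs' hsA using this
      have h1 := hy.2 r s (fun hl => hxA fun i => hsA i (hl i))
        (by rwa [show Sum.elim (fun a : A => (a : N)) (fun b : B => (b : N)) ∘ s = x from funext hs])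
      rwa [show Sum.elim (fun a : A => (a : N)) y ∘ s = f ∘ x from funext hs'] at h1

variable [L.IsRelational]

/-- If `B` avoids `acl A`, there are arbitrarily many disjoint positive copies over `A`. If `δ`
drops, each copy costs at least 1, and more than `δ(A)` copies make the predimension negative. If
`δ` is unchanged, minimality makes `B` simply algebraic over `A`, hence minimally so over some `A' ⊆
A`, and the number of copies is bounded. -/
lemma exists_mem_acl_of_delta_le (h : InC0 L N) (hK : CopiesBounded L N) {A B : Set N}
    (hA : A.Finite) (hB : B.Finite) (hd : Disjoint A B) (hne : B.Nonempty)
    (hle : delta L (A ∪ B) ≤ delta L A)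
    (hmin : ∀ B' ⊂ B, B'.Nonempty → delta L A < delta L (A ∪ B')) : ∃ b ∈ B, b ∈ acl L A := by
  classical
  by_contra hno
  push Not at hno
  have hcop := exists_relCopies h.occFin hA hB hd hno
  rcases hle.lt_or_eq with hlt | heq
  · obtain ⟨G, hG, hGd⟩ := hcop ((delta L A).toNat + 1)
    have hnew : (B.ncard : ℤ) < newOcc L A (A ∪ B) := by
      rw [delta_union_eq h.occFin hA hB hd] at hlt
      omega
    have key : ∀ s : Finset (Fin ((delta L A).toNat + 1)),
        delta L (A ∪ ⋃ j ∈ s, Set.range (G j)) ≤ delta L A - s.card := by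
      have := hB.to_subtype
      intro s
      induction s using Finset.induction_on with
      | empty => simp
      | @insert j s hj ih =>
        have hfin : (A ∪ ⋃ j ∈ s, Set.range (G j)).Finite :=
          hA.union (s.finite_toSet.biUnion fun j _ => Set.finite_range (G j))
        obtain ⟨h1, h2, h3⟩ := (hG j).newOcc_le h.occFin hA hB hd
        have h4 := delta_union_eq h.occFin hA (Set.finite_range (G j)) h1
        have h5 := predim_diff_le h.occFin (le_refl (Set.univ : Set (RelSym L)))
          (hA.union (Set.finite_range (G j))) hfin
        have h6 : (A ∪ Set.range (G j)) ∩ (A ∪ ⋃ j ∈ s, Set.range (G j)) = A := by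
          rw [← Set.union_inter_distrib_left, Set.union_eq_left]
          rintro v ⟨⟨w, rfl⟩, hv⟩
          simp only [Set.mem_iUnion] at hv
          obtain ⟨j', hj', w', hw'⟩ := hv
          exact absurd hw' (hGd j' j (fun h => hj (h ▸ hj')) _ _)
        have h7 : (A ∪ Set.range (G j)) ∪ (A ∪ ⋃ j ∈ s, Set.range (G j)) =
            A ∪ ⋃ j' ∈ insert j s, Set.range (G j') := by
          rw [Finset.set_biUnion_insert, ← Set.union_union_distrib_left]
        rw [h6, h7] at h5
        rw [Finset.card_insert_of_notMem hj]
        unfold delta at *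
        push_cast
        omega
    have h1 := key Finset.univ
    have := hB.to_subtype
    have h2 := h.delta_nonneg (A := A ∪ ⋃ j ∈ (Finset.univ : Finset (Fin ((delta L A).toNat + 1))),
      Set.range (G j)) (hA.union (Finset.univ.finite_toSet.biUnion fun j _ => Set.finite_range (G j)))
    rw [Finset.card_univ, Fintype.card_fin] at h1
    omega
  · have hs : SimplyAlgebraic L A B := by
      refine ⟨hne, hd, fun D hAD hD => ?_, heq, fun B' hB' hne' => (hmin B' hB' hne').ne'⟩
      have hD' : D = A ∪ (D \ A) := (Set.union_sdiff_cancel hAD).symm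
      have hDB : D \ A ⊆ B := Set.sdiff_subset_iff.2 hD
      rcases Set.eq_empty_or_nonempty (D \ A) with h0 | h0
      · rw [hD', h0, Set.union_empty]
      · rcases hDB.eq_or_ssubset with h1 | h1
        · rw [hD', h1, heq]
        · rw [hD']; exact (hmin _ h1 h0).le
    obtain ⟨A', hA', hm⟩ := exists_minSimplyAlgebraic hA hs
    have hd' := hd.mono_left hA'
    obtain ⟨E, f, hf, hfA, hfB⟩ := exists_ext (L := L) (hA.subset hA') hB hd'
    have hE : E.IsMSA := hf.isMSA h.1 h.occFin (by rwa [hfA, hfB])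
    obtain ⟨K, hK⟩ := hK E hE
    obtain ⟨G, hG, hGd⟩ := hcop (K + 1)
    have hmemA : ∀ v, v ∈ E.base → f v ∈ A := fun v hv => hA' (hfA ▸ ⟨v, hv, rfl⟩)
    have hmemB : ∀ v, v ∉ E.base → f v ∈ B := fun v hv => hfB ▸ ⟨v, hv, rfl⟩
    let s : Fin E.size → A ⊕ B := fun v =>
      if hv : v ∈ E.base then .inl ⟨f v, hmemA v hv⟩ else .inr ⟨f v, hmemB v hv⟩
    have hs1 : ∀ v, Sum.elim (fun a : A => (a : N)) (fun b : B => (b : N)) (s v) = f v := by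
      intro v
      by_cases hv : v ∈ E.base <;> simp [s, hv]
    have hs2 : ∀ v, (s v).isLeft → v ∈ E.base := by
      intro v hv
      by_contra hv'
      simp [s, hv'] at hv
    have hof : OfForm E f fun j v => Sum.elim (fun a : A => (a : N)) (G j) (s v) := by
      refine ⟨hf.1.injOn, fun r x _ => (hf.2 r x).symm, fun j v w hvw => ?_, fun j v hv => ?_,
        fun j r x hx hr => ?_, fun j j' hj v hv v' hv' => ?_⟩
      · have := (hG j).1 hvw
        apply hf.1
        rw [← hs1, this, hs1]
      · simp [s, hv]
      · refine (hG j).2 r (s ∘ x) (fun hl => hx fun i => hs2 _ (hl i)) ?_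
        rw [← Function.comp_assoc,
          show Sum.elim (fun a : A => (a : N)) (fun b : B => (b : N)) ∘ s = f from funext hs1]
        exact (hf.2 r x).1 hr
      · simp only [s, hv, hv', dif_neg, not_false_eq_true, Sum.elim_inr]
        exact hGd j j' hj _ _
    have := hK f (K + 1) _ hof
    omega

/-- The argument runs over `K = D ∩ acl A` instead of `A`, where `D` computes `d(Ax)`. If `x` were
outside `K`, a minimal nonempty `Y ⊆ D \ K` with `δ(K ∪ Y) ≤ δ(K)` would exist and contain a point
algebraic over `K`, hence over `A`; but such points of `D` already belong to `K`. -/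
lemma mem_acl_of_dfun_eq (h : InC0 L N) (hK : CopiesBounded L N) {A : Set N} (hA : A.Finite)
    {x : N} (hx : dfun L (insert x A) = dfun L A) : x ∈ acl L A := by
  obtain ⟨D, hD, hAD, hd⟩ := h.exists_delta_eq_dfun (hA.insert x)
  rw [hx] at hd
  have hAD' : A ⊆ D := (Set.subset_insert x A).trans hAD
  by_contra hxacl
  set K := D ∩ acl L A with hKdef
  have hKf : K.Finite := hD.inter_of_left _
  have hDK : delta L D ≤ delta L K := hd ▸ h.dfun_le hKf (Set.subset_inter hAD' (subset_acl A))
  have hxD : x ∈ D := hAD (Set.mem_insert x A)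
  obtain ⟨Y, hY, hYmin⟩ := ((hD.finite_subsets.subset fun Y (hY : Y ⊆ D \ K) =>
      hY.trans Set.sdiff_subset).inter_of_left {Y | Y.Nonempty ∧ delta L (K ∪ Y) ≤ delta L K}).exists_minimal
    ⟨D \ K, Set.Subset.refl (D \ K), ⟨x, hxD, fun hxK => hxacl hxK.2⟩, by
      rwa [Set.union_sdiff_cancel Set.inter_subset_left]⟩
  have hYf : Y.Finite := hD.subset (Set.Subset.trans (b := D \ K) hY.1 Set.sdiff_subset)
  obtain ⟨b, hb, hbacl⟩ := exists_mem_acl_of_delta_le h hK hKf hYf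
    (Set.disjoint_sdiff_right.mono_right hY.1) hY.2.1 hY.2.2 fun B' hB' hne => by
      by_contra hlt
      exact hB'.2 (hYmin ⟨Set.Subset.trans (b := Y) hB'.1 hY.1, hne, not_lt.1 hlt⟩ hB'.1)
  exact (hY.1 hb).2 ⟨(hY.1 hb).1, acl_trans (Set.inter_subset_right) hbacl⟩

end ClosureAlgebraic

/-! ### Copies of an extension relative to a strong set. -/

section Copies

variable {L : FirstOrder.Language.{0, 0}} {V : Type*} [L.Structure V]

/-- If only some of the new points were in `S`, the others would bring strictly more occurrences
than points, so the part inside `S` would have larger predimension than the whole copy, against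
strongness. -/
lemma PosCopy.subset_of_mem (h : OccFin L V) {E : Ext L} (hE : E.IsMSA) {f : Fin E.size → V}
    (hf : PosCopy E f) {S : Set V} (hS : S.Finite) (hs : Strong L S) (hb : ∀ v ∈ E.base, f v ∈ S)
    {v : Fin E.size} (hv : v ∉ E.base) (hvS : f v ∈ S) : ∀ w, f w ∈ S := by
  set U := E.baseᶜ ∩ f ⁻¹' S with hU
  have hUe : Set.range f ∩ S = f '' (E.base ∪ U) := by
    ext y
    constructor
    · rintro ⟨⟨w, rfl⟩, hw⟩
      by_cases hwb : w ∈ E.base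
      · exact ⟨w, .inl hwb, rfl⟩
      · exact ⟨w, .inr ⟨hwb, hw⟩, rfl⟩
    · rintro ⟨w, hw | hw, rfl⟩
      · exact ⟨⟨w, rfl⟩, hb w hw⟩
      · exact ⟨⟨w, rfl⟩, hw.2⟩
  by_contra hno
  push Not at hno
  obtain ⟨w, hw⟩ := hno
  have hUs : U ⊂ E.baseᶜ := ⟨Set.inter_subset_left, fun h' =>
    hw (h' (show w ∉ E.base from fun hwb => hw (hb w hwb))).2⟩
  have h1 := hf.ncard_lt h hE E.symIn_univ hUs ⟨v, hv, hvS⟩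
  have h2 := hs.delta_inter_le h hS (Set.finite_range f)
  rw [hUe] at h2
  have h3 := predim_sub h (Set.univ : Set (RelSym L)) (Set.finite_range f)
    (Set.image_subset_range f (E.base ∪ U))
  have h4 : Set.range f \ f '' (E.base ∪ U) = f '' (E.baseᶜ \ U) := by
    rw [← Set.image_univ, ← Set.image_sdiff hf.1]
    congr 1
    ext; simp
  rw [h4, Set.ncard_image_of_injective _ hf.1] at h3
  unfold delta at h2
  omega

/-- New occurrences contributed by a copy over a base not inside `S`. -/
lemma PosCopy.ncard_new (h : OccFin L V) {E : Ext L} (hE : E.IsMSA) {f : Fin E.size → V}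
    (hf : PosCopy E f) {S : Set V} (hb : ∃ v ∈ E.base, f v ∉ S)
    {q : Prop} [Decidable q] (hq : q → ∃ v ∉ E.base, f v ∈ S) :
    (f '' E.baseᶜ \ S).ncard + (if q then 1 else 0) ≤
      (occ (Set.univ : Set (RelSym L)) (Set.range f) \
        (occ Set.univ (f '' E.base) ∪ occ Set.univ S)).ncard := by
  set U := E.baseᶜ ∩ f ⁻¹' S with hU
  have hfin := (h _ (Set.finite_range f))
  have hY : f '' E.baseᶜ \ S = f '' (E.baseᶜ \ U) := by
    ext y
    constructor
    · rintro ⟨⟨w, hw, rfl⟩, hwS⟩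
      exact ⟨w, ⟨hw, fun h => hwS h.2⟩, rfl⟩
    · rintro ⟨w, ⟨hw, hwU⟩, rfl⟩
      exact ⟨⟨w, hw, rfl⟩, fun h => hwU ⟨hw, h⟩⟩
  rw [hY, Set.ncard_image_of_injective _ hf.1]
  have hkey : occ (Set.univ : Set (RelSym L)) (Set.range f) \ occ Set.univ (f '' (E.base ∪ U)) ⊆
      occ (Set.univ : Set (RelSym L)) (Set.range f) \ (occ Set.univ (f '' E.base) ∪ occ Set.univ S) := by
    rintro p ⟨hp, hp'⟩
    refine ⟨hp, ?_⟩
    rintro (hpb | hpS)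
    · exact hp' (occ_mono subset_rfl (Set.image_mono Set.subset_union_left) hpb)
    · refine hp' (mem_occ.2 ⟨trivial, (mem_occ.1 hp).2.1, fun v hv => ?_⟩)
      obtain ⟨w, rfl⟩ := mem_of_mem_occ hp v hv
      by_cases hw : w ∈ E.base
      · exact ⟨w, .inl hw, rfl⟩
      · exact ⟨w, .inr ⟨hw, mem_of_mem_occ hpS _ hv⟩, rfl⟩
  have hle := Set.ncard_le_ncard hkey hfin.sdiff
  have hUsub : U ⊆ E.baseᶜ := Set.inter_subset_left
  rcases hUsub.eq_or_ssubset with hUeq | hUs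
  -- All new points are in `S`, so there is nothing to count outside. The one occurrence needed
  -- comes from a base point outside `S`, which by minimality lies on a relation with a new point.
  · have h0 : (E.baseᶜ \ U).ncard = 0 := by rw [hUeq, Set.sdiff_self]; simp
    obtain ⟨v, hv, hvS⟩ := hb
    obtain ⟨r, x, hr, hx, i, rfl⟩ := hE.exists_rel hv
    have hmem : (r, Finset.univ.val.map (f ∘ x)) ∈ occ (Set.univ : Set (RelSym L)) (Set.range f) \
        (occ Set.univ (f '' E.base) ∪ occ Set.univ S) := by
      refine ⟨mem_occ_of_relMap (Set.mem_univ _) (hf.2 r x hx hr) fun i => ⟨x i, rfl⟩, ?_⟩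
      rintro (hp | hp)
      · refine hx fun k => ?_
        obtain ⟨w, hw, hwk⟩ := mem_of_mem_occ hp _
          (Multiset.mem_map_of_mem (f ∘ x) (Finset.mem_univ_val k))
        rwa [← hf.1 hwk]
      · exact hvS (mem_of_mem_occ hp _ (Multiset.mem_map_of_mem (f ∘ x) (Finset.mem_univ_val i)))
    have h1 := (Set.ncard_pos hfin.sdiff).2 ⟨_, hmem⟩
    split_ifs <;> omega
  · rcases U.eq_empty_or_nonempty with hU0 | hne
    · have hnq : ¬ q := fun h => by
        obtain ⟨v, hv, hvS⟩ := hq h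
        exact (Set.ext_iff.1 hU0 v).1 ⟨hv, hvS⟩
      rw [hU0, Set.union_empty] at hle
      have := hf.ncard_base_le h hE E.symIn_univ
      rw [if_neg hnq, hU0, Set.sdiff_empty]
      omega
    · have := hf.ncard_lt h hE E.symIn_univ hUs hne
      split_ifs <;> omega

open scoped Classical in
/-- If the base is not inside the strong set `S`, few copies meet `S`. -/
lemma OfForm.card_meeting_le (h : InC0 L V) {E : Ext L} (hE : E.IsMSA) {a : Fin E.size → V} {r : ℕ}
    {F : Fin r → Fin E.size → V} (hF : OfForm E a F) {S : Set V} (hS : S.Finite)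
    (hs : Strong L S) (hb : ∃ v ∈ E.base, a v ∉ S) :
    ((Finset.univ.filter fun j => ∃ v ∉ E.base, F j v ∈ S).card : ℤ) ≤ delta L (a '' E.base) := by
  set Y : Fin r → Set V := fun j => F j '' E.baseᶜ with hYdef
  set q : Fin r → Prop := fun j => ∃ v ∉ E.base, F j v ∈ S with hq
  have hYf : ∀ j, (Y j).Finite := fun j => (Set.toFinite _).image _
  have hXf : (a '' E.base).Finite := (Set.toFinite _).image _
  set T : Finset (Fin r) → Set V := fun s => a '' E.base ∪ ⋃ j ∈ s, Y j with hT
  have hTf : ∀ s, (T s).Finite := fun s => hXf.union (s.finite_toSet.biUnion fun j _ => hYf j)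
  have hrel : ∀ T : Set V, T.Finite → delta L T - delta L (T ∩ S) = ((T \ S).ncard : ℤ) -
      ((occ (Set.univ : Set (RelSym L)) T \ occ Set.univ S).ncard : ℤ) := by
    intro T hT
    have := predim_sub h.occFin (Set.univ : Set (RelSym L)) hT (Set.inter_subset_left (t := S))
    rwa [Set.sdiff_self_inter, occ_inter, Set.sdiff_self_inter] at this
  -- Adding a copy never increases the predimension relative to the part in `S`, and lowers it by at
  -- least 1 if the copy meets `S`. Strongness of `S` keeps the total nonnegative, which bounds the
  -- number of such copies by `δ` of the base.
  have key : ∀ s : Finset (Fin r), delta L (T s) - delta L (T s ∩ S) ≤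
      delta L (a '' E.base) - delta L (a '' E.base ∩ S) - ((s.filter q).card : ℤ) := by
    intro s
    induction s using Finset.induction_on with
    | empty => simp [hT]
    | @insert j s hj ih =>
      have hdisj : Disjoint (T s) (Y j) := by
        rw [Set.disjoint_left]
        rintro y (hy | hy) ⟨v, hv, rfl⟩
        · rw [← hF.image_base j] at hy
          obtain ⟨w, hw, hwv⟩ := hy
          rw [hF.2.2.1 j hwv] at hw
          exact hv hw
        · simp only [Set.mem_iUnion] at hy
          obtain ⟨j', hj', v', hv', he⟩ := hy
          exact hF.2.2.2.2.2 j' j (fun h => hj (h ▸ hj')) v' hv' v hv he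
      have hTi : T (insert j s) = T s ∪ Y j := by
        simp only [hT]
        rw [Finset.set_biUnion_insert]
        ext; simp only [Set.mem_union]; tauto
      have hr : Set.range (F j) = a '' E.base ∪ Y j := by
        rw [← hF.image_base j, ← Set.image_union, Set.union_compl_self, Set.image_univ]
      have h1 := (hF.posCopy j).ncard_new h.occFin hE (S := S) (q := q j)
        (by obtain ⟨v, hv, hvS⟩ := hb; exact ⟨v, hv, by rwa [hF.2.2.2.1 j v hv]⟩) id
      rw [hF.image_base j] at h1
      change (Y j \ S).ncard + _ ≤ _ at h1
      have h2 : ((T s ∪ Y j) \ S).ncard = (T s \ S).ncard + (Y j \ S).ncard := by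
        rw [Set.union_sdiff_distrib, Set.ncard_union_eq (hdisj.mono Set.sdiff_subset Set.sdiff_subset)
          (hTf s).sdiff (hYf j).sdiff]
      have h3 : (occ (Set.univ : Set (RelSym L)) (T s) \ occ Set.univ S).ncard +
          (occ (Set.univ : Set (RelSym L)) (Set.range (F j)) \
            (occ Set.univ (a '' E.base) ∪ occ Set.univ S)).ncard ≤
          (occ (Set.univ : Set (RelSym L)) (T s ∪ Y j) \ occ Set.univ S).ncard := by
        rw [← Set.ncard_union_eq _ (h.occFin _ (hTf s)).sdiff (h.occFin _ (Set.finite_range _)).sdiff]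
        · refine Set.ncard_le_ncard ?_ (h.occFin _ ((hTf s).union (hYf j))).sdiff
          rintro p (⟨hp, hp'⟩ | ⟨hp, hp'⟩)
          · exact ⟨occ_mono subset_rfl Set.subset_union_left hp, hp'⟩
          · refine ⟨occ_mono subset_rfl ?_ hp, fun h => hp' (.inr h)⟩
            rw [hr]
            exact Set.union_subset_union_left _ Set.subset_union_left
        · rw [Set.disjoint_left]
          rintro p ⟨hp, _⟩ ⟨hp1, hp2⟩
          refine hp2 (.inl ?_)
          have : T s ∩ Set.range (F j) ⊆ a '' E.base := by
            rw [hr]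
            rintro v ⟨hv, hv' | hv'⟩
            · exact hv'
            · exact absurd hv' (Set.disjoint_left.1 hdisj hv)
          exact occ_mono subset_rfl this (by rw [occ_inter]; exact ⟨hp, hp1⟩)
      have h4 := hrel _ (hTf s)
      have h5 := hrel _ ((hTf s).union (hYf j))
      rw [hTi, h5, Finset.filter_insert]
      rw [h4] at ih
      by_cases hqj : q j
      · rw [if_pos hqj] at h1 ⊢
        rw [Finset.card_insert_of_notMem (by simp [hj])]
        push_cast
        omega
      · rw [if_neg hqj] at h1 ⊢
        omega
  have h1 := key Finset.univ
  have h2 := hs.delta_inter_le h.occFin hS (hTf Finset.univ)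
  have h3 := h.delta_nonneg (hXf.inter_of_left S)
  linarith

end Copies

/-! ### Free joins. -/

section Joins

variable {L : FirstOrder.Language.{0, 0}} {D C : Type} [L.Structure D] [L.Structure C]

/-- The free join of `D` and `C` along the map `u` from a subset of `C` to `D`: the relations of `D`
and those relations of `C` which do not hold inside the subset. -/
def Join {D C : Type} {B : Set C} (_ : B → D) : Type := D ⊕ ↥Bᶜ

namespace Join

variable {B : Set C} (u : B → D)

/-- The inclusion of `D`. -/
def inl (d : D) : Join u := Sum.inl d

open scoped Classical in
/-- The inclusion of `C`. -/
noncomputable def inr (c : C) : Join u :=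
  if h : c ∈ B then Sum.inl (u ⟨c, h⟩) else Sum.inr ⟨c, h⟩

lemma inr_of_mem {c : C} (h : c ∈ B) : inr u c = inl u (u ⟨c, h⟩) := dif_pos h

lemma inr_of_notMem {c : C} (h : c ∉ B) : inr u c = Sum.inr ⟨c, h⟩ := dif_neg h

instance [Finite D] [Finite C] : Finite (Join u) := inferInstanceAs (Finite (D ⊕ ↥Bᶜ))

lemma inl_injective : Function.Injective (inl u) := Sum.inl_injective

lemma inr_mem_range_inl {c : C} : inr u c ∈ Set.range (inl u) ↔ c ∈ B := by
  constructor
  · rintro ⟨d, hd⟩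
    by_contra hc
    rw [inr_of_notMem u hc] at hd
    exact Sum.inl_ne_inr hd
  · intro h
    exact ⟨_, (inr_of_mem u h).symm⟩

variable {u} in
lemma inr_injective (hu : Function.Injective u) : Function.Injective (inr u) := by
  intro c c' h
  by_cases hc : c ∈ B
  · have hc' : c' ∈ B := (inr_mem_range_inl u).1 (h ▸ (inr_mem_range_inl u).2 hc)
    rw [inr_of_mem u hc, inr_of_mem u hc'] at h
    exact congrArg Subtype.val (hu (inl_injective u h))
  · have hc' : c' ∉ B := fun hc' => hc ((inr_mem_range_inl u).1 (h ▸ (inr_mem_range_inl u).2 hc'))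
    rw [inr_of_notMem u hc, inr_of_notMem u hc'] at h
    exact congrArg Subtype.val (Sum.inr_injective h)

lemma exists_inr {j : Join u} (h : j ∉ Set.range (inl u)) : ∃ c ∉ B, inr u c = j := by
  rcases j with d | c
  · exact absurd ⟨d, rfl⟩ h
  · exact ⟨c, c.2, inr_of_notMem u c.2⟩

variable [L.IsRelational]

instance : L.Structure (Join u) where
  funMap f := isEmptyElim f
  RelMap r x := (∃ y, x = inl u ∘ y ∧ Structure.RelMap r y) ∨
    ∃ y, x = inr u ∘ y ∧ (¬ ∀ i, y i ∈ B) ∧ Structure.RelMap r y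

lemma relMap_iff {r : RelSym L} {x : Fin r.1 → Join u} : Structure.RelMap r.2 x ↔
    (∃ y, x = inl u ∘ y ∧ Structure.RelMap r.2 y) ∨
    ∃ y, x = inr u ∘ y ∧ (¬ ∀ i, y i ∈ B) ∧ Structure.RelMap r.2 y := Iff.rfl

lemma isEmb_inl : IsEmb L (inl u) := by
  refine ⟨inl_injective u, fun r x => ?_⟩
  rw [relMap_iff]
  constructor
  · exact fun h => .inl ⟨x, rfl, h⟩
  · rintro (⟨y, hy, h⟩ | ⟨y, hy, hB, _⟩)
    · rwa [(inl_injective u).comp_left hy]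
    · exact absurd (fun i => (inr_mem_range_inl u).1 ⟨x i, congrFun hy i⟩) hB

variable {u} in
lemma relEmbOn_inr (hu : Function.Injective u) (S : Set C) : RelEmbOn L (inr u) B S := by
  refine ⟨(inr_injective hu).injOn, fun r x _ hx => ?_⟩
  rw [relMap_iff]
  constructor
  · exact fun h => .inr ⟨x, rfl, hx, h⟩
  · rintro (⟨y, hy, h⟩ | ⟨y, hy, hB, h⟩)
    · exact absurd (fun i => (inr_mem_range_inl u).1 ⟨y i, (congrFun hy i).symm⟩) hx
    · rwa [(inr_injective hu).comp_left hy]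

variable {u} in
lemma pEmbOn_inr (hu : Function.Injective u) {P : Set (RelSym L)}
    (hP : ∀ r ∈ P, ∀ x : Fin r.1 → B, Structure.RelMap r.2 (fun i => (x i : C)) ↔
      Structure.RelMap r.2 (u ∘ x)) (S : Set C) : PEmbOn P (inr u) S := by
  refine ⟨(inr_injective hu).injOn, fun r hr x hS => ?_⟩
  by_cases hx : ∀ i, x i ∈ B
  · have h1 : inr u ∘ x = inl u ∘ (u ∘ fun i => ⟨x i, hx i⟩) :=
      funext fun i => inr_of_mem u (hx i)
    rw [h1, ← (isEmb_inl u).2 r]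
    exact hP r hr fun i => ⟨x i, hx i⟩
  · exact (relEmbOn_inr hu S).2 r x hS hx

variable {u}

lemma rel_not_inl {r : RelSym L} {x : Fin r.1 → Join u} (h : Structure.RelMap r.2 x)
    (hx : ¬ ∀ i, x i ∈ Set.range (inl u)) :
    ∃ y, x = inr u ∘ y ∧ (¬ ∀ i, y i ∈ B) ∧ Structure.RelMap r.2 y := by
  rcases (relMap_iff u).1 h with ⟨y, rfl, _⟩ | h
  · exact absurd (fun i => ⟨y i, rfl⟩) hx
  · exact h

lemma symmetric (hD : Symmetric L D) (hC : Symmetric L C) : Symmetric L (Join u) := by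
  intro r x σ hx
  rcases (relMap_iff u).1 hx with ⟨y, rfl, h⟩ | ⟨y, rfl, hB, h⟩
  · exact (relMap_iff u).2 (.inl ⟨y ∘ σ, rfl, hD r y σ h⟩)
  · refine (relMap_iff u).2 (.inr ⟨y ∘ σ, rfl, fun hb => hB fun i => ?_, hC r y σ h⟩)
    simpa using hb (σ.symm i)

lemma occFin [Finite D] [Finite C] (hD : OccFin L D) (hC : OccFin L C) : OccFin L (Join u) := by
  refine occFin_of_finite ?_
  refine (((hD _ Set.finite_univ).image (occMap (inl u))).union
    ((hC _ Set.finite_univ).image (occMap (inr u)))).subset ?_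
  rintro p ⟨_, x, hx, _, hp⟩
  rcases (relMap_iff u).1 hx with ⟨y, rfl, h⟩ | ⟨y, rfl, _, h⟩
  · refine .inl ⟨_, mem_occ_of_relMap (r := p.1) (Set.mem_univ _) h fun _ => trivial, Prod.ext rfl ?_⟩
    simp only [occMap, Multiset.map_map, hp]
  · refine .inr ⟨_, mem_occ_of_relMap (r := p.1) (Set.mem_univ _) h fun _ => trivial, Prod.ext rfl ?_⟩
    simp only [occMap, Multiset.map_map, hp]

variable [Finite D] [Finite C]

/-- Points and occurrences of `X` outside `D` correspond under `inr` to those of its preimage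
outside `B`. It is not required that `u` preserve the relations on `B`, so the formula also serves
joins over bases that agree only approximately. -/
lemma predim_sub_inl (hD : OccFin L D) (hC : OccFin L C) (hu : Function.Injective u)
    (P : Set (RelSym L)) (X : Set (Join u)) :
    predim P X - predim P (X ∩ Set.range (inl u)) =
      predim P (inr u ⁻¹' X) - predim P (inr u ⁻¹' X ∩ B) := by
  rw [predim_sub (occFin hD hC) P (Set.toFinite X) Set.inter_subset_left,
    predim_sub hC P (Set.toFinite _) Set.inter_subset_left, Set.sdiff_self_inter,
    Set.sdiff_self_inter]
  set S := inr u ⁻¹' X with hS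
  have h1 : X \ Set.range (inl u) = inr u '' (S \ B) := by
    ext j
    constructor
    · rintro ⟨hj, hj'⟩
      obtain ⟨c, hc, rfl⟩ := exists_inr u hj'
      exact ⟨c, ⟨hj, hc⟩, rfl⟩
    · rintro ⟨c, ⟨hc, hcB⟩, rfl⟩
      exact ⟨hc, fun h => hcB ((inr_mem_range_inl u).1 h)⟩
  have h2 : occ P X \ occ P (X ∩ Set.range (inl u)) =
      occ P (inr u '' S) \ occ P (inr u '' (S ∩ B)) := by
    ext p
    constructor
    · rintro ⟨⟨hr, x, hx, hxX, hp⟩, hp'⟩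
      have hni : ¬ ∀ i, x i ∈ Set.range (inl u) := fun h => hp' ⟨hr, x, hx, fun i => ⟨hxX i, h i⟩, hp⟩
      obtain ⟨y, rfl, hB, hy⟩ := rel_not_inl hx hni
      refine ⟨⟨hr, _, hx, fun i => ⟨y i, hxX i, rfl⟩, hp⟩, fun h => hB fun i => ?_⟩
      obtain ⟨c, hc, hci⟩ := mem_of_mem_occ h (inr u (y i)) (by
        rw [hp]; exact Multiset.mem_map_of_mem (inr u ∘ y) (Finset.mem_univ_val i))
      rw [← inr_injective hu hci]
      exact hc.2
    · rintro ⟨hp, hp'⟩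
      refine ⟨occ_mono subset_rfl (by rintro _ ⟨c, hc, rfl⟩; exact hc) hp, fun h => hp' ?_⟩
      refine mem_occ.2 ⟨hp.1, (mem_occ.1 hp).2.1, fun v hv => ?_⟩
      obtain ⟨c, hc, rfl⟩ := mem_of_mem_occ hp v hv
      exact ⟨c, ⟨hc, (inr_mem_range_inl u).1 (mem_of_mem_occ h _ hv).2⟩, rfl⟩
  rw [h1, h2, Set.ncard_image_of_injective _ (inr_injective hu),
    occ_diff_image (inr_injective hu).injOn Set.inter_subset_left, Set.InjOn.ncard_image
      (occMap_injOn (inr_injective hu).injOn (A := Set.univ) (by simp))]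
  intro r _ x hxS hx
  exact (relEmbOn_inr hu S).2 r x hxS fun h => hx fun i => ⟨hxS i, h i⟩

lemma predim_sub_inr (hD : OccFin L D) (hC : OccFin L C) (hu : Function.Injective u)
    (P : Set (RelSym L)) (X : Set (Join u)) :
    predim P X - predim P (X ∩ Set.range (inr u)) =
      predim P (X ∩ Set.range (inl u)) -
        predim P (X ∩ Set.range (inl u) ∩ Set.range (inr u)) := by
  have h1 := predim_sub_inl hD hC hu P X
  have h2 := predim_sub_inl hD hC hu P (X ∩ Set.range (inr u))
  rw [Set.preimage_inter, Set.preimage_range, Set.inter_univ, Set.inter_right_comm] at h2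
  linarith

lemma strong_range_inl (hD : OccFin L D) (hC : OccFin L C) (hu : Function.Injective u)
    (hB : Strong L B) : Strong L (Set.range (inl u)) := by
  intro X _ hX
  have h1 := predim_sub_inl hD hC hu Set.univ X
  have h2 : B ⊆ inr u ⁻¹' X := fun c hc => hX ((inr_mem_range_inl u).2 hc)
  have h3 := hB _ (Set.toFinite _) h2
  rw [Set.inter_eq_right.2 hX, Set.inter_eq_right.2 h2] at h1
  unfold delta at *
  linarith

lemma inC0 (hD : InC0 L D) (hC : InC0 L C) (hu : Function.Injective u)
    (hB : Strong L B) : InC0 L (Join u) := by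
  have ho := occFin (u := u) hD.occFin hC.occFin
  refine ⟨symmetric hD.1 hC.1, fun A hA => ⟨ho A hA, ?_⟩⟩
  refine le_trans ?_ ((strong_range_inl hD.occFin hC.occFin hu hB).delta_inter_le ho
    (Set.finite_range _) hA)
  rw [delta, ← (isEmb_inl u).predim_preimage]
  exact hD.delta_nonneg (Set.toFinite _)

/-- A copy whose new points avoid `D` comes from `C`. -/
lemma exists_lift {E : Ext L} (hE : E.IsMSA) (hu : Function.Injective u)
    {f : Fin E.size → Join u} (hf : PosCopy E f) (hd : ∀ v ∉ E.base, f v ∉ Set.range (inl u)) :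
    ∃ f' : Fin E.size → C, (∀ v, inr u (f' v) = f v) ∧ PosCopy E f' ∧ ∀ v ∉ E.base, f' v ∉ B := by
  have hex : ∀ v, ∃ c, inr u c = f v := by
    intro v
    by_cases hv : v ∈ E.base
    -- A base point lies on a relation that also involves a new point. As that new point is outside
    -- `D`, the relation comes from `C`, and so does the base point.
    · obtain ⟨r, x, hr, hx, i, rfl⟩ := hE.exists_rel hv
      obtain ⟨y, hy, _, _⟩ := rel_not_inl (hf.2 r x hx hr) fun h => hx fun i => by
        by_contra hi
        exact hd _ hi (h i)
      exact ⟨y i, (congrFun hy i).symm⟩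
    · obtain ⟨c, _, hc⟩ := exists_inr u (hd v hv)
      exact ⟨c, hc⟩
  choose f' hf' using hex
  have hB : ∀ v ∉ E.base, f' v ∉ B := fun v hv h =>
    hd v hv (hf' v ▸ (inr_mem_range_inl u).2 h)
  refine ⟨f', hf', ⟨fun v w h => hf.1 (by rw [← hf' v, ← hf' w, h]), fun r x hx hr => ?_⟩, hB⟩
  refine ((relEmbOn_inr hu Set.univ).2 r (f' ∘ x) (fun _ => trivial) fun h => hx fun i => ?_).2 ?_
  · by_contra hi
    exact hB _ hi (h i)
  · have : inr u ∘ f' ∘ x = f ∘ x := funext fun i => hf' (x i)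
    rw [this]
    exact hf.2 r x hx hr

end Join

end Joins

/-! ### Primitive extensions. -/

section Primitive

variable {L : FirstOrder.Language.{0, 0}} {C : Type*} [L.Structure C] [Finite C]

/-- No proper intermediate set over `B` has the predimension of `B`. -/
def Primitive (L : FirstOrder.Language.{0, 0}) {C : Type*} [L.Structure C] (B : Set C) : Prop :=
  ∀ Y ⊂ Bᶜ, Y.Nonempty → delta L (B ∪ Y) ≠ delta L B

/-- Equal multisets of values mean fibres of equal size, and the permutation matches the fibres.
With symmetry this turns occurrences, recorded up to permutation, back into tuples. -/
lemma exists_perm_of_map_eq {α : Type*} {n : ℕ} {x y : Fin n → α}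
    (h : Finset.univ.val.map x = Finset.univ.val.map y) : ∃ σ : Equiv.Perm (Fin n), x = y ∘ σ := by
  classical
  have hc : ∀ a, Fintype.card {i // x i = a} = Fintype.card {i // y i = a} := by
    intro a
    have := congrArg (Multiset.count a) h
    rw [Multiset.count_map, Multiset.count_map] at this
    rw [Fintype.card_subtype, Fintype.card_subtype, Finset.card_def, Finset.card_def,
      Finset.filter_val, Finset.filter_val]
    simpa only [eq_comm] using this
  refine ⟨(Equiv.sigmaFiberEquiv x).symm.trans ((Equiv.sigmaCongrRight fun a =>
    Fintype.equivOfCardEq (hc a)).trans (Equiv.sigmaFiberEquiv y)), funext fun i => ?_⟩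
  exact ((Fintype.equivOfCardEq (hc (x i))) ⟨i, rfl⟩).2.symm

/-- A copy over a subset of `B`, with new points outside `B`, of a primitive extension of `B`
exhausts the extension. -/
lemma PosCopy.exhausts (h : OccFin L C) {B : Set C} (hB : Strong L B) (hp : Primitive L B)
    {E : Ext L} (hE : E.IsMSA) {f : Fin E.size → C} (hf : PosCopy E f)
    (hb : ∀ v ∈ E.base, f v ∈ B) (hn : ∀ v ∉ E.base, f v ∉ B) :
    (∀ c ∉ B, ∃ v ∉ E.base, f v = c) ∧ delta L (Set.univ : Set C) = delta L B ∧
      ∀ (r : RelSym L) (x : Fin r.1 → C), Structure.RelMap r.2 x → (¬ ∀ i, x i ∈ B) →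
        ∃ y, x = f ∘ y ∧ (¬ ∀ i, y i ∈ E.base) ∧ E.Rel r y := by
  set Y := f '' E.baseᶜ with hY
  have hYB : Y ⊆ Bᶜ := by rintro _ ⟨v, hv, rfl⟩; exact hn v hv
  have hne : Y.Nonempty := hE.msa.1.1.image f
  have hri : Set.range f ∩ B = f '' E.base := by
    ext y
    constructor
    · rintro ⟨⟨v, rfl⟩, hv⟩
      by_cases hvb : v ∈ E.base
      · exact ⟨v, hvb, rfl⟩
      · exact absurd hv (hn v hvb)
    · rintro ⟨v, hv, rfl⟩
      exact ⟨⟨v, rfl⟩, hb v hv⟩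
  have hru : Set.range f ∪ B = B ∪ Y := by
    rw [← Set.image_univ, ← Set.union_compl_self E.base, Set.image_union]
    ext y
    simp only [Set.mem_union]
    constructor
    · rintro ((⟨v, hv, rfl⟩ | h) | h)
      exacts [.inl (hb v hv), .inr h, .inl h]
    · tauto
  have h1 := predim_diff_le h (le_refl (Set.univ : Set (RelSym L))) (Set.toFinite (Set.range f))
    (Set.toFinite B)
  rw [hri, hru, predim_sub h _ (Set.toFinite _) (Set.image_subset_range _ _)] at h1
  have h2 := hf.ncard_base_le h hE E.symIn_univ
  have h3 : (Set.range f \ f '' E.base).ncard = E.baseᶜ.ncard := by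
    rw [← Set.image_univ, ← Set.image_sdiff hf.1, Set.ncard_image_of_injective _ hf.1,
      Set.compl_eq_univ_sdiff]
  have h4 := hB (B ∪ Y) (Set.toFinite _) Set.subset_union_left
  -- The copy brings at least as many occurrences as points, so `δ` does not rise, while strongness
  -- of `B` prevents a fall. Primitivity then makes `Y` the whole complement of `B`.
  have h5 : delta L (B ∪ Y) = delta L B := by
    unfold delta at *
    omega
  have hYe : Y = Bᶜ := by
    by_contra hYe
    exact hp Y (hYB.ssubset_of_ne hYe) hne h5
  have h6 : delta L (Set.univ : Set C) = delta L B := by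
    rw [← h5, hYe, Set.union_compl_self]
  refine ⟨fun c hc => ?_, h6, fun r x hr hx => ?_⟩
  · have : c ∈ Y := hYe ▸ hc
    exact this
  · have h7 : occMap f '' (occ (Set.univ : Set (RelSym L)) Set.univ \ occ Set.univ E.base) ⊆
        occ (Set.univ : Set (RelSym L)) Set.univ \ occ Set.univ B := by
      have := (hf.ncard_le h hE E.symIn_univ ∅).1
      rw [Set.union_empty] at this
      refine this.trans ?_
      rintro p ⟨hp1, hp2⟩
      refine ⟨occ_mono subset_rfl (Set.subset_univ _) hp1, fun hpB => hp2 ?_⟩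
      rw [← hri, occ_inter]
      exact ⟨hp1, hpB⟩
    have h8 : (occ (Set.univ : Set (RelSym L)) (Set.univ : Set C) \ occ Set.univ B).ncard ≤
        (occMap f '' (occ (Set.univ : Set (RelSym L)) Set.univ \ occ Set.univ E.base)).ncard := by
      rw [Set.InjOn.ncard_image (occMap_injOn hf.1.injOn (A := Set.univ) (by simp))]
      have h9 := predim_sub h (Set.univ : Set (RelSym L)) (Set.finite_univ) (Set.subset_univ B)
      have h10 := predim_sub hE.occFin (Set.univ : Set (RelSym L)) (Set.finite_univ)
        (Set.subset_univ E.base)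
      have h11 := hE.delta_univ
      rw [← Set.compl_eq_univ_sdiff] at h9 h10
      rw [← hYe, hY, Set.ncard_image_of_injective _ hf.1] at h9
      unfold delta at h6 h11
      omega
    -- In `E` over its base and in `C` over `B` there are as many new occurrences as new points. So
    -- the images of the relations of `E` are all the relations of `C` not inside `B`.
    have h9 := Set.eq_of_subset_of_ncard_le h7 h8 (h _ Set.finite_univ).sdiff
    have hmem : (r, Finset.univ.val.map x) ∈
        occ (Set.univ : Set (RelSym L)) Set.univ \ occ Set.univ B :=
      ⟨mem_occ_of_relMap (Set.mem_univ _) hr fun _ => trivial, fun hB => hx fun i =>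
        mem_of_mem_occ hB _ (Multiset.mem_map_of_mem x (Finset.mem_univ_val i))⟩
    rw [← h9] at hmem
    obtain ⟨⟨r', s⟩, ⟨⟨_, y, hy, _, hs⟩, hyb⟩, he⟩ := hmem
    simp only [occMap, Prod.mk.injEq] at he hs hy
    obtain ⟨rfl, he⟩ := he
    rw [hs, Multiset.map_map] at he
    obtain ⟨σ, hσ⟩ := exists_perm_of_map_eq he.symm
    refine ⟨y ∘ σ, hσ, fun hb' => hyb ⟨trivial, y, hy, fun i => ?_, hs⟩, hE.1 r' y σ hy⟩
    simpa using hb' (σ.symm i)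

end Primitive

/-! ### Witnesses against strongness and the argument `g` of `μ`. -/

section Witnesses

variable {L : FirstOrder.Language.{0, 0}} {V W : Type*} [L.Structure V] [L.Structure W]
  (idx : RelSym L → ℕ)

/-- Some `X ⊇ A` of size at most `|A| + m` has smaller predimension than `A` for the first `m`
relations. -/
def Wit (A : Set V) (m : ℕ) : Prop :=
  ∃ X : Set V, X.Finite ∧ A ⊆ X ∧ X.ncard ≤ A.ncard + m ∧
    predim {r | idx r < m} X < predim {r | idx r < m} A

variable {idx}

/-- Counting more relations only lowers the increment from `A` to `X`. -/
lemma Wit.mono (h : OccFin L V) {A : Set V} {m n : ℕ} (hmn : m ≤ n) (hw : Wit idx A m) :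
    Wit idx A n := by
  obtain ⟨X, hX, hAX, hc, hd⟩ := hw
  refine ⟨X, hX, hAX, by omega, ?_⟩
  have := predim_mono_sub h (P := {r | idx r < m}) (Q := {r | idx r < n})
    (fun r hr => lt_of_lt_of_le hr hmn) hX hAX
  linarith

lemma gfun_congr {A : Set V} {A' : Set W} (h : ∀ m, Wit idx A m ↔ Wit idx A' m) :
    gfun idx A = gfun idx A' := by
  unfold gfun
  congr 1
  ext n
  exact exists_congr fun m => and_congr_right fun _ => h m

lemma gfun_eq_top_or (A : Set V) :
    gfun idx A = ⊤ ∧ (∀ m, ¬ Wit idx A m) ∨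
      ∃ m : ℕ, gfun idx A = m ∧ Wit idx A m ∧ ∀ k < m, ¬ Wit idx A k := by
  classical
  by_cases h : ∃ m, Wit idx A m
  · refine .inr ⟨Nat.find h, le_antisymm (sInf_le ⟨_, rfl, Nat.find_spec h⟩) (le_sInf ?_),
      Nat.find_spec h, fun k hk => Nat.find_min h hk⟩
    rintro _ ⟨m, rfl, hm⟩
    exact Nat.cast_le.2 (Nat.find_min' h hm)
  · push Not at h
    refine .inl ⟨?_, h⟩
    unfold gfun
    rw [sInf_eq_top]
    rintro _ ⟨m, rfl, hm⟩
    exact absurd hm (h m)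

/-- Since `f` is constant from `l` on, what matters is whether `g` is below `l` and its value there,
and both are decided by the witnesses for `m < l`. This makes the value of `μ` a matter of finitely
many conditions on the base. -/
lemma mu_gfun_congr {f : ℕ∞ → ℕ} {l : ℕ} (hf : ∀ m : ℕ, l ≤ m → f m = f ⊤) {A : Set V} {A' : Set W}
    (h : ∀ m < l, Wit idx A m ↔ Wit idx A' m) : f (gfun idx A) = f (gfun idx A') := by
  rcases gfun_eq_top_or (idx := idx) A with ⟨h1, h2⟩ | ⟨m, h1, h2, h3⟩ <;>
  rcases gfun_eq_top_or (idx := idx) A' with ⟨h4, h5⟩ | ⟨m', h4, h5, h6⟩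
  · rw [h1, h4]
  · rw [h1, h4]
    have : l ≤ m' := not_lt.1 fun hm => h2 m' ((h m' hm).2 h5)
    rw [hf m' this]
  · rw [h1, h4]
    have : l ≤ m := not_lt.1 fun hm => h5 m ((h m hm).1 h2)
    rw [hf m this]
  · rw [h1, h4]
    rcases lt_or_ge m l with hm | hm
    · have h7 : Wit idx A' m := (h m hm).1 h2
      have h8 : m' ≤ m := not_lt.1 fun h' => h6 m h' h7
      have h9 : m ≤ m' := not_lt.1 fun h' => h3 m' h' ((h m' (h'.trans hm)).2 h5)
      rw [le_antisymm h8 h9]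
    · have : l ≤ m' := not_lt.1 fun hm' => h3 m' (hm'.trans_le hm) ((h m' hm').2 h5)
      rw [hf m hm, hf m' this]

/-- Cutting a witness down to the strong image of `f` does not raise its predimension, in any
sublanguage. -/
lemma IsEmb.wit_image [Finite V] {f : V → W} (hf : IsEmb L f) (h : OccFin L W)
    (hs : Strong L (Set.range f)) (A : Set V) (m : ℕ) : Wit idx (f '' A) m ↔ Wit idx A m := by
  have hc : ∀ B : Set V, (f '' B).ncard = B.ncard := fun B => Set.ncard_image_of_injective B hf.1
  constructor
  · rintro ⟨X, hX, hAX, hcX, hd⟩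
    refine ⟨f ⁻¹' X, Set.toFinite _, Set.image_subset_iff.1 hAX, ?_, ?_⟩
    · rw [hc] at hcX
      refine le_trans ?_ hcX
      rw [← hc]
      exact Set.ncard_le_ncard (Set.image_preimage_subset f X) hX
    · rw [hf.predim_preimage, ← hf.predim_image _ A]
      exact (hs.predim_inter_le h (Set.finite_range f) _ hX).trans_lt hd
  · rintro ⟨X, hX, hAX, hcX, hd⟩
    refine ⟨f '' X, hX.image f, Set.image_mono hAX, by rwa [hc, hc], ?_⟩
    rwa [hf.predim_image, hf.predim_image]

lemma IsEmb.gfun_image [Finite V] {f : V → W} (hf : IsEmb L f) (h : OccFin L W)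
    (hs : Strong L (Set.range f)) (A : Set V) : gfun idx (f '' A) = gfun idx A :=
  gfun_congr (hf.wit_image h hs A)

end Witnesses

/-! ### Transport along embeddings. -/

section Transport

variable {L : FirstOrder.Language.{0, 0}} {V W U : Type*} [L.Structure V] [L.Structure W]
  [L.Structure U]

lemma OfForm.image {E : Ext L} {a : Fin E.size → V} {r : ℕ} {F : Fin r → Fin E.size → V}
    (h : OfForm E a F) {f : V → W} (hf : IsEmb L f) : OfForm E (f ∘ a) fun j => f ∘ F j :=
  ⟨fun _ hv _ hw he => h.1 hv hw (hf.1 he), fun s x hx => (hf.2 s _).symm.trans (h.2.1 s x hx),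
    fun j => hf.1.comp (h.2.2.1 j), fun j v hv => congrArg f (h.2.2.2.1 j v hv),
    fun j s x hx hr => (hf.2 s _).1 (h.2.2.2.2.1 j s x hx hr),
    fun j j' hj v hv w hw he => h.2.2.2.2.2 j j' hj v hv w hw (hf.1 he)⟩

lemma OfForm.of_image {E : Ext L} {a : Fin E.size → V} {r : ℕ} {F : Fin r → Fin E.size → V}
    {f : V → W} (hf : IsEmb L f) (h : OfForm E (f ∘ a) fun j => f ∘ F j) : OfForm E a F :=
  ⟨fun _ hv _ hw he => h.1 hv hw (congrArg f he), fun s x hx => (hf.2 s _).trans (h.2.1 s x hx),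
    fun j => (h.2.2.1 j).of_comp, fun j v hv => hf.1 (h.2.2.2.1 j v hv),
    fun j s x hx hr => (hf.2 s _).2 (h.2.2.2.2.1 j s x hx hr),
    fun j j' hj v hv w hw he => h.2.2.2.2.2 j j' hj v hv w hw (congrArg f he)⟩

/-- A family of copies depends only on the values of `a` on the base. -/
lemma OfForm.congr_left {E : Ext L} {a b : Fin E.size → V} {r : ℕ} {F : Fin r → Fin E.size → V}
    (h : OfForm E a F) (hab : ∀ v ∈ E.base, b v = a v) : OfForm E b F := by
  refine ⟨fun v hv w hw he => h.1 hv hw (by rwa [← hab v hv, ← hab w hw]), fun s x hx => ?_,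
    h.2.2.1, fun j v hv => (h.2.2.2.1 j v hv).trans (hab v hv).symm, h.2.2.2.2⟩
  rw [← h.2.1 s x hx, show b ∘ x = a ∘ x from funext fun i => hab _ (hx i)]

lemma OfForm.delta_base {E : Ext L} {a : Fin E.size → V} {r : ℕ} {F : Fin r → Fin E.size → V}
    (h : OfForm E a F) : delta L (a '' E.base) = E.deltaBase :=
  PEmbOn.predim_image (P := Set.univ) (A := E.base)
    ⟨h.1, fun s _ x hx => (h.2.1 s x hx).symm⟩ subset_rfl

lemma IsEmb.exists_factor {h : U → W} (hh : IsEmb L h) {f : V → W} (hf : IsEmb L f)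
    (hr : Set.range f ⊆ Set.range h) : ∃ j : V → U, IsEmb L j ∧ ∀ v, h (j v) = f v := by
  choose j hj using fun v => hr ⟨v, rfl⟩
  refine ⟨j, ⟨fun v w he => hf.1 (by rw [← hj v, ← hj w, he]), fun r x => ?_⟩, hj⟩
  rw [hh.2 r, hf.2 r, show h ∘ j ∘ x = f ∘ x from funext fun i => hj (x i)]

variable [L.IsRelational]

/-- An embedding in the sense of model theory. -/
def IsEmb.toEmbedding {f : V → W} (hf : IsEmb L f) : V ↪[L] W where
  toFun := f
  inj' := hf.1
  map_fun' g := isEmptyElim g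
  map_rel' {n} r x := (hf.2 ⟨n, r⟩ x).symm

lemma isEmb_of_embedding (f : V ↪[L] W) : IsEmb L f :=
  ⟨f.injective, fun r x => (f.map_rel r.2 x).symm⟩

lemma UniversallyAxiomatizable.of_emb {Z : StrProp L} (hZ : UniversallyAxiomatizable Z) {C D : Type}
    [L.Structure C] [L.Structure D] {f : C → D} (hf : IsEmb L f) (h : Z D) : Z C := by
  obtain ⟨T, hT, hTZ⟩ := hZ
  rw [hTZ] at h ⊢
  exact Theory.IsUniversal.models_of_embedding hf.toEmbedding

lemma isEmb_subtype (S : Set V) : IsEmb L (Subtype.val : S → V) :=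
  ⟨Subtype.val_injective, fun _ _ => Iff.rfl⟩

lemma isEmb_pull {X : Type*} {f : X → V} (hf : Function.Injective f) :
    @IsEmb L X V (pullStructure f) _ f := by
  let := pullStructure (L := L) f
  exact ⟨hf, fun _ _ => Iff.rfl⟩

/-- The hull is presented on some `Fin n` because the amalgamation class consists of structures in
`Type`, whereas the ambient structure may live in any universe. -/
lemma exists_hull (h : InC0 L V) {X : Set V} (hX : X.Finite) :
    ∃ (n : ℕ) (_ : L.Structure (Fin n)) (f : Fin n → V), IsEmb L f ∧ Strong L (Set.range f) ∧
      X ⊆ Set.range f := by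
  obtain ⟨D, hD, hXD, hs, _⟩ := h.exists_strong hX
  obtain ⟨n, f, hf, hr⟩ := hD.fin_param
  exact ⟨n, pullStructure f, f, isEmb_pull hf, hr ▸ hs, hr ▸ hXD⟩

variable {idx : RelSym L → ℕ} {μ : Ext L → ℕ∞ → ℕ} {Z : StrProp L}

lemma InClass.of_emb (hZ : UniversallyAxiomatizable Z) {C D : Type} [L.Structure C] [L.Structure D]
    {f : C → D} (hf : IsEmb L f) (hs : Strong L (Set.range f)) (h : InClass idx μ Z D) :
    InClass idx μ Z C := by
  have := h.finite
  have hC : Finite C := Finite.of_injective f hf.1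
  refine ⟨hC, hf.inC0 h.inC0, fun E hE a r F hF => ?_, hZ.of_emb hf h.zeta⟩
  have := h.bound E hE _ r _ (hF.image hf)
  rwa [Set.image_comp, hf.gfun_image h.inC0.occFin hs] at this

end Transport

/-! ### Classes of structures in which finite strong subsets determine types. -/

section Classes

variable {L : FirstOrder.Language.{0, 0}} [L.IsRelational] {idx : RelSym L → ℕ}
  {μ : Ext L → ℕ∞ → ℕ} {Z : StrProp L}

/-- A class of structures whose finite strong subsets are in the amalgamation class, and in which
strong extensions in the amalgamation class are realized in elementary extensions. -/
structure StrongClass (idx : RelSym L → ℕ) (μ : Ext L → ℕ∞ → ℕ) (Z : StrProp L)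
    (K : ∀ (N : Type u) [L.Structure N], Prop) : Prop where
  inC0 : ∀ (N : Type u) [L.Structure N], K N → InC0 L N
  mem : ∀ (N : Type u) [L.Structure N], K N → ∀ (C : Type) [L.Structure C] [Finite C] (f : C → N),
    IsEmb L f → Strong L (Set.range f) → InClass idx μ Z C
  extend : ∀ (N : Type u) [L.Structure N], K N → ∀ (B C : Type) [L.Structure B] [L.Structure C]
    [Finite B] (f : B → N) (j : B → C), IsEmb L f → Strong L (Set.range f) → IsEmb L j →
    Strong L (Set.range j) → InClass idx μ Z C →
    ∃ (N' : Type u) (_ : L.Structure N') (e : N ↪ₑ[L] N') (g : C → N'), K N' ∧ IsEmb L g ∧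
      Strong L (Set.range g) ∧ ∀ b, g (j b) = e (f b)

variable {K : ∀ (N : Type u) [L.Structure N], Prop}

/-- The base and the copies lie in a finite strong hull, which belongs to the amalgamation class and
yields the same value of `g`. -/
lemma StrongClass.bound (hK : StrongClass idx μ Z K) {N : Type u} [L.Structure N] (hN : K N)
    {E : Ext L} (hE : E.IsMSA) {a : Fin E.size → N} {r : ℕ} {F : Fin r → Fin E.size → N}
    (hF : OfForm E a F) : r ≤ μ E (gfun idx (a '' E.base)) := by
  have h0 := hK.inC0 N hN
  obtain ⟨n, _, f, hf, hs, hsub⟩ := exists_hull h0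
    ((Set.finite_range a).union (Set.finite_iUnion fun j => Set.finite_range (F j)))
  choose a' ha' using fun v => hsub (Set.mem_union_left _ (Set.mem_range_self (f := a) v))
  choose F' hF' using fun j v => hsub (Set.mem_union_right _ (Set.mem_iUnion.2 ⟨j, Set.mem_range_self (f := F j) v⟩))
  obtain rfl : f ∘ a' = a := funext ha'
  obtain rfl : (fun j => f ∘ F' j) = F := funext fun j => funext (hF' j)
  have := (hK.mem N hN (Fin n) f hf hs).bound E hE a' r F' (hF.of_image hf)
  rwa [Set.image_comp, hf.gfun_image h0.occFin hs]

lemma IsMu.exists_bound (hμ : IsMu μ) {E : Ext L} (hE : E.IsMSA) : ∃ k, ∀ m, μ E m ≤ k := by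
  obtain ⟨l, hl⟩ := Filter.eventually_atTop.1 (hμ.limit E hE)
  refine ⟨μ E ⊤ + ∑ i ∈ Finset.range l, μ E i, fun m => ?_⟩
  induction m using ENat.recTopCoe with
  | top => omega
  | coe m =>
    rcases lt_or_ge m l with h | h
    · exact (Finset.single_le_sum (f := fun i : ℕ => μ E i) (fun _ _ => Nat.zero_le _)
        (Finset.mem_range.2 h)).trans (Nat.le_add_left _ _)
    · rw [hl m h]; omega

lemma StrongClass.copiesBounded (hK : StrongClass idx μ Z K) (hμ : IsMu μ) {N : Type u}
    [L.Structure N] (hN : K N) : CopiesBounded L N := by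
  intro E hE
  obtain ⟨k, hk⟩ := hμ.exists_bound hE
  exact ⟨k, fun a r F hF => (hK.bound hN hE hF).trans (hk _)⟩

lemma exists_eq_var {α : Type*} (t : L.Term α) : ∃ s, t = Term.var s := by
  cases t with
  | var s => exact ⟨s, rfl⟩
  | func f _ => exact isEmptyElim f

/-- Isomorphic finite strong subsets satisfy the same formulas. -/
theorem StrongClass.realize_iff (hK : StrongClass idx μ Z K) {α : Type*} {n : ℕ}
    (φ : L.BoundedFormula α n) : ∀ (N₁ N₂ : Type u) [L.Structure N₁] [L.Structure N₂], K N₁ → K N₂ →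
    ∀ (C : Type) [L.Structure C] [Finite C] (f₁ : C → N₁) (f₂ : C → N₂), IsEmb L f₁ → IsEmb L f₂ →
    Strong L (Set.range f₁) → Strong L (Set.range f₂) → ∀ (v : α → C) (xs : Fin n → C),
    (φ.Realize (f₁ ∘ v) (f₁ ∘ xs) ↔ φ.Realize (f₂ ∘ v) (f₂ ∘ xs)) := by
  induction φ with
  | falsum => intros; rfl
  | equal t₁ t₂ =>
    intro N₁ N₂ _ _ _ _ C _ _ f₁ f₂ hf₁ hf₂ _ _ v xs
    obtain ⟨s₁, rfl⟩ := exists_eq_var t₁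
    obtain ⟨s₂, rfl⟩ := exists_eq_var t₂
    simp only [BoundedFormula.Realize, Term.realize_var, ← Sum.comp_elim, Function.comp_apply,
      hf₁.1.eq_iff, hf₂.1.eq_iff]
  | rel R ts =>
    intro N₁ N₂ _ _ _ _ C _ _ f₁ f₂ hf₁ hf₂ _ _ v xs
    choose s hs using fun i => exists_eq_var (ts i)
    simp only [BoundedFormula.Realize, hs, Term.realize_var, ← Sum.comp_elim]
    exact (hf₁.2 ⟨_, R⟩ (Sum.elim v xs ∘ s)).symm.trans (hf₂.2 ⟨_, R⟩ _)
  | imp _ _ ih₁ ih₂ =>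
    intro N₁ N₂ _ _ h₁ h₂ C _ _ f₁ f₂ hf₁ hf₂ hs₁ hs₂ v xs
    exact imp_congr (ih₁ N₁ N₂ h₁ h₂ C f₁ f₂ hf₁ hf₂ hs₁ hs₂ v xs)
      (ih₂ N₁ N₂ h₁ h₂ C f₁ f₂ hf₁ hf₂ hs₁ hs₂ v xs)
  | @all n φ ih =>
    have key : ∀ (N₁ N₂ : Type u) [L.Structure N₁] [L.Structure N₂], K N₁ → K N₂ →
        ∀ (C : Type) [L.Structure C] [Finite C] (f₁ : C → N₁) (f₂ : C → N₂), IsEmb L f₁ →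
        IsEmb L f₂ → Strong L (Set.range f₁) → Strong L (Set.range f₂) → ∀ v (xs : Fin n → C),
        φ.all.Realize (f₁ ∘ v) (f₁ ∘ xs) → φ.all.Realize (f₂ ∘ v) (f₂ ∘ xs) := by
      intro N₁ N₂ _ _ h₁ h₂ C _ _ f₁ f₂ hf₁ hf₂ hs₁ hs₂ v xs hφ y
      have hc := hK.inC0 N₂ h₂
      obtain ⟨k, _, f₃, hf₃, hs₃, hsub⟩ := exists_hull hc
        ((Set.finite_range f₂).union (Set.finite_singleton y))
      obtain ⟨j, hj, hjf⟩ := hf₃.exists_factor hf₂ (Set.subset_union_left.trans hsub)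
      obtain ⟨c, hcy⟩ := hsub (Set.mem_union_right _ (Set.mem_singleton y))
      have hjs : Strong L (Set.range j) := by
        rw [← hf₃.strong_image hc.occFin hs₃, ← Set.range_comp,
          show f₃ ∘ j = f₂ from funext hjf]
        exact hs₂
      -- The hull of `f₂(C)` and the new point is realized over `f₁(C)` in an elementary extension
      -- of `N₁` only. This is enough, because the universally quantified formula passes from `N₁`
      -- to that extension.
      obtain ⟨N', _, e, g, h', hg, hgs, hgj⟩ := hK.extend N₁ h₁ C (Fin k) f₁ j hf₁ hs₁ hj hjs
        (hK.mem N₂ h₂ _ f₃ hf₃ hs₃)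
      have h3 : φ.all.Realize (e ∘ f₁ ∘ v) (e ∘ f₁ ∘ xs) := (e.map_boundedFormula φ.all _ _).2 hφ
      have h4 := h3 (g c)
      have e1 : e ∘ f₁ ∘ v = g ∘ j ∘ v := funext fun i => (hgj (v i)).symm
      have e2 : Fin.snoc (e ∘ f₁ ∘ xs) (g c) = g ∘ (Fin.snoc (j ∘ xs) c : Fin (n + 1) → Fin k) := by
        rw [Fin.comp_snoc]
        congr 1
        exact funext fun i => (hgj (xs i)).symm
      have e3 : f₂ ∘ v = f₃ ∘ j ∘ v := funext fun i => (hjf (v i)).symm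
      have e4 : Fin.snoc (f₂ ∘ xs) y = f₃ ∘ (Fin.snoc (j ∘ xs) c : Fin (n + 1) → Fin k) := by
        rw [Fin.comp_snoc, hcy]
        congr 1
        exact funext fun i => (hjf (xs i)).symm
      rw [e1, e2] at h4
      rw [e3, e4]
      exact (ih N' N₂ h' h₂ (Fin k) g f₃ hg hf₃ hgs hs₃ _ _).1 h4
    intro N₁ N₂ _ _ h₁ h₂ C _ _ f₁ f₂ hf₁ hf₂ hs₁ hs₂ v xs
    exact ⟨key N₁ N₂ h₁ h₂ C f₁ f₂ hf₁ hf₂ hs₁ hs₂ v xs,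
      key N₂ N₁ h₂ h₁ C f₂ f₁ hf₂ hf₁ hs₂ hs₁ v xs⟩

end Classes

/-! ### When a free join belongs to the amalgamation class. -/

section JoinClass

variable {L : FirstOrder.Language.{0, 0}} [L.IsRelational] {idx : RelSym L → ℕ}
  {μ : Ext L → ℕ∞ → ℕ} {Z : StrProp L} {D C : Type} [L.Structure D] [L.Structure C] [Finite C]
  {B : Set C} {u : B → D}

/-- If a free join violates the bound, then one of the copies has its new points outside `D`. -/
lemma Join.exists_copy_avoiding (hlow : ∀ E : Ext L, E.IsMSA → ∀ m, E.deltaBase ≤ (μ E m : ℤ))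
    (hD : InClass idx μ Z D) (hC : InC0 L C) (hu : Function.Injective u) (hB : Strong L B)
    {E : Ext L} (hE : E.IsMSA) {a : Fin E.size → Join u} {r : ℕ} {F : Fin r → Fin E.size → Join u}
    (hF : OfForm E a F) (hr : μ E (gfun idx (a '' E.base)) < r) :
    ∃ i, ∀ v ∉ E.base, F i v ∉ Set.range (Join.inl u) := by
  have := hD.finite
  have hJ := Join.inC0 hD.inC0 hC hu hB
  have hs := Join.strong_range_inl hD.inC0.occFin hC.occFin hu hB
  classical
  by_contra hno
  push Not at hno
  -- Suppose every copy meets `D` in a new point. If the base is inside `D`, the copies lie in `D`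
  -- and violate its bound. If not, at most `δ(A) ≤ μ` copies can meet `D`.
  by_cases hb : ∀ v ∈ E.base, a v ∈ Set.range (Join.inl u)
  · have hall : ∀ i v, F i v ∈ Set.range (Join.inl u) := fun i => by
      obtain ⟨v, hv, hvD⟩ := hno i
      exact (hF.posCopy i).subset_of_mem hJ.occFin hE (Set.finite_range _) hs
        (fun v hv => by rw [hF.2.2.2.1 i v hv]; exact hb v hv) hv hvD
    choose F' hF' using hall
    have hr0 : 0 < r := by omega
    obtain rfl : (fun i => Join.inl u ∘ F' i) = F := funext fun i => funext (hF' i)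
    have hF2 : OfForm E (Join.inl u ∘ F' ⟨0, hr0⟩) fun i => Join.inl u ∘ F' i :=
      hF.congr_left fun v hv => hF.2.2.2.1 ⟨0, hr0⟩ v hv
    have h1 := hD.bound E hE _ r _ (hF2.of_image (Join.isEmb_inl u))
    rw [← (Join.isEmb_inl u).gfun_image hJ.occFin hs, ← Set.image_comp,
      hF.image_base ⟨0, hr0⟩] at h1
    omega
  · push Not at hb
    have h1 := hF.card_meeting_le hJ hE (Set.finite_range _) hs hb
    rw [show (Finset.univ.filter fun i => ∃ v ∉ E.base, F i v ∈ Set.range (Join.inl u)) = Finset.univ from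
      Finset.filter_true_of_mem fun i _ => hno i, Finset.card_univ, Fintype.card_fin,
      hF.delta_base] at h1
    have := hlow E hE (gfun idx (a '' E.base))
    omega

/-- When `u` is an embedding, both `D` and `C` embed in the join and preservation by free joins
applies. Over a base that agrees only approximately, `inr` need not be an embedding;
`JoinDetermined` covers that case. -/
lemma Join.zeta (hZ : UniversallyAxiomatizable Z) (hZ' : PreservedByFreeJoins Z) [Finite D]
    (hsD : Symmetric L D) (hsC : Symmetric L C) (hD : Z D) (hC : Z C) (hu : IsEmb L u) :
    Z (Join u) := by
  have hi : IsEmb L (Join.inr u) := by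
    have := Join.pEmbOn_inr (L := L) (P := Set.univ) hu.1 (fun r _ x => hu.2 r x) Set.univ
    exact ⟨Join.inr_injective hu.1, fun r x => this.2 r trivial x fun _ => trivial⟩
  refine hZ' (Join u) (Join.symmetric hsD hsC) (Set.range (Join.inl u)) (Set.range (Join.inr u))
    ?_ ?_ ?_ ?_
  · refine Set.eq_univ_of_forall fun j => ?_
    by_cases h : j ∈ Set.range (Join.inl u)
    · exact .inl h
    · obtain ⟨c, _, hc⟩ := Join.exists_inr u h
      exact .inr ⟨c, hc⟩
  · intro r x hx
    by_cases h : ∀ i, x i ∈ Set.range (Join.inl u)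
    · exact .inl h
    · obtain ⟨y, rfl, _⟩ := Join.rel_not_inl hx h
      exact .inr fun i => ⟨y i, rfl⟩
  · obtain ⟨j, hj, _⟩ := (Join.isEmb_inl (L := L) u).exists_factor
      (isEmb_subtype (Set.range (Join.inl u))) Subtype.range_coe.subset
    exact hZ.of_emb hj hD
  · obtain ⟨j, hj, _⟩ := hi.exists_factor (isEmb_subtype (Set.range (Join.inr u))) Subtype.range_coe.subset
    exact hZ.of_emb hj hC

/-- The amalgamation class is closed under adjoining a further isolated point. -/
lemma Join.inClass_of_isolated
    (hlow : ∀ E : Ext L, E.IsMSA → ∀ m, E.deltaBase ≤ (μ E m : ℤ)) (hD : InClass idx μ Z D)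
    (hC : InC0 L C) (hu : Function.Injective u) (hB : Strong L B) {c₀ : C} (hc₀ : Bᶜ = {c₀})
    (hdelta : delta L B < delta L (Set.univ : Set C)) (hZ : Z (Join u)) :
    InClass idx μ Z (Join u) := by
  have := hD.finite
  refine ⟨inferInstance, Join.inC0 hD.inC0 hC hu hB, fun E hE a r F hF => ?_, hZ⟩
  by_contra hr
  obtain ⟨i, hi⟩ := Join.exists_copy_avoiding hlow hD hC hu hB hE hF (not_le.1 hr)
  obtain ⟨f', hf', hpos, hn⟩ := Join.exists_lift hE hu (hF.posCopy i) hi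
  -- With a single new point the extension is trivially primitive, so a copy avoiding `D` would
  -- exhaust it and force `δ(C) = δ(B)`, against `hdelta`.
  have hprim : Primitive L B := by
    intro Y hY hne
    rw [hc₀] at hY
    rw [Set.ssubset_singleton_iff.1 hY] at hne
    exact absurd hne Set.not_nonempty_empty
  obtain ⟨w, hw⟩ := hE.msa.1.1
  have hfw : f' w = c₀ := by
    have : f' w ∈ Bᶜ := hn w hw
    rwa [hc₀] at this
  have := (hpos.exhausts hC.occFin hB hprim hE (fun v hv => by
    by_contra hvB
    have h1 : f' v ∈ Bᶜ := hvB
    rw [hc₀] at h1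
    have h2 : v = w := hpos.1 (h1.trans hfw.symm)
    exact hw (h2 ▸ hv)) hn).2.1
  omega

end JoinClass

/-! ### The second factor of a free join over a strong base. -/

section JoinRight

variable {L : FirstOrder.Language.{0, 0}} [L.IsRelational] {D C : Type} [L.Structure D]
  [L.Structure C] {B : Set C} {u : B → D}

lemma Join.isEmb_inr (hu : IsEmb L u) : IsEmb L (Join.inr u) := by
  have := Join.pEmbOn_inr (L := L) (P := Set.univ) hu.1 (fun r _ x => hu.2 r x) Set.univ
  exact ⟨Join.inr_injective hu.1, fun r x => this.2 r (Set.mem_univ _) x fun _ => Set.mem_univ _⟩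

lemma Join.range_inl_inter_range_inr :
    Set.range (Join.inl u) ∩ Set.range (Join.inr u) = Join.inl u '' Set.range u := by
  ext j
  constructor
  · rintro ⟨h, c, rfl⟩
    have hc := (Join.inr_mem_range_inl u).1 h
    exact ⟨_, ⟨⟨c, hc⟩, rfl⟩, (Join.inr_of_mem u hc).symm⟩
  · rintro ⟨_, ⟨b, rfl⟩, rfl⟩
    exact ⟨⟨_, rfl⟩, b, Join.inr_of_mem u b.2⟩

lemma Join.strong_range_inr [Finite D] [Finite C] (hD : OccFin L D) (hC : OccFin L C)
    (hu : Function.Injective u) (hs : Strong L (Set.range u)) : Strong L (Set.range (Join.inr u)) := by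
  intro X _ hX
  have h1 := Join.predim_sub_inr hD hC hu Set.univ X
  rw [Set.inter_eq_right.2 hX, Set.inter_assoc, Join.range_inl_inter_range_inr,
    Set.inter_eq_right.2 (show Join.inl u '' Set.range u ⊆ X from fun j hj => hX
      (Join.range_inl_inter_range_inr.superset hj).2),
    (Join.isEmb_inl u).predim_image, Set.inter_comm, ← Set.image_preimage_eq_range_inter,
    (Join.isEmb_inl u).predim_image] at h1
  have h2 := hs (Join.inl u ⁻¹' X) (Set.toFinite _) fun d hd => hX
      (Join.range_inl_inter_range_inr.superset ⟨d, hd, rfl⟩).2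
  unfold delta at *
  linarith

end JoinRight

/-! ### Algebraic points do not raise `d`. -/

section Closure

variable {L : FirstOrder.Language.{0, 0}} [L.IsRelational] {idx : RelSym L → ℕ}
  {μ : Ext L → ℕ∞ → ℕ} {Z : StrProp L} {K : ∀ (N : Type u) [L.Structure N], Prop}

/-- In an elementary extension, a finite definable set has no new points. -/
lemma mem_image_of_finite {N N' : Type u} [L.Structure N] [L.Structure N'] (e : N ↪ₑ[L] N') {n : ℕ}
    (φ : L.Formula (Fin n ⊕ Unit)) {a : Fin n → N}
    (hfin : {y | φ.Realize (Sum.elim a fun _ => y)}.Finite) {y : N'}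
    (hy : φ.Realize (Sum.elim (e ∘ a) fun _ => y)) :
    y ∈ e '' {y | φ.Realize (Sum.elim a fun _ => y)} := by
  obtain ⟨k, b, hb, hbr⟩ := hfin.fin_param
  have h1 : Elem (L := L) (fun (N : Type u) [L.Structure N] (w : (Fin n ⊕ Fin k) ⊕ Unit → N) =>
      φ.Realize (w ∘ Sum.map Sum.inl id)) := (Elem.of_formula φ).comp _
  have h2 : Elem (L := L) (fun (N : Type u) [L.Structure N] (w : (Fin n ⊕ Fin k) ⊕ Unit → N) =>
      ∃ i, w (.inl (.inr i)) = w (.inr ())) := by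
    refine Elem.of_samePat ∅ Set.finite_empty fun _ _ _ _ _ _ h => ?_
    rintro ⟨i, hi⟩
    exact ⟨i, (h.1 _ _).1 hi⟩
  obtain ⟨ψ, hψ⟩ := (h1.imp h2).all
  have h3 : ψ.Realize (Sum.elim a b) := by
    rw [← hψ]
    intro w hw
    have h4 : w () ∈ Set.range b := by
      rw [hbr]
      change φ.Realize _
      convert hw using 1
      funext s
      rcases s with s | s <;> rfl
    exact h4
  have h5 : ψ.Realize (e ∘ Sum.elim a b) := (e.map_formula ψ _).2 h3
  rw [← hψ] at h5
  obtain ⟨i, hi⟩ := h5 (fun _ => y) (by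
    convert hy using 1
    funext s
    rcases s with s | s <;> rfl)
  exact ⟨b i, hbr.subset ⟨i, rfl⟩, hi⟩

/-- If `x` raises `d`, then for a strong `D₀ ⊇ A` computing `d(A)` also `D₀x` is strong, with larger
predimension. A strong hull of `D₀x` and of the finite set defined by `φ` is freely joined with a
second copy of `D₀x` over `D₀`. The join is in the class, hence realized in an elementary extension,
where the second copy of `x` satisfies `φ` by `StrongClass.realize_iff`. It is a new point, although
a finite definable set cannot grow. -/
theorem StrongClass.dfun_eq_of_mem_acl (hK : StrongClass idx μ Z K)
    (hlow : ∀ E : Ext L, E.IsMSA → ∀ m, E.deltaBase ≤ (μ E m : ℤ))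
    (hZ : UniversallyAxiomatizable Z) (hZ' : PreservedByFreeJoins Z) {N : Type u} [L.Structure N]
    (hN : K N) {A : Set N} (hA : A.Finite) {x : N} (hx : x ∈ acl L A) :
    dfun L (insert x A) = dfun L A := by
  have h0 := hK.inC0 N hN
  by_contra hne
  have hlt : dfun L (insert x A) = dfun L A + 1 := by
    have := h0.dfun_insert_le hA x
    have := h0.dfun_mono (hA.insert x) (Set.subset_insert x A)
    omega
  obtain ⟨D₀, hD₀, hAD, hsD, hdD⟩ := h0.exists_strong hA
  have hxD : x ∉ D₀ := fun h => by
    have := h0.dfun_le hD₀ (Set.insert_subset h hAD)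
    omega
  have hdX : delta L (insert x D₀) = dfun L (insert x A) := by
    refine le_antisymm ?_ (h0.dfun_le (hD₀.insert x) (Set.insert_subset_insert hAD))
    have h1 := predim_sub h0.occFin (Set.univ : Set (RelSym L)) (hD₀.insert x) (Set.subset_insert x D₀)
    have h2 : (insert x D₀ \ D₀).ncard = 1 := by
      rw [Set.insert_sdiff_of_notMem _ hxD, sdiff_self, Set.bot_eq_empty, insert_empty_eq,
        Set.ncard_singleton]
    unfold delta at *
    omega
  have hsX := (h0.strong_of_delta_eq (hD₀.insert x) (Set.insert_subset_insert hAD) hdX).1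
  obtain ⟨n, φ, a, ha, hφ, hfin⟩ := exists_formula_of_mem_acl hx
  obtain ⟨p, f, hf, hfr⟩ := (hD₀.insert x).fin_param
  let : L.Structure (Fin p) := pullStructure f
  have hfe : IsEmb L f := isEmb_pull hf
  have hfs : Strong L (Set.range f) := hfr ▸ hsX
  set B : Set (Fin p) := f ⁻¹' D₀ with hB
  have hfB : f '' B = D₀ := by
    rw [hB, Set.image_preimage_eq_inter_range, hfr]
    exact Set.inter_eq_left.2 (Set.subset_insert _ _)
  have hsB : Strong L B := (hfe.strong_image h0.occFin hfs).1 (by rwa [hfB])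
  obtain ⟨c₀, hc₀⟩ : x ∈ Set.range f := hfr ▸ Set.mem_insert x D₀
  have hBc : Bᶜ = {c₀} := by
    ext c
    constructor
    · intro hc
      rcases hfr.subset ⟨c, rfl⟩ with h | h
      · exact hf (h.trans hc₀.symm)
      · exact absurd h hc
    · rintro rfl h
      exact hxD (hc₀ ▸ h)
  have hdelta : delta L B < delta L (Set.univ : Set (Fin p)) := by
    rw [← hfe.delta_image, hfB, ← hfe.delta_image Set.univ, Set.image_univ, hfr]
    omega
  obtain ⟨q, _, h, hh, hhs, hsub⟩ := exists_hull h0 ((hD₀.insert x).union hfin)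
  obtain ⟨j, hj, hjf⟩ := hh.exists_factor hfe (hfr ▸ Set.subset_union_left.trans hsub)
  have hjs : Strong L (Set.range j) := by
    rw [← hh.strong_image h0.occFin hhs, ← Set.range_comp, show h ∘ j = f from funext hjf]
    exact hfs
  let u : B → Fin q := fun b => j b
  have hu : IsEmb L u := hj.comp (isEmb_subtype B)
  have hqC := hK.mem N hN _ h hh hhs
  have hpC := hK.mem N hN _ f hfe hfs
  have hus : Strong L (Set.range u) := by
    have := (hj.strong_image hqC.inC0.occFin hjs (A := B)).2 hsB
    rwa [Set.image_eq_range] at this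
  have hJ : InClass idx μ Z (Join u) := Join.inClass_of_isolated hlow hqC hpC.inC0 hu.1 hsB hBc hdelta
    (Join.zeta hZ hZ' hqC.inC0.1 hpC.inC0.1 hqC.zeta hpC.zeta hu)
  obtain ⟨N', _, e, g, hN', hg, hgs, hge⟩ := hK.extend N hN (Fin q) (Join u) h (Join.inl u) hh hhs
    (Join.isEmb_inl u) (Join.strong_range_inl hqC.inC0.occFin hpC.inC0.occFin hu.1 hsB) hJ
  have hgir : Strong L (Set.range (g ∘ Join.inr u)) :=
    IsEmb.strong_range_comp (Join.strong_range_inr hqC.inC0.occFin hpC.inC0.occFin hu.1 hus) hg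
      (hK.inC0 N' hN').occFin hgs
  have haB : ∀ i, ∃ b ∈ B, f b = a i := fun i => by
    obtain ⟨b, hb, hb'⟩ := hfB.superset (hAD (ha i))
    exact ⟨b, hb, hb'⟩
  choose a' ha'B ha' using haB
  have hiff := hK.realize_iff φ N N' hN hN' (Fin p) f (g ∘ Join.inr u) hfe
    (hg.comp (Join.isEmb_inr hu)) hfs hgir (Sum.elim a' fun _ => c₀) default
  have e1 : f ∘ Sum.elim a' (fun _ : Unit => c₀) = Sum.elim a fun _ => x := by
    funext s
    rcases s with s | s
    · exact ha' s
    · exact hc₀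
  have e2 : (g ∘ Join.inr u) ∘ Sum.elim a' (fun _ : Unit => c₀) =
      Sum.elim (e ∘ a) fun _ => g (Join.inr u c₀) := by
    funext s
    rcases s with s | s
    · change g (Join.inr u (a' s)) = e (a s)
      rw [Join.inr_of_mem u (ha'B s), hge, hjf, ha']
    · rfl
  rw [e1, e2, Subsingleton.elim (f ∘ default) default,
    Subsingleton.elim ((g ∘ Join.inr u) ∘ default) default] at hiff
  obtain ⟨z, hz, hez⟩ := mem_image_of_finite e φ hfin (hiff.1 hφ)
  obtain ⟨d, rfl⟩ := hsub (Set.mem_union_right _ hz)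
  rw [← hge] at hez
  have : c₀ ∈ B := (Join.inr_mem_range_inl u).1 ⟨d, hg.1 hez⟩
  exact (hBc.superset rfl : c₀ ∈ Bᶜ) this

theorem StrongClass.givenByD (hK : StrongClass idx μ Z K) (hμ : IsMu μ)
    (hZ : UniversallyAxiomatizable Z) (hZ' : PreservedByFreeJoins Z) {N : Type u} [L.Structure N]
    (hN : K N) : GivenByD L (acl L (N := N)) :=
  ⟨acl_finitary, fun _ _ hA => ⟨fun hx => hK.dfun_eq_of_mem_acl hμ.lower hZ hZ' hN hA hx,
    fun hx => mem_acl_of_dfun_eq (hK.inC0 N hN) (hK.copiesBounded hμ hN) hA hx⟩⟩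

end Closure

/-! ### Generic models as rich structures; a single edge is not disintegrated. -/

section Generic

variable {L : FirstOrder.Language.{0, 0}} [L.IsRelational] {idx : RelSym L → ℕ}
  {μ : Ext L → ℕ∞ → ℕ} {Z : StrProp L}

lemma IsEmb.strong_image_of_surjective {V W : Type*} [L.Structure V] [L.Structure W] {f : V → W}
    (hf : IsEmb L f) (hs : Function.Surjective f) {A : Set V} :
    Strong L (f '' A) ↔ Strong L A := by
  constructor
  · intro h D hD hAD
    rw [← hf.delta_image, ← hf.delta_image D]
    exact h _ (hD.image f) (Set.image_mono hAD)
  · intro h D hD hAD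
    rw [← Set.image_preimage_eq D hs, hf.delta_image, hf.delta_image]
    exact h _ (hD.preimage hf.1.injOn) (Set.image_subset_iff.1 hAD)

/-- `N` is isomorphic to `M`. -/
def IsoTo (M : Type) [L.Structure M] (N : Type u) [L.Structure N] : Prop :=
  ∃ e : M → N, IsEmb L e ∧ Function.Surjective e

lemma IsoTo.inv {M : Type} [L.Structure M] {N : Type u} [L.Structure N] {e : M → N}
    (he : IsEmb L e) (hs : Function.Surjective e) :
    ∃ e' : N → M, IsEmb L e' ∧ Function.Surjective e' ∧ ∀ y, e (e' y) = y := by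
  obtain ⟨e', he'⟩ := hs.hasRightInverse
  refine ⟨e', ⟨he'.injective, fun r x => ?_⟩, fun m => ⟨e m, he.1 (he' _)⟩, he'⟩
  rw [he.2 r, show e ∘ e' ∘ x = x from funext fun i => he' (x i)]

/-- `N` has the defining properties of a generic model, apart from countability. -/
structure Rich (idx : RelSym L → ℕ) (μ : Ext L → ℕ∞ → ℕ) (Z : StrProp L) (N : Type u)
    [L.Structure N] : Prop where
  inC0 : InC0 L N
  mem : ∀ (C : Type) [L.Structure C] [Finite C] (f : C → N), IsEmb L f → Strong L (Set.range f) →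
    InClass idx μ Z C
  extend : ∀ (B C : Type) [L.Structure B] [L.Structure C] [Finite B] (f : B → N) (j : B → C),
    IsEmb L f → Strong L (Set.range f) → IsEmb L j → Strong L (Set.range j) → InClass idx μ Z C →
    ∃ g : C → N, IsEmb L g ∧ Strong L (Set.range g) ∧ ∀ b, g (j b) = f b

theorem Rich.strongClass (idx : RelSym L → ℕ) (μ : Ext L → ℕ∞ → ℕ) (Z : StrProp L) :
    StrongClass idx μ Z (fun (N : Type u) [L.Structure N] => Rich idx μ Z N) where
  inC0 _ _ h := h.inC0
  mem _ _ h := h.mem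
  extend N _ h B C _ _ _ f j hf hfs hj hjs hC := by
    obtain ⟨g, hg, hgs, hgj⟩ := h.extend B C f j hf hfs hj hjs hC
    exact ⟨N, _, .refl L N, g, h, hg, hgs, hgj⟩

/-- Stated for isomorphic copies, because models of the theory range over an arbitrary universe
while the generic model is in `Type`. -/
theorem IsGeneric.rich (hZ : UniversallyAxiomatizable Z) {M : Type} [L.Structure M]
    (h : IsGeneric idx μ Z M) {N : Type u} [L.Structure N] (hMN : IsoTo (L := L) M N) :
    Rich idx μ Z N where
  inC0 := by
    obtain ⟨e, he, hs⟩ := hMN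
    obtain ⟨e', he', _⟩ := IsoTo.inv he hs
    exact he'.inC0 h.inC0
  mem := by
    intro C _ _ f hf hfs
    obtain ⟨e, he, hs⟩ := hMN
    obtain ⟨e', he', hs', hee'⟩ := IsoTo.inv he hs
    have h1 := (he'.strong_image_of_surjective hs').2 hfs
    have h2 := h.mem _ ((Set.finite_range f).image e') h1
    obtain ⟨j, hj, hjf⟩ := (isEmb_subtype (L := L) (e' '' Set.range f)).exists_factor (he'.comp hf)
      (by rw [Set.range_comp, Subtype.range_coe])
    refine InClass.of_emb hZ hj ?_ h2
    have : Set.range j = Set.univ := by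
      refine Set.eq_univ_of_forall ?_
      rintro ⟨_, _, ⟨c, rfl⟩, rfl⟩
      exact ⟨c, Subtype.ext (hjf c)⟩
    rw [this]
    intro D _ hD
    rw [Set.univ_subset_iff.1 hD]
  extend := by
    intro B C _ _ _ f j hf hfs hj hjs hC
    obtain ⟨e, he, hs⟩ := hMN
    obtain ⟨e', he', hs', hee'⟩ := IsoTo.inv he hs
    have h1 := (he'.strong_image_of_surjective hs').2 hfs
    have hef := he'.comp hf
    obtain ⟨k, hk, hkf⟩ := hef.exists_factor (isEmb_subtype (L := L) (e' '' Set.range f))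
      (by rw [Set.range_comp, Subtype.range_coe])
    have hkj := hj.comp hk
    have hks : Function.Surjective k := fun b =>
      ⟨⟨e' (f b), _, ⟨b, rfl⟩, rfl⟩, hef.1 (hkf _)⟩
    obtain ⟨g, hg, hgs⟩ := h.extend _ ((Set.finite_range f).image e') h1 C hC hkj.toEmbedding (by
      change Strong L (Set.range (j ∘ k))
      rwa [hks.range_comp])
    have hge := isEmb_of_embedding g
    refine ⟨e ∘ g, he.comp hge, ?_, fun b => ?_⟩
    · rw [Set.range_comp]
      exact (he.strong_image_of_surjective hs).2 hgs
    · obtain ⟨a, rfl⟩ := hks b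
      have h3 : g (j (k a)) = a := hg a
      change e (g (j (k a))) = f (k a)
      rw [h3, ← hkf a]
      exact hee' _

lemma IsoTo.refl (M : Type) [L.Structure M] : IsoTo (L := L) M M :=
  ⟨id, ⟨Function.injective_id, fun _ _ => Iff.rfl⟩, Function.surjective_id⟩

/-- An occurrence of a nullary symbol would sit on the empty set and give it negative predimension.
Hence the empty set embeds strongly in every member of the class. -/
lemma InC0.not_relMap_zero {V : Type*} [L.Structure V] (h : InC0 L V) (r : RelSym L) (hr : r.1 = 0)
    (x : Fin r.1 → V) : ¬ Structure.RelMap r.2 x := by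
  intro hx
  have h1 := h.delta_empty
  have h2 : occ (Set.univ : Set (RelSym L)) (∅ : Set V) = ∅ := by
    rw [← Set.ncard_eq_zero (h.occFin _ Set.finite_empty)]
    unfold delta predim at h1
    rw [Set.ncard_empty] at h1
    omega
  have := mem_occ_of_relMap (A := ∅) (Set.mem_univ r) hx fun i => by
    have := i.2
    omega
  rw [h2] at this
  exact this

lemma IsGeneric.exists_emb {M : Type} [L.Structure M] (h : IsGeneric idx μ Z M) {C : Type}
    [L.Structure C] (hC : InClass idx μ Z C) : ∃ f : C → M, IsEmb L f ∧ Strong L (Set.range f) := by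
  have hj : IsEmb L (fun b : (∅ : Set M) => (b.2.elim : C)) := by
    refine ⟨fun b => b.2.elim, fun r x => ?_⟩
    by_cases hr : r.1 = 0
    · exact iff_of_false ((isEmb_subtype (L := L) (∅ : Set M)).inC0 h.inC0 |>.not_relMap_zero r hr x)
        (hC.inC0.not_relMap_zero r hr _)
    · exact (x ⟨0, by omega⟩).2.elim
  obtain ⟨f, _, hf⟩ := h.extend ∅ Set.finite_empty h.inC0.strong_empty C hC hj.toEmbedding (by
    convert hC.inC0.strong_empty
    refine Set.eq_empty_of_forall_notMem ?_
    rintro _ ⟨b, rfl⟩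
    exact b.2)
  exact ⟨f, isEmb_of_embedding f, hf⟩

lemma two_le_delta_singleEdge (R : L.Relations 3) :
    letI := singleEdge R
    delta L (Set.univ : Set (Fin 3)) = 2 ∧
      ∀ S : Set (Fin 3), 2 ≤ S.ncard → 2 ≤ delta L S := by
  let := singleEdge R
  have hperm : ∀ x : Fin 3 → Fin 3, Function.Injective x →
      Finset.univ.val.map x = (Finset.univ : Finset (Fin 3)).val := by
    intro x hx
    have := congrArg Finset.val (Finset.map_univ_equiv (Equiv.ofBijective x (Finite.injective_iff_bijective.1 hx)))
    exact this
  have hocc : ∀ S : Set (Fin 3), occ (Set.univ : Set (RelSym L)) S ⊆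
      {((⟨3, R⟩ : RelSym L), (Finset.univ : Finset (Fin 3)).val)} := by
    rintro S ⟨⟨k, s⟩, m⟩ ⟨_, x, ⟨hs, hx⟩, _, hm⟩
    cases hs
    exact Prod.ext rfl (hm.trans (hperm x hx))
  have huniv : occ (Set.univ : Set (RelSym L)) (Set.univ : Set (Fin 3)) =
      {((⟨3, R⟩ : RelSym L), (Finset.univ : Finset (Fin 3)).val)} := by
    refine (hocc _).antisymm ?_
    rintro _ rfl
    exact ⟨Set.mem_univ _, id, ⟨rfl, Function.injective_id⟩, fun _ => Set.mem_univ _, by simp⟩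
  have h1 : delta L (Set.univ : Set (Fin 3)) = 2 := by
    unfold delta predim
    rw [huniv, Set.ncard_univ, Set.ncard_singleton]
    simp
  refine ⟨h1, fun S hS => ?_⟩
  by_cases hu : S = Set.univ
  · rw [hu, h1]
  · have : occ (Set.univ : Set (RelSym L)) S = ∅ := by
      refine Set.eq_empty_of_forall_notMem ?_
      rintro ⟨⟨k, s⟩, m⟩ ⟨_, x, ⟨hs, hx⟩, hxS, _⟩
      cases hs
      refine hu (Set.eq_univ_of_forall fun i => ?_)
      obtain ⟨j, rfl⟩ := Finite.injective_iff_surjective.1 hx i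
      exact hxS j
    unfold delta predim
    rw [this, Set.ncard_empty]
    omega

/-- The strong triple has dimension 2 and any two of its points are independent. So the third point
is in the closure of the other two, but in the closure of neither of them. -/
theorem not_disintegrated_of_singleEdge {N : Type*} [L.Structure N] (h : InC0 L N) {cl : Set N → Set N}
    (hcl : GivenByD L cl) {R : L.Relations 3} {g : Fin 3 → N}
    (hg : @IsEmb L (Fin 3) N (singleEdge R) _ g) (hs : Strong L (Set.range g)) :
    ¬ Disintegrated cl := by
  let := singleEdge R
  obtain ⟨h1, h2⟩ := two_le_delta_singleEdge R
  have h3 : ∀ S : Set (Fin 3), 2 ≤ S.ncard → 2 ≤ dfun L (g '' S) := by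
    intro S hS
    obtain ⟨D, hD, hSD, hd⟩ := h.exists_delta_eq_dfun ((Set.toFinite S).image g)
    rw [← hd]
    refine le_trans ?_ (hs.delta_inter_le h.occFin (Set.finite_range g) hD)
    rw [← Set.image_preimage_eq_inter_range, hg.delta_image]
    exact h2 _ (hS.trans (Set.ncard_le_ncard (Set.image_subset_iff.1 hSD)))
  have h4 : ∀ i j : Fin 3, i ≠ j → 2 ≤ dfun L {g i, g j} := fun i j hij => by
    have := h3 {i, j} (Set.ncard_pair hij).ge
    rwa [Set.image_pair] at this
  have h5 : g 2 ∈ cl {g 0, g 1} := by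
    rw [hcl.mem_iff _ _ (Set.toFinite _)]
    refine le_antisymm ?_ (h.dfun_mono (Set.toFinite _) (Set.subset_insert _ _))
    refine le_trans ?_ (h4 0 1 (by decide))
    rw [← h1, ← hg.delta_image]
    refine h.dfun_le (Set.toFinite _) ?_
    rw [Set.image_univ]
    rintro _ (rfl | rfl | rfl) <;> exact ⟨_, rfl⟩
  intro hdis
  rw [hdis _ ⟨_, Set.mem_insert _ _⟩] at h5
  simp only [Set.mem_iUnion] at h5
  obtain ⟨a, ha, hx⟩ := h5
  rw [hcl.mem_iff _ _ (Set.finite_singleton _)] at hx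
  have h6 := h.dfun_singleton_le a
  rcases ha with rfl | rfl
  · have := h4 2 0 (by decide)
    omega
  · have := h4 2 1 (by decide)
    omega

instance uliftStructure (M : Type) [L.Structure M] : L.Structure (ULift.{u} M) :=
  pullStructure ULift.down

lemma isoTo_ulift (M : Type) [L.Structure M] : IsoTo (L := L) M (ULift.{u} M) :=
  ⟨ULift.up, ⟨ULift.up_injective, fun _ _ => Iff.rfl⟩, ULift.up_surjective⟩

lemma ulift_models (M : Type) [L.Structure M] : ULift.{u} M ⊨ L.completeTheory M := by
  have : M ≃[L] ULift.{u} M :=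
    ⟨Equiv.ulift.symm, fun f => isEmptyElim f, fun _ _ => Iff.rfl⟩
  exact StrongHomClass.theory_model this

end Generic

/-! ### Uniformity of `μ` for the extensions inside a finite structure. -/

section Uniform

variable {L : FirstOrder.Language.{0, 0}} [L.IsRelational] {μ : Ext L → ℕ∞ → ℕ}

/-- For extensions embedded in `C`, the value of `μ` depends on the `P`-type of the base only, and is
constant from `l` on. -/
def UniformFor (μ : Ext L → ℕ∞ → ℕ) (C : Type*) [L.Structure C] (P : Set (RelSym L)) (l : ℕ) : Prop :=
  ∀ E : Ext L, E.IsMSA → ∀ f : Fin E.size → C, Function.Injective f →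
    (∀ (r : RelSym L) x, E.Rel r x → Structure.RelMap r.2 (f ∘ x)) →
    (∀ m : ℕ, l ≤ m → μ E m = μ E ⊤) ∧
    ∀ E₂ : Ext L, E₂.IsMSA → ∀ σ : Fin E.size ≃ Fin E₂.size, E.SameRelType E₂ σ →
      (∀ r ∈ P, ∀ x : Fin r.1 → Fin E.size, (∀ i, x i ∈ E.base) →
        (E.Rel r x ↔ E₂.Rel r (σ ∘ x))) → ∀ m, μ E m = μ E₂ m

lemma finite_relMap {C : Type*} [L.Structure C] [Finite C] (h : OccFin L C) :
    Finite {p : Σ r : RelSym L, Fin r.1 → C // Structure.RelMap p.1.2 p.2} := by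
  have h1 : {r : RelSym L | ∃ x : Fin r.1 → C, Structure.RelMap r.2 x}.Finite := by
    refine ((h _ Set.finite_univ).image Prod.fst).subset ?_
    rintro r ⟨x, hx⟩
    exact ⟨_, mem_occ_of_relMap (Set.mem_univ _) hx fun _ => Set.mem_univ _, rfl⟩
  have := h1.to_subtype
  refine Finite.of_injective (β := Σ r : {r : RelSym L | ∃ x : Fin r.1 → C, Structure.RelMap r.2 x},
    Fin r.1.1 → C) (fun p => ⟨⟨p.1.1, p.1.2, p.2⟩, p.1.2⟩) ?_
  rintro ⟨⟨r, x⟩, hx⟩ ⟨⟨s, y⟩, hy⟩ he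
  simp only [Sigma.mk.injEq, Subtype.mk.injEq] at he
  obtain ⟨rfl, he⟩ := he
  obtain rfl := eq_of_heq he
  rfl

/-- Such a pair is determined by its size, the injection, the base, and the subset of the finitely
many relation instances of `C` that it retains. Relations need not be reflected, since copies of the
form of an extension may carry additional ones. -/
lemma Ext.finite_embedded {C : Type*} [L.Structure C] [Finite C] (h : OccFin L C) :
    {E : Ext L | ∃ f : Fin E.size → C, Function.Injective f ∧
      ∀ (r : RelSym L) x, E.Rel r x → Structure.RelMap r.2 (f ∘ x)}.Finite := by
  have := finite_relMap h
  let R := {p : Σ r : RelSym L, Fin r.1 → C // Structure.RelMap p.1.2 p.2}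
  let ι := Σ s : Fin (Nat.card C + 1), (Fin s → C) × Set (Fin s) × Set R
  let g : ι → Ext L := fun i =>
    { size := i.1
      str := { funMap := fun f => isEmptyElim f
               RelMap := fun {k} r x => ∃ h, (⟨⟨⟨k, r⟩, i.2.1 ∘ x⟩, h⟩ : R) ∈ i.2.2.2 }
      base := i.2.2.1 }
  refine (Set.finite_range g).subset ?_
  rintro ⟨s, str, b⟩ ⟨f, hf, hr⟩
  have hs : s ≤ Nat.card C := by
    have := Nat.card_le_card_of_injective f hf
    rwa [Nat.card_eq_fintype_card, Fintype.card_fin] at this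
  refine ⟨⟨⟨s, by omega⟩, f, b, {p | ∃ x : Fin p.1.1.1 → Fin s, f ∘ x = p.1.2 ∧
    @Structure.RelMap L (Fin s) str _ p.1.1.2 x}⟩, ?_⟩
  simp only [g]
  congr 1
  refine Structure.ext ?_ ?_
  · funext n φ
    exact isEmptyElim φ
  · funext n r x
    refine propext ⟨?_, fun hx => ⟨hr ⟨n, r⟩ x hx, x, rfl, hx⟩⟩
    rintro ⟨_, y, hy, h⟩
    rwa [← hf.comp_left hy]

/-- Only finitely many extensions are involved, so their finite sublanguages and their thresholds
can be combined. -/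
lemma IsMu.exists_uniformFor (hμ : IsMu μ) {C : Type*} [L.Structure C] [Finite C] (h : OccFin L C) :
    ∃ (P : Set (RelSym L)) (l : ℕ), P.Finite ∧ UniformFor μ C P l := by
  have hfin := Ext.finite_embedded h
  set 𝓔 := {E : Ext L | ∃ f : Fin E.size → C, Function.Injective f ∧
      ∀ (r : RelSym L) x, E.Rel r x → Structure.RelMap r.2 (f ∘ x)}
  have h1 : ∀ E : Ext L, ∃ P : Set (RelSym L), ∃ l : ℕ, P.Finite ∧ (E.IsMSA →
      (∀ m : ℕ, l ≤ m → μ E m = μ E ⊤) ∧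
      ∀ E₂ : Ext L, E₂.IsMSA → ∀ σ : Fin E.size ≃ Fin E₂.size, E.SameRelType E₂ σ →
      (∀ r ∈ P, ∀ x : Fin r.1 → Fin E.size, (∀ i, x i ∈ E.base) →
        (E.Rel r x ↔ E₂.Rel r (σ ∘ x))) → ∀ m, μ E m = μ E₂ m) := by
    intro E
    by_cases hE : E.IsMSA
    · obtain ⟨P, hP, hPE⟩ := hμ.uniform E hE
      obtain ⟨l, hl⟩ := Filter.eventually_atTop.1 (hμ.limit E hE)
      refine ⟨P, l, hP, fun _ => ⟨hl, fun E₂ hE₂ σ hσ hPσ m => ?_⟩⟩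
      exact hPE E E₂ hE hE₂ (Equiv.refl _) σ ⟨fun _ => Iff.rfl, fun _ _ _ => Iff.rfl⟩ hσ hPσ m
    · exact ⟨∅, 0, Set.finite_empty, fun h => absurd h hE⟩
  choose P l hP hl using h1
  obtain ⟨k, hk⟩ := (hfin.image l).bddAbove
  refine ⟨⋃ E ∈ 𝓔, P E, k, hfin.biUnion fun E _ => hP E, fun E hE f hf hr => ?_⟩
  have hE' : E ∈ 𝓔 := ⟨f, hf, hr⟩
  have hlk : l E ≤ k := hk ⟨E, hE', rfl⟩
  obtain ⟨h2, h3⟩ := hl E hE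
  exact ⟨fun m hm => h2 m (hlk.trans hm), fun E₂ hE₂ σ hσ hPσ => h3 E₂ hE₂ σ hσ fun r hr =>
    hPσ r (Set.mem_biUnion hE' hr)⟩

end Uniform

/-! ### Changing the relations on the base of an extension. -/

section Rebase

variable {L : FirstOrder.Language.{0, 0}} [L.IsRelational] {V : Type*} [L.Structure V]

/-- The extension with the relative type of `E` whose base has the structure induced by `f`. -/
abbrev Ext.rebase (E : Ext L) (f : Fin E.size → V) : Ext L where
  size := E.size
  str :=
    { funMap := fun g => isEmptyElim g
      RelMap := fun {k} r x => ((∀ i, x i ∈ E.base) ∧ Structure.RelMap r (f ∘ x)) ∨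
        ((¬ ∀ i, x i ∈ E.base) ∧ E.Rel ⟨k, r⟩ x) }
  base := E.base

lemma Ext.rebase_rel_base (E : Ext L) (f : Fin E.size → V) {s : RelSym L}
    {x : Fin s.1 → Fin E.size} (hx : ∀ i, x i ∈ E.base) :
    (E.rebase f).Rel s x ↔ Structure.RelMap s.2 (f ∘ x) :=
  ⟨fun h => h.elim And.right fun h => absurd hx h.1, fun h => .inl ⟨hx, h⟩⟩

lemma Ext.rebase_rel_new (E : Ext L) (f : Fin E.size → V) {s : RelSym L}
    {x : Fin s.1 → Fin E.size} (hx : ¬ ∀ i, x i ∈ E.base) :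
    (E.rebase f).Rel s x ↔ E.Rel s x :=
  ⟨fun h => h.elim (fun h => absurd h.1 hx) And.right, fun h => .inr ⟨hx, h⟩⟩

lemma Ext.sameRelType_rebase (E : Ext L) (f : Fin E.size → V) :
    E.SameRelType (E.rebase f) (Equiv.refl _) :=
  ⟨fun _ => Iff.rfl, fun _ _ hx => (E.rebase_rel_new f hx).symm⟩

lemma Ext.IsMSA.rebase {E : Ext L} (hE : E.IsMSA) (hs : Symmetric L V) (ho : OccFin L V)
    {f : Fin E.size → V} (hf : Set.InjOn f E.base) : (E.rebase f).IsMSA := by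
  refine (E.sameRelType_rebase f).isMSA hE ?_ ?_
  · rintro s x σ (h | h)
    · exact .inl ⟨fun j => h.1 _, hs s _ σ h.2⟩
    · refine .inr ⟨fun h' => h.1 fun j => ?_, hE.1 s x σ h.2⟩
      simpa using h' (σ.symm j)
  · intro A _
    have h1 : {p : RelSym L × Multiset (Fin E.size) | (∀ v ∈ p.2, v ∈ E.base) ∧
        occMap f p ∈ occ (Set.univ : Set (RelSym L)) (f '' E.base)}.Finite :=
      Set.Finite.of_finite_image ((ho _ ((Set.toFinite E.base).image f)).subset
        (by rintro _ ⟨p, hp, rfl⟩; exact hp.2)) (occMap_injOn hf fun p hp => hp.1)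
    refine (h1.union (hE.occFin _ Set.finite_univ)).subset ?_
    rintro q ⟨_, x, hx, _, hm⟩
    rcases hx with h | h
    · refine Or.inl ⟨fun v hv => ?_, Set.mem_univ _, f ∘ x, h.2, fun i => ⟨_, h.1 i, rfl⟩, ?_⟩
      · rw [hm] at hv
        obtain ⟨i, _, rfl⟩ := Multiset.mem_map.1 hv
        exact h.1 i
      · simp only [occMap, hm, Multiset.map_map]
        rfl
    · exact Or.inr ⟨Set.mem_univ _, x, h.2, fun _ => Set.mem_univ _, hm⟩

end Rebase

/-! ### Violations of the bound in joins over approximate bases. -/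

section Violation

variable {L : FirstOrder.Language.{0, 0}} [L.IsRelational] {idx : RelSym L → ℕ}
  {μ : Ext L → ℕ∞ → ℕ} {Z : StrProp L} {D C : Type} [L.Structure D] [L.Structure C]
  {B : Set C} {u : B → D}

/-- The base `range u` need not be strong in `D`; it merely has no witness for `p`. That is enough
for sets of at most `p` points: cutting them down to the image of `C` does not raise the
predimension. -/
lemma Join.predim_inter_inr_le [Finite D] [Finite C] (hD : OccFin L D) (hC : OccFin L C)
    (hu : Function.Injective u)
    {p : ℕ} (hw : ¬ Wit idx (Set.range u) p) {m : ℕ} (hm : m ≤ p) {X : Set (Join u)}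
    (hX : X.ncard ≤ p) :
    predim {r | idx r < m} (X ∩ Set.range (Join.inr u)) ≤ predim {r | idx r < m} X := by
  have hJ := Join.occFin (u := u) hD hC
  set Y := Join.inl u ⁻¹' X with hY
  have h1 := Join.predim_sub_inr hD hC hu {r | idx r < m} X
  have h2 : X ∩ Set.range (Join.inl u) = Join.inl u '' Y := by
    rw [hY, Set.image_preimage_eq_inter_range]
  have h3 : X ∩ Set.range (Join.inl u) ∩ Set.range (Join.inr u) = Join.inl u '' (Y ∩ Set.range u) := by
    rw [Set.inter_assoc, Join.range_inl_inter_range_inr, Set.image_inter (Join.inl_injective u), ← h2,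
      Set.inter_assoc]
    congr 1
    exact (Set.inter_eq_right.2 (Set.image_subset_range _ _)).symm
  rw [h3, h2, (Join.isEmb_inl u).predim_image, (Join.isEmb_inl u).predim_image] at h1
  have h4 := predim_diff_le hD (le_refl {r | idx r < m}) (Set.toFinite Y) (Set.toFinite (Set.range u))
  have h5 := predim_mono_sub hD (P := {r | idx r < m}) (Q := {r | idx r < p})
    (fun r hr => lt_of_lt_of_le hr hm) (Set.toFinite (Y ∪ Set.range u)) Set.subset_union_right
  have h6 : predim {r | idx r < p} (Set.range u) ≤ predim {r | idx r < p} (Y ∪ Set.range u) := by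
    by_contra h
    refine hw ⟨Y ∪ Set.range u, Set.toFinite _, Set.subset_union_right, ?_, not_le.1 h⟩
    have h7 := Set.ncard_union_le Y (Set.range u)
    have h8 : Y.ncard ≤ X.ncard := by
      rw [← Set.ncard_image_of_injective Y (Join.inl_injective u), ← h2]
      exact Set.ncard_le_ncard Set.inter_subset_left
    omega
  linarith

/-- If a free join over a primitive extension violates the bound, then a copy of the extension is
already present. -/
theorem Join.exists_copy_of_violation
    (hlow : ∀ E : Ext L, E.IsMSA → ∀ m, E.deltaBase ≤ (μ E m : ℤ))
    (hD : InClass idx μ Z D) (hC : InClass idx μ Z C) (hu : Function.Injective u) (hB : Strong L B)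
    (hprim : Primitive L B) {P : Set (RelSym L)} {l p : ℕ} (hunif : UniformFor μ C P l)
    (hPp : ∀ r ∈ P, idx r < p) (hsym : ∀ (r : RelSym L) (x : Fin r.1 → C), Structure.RelMap r.2 x →
      idx r < p) (hup : ∀ r : RelSym L, idx r < p → ∀ x : Fin r.1 → B,
        (Structure.RelMap r.2 (fun i => (x i : C)) ↔ Structure.RelMap r.2 (u ∘ x)))
    (hw : ¬ Wit idx (Set.range u) p) (hcard : Nat.card C + l ≤ p)
    {E : Ext L} (hE : E.IsMSA) {a : Fin E.size → Join u} {r : ℕ} {F : Fin r → Fin E.size → Join u}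
    (hF : OfForm E a F) (hr : μ E (gfun idx (a '' E.base)) < r) :
    delta L (Set.univ : Set C) = delta L B ∧
    ∃ c : C → D, Function.Injective c ∧ (∀ b : B, c b = u b) ∧
      ∀ (r : RelSym L) (x : Fin r.1 → C), (¬ ∀ i, x i ∈ B) → Structure.RelMap r.2 x →
        Structure.RelMap r.2 (c ∘ x) := by
  have := hD.finite
  have := hC.finite
  have hoD := hD.inC0.occFin
  have hoC := hC.inC0.occFin
  have hoJ := Join.occFin (u := u) hoD hoC
  obtain ⟨i, hi⟩ := Join.exists_copy_avoiding hlow hD hC.inC0 hu hB hE hF hr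
  obtain ⟨f, hf, hpos, hnB⟩ := Join.exists_lift hE hu (hF.posCopy i) hi
  have hinr : PEmbOn {r | idx r < p} (Join.inr u) Set.univ := Join.pEmbOn_inr hu hup _
  have hfa : ∀ v ∈ E.base, Join.inr u (f v) = a v := fun v hv => (hf v).trans (hF.2.2.2.1 i v hv)
  -- `C` and the join agree on the first `p` relations only, so the base may carry different
  -- relations in the two. `E'` has the base as found in `C`, and by uniformity `μ` does not
  -- distinguish it from `E`.
  let E' : Ext L := E.rebase f
  have hrel : ∀ (s : RelSym L) (x : Fin s.1 → Fin E.size), E'.Rel s x ↔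
      ((∀ i, x i ∈ E.base) ∧ Structure.RelMap s.2 (f ∘ x)) ∨
        ((¬ ∀ i, x i ∈ E.base) ∧ E.Rel s x) := fun s x => Iff.rfl
  have hrelC : ∀ (s : RelSym L) (x : Fin s.1 → Fin E.size), E'.Rel s x →
      Structure.RelMap s.2 (f ∘ x) := by
    intro s x hx
    rcases (hrel s x).1 hx with h | h
    · exact h.2
    · exact hpos.2 s x h.1 h.2
  have hsame := E.sameRelType_rebase f
  have hsame' : E'.SameRelType E (Equiv.refl _) :=
    ⟨fun _ => Iff.rfl, fun s x hx => (hsame.2 s x hx).symm⟩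
  have hE' : E'.IsMSA := hE.rebase hC.inC0.1 hoC hpos.1.injOn
  obtain ⟨hlim, hμE⟩ := hunif E' hE' f hpos.1 hrelC
  have hμE : ∀ m, μ E' m = μ E m := by
    refine hμE E hE (Equiv.refl _) hsame' fun s hs x hx => ?_
    change E'.Rel s x ↔ E.Rel s x
    rw [hrel, ← hF.2.1 s x hx, show a ∘ x = Join.inr u ∘ f ∘ x from funext fun j => (hfa _ (hx j)).symm,
      ← hinr.2 s (hPp s hs) (f ∘ x) fun _ => Set.mem_univ _]
    have hx : ∀ i, x i ∈ E.base := hx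
    tauto
  have hsize : E.size ≤ Nat.card C := by
    have := Nat.card_le_card_of_injective f hpos.1
    rwa [Nat.card_eq_fintype_card, Fintype.card_fin] at this
  have hbase : a '' E.base = Join.inr u '' (f '' E.base) := by
    rw [← Set.image_comp]
    exact Set.image_congr fun v hv => (hfa v hv).symm
  have hbc : (Join.inr u '' (f '' E.base)).ncard = (f '' E.base).ncard :=
    Set.ncard_image_of_injective _ (Join.inr_injective hu)
  have hbs : (f '' E.base).ncard ≤ Nat.card C := by
    rw [← Set.ncard_univ]
    exact Set.ncard_le_ncard (Set.subset_univ _)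
  -- Witnesses for `m < l` over the base have at most `|C| + l ≤ p` points, so those in the join can
  -- be cut down to `C`.
  have hg : μ E' (gfun idx (f '' E.base)) = μ E (gfun idx (a '' E.base)) := by
    rw [← hμE]
    refine mu_gfun_congr hlim fun m hm => ?_
    have hinr' : PEmbOn {r | idx r < m} (Join.inr u) Set.univ :=
      hinr.mono (fun r (hr : idx r < m) => (by change idx r < p; omega)) subset_rfl
    rw [hbase]
    constructor
    · rintro ⟨X, hX, hAX, hcX, hd⟩
      refine ⟨Join.inr u '' X, hX.image _, Set.image_mono hAX, ?_, ?_⟩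
      · rwa [hbc, Set.ncard_image_of_injective _ (Join.inr_injective hu)]
      · rwa [hinr'.predim_image (Set.subset_univ _), hinr'.predim_image (Set.subset_univ _)]
    · rintro ⟨X, hX, hAX, hcX, hd⟩
      rw [hbc] at hcX
      have h1 := Join.predim_inter_inr_le hoD hoC hu hw (m := m) (by omega) (X := X) (by omega)
      refine ⟨Join.inr u ⁻¹' X, Set.toFinite _, Set.image_subset_iff.1 hAX, ?_, ?_⟩
      · refine le_trans ?_ hcX
        rw [← Set.ncard_image_of_injective _ (Join.inr_injective hu), Set.image_preimage_eq_inter_range]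
        exact Set.ncard_le_ncard Set.inter_subset_left hX
      · rw [← hinr'.predim_image (Set.subset_univ (Join.inr u ⁻¹' X)),
          ← hinr'.predim_image (Set.subset_univ (f '' E.base)), Set.image_preimage_eq_inter_range]
        omega
  -- If all copies were inside `C`, the bound would fail in `C`. So some `F j` has a new point
  -- outside `C`, and then all its new points are outside, since a mixed copy would produce a
  -- witness for `p`. Its relations hence come from `D`, and the base lies in `B`; so `f` exhausts
  -- `C` over `B`, and `F j` carries `C` into `D`.
  by_cases hall : ∀ j v, F j v ∈ Set.range (Join.inr u)
  · exfalso
    choose F' hF' using hall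
    have hform : OfForm E' f F' := by
      refine ⟨hpos.1.injOn, fun s x hx => ?_, fun j v w h => ?_, fun j v hv => ?_, fun j s x hx hs => ?_,
        fun j j' hj v hv w hw he => ?_⟩
      · rw [hrel]
        have hx : ∀ i, x i ∈ E.base := hx
        tauto
      · exact hF.2.2.1 j (by rw [← hF', ← hF', h])
      · apply Join.inr_injective hu
        rw [hF', hfa v hv, hF.2.2.2.1 j v hv]
      · have hs' := hrelC s x hs
        have hsp := hsym s _ hs'
        rw [hinr.2 s hsp _ fun _ => Set.mem_univ _, show Join.inr u ∘ F' j ∘ x = F j ∘ x from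
          funext fun k => hF' j _]
        exact hF.2.2.2.2.1 j s x hx ((hsame.2 s x hx).2 hs)
      · exact hF.2.2.2.2.2 j j' hj v hv w hw (by rw [← hF', ← hF', he])
    have := hC.bound E' hE' f r F' hform
    change r ≤ μ E' (gfun idx (f '' E.base)) at this
    omega
  · push Not at hall
    obtain ⟨j, w, hw'⟩ := hall
    have hwb : w ∉ E.base := fun hwb => hw' ⟨f w, by rw [hfa w hwb, hF.2.2.2.1 j w hwb]⟩
    have hSym : E.SymIn {r | idx r < p} := fun s x hx hs => hsym s _ (hpos.2 s x hx hs)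
    have hout : ∀ v ∉ E.base, F j v ∉ Set.range (Join.inr u) := by
      by_contra hno
      push Not at hno
      obtain ⟨v, hv, hvr⟩ := hno
      set U : Set (Fin E.size) := E.baseᶜ ∩ F j ⁻¹' Set.range (Join.inr u) with hU
      have hUs : U ⊂ E.baseᶜ := ⟨Set.inter_subset_left, fun h' => hw' (h' hwb).2⟩
      have h1 := (hF.posCopy j).ncard_lt hoJ hE hSym hUs ⟨v, hv, hvr⟩
      have h2 : Set.range (F j) ∩ Set.range (Join.inr u) = F j '' (E.base ∪ U) := by
        ext y
        constructor
        · rintro ⟨⟨z, rfl⟩, hz⟩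
          by_cases hzb : z ∈ E.base
          · exact ⟨z, .inl hzb, rfl⟩
          · exact ⟨z, .inr ⟨hzb, hz⟩, rfl⟩
        · rintro ⟨z, hz | hz, rfl⟩
          · exact ⟨⟨z, rfl⟩, f z, by rw [hfa z hz, hF.2.2.2.1 j z hz]⟩
          · exact ⟨⟨z, rfl⟩, hz.2⟩
      have h3 := Join.predim_inter_inr_le hoD hoC hu hw (le_refl p) (X := Set.range (F j)) (by
        rw [← Set.image_univ, Set.ncard_image_of_injective _ (hF.2.2.1 j), Set.ncard_univ,
          Nat.card_eq_fintype_card, Fintype.card_fin]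
        omega)
      rw [h2] at h3
      have h4 := predim_sub hoJ {r | idx r < p} (Set.finite_range (F j))
        (Set.image_subset_range (F j) (E.base ∪ U))
      have h5 : Set.range (F j) \ F j '' (E.base ∪ U) = F j '' (E.baseᶜ \ U) := by
        rw [← Set.image_univ, ← Set.image_sdiff (hF.2.2.1 j)]
        congr 1
        ext; simp
      rw [h5, Set.ncard_image_of_injective _ (hF.2.2.1 j)] at h4
      omega
    have hinl : ∀ (s : RelSym L) (x : Fin s.1 → Fin E.size), (¬ ∀ i, x i ∈ E.base) → E.Rel s x →
        ∃ y, F j ∘ x = Join.inl u ∘ y ∧ Structure.RelMap s.2 y := by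
      intro s x hx hs
      rcases (Join.relMap_iff u).1 (hF.2.2.2.2.1 j s x hx hs) with h | ⟨y, hy, _⟩
      · exact h
      · exfalso
        push Not at hx
        obtain ⟨k, hk⟩ := hx
        exact hout _ hk ⟨y k, (congrFun hy k).symm⟩
    have hfB : ∀ v ∈ E.base, f v ∈ B := by
      intro v hv
      obtain ⟨s, x, hs, hx, k, rfl⟩ := hE.exists_rel hv
      obtain ⟨y, hy, _⟩ := hinl s x hx hs
      refine (Join.inr_mem_range_inl u).1 ⟨y k, ?_⟩
      rw [hfa _ hv, ← hF.2.2.2.1 j _ hv]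
      exact (congrFun hy k).symm
    obtain ⟨hex, hdelta, hrelE⟩ := hpos.exhausts hoC hB hprim hE hfB hnB
    have hinl' : ∀ v ∉ E.base, ∃ d, Join.inl u d = F j v := by
      intro v hv
      by_contra hd
      obtain ⟨c, _, hc⟩ := Join.exists_inr u (fun h => hd h : F j v ∉ Set.range (Join.inl u))
      exact hout v hv ⟨c, hc⟩
    have hc : ∀ x : C, ∃ d : D, (∀ h : x ∈ B, d = u ⟨x, h⟩) ∧
        ∀ v ∉ E.base, f v = x → Join.inl u d = F j v := by
      intro x
      by_cases hx : x ∈ B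
      · exact ⟨u ⟨x, hx⟩, fun _ => rfl, fun v hv h => absurd (h ▸ hx) (hnB v hv)⟩
      · obtain ⟨v, hv, rfl⟩ := hex x hx
        obtain ⟨d, hd⟩ := hinl' v hv
        exact ⟨d, fun h => absurd h hx, fun v' _ h => hpos.1 h ▸ hd⟩
    choose c hcB hcF using hc
    have hcv : ∀ v, Join.inl u (c (f v)) = F j v := by
      intro v
      by_cases hv : v ∈ E.base
      · rw [hcB _ (hfB v hv), ← Join.inr_of_mem u (hfB v hv), hfa v hv, hF.2.2.2.1 j v hv]
      · exact hcF _ v hv rfl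
    refine ⟨hdelta, c, ?_, fun b => hcB _ b.2, ?_⟩
    · have hBout : ∀ x (hx : x ∈ B) y, y ∉ B → c x ≠ c y := by
        intro x hx y hy h
        obtain ⟨v, hv, rfl⟩ := hex y hy
        refine hout v hv ⟨x, ?_⟩
        rw [← hcv, ← h, hcB x hx, ← Join.inr_of_mem u hx]
      intro x y h
      by_cases hx : x ∈ B <;> by_cases hy : y ∈ B
      · rw [hcB x hx, hcB y hy] at h
        exact congrArg Subtype.val (hu h)
      · exact absurd h (hBout x hx y hy)
      · exact absurd h.symm (hBout y hy x hx)
      · obtain ⟨v, hv, rfl⟩ := hex x hx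
        obtain ⟨v', hv', rfl⟩ := hex y hy
        rw [hF.2.2.1 j (a₁ := v) (a₂ := v') (by rw [← hcv, ← hcv, h])]
    · intro s x hx hs
      obtain ⟨y, rfl, hy, hEy⟩ := hrelE s x hs hx
      obtain ⟨z, hz, hzr⟩ := hinl s y hy hEy
      convert hzr using 1
      funext k
      apply Join.inl_injective u
      rw [Function.comp_apply, Function.comp_apply, hcv]
      exact congrFun hz k

end Violation

/-! ### Finite approximations of strong embeddings. -/

section Nice

variable {L : FirstOrder.Language.{0, 0}} [L.IsRelational] {idx : RelSym L → ℕ} {X N : Type*}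
  [L.Structure X] [L.Structure N]

/-- A finite approximation of a strong embedding: only the first `p` relations are considered, and
only extensions by at most `p` points. -/
def Nice (idx : RelSym L → ℕ) (p : ℕ) (f : X → N) : Prop :=
  Function.Injective f ∧ (∀ r : RelSym L, idx r < p → ∀ x : Fin r.1 → X,
    (Structure.RelMap r.2 x ↔ Structure.RelMap r.2 (f ∘ x))) ∧ ¬ Wit idx (Set.range f) p

lemma Nice.mono (h : OccFin L N) {p q : ℕ} (hpq : p ≤ q) {f : X → N} (hf : Nice idx q f) :
    Nice idx p f :=
  ⟨hf.1, fun r hr => hf.2.1 r (hr.trans_le hpq), fun hw => hf.2.2 (hw.mono h hpq)⟩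

lemma not_wit_of_strong (h : OccFin L N) {A : Set N} (hA : A.Finite) (hs : Strong L A) (p : ℕ) :
    ¬ Wit idx A p := by
  rintro ⟨X, hX, hAX, _, hd⟩
  have := hs.predim_inter_le h hA {r | idx r < p} hX
  rw [Set.inter_eq_right.2 hAX] at this
  omega

lemma IsEmb.nice [Finite X] (h : OccFin L N) {f : X → N} (hf : IsEmb L f) (hs : Strong L (Set.range f))
    (p : ℕ) : Nice idx p f :=
  ⟨hf.1, fun r _ => hf.2 r, not_wit_of_strong h (Set.finite_range f) hs p⟩

lemma exists_idx_bound {P : Set (RelSym L)} (hP : P.Finite) (idx : RelSym L → ℕ) :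
    ∃ b, ∀ r ∈ P, idx r < b := by
  obtain ⟨b, hb⟩ := (hP.image idx).bddAbove
  exact ⟨b + 1, fun r hr => Nat.lt_succ_of_le (hb ⟨r, hr, rfl⟩)⟩

/-- A finite superset of the image carries finitely many symbols, so its predimension is computed in
a finite sublanguage, and a failure of strongness would be a witness for some `p`. -/
lemma isEmb_strong_of_nice [Finite X] (h : OccFin L N) {f : X → N} (hf : ∀ p, Nice idx p f) :
    IsEmb L f ∧ Strong L (Set.range f) := by
  refine ⟨⟨(hf 0).1, fun r => (hf (idx r + 1)).2.1 r (Nat.lt_succ_self _)⟩, fun D hD hfD => ?_⟩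
  obtain ⟨b, hb⟩ := exists_idx_bound ((h D hD).image Prod.fst) idx
  have hpre : ∀ S ⊆ D, delta L S = predim {r | idx r < D.ncard + b} S := by
    intro S hS
    unfold delta predim
    congr 3
    refine Set.Subset.antisymm (fun p hp => ⟨?_, hp.2⟩) (occ_mono (Set.subset_univ _) subset_rfl)
    have := hb p.1 ⟨p, occ_mono subset_rfl hS hp, rfl⟩
    change idx p.1 < _
    omega
  rw [hpre _ hfD, hpre _ subset_rfl]
  by_contra hlt
  exact (hf (D.ncard + b)).2.2 ⟨D, hD, hfD, by omega, not_le.1 hlt⟩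

/-- A positive copy of an extension of predimension `0` over a base that has few extensions of
smaller predimension. -/
lemma nice_of_positive [Finite X] (hX : OccFin L X) (hN : OccFin L N) (hs : Symmetric L X) {B : Set X}
    {c : X → N} (hc : Function.Injective c) {p m : ℕ} (hu : Nice idx p (fun b : B => c b))
    (hdelta : delta L (Set.univ : Set X) = delta L B)
    (hsym : ∀ (r : RelSym L) (x : Fin r.1 → X), Structure.RelMap r.2 x → idx r < m)
    (hmp : Nat.card X + m ≤ p)
    (hpos : ∀ (r : RelSym L) (x : Fin r.1 → X), (¬ ∀ i, x i ∈ B) → Structure.RelMap r.2 x →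
        Structure.RelMap r.2 (c ∘ x)) : Nice idx m c := by
  have hru : Set.range (fun b : B => c b) = c '' B := (Set.image_eq_range c B).symm
  have hup := hu.2.1
  have huw := hu.2.2
  rw [hru] at huw
  have hO : (occ (Set.univ : Set (RelSym L)) (Set.univ : Set X) \ occ Set.univ B).ncard = Bᶜ.ncard := by
    have := predim_sub hX (Set.univ : Set (RelSym L)) Set.finite_univ (Set.subset_univ B)
    rw [← Set.compl_eq_univ_sdiff] at this
    unfold delta at hdelta
    omega
  have hcount : ∀ q, m ≤ q →
      occMap c '' (occ (Set.univ : Set (RelSym L)) Set.univ \ occ Set.univ B) ⊆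
        occ {r | idx r < q} (c '' Set.univ) \ occ {r | idx r < q} (c '' B) ∧
      Bᶜ.ncard ≤ (occ {r | idx r < q} (c '' Set.univ) \ occ {r | idx r < q} (c '' B)).ncard := by
    intro q hq
    rw [← hO]
    exact ncard_occ_diff_le hN Set.finite_univ hc.injOn (Set.subset_univ _) fun r _ x _ hx hr =>
      ⟨(hsym r x hr).trans_le hq, hpos r x hx hr⟩
  have hsub : ∀ q, predim {r | idx r < q} (c '' Set.univ) - predim {r | idx r < q} (c '' B) =
      (Bᶜ.ncard : ℤ) - (occ {r | idx r < q} (c '' Set.univ) \ occ {r | idx r < q} (c '' B)).ncard := by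
    intro q
    rw [predim_sub hN _ (Set.finite_univ.image c) (Set.image_mono (Set.subset_univ B)),
      ← Set.image_sdiff hc, Set.ncard_image_of_injective _ hc, Set.compl_eq_univ_sdiff]
  have hcardB : (c '' B).ncard = B.ncard := Set.ncard_image_of_injective _ hc
  have hcardX : (c '' Set.univ).ncard = Nat.card X := by
    rw [Set.ncard_image_of_injective _ hc, Set.ncard_univ]
  have hwit : ∀ Y : Set N, Y.Finite → c '' B ⊆ Y → Y.ncard ≤ Nat.card X + m →
      predim {r | idx r < p} (c '' B) ≤ predim {r | idx r < p} Y := by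
    intro Y hY hBY hcY
    by_contra hlt
    exact huw ⟨Y, hY, hBY, by omega, not_le.1 hlt⟩
  refine ⟨hc, fun r hr x => ?_, ?_⟩
  · by_cases hx : ∀ i, x i ∈ B
    · exact hup r (by omega) fun i => ⟨x i, hx i⟩
    · refine ⟨hpos r x hx, fun h => ?_⟩
      obtain ⟨h1, h2⟩ := hcount p (by omega)
      have h3 := hwit (c '' Set.univ) (Set.finite_univ.image c) (Set.image_mono (Set.subset_univ B))
        (by omega)
      have h4 := hsub p
      -- The transported occurrences are as many as the new points. An additional one on the copy
      -- would give a witness for `p` over the base, so there are no others.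
      have h5 := Set.eq_of_subset_of_ncard_le h1 (by
        rw [Set.InjOn.ncard_image (occMap_injOn (A := Set.univ) hc.injOn fun p _ v _ => Set.mem_univ v),
          hO]
        omega) ((hN.fin _ (Set.finite_univ.image c)).sdiff)
      have h6 : (r, Finset.univ.val.map (c ∘ x)) ∈
          occ {r | idx r < p} (c '' Set.univ) \ occ {r | idx r < p} (c '' B) := by
        refine ⟨mem_occ_of_relMap (show idx r < p by omega) h fun i => ⟨x i, Set.mem_univ _, rfl⟩,
          fun h' => hx fun i => ?_⟩
        obtain ⟨b, hb, hbx⟩ := mem_of_mem_occ h' (c (x i))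
          (Multiset.mem_map_of_mem (c ∘ x) (Finset.mem_univ_val i))
        exact hc hbx ▸ hb
      rw [← h5] at h6
      obtain ⟨⟨r', s⟩, ⟨⟨_, y, hy, _, hys⟩, _⟩, he⟩ := h6
      obtain ⟨rfl, he⟩ := Prod.mk.inj he
      simp only at hys
      change s.map c = _ at he
      rw [hys, Multiset.map_map] at he
      obtain ⟨σ, hσ⟩ := exists_perm_of_map_eq he.symm
      have hσ' : x = y ∘ σ := hc.comp_left hσ
      rw [hσ']
      exact hs _ y σ hy
  -- Passing from the base to the copy does not raise the predimension counted in the first `m`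
  -- relations, so a witness `Y` over the copy would also be one for `p` over the base.
  · rintro ⟨Y, hY, hcY, hYc, hd⟩
    rw [← Set.image_univ] at hcY hYc hd
    rw [hcardX] at hYc
    have hBY := (Set.image_mono (f := c) (Set.subset_univ B)).trans hcY
    have h1 := hwit Y hY hBY hYc
    have h2 := predim_mono_sub hN (P := {r | idx r < m}) (Q := {r | idx r < p})
      (fun r (hr : idx r < m) => (by change idx r < p; omega)) hY hBY
    have h3 := hsub m
    have h4 := (hcount m le_rfl).2
    omega

end Nice

/-! ### Extending approximately strong maps. -/

section Extension

variable {L : FirstOrder.Language.{0, 0}} [L.IsRelational] {idx : RelSym L → ℕ}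
  {μ : Ext L → ℕ∞ → ℕ} {Z : StrProp L}

/-- `Z` passes to joins over bases which agree for finitely many relations. -/
def JoinDetermined (idx : RelSym L → ℕ) (μ : Ext L → ℕ∞ → ℕ) (Z : StrProp L) : Prop :=
  ∀ (C : Type) [L.Structure C] (B : Set C), InClass idx μ Z C → Strong L B → ∃ p : ℕ,
    ∀ (D : Type) [L.Structure D], InClass idx μ Z D → ∀ u : B → D, Function.Injective u →
      (∀ r : RelSym L, idx r < p → ∀ x : Fin r.1 → B,
        (Structure.RelMap r.2 (fun i => (x i : C)) ↔ Structure.RelMap r.2 (u ∘ x))) → Z (Join u)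

/-- The join of `C` with a strong hull of the given map is formed. If it lies in the class, richness
realizes it and the restriction to `C` is nice. If not, the bound is violated, so a positive copy of
`C` with `δ(C) = δ(B)` is already present, and `nice_of_positive` applies. The number `p` must
exceed the size of `C`, the indices of its symbols, and the finite data on which `μ` and `Z` depend.
-/
theorem Rich.exists_nice_of_primitive (hμ : IsMu μ) (hZ : JoinDetermined idx μ Z) {C : Type}
    [L.Structure C] (hC : InClass idx μ Z C) {B : Set C} (hB : Strong L B) (hprim : Primitive L B)
    (m : ℕ) : ∃ p : ℕ, ∀ (N : Type u) [L.Structure N], Rich idx μ Z N → ∀ u : B → N, Nice idx p u →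
      ∃ c : C → N, (∀ b : B, c b = u b) ∧ Nice idx m c := by
  have := hC.finite
  have hoC := hC.inC0.occFin
  obtain ⟨P, l, hP, hunif⟩ := hμ.exists_uniformFor hoC
  obtain ⟨b₁, hb₁⟩ := exists_idx_bound hP idx
  have := finite_relMap hoC
  obtain ⟨b₂, hb₂⟩ := exists_idx_bound (Set.finite_range fun p :
    {p : Σ r : RelSym L, Fin r.1 → C // Structure.RelMap p.1.2 p.2} => p.1.1) idx
  have hsym : ∀ (r : RelSym L) (x : Fin r.1 → C), Structure.RelMap r.2 x → idx r < b₂ :=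
    fun r x hx => hb₂ r ⟨⟨⟨r, x⟩, hx⟩, rfl⟩
  obtain ⟨b₃, hb₃⟩ := hZ C B hC hB
  refine ⟨Nat.card C + l + b₁ + b₂ + b₃ + m, fun N _ hN u hu => ?_⟩
  set p := Nat.card C + l + b₁ + b₂ + b₃ + m with hp
  have hoN := hN.inC0.occFin
  obtain ⟨q, _, h, hh, hhs, hsub⟩ := exists_hull hN.inC0 (Set.finite_range u)
  choose v hv using fun b => hsub ⟨b, rfl⟩
  have huv : h ∘ v = u := funext hv
  have hD := hN.mem _ h hh hhs
  have hvi : Function.Injective v := (huv ▸ hu.1 : Function.Injective (h ∘ v)).of_comp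
  have hvp : ∀ r : RelSym L, idx r < p → ∀ x : Fin r.1 → B,
      (Structure.RelMap r.2 (fun i => (x i : C)) ↔ Structure.RelMap r.2 (v ∘ x)) := by
    intro r hr x
    rw [hh.2 r, ← Function.comp_assoc, huv, ← hu.2.1 r hr x]
    rfl
  have hvw : ¬ Wit idx (Set.range v) p := by
    rw [← hh.wit_image hoN hhs, ← Set.range_comp, huv]
    exact hu.2.2
  by_cases hJ : InClass idx μ Z (Join v)
  · obtain ⟨g, hg, hgs, hgv⟩ := hN.extend _ _ h (Join.inl v) hh hhs (Join.isEmb_inl v)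
      (Join.strong_range_inl hD.inC0.occFin hoC hvi hB) hJ
    have hinr : PEmbOn {r | idx r < p} (Join.inr v) Set.univ := Join.pEmbOn_inr hvi hvp _
    refine ⟨g ∘ Join.inr v, fun b => ?_, hg.1.comp (Join.inr_injective hvi), fun r hr x => ?_, ?_⟩
    · rw [Function.comp_apply, Join.inr_of_mem v b.2, hgv, hv]
    · rw [Function.comp_assoc, ← hg.2 r]
      exact hinr.2 r (show idx r < p by omega) x fun _ => Set.mem_univ _
    · rw [Set.range_comp, hg.wit_image hoN hgs]
      rintro ⟨X, hX, hrX, hcX, hd⟩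
      have hc : (Set.range (Join.inr v)).ncard = Nat.card C := by
        rw [← Set.image_univ, Set.ncard_image_of_injective _ (Join.inr_injective hvi), Set.ncard_univ]
      have := Join.predim_inter_inr_le hD.inC0.occFin hoC hvi hvw (m := m) (by omega) (X := X)
        (by omega)
      rw [Set.inter_eq_right.2 hrX] at this
      omega
  · have hviol : ∃ (E : Ext L) (a : Fin E.size → Join v) (r : ℕ) (F : Fin r → Fin E.size → Join v),
        E.IsMSA ∧ OfForm E a F ∧ μ E (gfun idx (a '' E.base)) < r := by
      by_contra hno
      exact hJ ⟨inferInstance, Join.inC0 hD.inC0 hC.inC0 hvi hB, fun E hE a r F hF =>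
        not_lt.1 fun hlt => hno ⟨E, a, r, F, hE, hF, hlt⟩,
        hb₃ _ hD v hvi fun r hr => hvp r (by omega)⟩
    obtain ⟨E, a, r, F, hE, hF, hr⟩ := hviol
    obtain ⟨hdelta, c, hc, hcv, hcr⟩ := Join.exists_copy_of_violation hμ.lower hD hC hvi hB hprim hunif
      (p := p) (fun r hr => by have := hb₁ r hr; omega)
      (fun r x hx => by have := hsym r x hx; omega) hvp hvw (by omega) hE hF hr
    have hcu : ∀ b : B, (h ∘ c) b = u b := fun b => by
      rw [Function.comp_apply, hcv, hv]
    refine ⟨h ∘ c, hcu, ?_⟩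
    refine (nice_of_positive (m := b₂ + m) (p := p) hoC hoN hC.inC0.1 (B := B) (hh.1.comp hc) ?_ hdelta
      (fun r x hx => by have := hsym r x hx; omega) (by omega) fun r x hx hr => ?_).mono hoN (by omega)
    · rwa [show (fun b : B => (h ∘ c) b) = u from funext hcu]
    · exact (hh.2 r (c ∘ x)).1 (hcr r x hx hr)

/-- A non-primitive extension splits at an intermediate set of the same predimension, which is again
strong. The precision required by the upper step is the one demanded from the lower step. -/
theorem Rich.exists_nice (hμ : IsMu μ) (hZ : JoinDetermined idx μ Z)
    (hZu : UniversallyAxiomatizable Z) (k : ℕ) : ∀ {C : Type}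
    [L.Structure C], InClass idx μ Z C → ∀ {B : Set C}, Strong L B → Bᶜ.ncard ≤ k →
    ∀ m : ℕ, ∃ p : ℕ, ∀ (N : Type u) [L.Structure N], Rich idx μ Z N → ∀ u : B → N, Nice idx p u →
      ∃ c : C → N, (∀ b : B, c b = u b) ∧ Nice idx m c := by
  induction k with
  | zero =>
    intro C _ hC B hB hk m
    have := hC.finite
    have hBu : Bᶜ = ∅ := (Set.ncard_eq_zero).1 (Nat.le_zero.1 hk)
    exact Rich.exists_nice_of_primitive hμ hZ hC hB
      (fun Y hY hne => by
        rw [hBu] at hY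
        exact absurd hne (Set.not_nonempty_iff_eq_empty.2 (Set.subset_empty_iff.1 hY.1))) m
  | succ k ih =>
    intro C _ hC B hB hk m
    have := hC.finite
    have hoC := hC.inC0.occFin
    by_cases hprim : Primitive L B
    · exact Rich.exists_nice_of_primitive hμ hZ hC hB hprim m
    · unfold Primitive at hprim
      push Not at hprim
      obtain ⟨Y, hY, hYne, hYd⟩ := hprim
      have hS : Strong L (B ∪ Y) := fun D hD hBD =>
        hYd.le.trans (hB D hD (Set.subset_union_left.trans hBD))
      have hval := isEmb_subtype (L := L) (B ∪ Y)
      have hval' : Strong L (Set.range (Subtype.val : ↥(B ∪ Y) → C)) := by rwa [Subtype.range_coe]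
      set B₁ : Set ↥(B ∪ Y) := Subtype.val ⁻¹' B with hB₁
      have hB₁i : Subtype.val '' B₁ = B := by
        rw [hB₁, Subtype.image_preimage_coe]
        exact Set.inter_eq_right.2 Set.subset_union_left
      have hB₁s : Strong L B₁ := (hval.strong_image hoC hval').1 (by rwa [hB₁i])
      have hYk : Y.ncard < Bᶜ.ncard := Set.ncard_lt_ncard hY
      obtain ⟨p₁, hp₁⟩ := ih hC hS (by
        have h1 : (B ∪ Y)ᶜ = Bᶜ \ Y := by rw [Set.compl_union]; rfl
        have h2 := Set.ncard_sdiff_add_ncard_of_subset hY.1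
        have h3 := hYne.ncard_pos
        rw [h1]
        omega) m
      obtain ⟨p, hp⟩ := ih (InClass.of_emb hZu hval hval' hC) hB₁s (by
        refine le_trans (Set.ncard_le_ncard_of_injOn (t := Y) Subtype.val ?_
          Subtype.val_injective.injOn) (by omega)
        rintro ⟨x, hx⟩ hxB
        exact hx.resolve_left hxB) p₁
      refine ⟨p, fun N _ hN u hu => ?_⟩
      obtain ⟨c₁, hc₁, hn₁⟩ := hp N hN (fun b => u ⟨b.1.1, b.2⟩) (by
        refine ⟨fun b b' h => by
          have := congrArg Subtype.val (hu.1 h)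
          exact Subtype.ext (Subtype.ext this),
          fun r hr x => hu.2.1 r hr fun i => ⟨(x i).1.1, (x i).2⟩, ?_⟩
        have : Set.range (fun b : B₁ => u ⟨b.1.1, b.2⟩) = Set.range u := by
          ext y
          constructor
          · rintro ⟨b, rfl⟩
            exact ⟨_, rfl⟩
          · rintro ⟨b, rfl⟩
            exact ⟨⟨⟨b, .inl b.2⟩, b.2⟩, rfl⟩
        rw [this]
        exact hu.2.2)
      obtain ⟨c, hc, hn⟩ := hp₁ N hN c₁ hn₁
      refine ⟨c, fun b => ?_, hn⟩
      rw [hc ⟨b, .inl b.2⟩]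
      exact hc₁ ⟨⟨b, .inl b.2⟩, b.2⟩

end Extension

/-! ### Elementarity of conditions on predimensions. -/

section Patterns

variable {L : FirstOrder.Language.{0, 0}} {ι κ : Type*}

lemma SamePat.exists_map {P : Set (RelSym L)} {N N' : Type*} [L.Structure N] [L.Structure N']
    [Nonempty N'] {v : ι → N} {v' : ι → N'} (h : SamePat P v v') : ∃ g : N → N', g ∘ v = v' := by
  obtain ⟨y⟩ := ‹Nonempty N'›
  refine ⟨Function.extend v v' fun _ => y, funext fun i => ?_⟩
  exact Function.FactorsThrough.extend_apply (fun i j hij => (h.1 i j).1 hij) _ i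

lemma SamePat.predim_image_of_map {P : Set (RelSym L)} {N N' : Type*} [L.Structure N]
    [L.Structure N'] {v : ι → N} {v' : ι → N'} (h : SamePat P v v') (hg : ∃ g : N → N', g ∘ v = v')
    (S : Set ι) : predim P (v '' S) = predim P (v' '' S) := by
  obtain ⟨g, rfl⟩ := hg
  rw [Set.image_comp]
  refine (PEmbOn.predim_image (A := v '' S) ⟨?_, fun r hr x hx => ?_⟩ subset_rfl).symm
  · rintro _ ⟨i, _, rfl⟩ _ ⟨j, _, rfl⟩ hij
    exact (h.1 i j).2 hij
  · choose y _ hy using hx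
    obtain rfl : v ∘ y = x := funext hy
    exact h.2 r hr y

lemma SamePat.predim_image {P : Set (RelSym L)} {N N' : Type*} [L.Structure N] [L.Structure N']
    {v : ι → N} {v' : ι → N'} (h : SamePat P v v') (S : Set ι) :
    predim P (v '' S) = predim P (v' '' S) := by
  rcases isEmpty_or_nonempty N' with hN' | hN'
  · have : IsEmpty ι := ⟨fun i => hN'.elim (v' i)⟩
    rcases isEmpty_or_nonempty N with hN | hN
    · exact h.predim_image_of_map ⟨fun n => (hN.false n).elim, funext fun i => isEmptyElim i⟩ S
    · exact (h.symm.predim_image_of_map ⟨fun n => (hN'.false n).elim,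
        funext fun i => isEmptyElim i⟩ S).symm
  · exact h.predim_image_of_map h.exists_map S

variable {idx : RelSym L → ℕ}

lemma finite_idx_lt (hidx : Function.Injective idx) (p : ℕ) : {r | idx r < p}.Finite :=
  (Set.finite_lt_nat p).preimage hidx.injOn

/-- Replaces a set of bounded size by an `m`-tuple, hence by a quantifier over tuples. Shorter lists
are filled up by repeating a new point; one exists because the predimension drops strictly. -/
lemma wit_range_iff [Finite ι] {N : Type*} [L.Structure N] (v : ι → N) (m : ℕ) :
    Wit idx (Set.range v) m ↔ ∃ w : Fin m → N,
      predim {r | idx r < m} (Set.range (Sum.elim v w)) < predim {r | idx r < m} (Set.range v) := by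
  constructor
  · rintro ⟨X, hX, hvX, hcX, hd⟩
    have h1 := Set.ncard_sdiff_add_ncard_of_subset hvX hX
    have h2 : (X \ Set.range v).Nonempty := by
      rw [Set.nonempty_iff_ne_empty]
      intro h
      rw [Set.Subset.antisymm (Set.sdiff_eq_empty.1 h) hvX] at hd
      exact lt_irrefl _ hd
    obtain ⟨k, f, hf, hfr⟩ := (hX.sdiff (t := Set.range v)).fin_param
    have hk : k ≤ m := by
      have := Set.ncard_image_of_injective Set.univ hf
      rw [Set.image_univ, hfr, Set.ncard_univ, Nat.card_eq_fintype_card, Fintype.card_fin] at this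
      omega
    obtain ⟨y, hy⟩ := h2
    let w : Fin m → N := fun i => if h : (i : ℕ) < k then f ⟨i, h⟩ else y
    have hw : Set.range w = X \ Set.range v := by
      ext z
      constructor
      · rintro ⟨i, rfl⟩
        by_cases h : (i : ℕ) < k
        · simp only [w, h, dif_pos]
          exact hfr.subset ⟨_, rfl⟩
        · simp only [w, h, dif_neg, not_false_eq_true]
          exact hy
      · intro hz
        obtain ⟨i, rfl⟩ := hfr.superset hz
        exact ⟨⟨i, i.2.trans_le hk⟩, by simp [w]⟩
    refine ⟨w, ?_⟩
    rwa [Set.Sum.elim_range, hw, Set.union_sdiff_cancel hvX]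
  · rintro ⟨w, hd⟩
    refine ⟨_, Set.finite_range _, ?_, ?_, hd⟩
    · rw [Set.Sum.elim_range]
      exact Set.subset_union_left
    · rw [Set.Sum.elim_range]
      refine (Set.ncard_union_le _ _).trans ?_
      have : (Set.range w).ncard ≤ m := by
        rw [← Set.image_univ]
        refine (Set.ncard_image_le Set.finite_univ).trans ?_
        rw [Set.ncard_univ, Nat.card_eq_fintype_card, Fintype.card_fin]
      omega

lemma elem_wit (hidx : Function.Injective idx) [Finite ι] (m : ℕ) :
    Elem (L := L) (fun (N : Type u) [L.Structure N] (v : ι → N) => Wit idx (Set.range v) m) := by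
  refine Elem.congr (Elem.ex (κ := Fin m) (p := fun N _ w => predim {r | idx r < m} (Set.range w) <
      predim {r | idx r < m} (Set.range (w ∘ Sum.inl)))
    (Elem.of_samePat _ (finite_idx_lt hidx m) fun N N' _ _ v v' h hv => ?_)) fun N _ v => ?_
  · rw [← Set.image_univ, Set.range_comp] at hv ⊢
    rwa [← h.predim_image, ← h.predim_image]
  · rw [wit_range_iff]
    rfl

lemma elem_nice (hidx : Function.Injective idx) (X : Type*) [L.Structure X] [Finite X] (p : ℕ) :
    Elem (L := L) (fun (N : Type u) [L.Structure N] (v : X → N) => Nice idx p v) := by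
  have h : Elem (L := L) (fun (N : Type u) [L.Structure N] (v : X → N) => Function.Injective v ∧
      ∀ r : RelSym L, idx r < p → ∀ x : Fin r.1 → X,
        (Structure.RelMap r.2 x ↔ Structure.RelMap r.2 (v ∘ x))) := by
    refine Elem.of_samePat _ (finite_idx_lt hidx p) fun N N' _ _ v v' h hv => ?_
    exact ⟨fun i j hij => hv.1 ((h.1 i j).2 hij), fun r hr x => (hv.2 r hr x).trans (h.2 r hr x)⟩
  exact (h.and (elem_wit hidx p).not).congr fun N _ v => by unfold Nice; tauto

/-- Nonnegativity is elementary only for each finite sublanguage. In `N` it bounds every finite set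
of occurrences on `A` by `|A|`, so there are finitely many occurrences in all, and the full
predimension is nonnegative as well. -/
lemma InC0.of_models {M N : Type u} [L.Structure M] [L.Structure N] (hM : InC0 L M)
    (hN : N ⊨ L.completeTheory M) : InC0 L N := by
  have hfin : ∀ (P : Set (RelSym L)), P.Finite → ∀ A : Set N, A.Finite → 0 ≤ predim P A := by
    intro P hP A hA
    obtain ⟨k, f, hf, rfl⟩ := hA.fin_param
    have hel : Elem (L := L) (fun (N : Type u) [L.Structure N] (v : Fin k → N) =>
        0 ≤ predim P (Set.range v)) := by
      refine Elem.of_samePat P hP fun N N' _ _ v v' h hv => ?_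
      rw [← Set.image_univ] at hv ⊢
      rwa [← h.predim_image]
    refine hel.transfer hN (fun v => ?_) f
    · have h1 := hM.delta_nonneg (Set.finite_range v)
      have h2 := predim_mono_sub hM.occFin (Set.subset_univ P) (Set.finite_range v)
        (Set.empty_subset (Set.range v))
      have h3 : predim P (∅ : Set M) = 0 := by
        have h4 : occ P (∅ : Set M) = ∅ := by
          have h5 := hM.delta_empty
          unfold delta predim at h5
          rw [Set.ncard_empty] at h5
          have h6 := (Set.ncard_eq_zero (hM.occFin _ Set.finite_empty)).1 (by omega)
          exact Set.subset_empty_iff.1 (h6 ▸ occ_mono (Set.subset_univ P) subset_rfl)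
        simp [predim, h4]
      have h7 := hM.delta_empty
      unfold delta at h1 h7
      omega
  refine ⟨fun r x σ => ?_, fun A hA => ?_⟩
  · have hel : Elem (L := L) (fun (N : Type u) [L.Structure N] (x : Fin r.1 → N) =>
        Structure.RelMap r.2 x → Structure.RelMap r.2 (x ∘ σ)) := ?_
    · exact hel.transfer hN (fun v => hM.1 r v σ) x
    refine Elem.of_samePat {r} (Set.finite_singleton r) fun N N' _ _ v v' h hv hr => ?_
    exact (h.2 r rfl σ).1 (hv ((h.2 r rfl id).2 hr))
  · have hle : ∀ T : Set (RelSym L × Multiset N), T.Finite → T ⊆ occ Set.univ A →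
        T.ncard ≤ A.ncard := by
      intro T hT hTA
      have h1 := hfin (Prod.fst '' T) (hT.image _) A hA
      have h2 : T ⊆ occ (Prod.fst '' T) A := fun p hp => ⟨⟨p, hp, rfl⟩, (hTA hp).2⟩
      by_cases h3 : (occ (Prod.fst '' T) A).Finite
      · have := Set.ncard_le_ncard h2 h3
        unfold predim at h1
        omega
      · exfalso
        have hS : (Set.univ : Set (Σ r : Prod.fst '' T, (Fin r.1.1 → A))).Finite := by
          have := (hT.image Prod.fst).to_subtype
          have := hA.to_subtype
          exact Set.toFinite _
        refine h3 ((hS.image fun q => (q.1.1, Finset.univ.val.map fun i => (q.2 i : N))).subset ?_)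
        rintro ⟨r, s⟩ ⟨hr, x, _, hxA, hs⟩
        exact ⟨⟨⟨r, hr⟩, fun i => ⟨x i, hxA i⟩⟩, Set.mem_univ _, Prod.ext rfl hs.symm⟩
    have hf : (occ (Set.univ : Set (RelSym L)) A).Finite := by
      by_contra hinf
      obtain ⟨T, hTA, hT⟩ := Set.Infinite.exists_subset_card_eq hinf (A.ncard + 1)
      have := hle T T.finite_toSet hTA
      rw [Set.ncard_coe_finset] at this
      omega
    refine ⟨hf, ?_⟩
    have := hle _ hf subset_rfl
    unfold delta predim
    omega

end Patterns

/-! ### Dependence on finitely many symbols. -/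

section Formulas

variable {L : FirstOrder.Language.{0, 0}} [L.IsRelational]

/-- A formula depends on finitely many relation symbols only. -/
lemma exists_finite_symbols {α : Type*} {n : ℕ} (φ : L.BoundedFormula α n) :
    ∃ P : Set (RelSym L), P.Finite ∧ ∀ (V : Type*) (S S' : L.Structure V),
      (∀ r ∈ P, ∀ x : Fin r.1 → V, @Structure.RelMap L V S r.1 r.2 x ↔ @Structure.RelMap L V S' r.1 r.2 x) →
      ∀ (v : α → V) (xs : Fin n → V),
        (@BoundedFormula.Realize L V S _ _ φ v xs ↔ @BoundedFormula.Realize L V S' _ _ φ v xs) := by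
  induction φ with
  | falsum => exact ⟨∅, Set.finite_empty, fun _ _ _ _ _ _ => Iff.rfl⟩
  | equal t₁ t₂ =>
    obtain ⟨s₁, rfl⟩ := exists_eq_var t₁
    obtain ⟨s₂, rfl⟩ := exists_eq_var t₂
    exact ⟨∅, Set.finite_empty, fun _ _ _ _ _ _ => Iff.rfl⟩
  | rel R ts =>
    choose s hs using fun i => exists_eq_var (ts i)
    refine ⟨{⟨_, R⟩}, Set.finite_singleton _, fun V S S' h v xs => ?_⟩
    have := h ⟨_, R⟩ rfl fun i => Sum.elim v xs (s i)
    simpa only [BoundedFormula.Realize, hs, Term.realize_var] using this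
  | imp _ _ ih₁ ih₂ =>
    obtain ⟨P₁, hP₁, h₁⟩ := ih₁
    obtain ⟨P₂, hP₂, h₂⟩ := ih₂
    refine ⟨P₁ ∪ P₂, hP₁.union hP₂, fun V S S' h v xs => ?_⟩
    exact imp_congr (h₁ V S S' (fun r hr => h r (.inl hr)) v xs)
      (h₂ V S S' (fun r hr => h r (.inr hr)) v xs)
  | all _ ih =>
    obtain ⟨P, hP, h⟩ := ih
    exact ⟨P, hP, fun V S S' h' v xs => forall_congr' fun y => h V S S' h' v _⟩

variable {idx : RelSym L → ℕ} {μ : Ext L → ℕ∞ → ℕ} {Z : StrProp L}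

/-- A structure failing `Z` does so because of finitely many relations. -/
lemma UniversallyAxiomatizable.exists_finite (hZ : UniversallyAxiomatizable Z) {V : Type}
    [S : L.Structure V] (h : ¬ Z V) : ∃ P : Set (RelSym L), P.Finite ∧ ∀ S' : L.Structure V,
      (∀ r ∈ P, ∀ x : Fin r.1 → V, @Structure.RelMap L V S r.1 r.2 x ↔ @Structure.RelMap L V S' r.1 r.2 x) →
      ¬ @Z V S' := by
  obtain ⟨T, _, hTZ⟩ := hZ
  rw [hTZ, Theory.model_iff] at h
  push Not at h
  obtain ⟨σ, hσ, hn⟩ := h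
  obtain ⟨P, hP, hPσ⟩ := exists_finite_symbols σ
  refine ⟨P, hP, fun S' hS' hZ' => hn ?_⟩
  rw [hTZ] at hZ'
  exact (hPσ V S S' hS' _ _).2 (hZ'.realize_of_mem σ hσ)

/-- The value of `Z` depends on the relations in `P` only. -/
def DependsOn (Z : StrProp L) (P : Set (RelSym L)) : Prop :=
  ∀ (V : Type) (S S' : L.Structure V), (∀ r ∈ P, ∀ x : Fin r.1 → V,
    @Structure.RelMap L V S r.1 r.2 x ↔ @Structure.RelMap L V S' r.1 r.2 x) → @Z V S → @Z V S'

lemma dependsOn_univ (Z : StrProp L) : DependsOn Z Set.univ := by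
  intro V S S' h
  have : S = S' := Structure.ext (by funext n f; exact isEmptyElim f) (by
    funext n r x
    exact propext (h ⟨n, r⟩ trivial x))
  subst this
  exact id

lemma UniversalSentence.exists_dependsOn (hZ : UniversalSentence Z) :
    ∃ P : Set (RelSym L), P.Finite ∧ DependsOn Z P := by
  obtain ⟨σ, _, hσ⟩ := hZ
  obtain ⟨P, hP, h⟩ := exists_finite_symbols σ
  refine ⟨P, hP, fun V S S' hS hV => ?_⟩
  rw [hσ] at hV ⊢
  exact (h V S S' hS _ _).1 hV

/-- The structure in which only the relations in `P` are retained. -/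
abbrev keepOnly (P : Set (RelSym L)) (V : Type*) [L.Structure V] : L.Structure V where
  funMap f := isEmptyElim f
  RelMap {k} r x := (⟨k, r⟩ : RelSym L) ∈ P ∧ Structure.RelMap r x

/-- With all symbols outside `P` discarded, the base map becomes an embedding and the join a genuine
free join, while `Z` does not notice the change. -/
lemma DependsOn.joinDetermined {P : Set (RelSym L)} (hP : P.Finite) (hZP : DependsOn Z P)
    (hZ : UniversallyAxiomatizable Z) (hZ' : PreservedByFreeJoins Z) : JoinDetermined idx μ Z := by
  intro C _ B hC hB
  obtain ⟨p, hp⟩ := exists_idx_bound hP idx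
  refine ⟨p, fun D _ hD u hu hup => ?_⟩
  have := hC.finite
  have := hD.finite
  have key := @Join.zeta L _ Z D C (keepOnly P D) (keepOnly P C) _ B u hZ hZ' _
    (fun r x σ h => ⟨h.1, hD.inC0.1 r x σ h.2⟩) (fun r x σ h => ⟨h.1, hC.inC0.1 r x σ h.2⟩)
    (hZP D _ _ (fun r hr x => (and_iff_right hr).symm) hD.zeta)
    (hZP C _ _ (fun r hr x => (and_iff_right hr).symm) hC.zeta)
    ⟨hu, fun r x => and_congr_right fun hr => hup r (hp r hr) x⟩
  refine hZP _ _ _ (fun r hr x => ?_) key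
  refine (@Join.relMap_iff L D C (keepOnly P D) (keepOnly P C) B u _ r x).trans
    (Iff.trans ?_ (Join.relMap_iff u).symm)
  refine or_congr (exists_congr fun y => and_congr_right fun _ => and_iff_right hr)
    (exists_congr fun y => and_congr_right fun _ => and_congr_right fun _ => and_iff_right hr)

end Formulas

/-! ### All models of the theory of a rich structure. -/

section Models

variable {L : FirstOrder.Language.{0, 0}} [L.IsRelational] {idx : RelSym L → ℕ}
  {μ : Ext L → ℕ∞ → ℕ} {Z : StrProp L} {M N : Type u} [L.Structure M] [L.Structure N]

/-- A failure of `Z` on a finite subset of `N` is due to finitely many symbols, and the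
corresponding pattern would be realized in `M`, inside a finite strong set satisfying `Z`. -/
lemma Rich.zeta_of_models (hZ : UniversallyAxiomatizable Z)
    (hM : Rich idx μ Z M) (hN : N ⊨ L.completeTheory M) {C : Type} [S : L.Structure C] [Finite C]
    {f : C → N} (hf : IsEmb L f) : Z C := by
  by_contra hC
  obtain ⟨P, hP, hPZ⟩ := hZ.exists_finite hC
  have hel : Elem (L := L) (fun (N : Type u) [L.Structure N] (v : C → N) =>
      ¬ SamePat P (id : C → C) v) := by
    refine Elem.of_samePat P hP fun N N' _ _ v v' h hv hv' => hv ?_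
    exact ⟨fun i j => (hv'.1 i j).trans (h.1 i j).symm,
      fun r hr x => (hv'.2 r hr x).trans (h.2 r hr x).symm⟩
  refine hel.transfer hN (fun v hv => ?_) f
    ⟨fun i j => hf.1.eq_iff.symm, fun r _ x => hf.2 r x⟩
  obtain ⟨n, _, h, hh, hhs, hsub⟩ := exists_hull hM.inC0 (Set.finite_range v)
  have hvi : Function.Injective v := fun i j hij => (hv.1 i j).2 hij
  have hfac : ∃ j : C → Fin n, @IsEmb L C (Fin n) (pullStructure v) _ j := by
    let : L.Structure C := pullStructure v
    obtain ⟨j, hj, _⟩ := hh.exists_factor (isEmb_pull hvi) hsub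
    exact ⟨j, hj⟩
  obtain ⟨j, hj⟩ := hfac
  refine hPZ (pullStructure v) (fun r hr x => hv.2 r hr x) ?_
  exact @UniversallyAxiomatizable.of_emb L _ Z hZ _ _ (pullStructure v) _ j hj
    (hM.mem _ h hh hhs).zeta

/-- A violation is described by finitely much: the copies, the first `p` relations on the base, and
the truth of `Wit` for `m < l`, which together fix the value of `μ`. In `M` a tuple with this
description may carry other relations on its base, so the extension is rebased there, without effect
on `μ`. -/
lemma Rich.bound_of_models (hidx : Function.Injective idx) (hμ : IsMu μ)
    (hM : Rich idx μ Z M) (hN : N ⊨ L.completeTheory M) {E : Ext L} (hE : E.IsMSA)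
    {a : Fin E.size → N} {r : ℕ} {F : Fin r → Fin E.size → N} (hF : OfForm E a F) :
    r ≤ μ E (gfun idx (a '' E.base)) := by
  by_contra hlt
  obtain ⟨P, hP, hPE⟩ := hμ.uniform E hE
  obtain ⟨l, hl⟩ := Filter.eventually_atTop.1 (hμ.limit E hE)
  obtain ⟨b, hb⟩ := exists_idx_bound hP idx
  obtain ⟨b', hb'⟩ := exists_idx_bound ((hE.occFin _ Set.finite_univ).image Prod.fst) idx
  have hsym : ∀ (s : RelSym L) (x : Fin s.1 → Fin E.size), E.Rel s x → idx s < b' := fun s x hx =>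
    hb' s ⟨_, mem_occ_of_relMap (V := Fin E.size) (Set.mem_univ _) hx fun _ => Set.mem_univ _, rfl⟩
  set p := b + b' with hp
  let ι := Fin E.size ⊕ (Fin r × Fin E.size)
  let t : Fin l → Prop := fun m => Wit idx (a '' E.base) m
  let QF : ∀ (N : Type u) [L.Structure N], (ι → N) → Prop := fun N _ v =>
    Set.InjOn (v ∘ Sum.inl) E.base ∧
    (∀ s : RelSym L, idx s < p → ∀ x : Fin s.1 → Fin E.size, (∀ i, x i ∈ E.base) →
      (Structure.RelMap s.2 (v ∘ Sum.inl ∘ x) ↔ E.Rel s x)) ∧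
    (∀ j w w', v (.inr (j, w)) = v (.inr (j, w')) → w = w') ∧
    (∀ j, ∀ w ∈ E.base, v (.inr (j, w)) = v (.inl w)) ∧
    (∀ j (s : RelSym L) (x : Fin s.1 → Fin E.size), (¬ ∀ i, x i ∈ E.base) →
      E.Rel s x → Structure.RelMap s.2 (v ∘ fun i => .inr (j, x i))) ∧
    (∀ j j', j ≠ j' → ∀ w ∉ E.base, ∀ w' ∉ E.base, v (.inr (j, w)) ≠ v (.inr (j', w')))
  have hQF : Elem (L := L) QF := by
    refine Elem.of_samePat _ (finite_idx_lt hidx p) fun N N' _ _ v v' h hv => ?_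
    obtain ⟨h1, h2, h3, h4, h5, h6⟩ := hv
    refine ⟨fun w hw w' hw' he => h1 hw hw' ((h.1 _ _).2 he), fun s hs x hx => ?_,
      fun j w w' he => h3 j w w' ((h.1 _ _).2 he), fun j w hw => (h.1 _ _).1 (h4 j w hw),
      fun j s x hx hr => ?_, fun j j' hj w hw w' hw' he => h6 j j' hj w hw w' hw' ((h.1 _ _).2 he)⟩
    · rw [← h2 s hs x hx]
      exact (h.2 s hs (Sum.inl ∘ x)).symm
    · refine (h.2 s ?_ _).1 (h5 j s x hx hr)
      have := hsym s x hr
      change idx s < p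
      omega
  have hW : ∀ m : Fin l, Elem (L := L) (fun (N : Type u) [L.Structure N] (v : ι → N) =>
      Wit idx ((v ∘ Sum.inl) '' E.base) m ↔ t m) := by
    intro m
    have h1 : Elem (L := L) (fun (N : Type u) [L.Structure N] (v : ι → N) =>
        Wit idx ((v ∘ Sum.inl) '' E.base) m) := by
      refine ((elem_wit hidx (ι := E.base) m).comp fun w => (Sum.inl w.1 : ι)).congr fun N _ v => ?_
      rw [Set.image_eq_range]
      rfl
    by_cases ht : t m
    · exact h1.congr fun N _ v => iff_true_right ht
    · exact h1.not.congr fun N _ v => iff_false_right ht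
  have hQ := (hQF.and (Elem.forall_finite hW)).not
  refine hQ.transfer hN (fun v hv => ?_) (Sum.elim a fun q => F q.1 q.2) ⟨?_, fun m => Iff.rfl⟩
  · obtain ⟨⟨h1, h2, h3, h4, h5, h6⟩, h7⟩ := hv
    have hE' := hE.rebase hM.inC0.1 hM.inC0.occFin h1
    have hform : OfForm (E.rebase (v ∘ Sum.inl)) (v ∘ Sum.inl) fun j w => v (.inr (j, w)) :=
      ⟨h1, fun s x hx => (E.rebase_rel_base (v ∘ Sum.inl) hx).symm, fun j w w' => h3 j w w', h4,
        fun j s x hx hr => h5 j s x hx ((E.rebase_rel_new (v ∘ Sum.inl) hx).1 hr), h6⟩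
    have h8 := (Rich.strongClass idx μ Z).bound hM hE' hform
    have h9 : ∀ m, μ (E.rebase (v ∘ Sum.inl)) m = μ E m := by
      refine hPE _ E hE' hE (Equiv.refl _) (Equiv.refl _) (E.sameRelType_rebase _)
        ⟨fun _ => Iff.rfl, fun _ _ _ => Iff.rfl⟩ fun s hs x hx => ?_
      refine (E.rebase_rel_base (v ∘ Sum.inl) hx).trans (h2 s ?_ x hx)
      have := hb s hs
      omega
    rw [h9] at h8
    have h10 : μ E (gfun idx ((v ∘ Sum.inl) '' E.base)) = μ E (gfun idx (a '' E.base)) :=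
      mu_gfun_congr hl fun m hm => h7 ⟨m, hm⟩
    exact hlt (h8.trans h10.le)
  · exact ⟨hF.1, fun s _ x hx => hF.2.1 s x hx, fun j w w' he => hF.2.2.1 j he, hF.2.2.2.1,
      hF.2.2.2.2.1, hF.2.2.2.2.2⟩

/-- In an ultrapower over a nonprincipal ultrafilter on `ℕ`, the class of the sequence of maps `c m`
satisfies `Nice p` for every `p`, because almost all members do. -/
lemma exists_strong_of_nice (hidx : Function.Injective idx) (hN : InC0 L N) {B C : Type}
    [L.Structure C] [Finite C] {f : B → N} {j : B → C}
    (h : ∀ m, ∃ c : C → N, (∀ b, c (j b) = f b) ∧ Nice idx m c) :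
    ∃ (N' : Type u) (_ : L.Structure N') (e : N ↪ₑ[L] N') (g : C → N'), IsEmb L g ∧
      Strong L (Set.range g) ∧ ∀ b, g (j b) = e (f b) := by
  choose c hc hn using h
  rcases isEmpty_or_nonempty N with hNe | hNe
  -- The ultrapower needs a nonempty structure. Over an empty one all the maps `c m` coincide.
  · have : IsEmpty C := ⟨fun x => hNe.elim (c 0 x)⟩
    obtain ⟨h1, h2⟩ := isEmb_strong_of_nice (f := c 0) (idx := idx) hN.occFin fun m => by
      rw [show c 0 = c m from funext fun x => isEmptyElim x]
      exact hn m
    exact ⟨N, _, .refl L N, c 0, h1, h2, hc 0⟩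
  · let U : Ultrafilter ℕ := Filter.hyperfilter ℕ
    let N' : Type u := (U : Filter ℕ).Product fun _ : ℕ => N
    let e : N ↪ₑ[L] N' :=
      { toFun := fun y => ((fun _ => y : ℕ → N) : (U : Filter ℕ).Product fun _ : ℕ => N)
        map_formula' := fun n φ x => by
          refine (Ultraproduct.realize_formula_cast (u := U) φ fun i (_ : ℕ) => x i).trans ?_
          exact Filter.eventually_const }
    let g : C → N' := fun x => ((fun m => c m x : ℕ → N) : (U : Filter ℕ).Product fun _ : ℕ => N)
    have hN' : InC0 L N' := hN.of_models (e.elementarilyEquivalent.theory_model (T := L.completeTheory N))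
    have hg : ∀ p, Nice idx p g := by
      intro p
      obtain ⟨φ, hφ⟩ := elem_nice (L := L) hidx C p
      refine (hφ N' g).2 ?_
      refine (Ultraproduct.realize_formula_cast (u := U) φ fun i (m : ℕ) => c m i).2 ?_
      have h1 : ∀ᶠ m in (U : Filter ℕ), p ≤ m := by
        refine Filter.hyperfilter_le_cofinite ?_
        rw [Nat.cofinite_eq_atTop]
        exact Filter.eventually_ge_atTop p
      filter_upwards [h1] with m hm
      exact (hφ N (c m)).1 <| (hn m).mono hN.occFin hm
    obtain ⟨h1, h2⟩ := isEmb_strong_of_nice hN'.occFin hg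
    refine ⟨N', _, e, g, h1, h2, fun b => ?_⟩
    change ((fun m => c m (j b) : ℕ → N) : (U : Filter ℕ).Product fun _ : ℕ => N) = _
    simp only [hc]
    rfl

/-- For fixed `m` and `p`, the conclusion of `Rich.exists_nice` is elementary and so passes from `M`
to `N`. A strong embedding into `N` is nice for every `p`, which gives the approximations that
`exists_strong_of_nice` requires. -/
theorem Rich.strongClass_models (hidx : Function.Injective idx) (hμ : IsMu μ)
    (hZ : UniversallyAxiomatizable Z) (hZJ : JoinDetermined idx μ Z) (hM : Rich idx μ Z M) :
    StrongClass idx μ Z (fun (N : Type u) [L.Structure N] => N ⊨ L.completeTheory M) where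
  inC0 N _ hN := hM.inC0.of_models hN
  mem N _ hN C _ _ f hf hfs := by
    have h0 := hM.inC0.of_models hN
    refine ⟨inferInstance, hf.inC0 h0, fun E hE a r F hF => ?_, hM.zeta_of_models hZ hN hf⟩
    have := hM.bound_of_models hidx hμ hN hE (hF.image hf)
    rwa [Set.image_comp, hf.gfun_image h0.occFin hfs] at this
  extend N _ hN B C _ _ _ f j hf hfs hj hjs hC := by
    have h0 := hM.inC0.of_models hN
    have := hC.finite
    have hex : ∀ m, ∃ c : C → N, (∀ b, c (j b) = f b) ∧ Nice idx m c := by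
      intro m
      obtain ⟨p, hp⟩ := Rich.exists_nice.{u} hμ hZJ hZ _ hC hjs le_rfl m
      have hel : Elem (L := L) (fun (N : Type u) [L.Structure N] (v : Set.range j → N) =>
          Nice idx p v → ∃ c : C → N, (∀ b : Set.range j, c b = v b) ∧ Nice idx m c) := by
        have h1 : Elem (L := L) (fun (N : Type u) [L.Structure N] (w : Set.range j ⊕ C → N) =>
            ∀ b : Set.range j, w (.inr b) = w (.inl b)) :=
          Elem.of_samePat ∅ Set.finite_empty fun _ _ _ _ _ _ h hv b => (h.1 _ _).1 (hv b)
        have h2 := (elem_nice (L := L) hidx C m).comp (Sum.inr : C → Set.range j ⊕ C)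
        exact (elem_nice hidx (Set.range j) p).imp (h1.and h2).ex
      choose i hi using fun y : Set.range j => y.2
      obtain ⟨k, hk, hkf⟩ := hj.exists_factor (isEmb_subtype (L := L) (Set.range j))
        Subtype.range_coe.subset
      have hks : Function.Surjective k := fun b => ⟨⟨j b, b, rfl⟩, hj.1 (hkf _)⟩
      obtain ⟨c, hc, hn⟩ := hel.transfer hN (fun v => hp M hM v) (f ∘ k)
        ((hf.comp hk).nice h0.occFin (by rwa [hks.range_comp]) p)
      refine ⟨c, fun b => ?_, hn⟩
      have := hc ⟨j b, b, rfl⟩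
      rw [Function.comp_apply] at this
      rw [this]
      exact congrArg f (hj.1 (hkf _))
    obtain ⟨N', _, e, g, hg, hgs, hgj⟩ := exists_strong_of_nice hidx h0 hex
    exact ⟨N', _, e, g, e.elementarilyEquivalent.theory_model, hg, hgs, hgj⟩

end Models

/-! ### The geometry of the generic model and of its theory. -/

section MainGeneric

variable {L : FirstOrder.Language.{0, 0}} [L.IsRelational] {idx : RelSym L → ℕ}
  {μ : Ext L → ℕ∞ → ℕ} {Z : StrProp L} {M : Type} [L.Structure M]

lemma IsGeneric.givenByD (h : IsGeneric idx μ Z M) (hμ : IsMu μ) (hZ : UniversallyAxiomatizable Z)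
    (hZ' : PreservedByFreeJoins Z) : GivenByD L (acl L (N := M)) :=
  (Rich.strongClass idx μ Z).givenByD hμ hZ hZ' (h.rich hZ (IsoTo.refl M))

theorem IsGeneric.givenByD_of_models (h : IsGeneric idx μ Z M) (hidx : Function.Injective idx)
    (hμ : IsMu μ) (hZ : UniversallyAxiomatizable Z) (hZ' : PreservedByFreeJoins Z)
    (hZJ : JoinDetermined idx μ Z) {N : Type u} [L.Structure N] (hN : N ⊨ L.completeTheory M) :
    InC0 L N ∧ GivenByD L (acl L (N := N)) := by
  have hM := h.rich hZ (isoTo_ulift.{u} M)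
  have he : L.completeTheory M = L.completeTheory (ULift.{u} M) :=
    (StrongHomClass.elementarilyEquivalent
      (⟨Equiv.ulift.symm, fun f => isEmptyElim f, fun _ _ => Iff.rfl⟩ : M ≃[L] ULift.{u} M))
  rw [he] at hN
  have hK := hM.strongClass_models hidx hμ hZ hZJ
  exact ⟨hK.inC0 N hN, hK.givenByD hμ hZ hZ' hN⟩

theorem IsGeneric.flatTheory (h : IsGeneric idx μ Z M) (hidx : Function.Injective idx)
    (hμ : IsMu μ) (hZ : UniversallyAxiomatizable Z) (hZ' : PreservedByFreeJoins Z)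
    (hZJ : JoinDetermined idx μ Z) : FlatTheory.{u} (L.completeTheory M) := by
  intro N _ hN
  obtain ⟨h0, hd⟩ := h.givenByD_of_models hidx hμ hZ hZ' hZJ hN
  exact hd.flat h0

theorem IsGeneric.not_disintegrated (h : IsGeneric idx μ Z M) (hμ : IsMu μ)
    (hZ : UniversallyAxiomatizable Z) (hZ' : PreservedByFreeJoins Z) {R : L.Relations 3}
    (hR : @InClass L idx μ Z (Fin 3) (singleEdge R)) {N : Type u} [L.Structure N]
    (hN : IsoTo (L := L) M N) : ¬ Disintegrated (acl L (N := N)) := by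
  let := singleEdge R
  obtain ⟨f, hf, hfs⟩ := h.exists_emb hR
  have hr := h.rich hZ hN
  obtain ⟨e, he, hes⟩ := hN
  refine not_disintegrated_of_singleEdge hr.inC0 ((Rich.strongClass idx μ Z).givenByD hμ hZ hZ' hr)
    (he.comp hf) ?_
  rw [Set.range_comp]
  exact (he.strong_image_of_surjective hes).2 hfs

lemma joinDetermined_of_finite (hZ : UniversallyAxiomatizable Z) (hZ' : PreservedByFreeJoins Z)
    (h : Finite (RelSym L) ∨ UniversalSentence Z) : JoinDetermined idx μ Z := by
  rcases h with h | h
  · exact (dependsOn_univ Z).joinDetermined Set.finite_univ hZ hZ'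
  · obtain ⟨P, hP, hZP⟩ := h.exists_dependsOn
    exact hZP.joinDetermined hP hZ hZ'

end MainGeneric

/-! ### Extensions given by systems of ternary edges. -/

section Edges

/-- A hypergraph on `P ⊕ Q` with edges indexed by `Q`, the edge `ed q` containing the point `q`, which
defines a minimally simply algebraic extension of `P` by `Q`. -/
structure EdgeSystem {P Q : Type} (ed : Q → Set (P ⊕ Q)) : Prop where
  nonempty : Nonempty Q
  mem_self : ∀ q, Sum.inr q ∈ ed q
  inj : Function.Injective ed
  card : ∀ q, (ed q).ncard = 3
  conn : ∀ S : Set Q, S.Nonempty → (∀ q ∈ S, ∀ q', Sum.inr q' ∈ ed q → q' ∈ S) → S = Set.univ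
  cover : ∀ p, ∃ q, Sum.inl p ∈ ed q
  -- Every value of the concrete `μ` is at least 3, so a base point outside the old part of a join
  -- cannot support a violation of the bound.
  deg : ∀ q, {q' | Sum.inr q ∈ ed q'}.ncard ≤ 3
  not_base_subset : ∀ q, ∃ p, Sum.inl p ∉ ed q

variable {n : ℕ} {e : ℕ → ℕ}

/-- The ternary relation symbol. -/
abbrev hatR (n : ℕ) (e : ℕ → ℕ) : RelSym (hatLang n e) := ⟨3, none, rfl, fun _ h => by cases h⟩

lemma eq_hatR {r : RelSym (hatLang n e)} (h : r.2.1 = none) : r = hatR n e := by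
  obtain ⟨k, s, hs, hl⟩ := r
  obtain rfl : s = none := h
  obtain rfl : 3 = k := hs
  rfl

variable {P Q V : Type} [(hatLang n e).Structure V]

/-- The structure on `P ⊕ Q` induced by `x` on `P` and having in addition the edges `ed q`. -/
abbrev edgeStructure (ed : Q → Set (P ⊕ Q)) (x : P → V) : (hatLang n e).Structure (P ⊕ Q) where
  funMap f := isEmptyElim f
  RelMap r z := (∃ y, z = Sum.inl ∘ y ∧ Structure.RelMap r (x ∘ y)) ∨
    ((¬ ∀ i, z i ∈ Set.range Sum.inl) ∧ r.1 = none ∧ Function.Injective z ∧ ∃ q, Set.range z = ed q)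

section MSA

variable {ed : Q → Set (P ⊕ Q)} [S : (hatLang n e).Structure (P ⊕ Q)]

/-- The relations on tuples not contained in `P` are given by the edges. -/
def EdgeType (n : ℕ) (e : ℕ → ℕ) (ed : Q → Set (P ⊕ Q)) [(hatLang n e).Structure (P ⊕ Q)] : Prop :=
  ∀ (r : RelSym (hatLang n e)) (z : Fin r.1 → P ⊕ Q), (¬ ∀ i, z i ∈ Set.range Sum.inl) →
    (Structure.RelMap r.2 z ↔ r.2.1 = none ∧ Function.Injective z ∧ ∃ q, Set.range z = ed q)

lemma map_val_eq {α : Type*} {k : ℕ} {z : Fin k → α} (hz : Function.Injective z) {s : Set α}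
    (hs : s.Finite) (h : Set.range z = s) : Finset.univ.val.map z = hs.toFinset.val := by
  have : Finset.univ.map ⟨z, hz⟩ = hs.toFinset := by
    apply Finset.coe_injective
    rw [Finset.coe_map, Set.Finite.coe_toFinset, Finset.coe_univ, Set.image_univ]
    exact h
  exact congrArg Finset.val this

lemma exists_fin_three {α : Type*} {s : Set α} (h : s.ncard = 3) :
    ∃ z : Fin 3 → α, Function.Injective z ∧ Set.range z = s := by
  obtain ⟨k, z, hz, hzr⟩ := (Set.finite_of_ncard_ne_zero (by omega) : s.Finite).fin_param
  rw [← hzr, ← Set.image_univ, Set.ncard_image_of_injective _ hz, Set.ncard_univ,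
    Nat.card_eq_fintype_card, Fintype.card_fin] at h
  subst h
  exact ⟨z, hz, hzr⟩

variable [Finite P] [Finite Q]

lemma EdgeType.occ_eq (hS : EdgeType n e ed) (hE : EdgeSystem ed) {A B : Set (P ⊕ Q)}
    (hA : A ⊆ Set.range Sum.inl) (hB : B ⊆ Set.range Sum.inr) :
    occ (Set.univ : Set (RelSym (hatLang n e))) (A ∪ B) \ occ Set.univ A =
      (fun q => (hatR n e, (Set.toFinite (ed q)).toFinset.val)) '' {q | ed q ⊆ A ∪ B} := by
  ext p
  constructor
  · rintro ⟨⟨_, z, hz, hzA, hp⟩, hnA⟩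
    have hzn : ¬ ∀ i, z i ∈ A := fun h => hnA ⟨Set.mem_univ _, z, hz, h, hp⟩
    have hzl : ¬ ∀ i, z i ∈ Set.range Sum.inl := by
      intro h
      refine hzn fun i => (hzA i).resolve_right fun hi => ?_
      obtain ⟨a, ha⟩ := h i
      obtain ⟨b, hb⟩ := hB hi
      exact Sum.inl_ne_inr (ha.trans hb.symm)
    obtain ⟨h1, h2, q, h3⟩ := (hS p.1 z hzl).1 hz
    refine ⟨q, ?_, ?_⟩
    · change ed q ⊆ _
      rw [← h3]
      exact Set.range_subset_iff.2 hzA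
    · exact Prod.ext (eq_hatR h1).symm (by rw [hp, map_val_eq h2 (Set.toFinite _) h3])
  · rintro ⟨q, hq, rfl⟩
    have hq : ed q ⊆ A ∪ B := hq
    obtain ⟨z, hz, hzr⟩ := exists_fin_three (hE.card q)
    obtain ⟨i, hi⟩ := hzr.superset (hE.mem_self q)
    have hil : z i ∉ Set.range Sum.inl := by
      rw [hi]
      rintro ⟨a, ha⟩
      exact Sum.inl_ne_inr ha
    have hR := (hS (hatR n e) z fun h => hil (h i)).2 ⟨rfl, hz, q, hzr⟩
    refine ⟨⟨Set.mem_univ _, z, hR, fun i => hq (hzr.subset ⟨i, rfl⟩), (map_val_eq hz _ hzr).symm⟩,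
      fun h => hil (hA (mem_of_mem_occ h _ ?_))⟩
    change z i ∈ (Set.toFinite (ed q)).toFinset.val
    rw [← map_val_eq hz _ hzr]
    exact Multiset.mem_map_of_mem z (Finset.mem_univ_val i)

lemma EdgeType.newOcc_eq (hS : EdgeType n e ed) (hE : EdgeSystem ed) {A B : Set (P ⊕ Q)}
    (hA : A ⊆ Set.range Sum.inl) (hB : B ⊆ Set.range Sum.inr) :
    newOcc (hatLang n e) A (A ∪ B) = {q | ed q ⊆ A ∪ B}.ncard := by
  unfold newOcc
  rw [hS.occ_eq hE hA hB, Set.ncard_image_of_injective]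
  intro q q' h
  apply hE.inj
  have := Finset.val_injective (Prod.mk.inj h).2
  rw [← Set.Finite.coe_toFinset (Set.toFinite (ed q)), this, Set.Finite.coe_toFinset]

lemma compl_range_inl' : (Set.range (Sum.inl : P → P ⊕ Q))ᶜ = Set.range Sum.inr :=
  Set.isCompl_range_inl_range_inr.compl_eq

lemma EdgeType.occFin (hS : EdgeType n e ed) (hE : EdgeSystem ed)
    (h : (occ (Set.univ : Set (RelSym (hatLang n e))) (Set.range (Sum.inl : P → P ⊕ Q))).Finite) :
    OccFin (hatLang n e) (P ⊕ Q) := by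
  refine occFin_of_finite ?_
  have h1 := hS.occ_eq hE (subset_refl (Set.range (Sum.inl : P → P ⊕ Q)))
    (subset_refl (Set.range (Sum.inr : Q → P ⊕ Q)))
  rw [Set.range_inl_union_range_inr] at h1
  refine (h.union ((Set.toFinite _).subset h1.subset)).subset ?_
  intro p hp
  by_cases hpl : p ∈ occ (Set.univ : Set (RelSym (hatLang n e))) (Set.range (Sum.inl : P → P ⊕ Q))
  · exact .inl hpl
  · exact .inr ⟨hp, hpl⟩

/-- Each edge is charged to its own new point, so a set of new points spans at most as many edges as
it has elements. Equality makes it closed under passing along edges, and `conn` makes a nonempty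
such set everything. By `cover`, no base point can be omitted. -/
theorem EdgeType.minSimplyAlgebraic (hS : EdgeType n e ed) (hE : EdgeSystem ed)
    (ho : OccFin (hatLang n e) (P ⊕ Q)) :
    MinSimplyAlgebraic (hatLang n e) (Set.range (Sum.inl : P → P ⊕ Q)) (Set.range Sum.inl)ᶜ := by
  rw [compl_range_inl']
  have hself : ∀ {A B : Set (P ⊕ Q)}, A ⊆ Set.range Sum.inl → ∀ q, ed q ⊆ A ∪ B → Sum.inr q ∈ B := by
    intro A B hA q hq
    refine (hq (hE.mem_self q)).resolve_left fun h => ?_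
    obtain ⟨a, ha⟩ := hA h
    exact Sum.inl_ne_inr ha
  have hcardB : ∀ B ⊆ Set.range (Sum.inr : Q → P ⊕ Q), B.ncard = (Sum.inr ⁻¹' B : Set Q).ncard := by
    intro B hB
    rw [← Set.ncard_image_of_injective (Sum.inr ⁻¹' B : Set Q) (Sum.inr_injective (α := P)),
      Set.image_preimage_eq_inter_range, Set.inter_eq_left.2 hB]
  have hle : ∀ {A B : Set (P ⊕ Q)}, A ⊆ Set.range Sum.inl →
      {q | ed q ⊆ A ∪ B} ⊆ Sum.inr ⁻¹' B := fun hA q hq => hself hA q hq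
  have hne := hE.nonempty
  refine ⟨(simplyAlgebraic_iff ho (Set.toFinite _) (Set.toFinite _)).2 ⟨Set.range_nonempty _,
    Set.isCompl_range_inl_range_inr.disjoint, fun B hB => ?_, ?_, fun B hB hBne hB' => ?_⟩, ?_⟩
  · rw [hS.newOcc_eq hE subset_rfl hB, hcardB B hB]
    exact Set.ncard_le_ncard (hle subset_rfl)
  · rw [hS.newOcc_eq hE subset_rfl subset_rfl, hcardB _ subset_rfl, Set.range_inl_union_range_inr]
    congr 1
    ext q
    simp
  · rw [hS.newOcc_eq hE subset_rfl hB.1, hcardB B hB.1] at hB'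
    have h1 := Set.eq_of_subset_of_ncard_le (hle (B := B) subset_rfl) hB'.ge
    have h2 : (Sum.inr ⁻¹' B : Set Q) = Set.univ := by
      refine hE.conn _ ?_ fun q hq q' hq' => ?_
      · obtain ⟨b, hb⟩ := hBne
        obtain ⟨q, rfl⟩ := hB.1 hb
        exact ⟨q, hb⟩
      · have h3 : ed q ⊆ Set.range Sum.inl ∪ B := h1.superset hq
        refine (h3 hq').resolve_left fun h => ?_
        obtain ⟨a, ha⟩ := h
        exact Sum.inl_ne_inr ha
    refine hB.2 ?_
    rintro _ ⟨q, rfl⟩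
    exact h2.superset (Set.mem_univ q)
  · intro A hA hsa
    rw [simplyAlgebraic_iff ho (Set.toFinite _) (Set.toFinite _)] at hsa
    have h1 := hsa.2.2.2.1
    rw [hS.newOcc_eq hE hA.1 subset_rfl, hcardB _ subset_rfl] at h1
    have h2 := Set.eq_of_subset_of_ncard_le (hle (B := Set.range Sum.inr) hA.1) h1.ge
    refine hA.2 ?_
    rintro _ ⟨p, rfl⟩
    obtain ⟨q, hq⟩ := hE.cover p
    have h3 : ed q ⊆ A ∪ Set.range Sum.inr := h2.superset ⟨q, rfl⟩
    refine (h3 hq).resolve_right ?_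
    rintro ⟨b, hb⟩
    exact Sum.inl_ne_inr hb.symm

end MSA

end Edges

/-! ### The cyclic and the path patterns. -/

section Concrete

/-- The edges of the cyclic pattern, indexed by their first new point. -/
def cycleEd (n t : ℕ) (q : Fin (2 * t)) : Set (Fin (n + 2) ⊕ Fin (2 * t)) :=
  {Sum.inr q, Sum.inr (finRotate _ q),
    Sum.inl (if (q : ℕ) + 1 < 2 * t then
      ⟨q % (n + 1), (Nat.mod_lt q n.succ_pos).trans (Nat.lt_succ_self _)⟩ else Fin.last (n + 1))}

lemma val_finRotate {k : ℕ} (q : Fin k) :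
    (finRotate k q : ℕ) = if (q : ℕ) + 1 < k then (q : ℕ) + 1 else 0 := by
  cases k with
  | zero => exact q.elim0
  | succ k =>
    split_ifs with h
    · rw [coe_finRotate_of_ne_last]
      intro h'
      rw [h', Fin.val_last] at h
      omega
    · have : q = Fin.last k := Fin.ext (by rw [Fin.val_last]; omega)
      rw [this, finRotate_last]
      rfl

lemma cycleEdge_iff {n t : ℕ} {s : Set (Fin (n + 2) ⊕ Fin (2 * t))} :
    cycleEdge n t s ↔ ∃ q, s = cycleEd n t q := by
  constructor
  · rintro (⟨i, h, rfl⟩ | ⟨h, rfl⟩)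
    · refine ⟨⟨i, by omega⟩, ?_⟩
      have h1 : finRotate _ (⟨i, by omega⟩ : Fin (2 * t)) = ⟨i + 1, h⟩ :=
        Fin.ext (by rw [val_finRotate]; simp [h])
      unfold cycleEd
      rw [if_pos h, h1, Set.pair_comm (Sum.inr _) (Sum.inl _)]
    · refine ⟨⟨2 * t - 1, by omega⟩, ?_⟩
      have h1 : finRotate _ (⟨2 * t - 1, by omega⟩ : Fin (2 * t)) = ⟨0, h⟩ :=
        Fin.ext (by rw [val_finRotate]; exact if_neg (by simp; omega))
      unfold cycleEd
      rw [if_neg (by simp; omega), h1, Set.pair_comm (Sum.inr _) (Sum.inl _)]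
  · rintro ⟨q, rfl⟩
    by_cases h : (q : ℕ) + 1 < 2 * t
    · refine .inl ⟨q, h, ?_⟩
      have h1 : finRotate _ q = ⟨q + 1, h⟩ := Fin.ext (by rw [val_finRotate, if_pos h])
      unfold cycleEd
      rw [if_pos h, h1, Set.pair_comm (Sum.inr _) (Sum.inl _)]
    · refine .inr ⟨by omega, ?_⟩
      have h1 : finRotate _ q = ⟨0, by omega⟩ := Fin.ext (by rw [val_finRotate, if_neg h])
      have h2 : q = ⟨2 * t - 1, by omega⟩ := Fin.ext (by have := q.2; simp only; omega)
      unfold cycleEd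
      rw [if_neg h, h1, Set.pair_comm (Sum.inr _) (Sum.inl _), ← h2]

/-- A new point lies only on the edge it starts and on the preceding one. Passing along edges
rotates the cycle and reaches every new point, and the lower bound on `t` leaves room for every base
point to occur. -/
lemma edgeSystem_cycleEd {n t : ℕ} (hn : 1 ≤ n) (ht : n + 3 ≤ t) : EdgeSystem (cycleEd n t) := by
  have hne : ∀ q : Fin (2 * t), finRotate _ q ≠ q := by
    intro q h
    have := congrArg Fin.val h
    rw [val_finRotate] at this
    have := q.2
    split_ifs at * <;> omega
  have hmem : ∀ q q' : Fin (2 * t), Sum.inr q' ∈ cycleEd n t q ↔ q' = q ∨ q' = finRotate _ q := by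
    intro q q'
    simp [cycleEd]
  refine ⟨⟨⟨0, by omega⟩⟩, fun q => (hmem q q).2 (.inl rfl), fun q q' h => ?_, fun q => ?_,
    fun S hS hcl => ?_, fun p => ?_, fun q => ?_, fun q => ?_⟩
  · have h1 := (hmem q' q).1 (h ▸ (hmem q q).2 (.inl rfl))
    have h2 := (hmem q q').1 (h.symm ▸ (hmem q' q').2 (.inl rfl))
    rcases h1 with h1 | h1
    · exact h1
    rcases h2 with h2 | h2
    · exact h2.symm
    exfalso
    have h3 := congrArg Fin.val h1
    have h4 := congrArg Fin.val h2
    rw [val_finRotate] at h3 h4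
    have := q.2
    have := q'.2
    split_ifs at * <;> omega
  · unfold cycleEd
    rw [Set.ncard_eq_toFinset_card', Set.toFinset_insert, Set.toFinset_insert, Set.toFinset_singleton,
      Finset.card_insert_of_notMem, Finset.card_insert_of_notMem, Finset.card_singleton]
    · simp
    · simp only [Finset.mem_insert, Finset.mem_singleton, Sum.inr.injEq, reduceCtorEq, or_false]
      exact (hne q).symm
  · have hstep : ∀ k : ℕ, ∀ q ∈ S, (finRotate (2 * t))^[k] q ∈ S := by
      intro k
      induction k with
      | zero => exact fun q hq => hq
      | succ k ih =>
        intro q hq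
        exact ih _ (hcl q hq _ ((hmem _ _).2 (.inr rfl)))
    obtain ⟨q, hq⟩ := hS
    have hiter : ∀ (k : ℕ) (q : Fin (2 * t)), ((finRotate (2 * t))^[k] q : ℕ) = (q + k) % (2 * t) := by
      intro k
      induction k with
      | zero => exact fun q => (Nat.mod_eq_of_lt q.2).symm
      | succ k ih =>
        intro q
        rw [Function.iterate_succ_apply, ih, val_finRotate]
        have := q.2
        split_ifs with h
        · congr 1; omega
        · rw [show (q : ℕ) + (k + 1) = 0 + k + 2 * t by omega, Nat.add_mod_right]
    refine Set.eq_univ_of_forall fun q' => ?_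
    -- The number of steps is `q' - q` modulo `2t`, raised by `2t` to avoid truncated subtraction.
    have h1 : (finRotate (2 * t))^[q' + (2 * t - q)] q = q' := by
      apply Fin.ext
      rw [hiter, show (q : ℕ) + (q' + (2 * t - q)) = q' + 2 * t by have := q.2; omega, Nat.add_mod_right,
        Nat.mod_eq_of_lt q'.2]
    exact h1 ▸ hstep _ q hq
  · by_cases hp : (p : ℕ) < n + 1
    · refine ⟨⟨p, by omega⟩, ?_⟩
      unfold cycleEd
      rw [if_pos (by simp only; omega)]
      simp [Nat.mod_eq_of_lt hp]
    · refine ⟨⟨2 * t - 1, by omega⟩, ?_⟩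
      unfold cycleEd
      rw [if_neg (by simp only; omega)]
      have : p = Fin.last (n + 1) := Fin.ext (by have := p.2; simp only [Fin.val_last]; omega)
      simp [this]
  · refine (Set.ncard_le_ncard (t := {q, (finRotate (2 * t)).symm q}) ?_ (Set.toFinite _)).trans
      ((Set.ncard_insert_le _ _).trans ?_)
    · intro q' hq'
      rcases (hmem q' q).1 hq' with h | h
      · exact .inl h.symm
      · exact .inr (by rw [h]; exact (Equiv.symm_apply_apply _ _).symm)
    · rw [Set.ncard_singleton]
      omega
  · by_contra hno
    push Not at hno
    have h0 := hno ⟨0, by omega⟩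
    have h1 := hno ⟨1, by omega⟩
    unfold cycleEd at h0 h1
    simp only [Set.mem_insert_iff, Set.mem_singleton_iff, reduceCtorEq, false_or, Sum.inl.injEq] at h0 h1
    rw [← h1] at h0
    exact absurd (congrArg Fin.val h0) (by simp)

/-- The edges of the path, indexed by their middle point. -/
def pathEd (t : ℕ) (q : Fin (t - 2)) : Set (Fin 2 ⊕ Fin (t - 2)) :=
  {v | pathPos t v = q ∨ pathPos t v = q + 1 ∨ pathPos t v = q + 2}

lemma pathEdge_iff {t : ℕ} {s : Set (Fin 2 ⊕ Fin (t - 2))} : pathEdge t s ↔ ∃ q, s = pathEd t q := by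
  constructor
  · rintro ⟨i, h, rfl⟩
    exact ⟨⟨i, by omega⟩, rfl⟩
  · rintro ⟨q, rfl⟩
    exact ⟨q, by have := q.2; omega, rfl⟩

/-- The edge `q` occupies the positions `q`, `q + 1`, `q + 2`, and the new point `q` has position `q
+ 1`; hence at most three edges pass through a point. The two end points lie on a common edge only
for `t = 3`. -/
lemma edgeSystem_pathEd {t : ℕ} (ht : 4 ≤ t) : EdgeSystem (pathEd t) := by
  have hinj : Function.Injective (pathPos t) := by
    rintro (a | a) (b | b) h
    · simp only [pathPos] at h
      congr 1
      split_ifs at h <;> omega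
    · exfalso
      have := b.2
      simp only [pathPos] at h
      split_ifs at h <;> omega
    · exfalso
      have := a.2
      simp only [pathPos] at h
      split_ifs at h <;> omega
    · simp only [pathPos] at h
      congr 1
      omega
  have hsurj : ∀ k < t, ∃ v, pathPos t v = k := by
    intro k hk
    rcases Nat.eq_zero_or_pos k with rfl | h0
    · exact ⟨.inl 0, by simp [pathPos]⟩
    by_cases h1 : k = t - 1
    · exact ⟨.inl 1, by simp [pathPos, h1]⟩
    · exact ⟨.inr ⟨k - 1, by omega⟩, by simp only [pathPos]; omega⟩
  have hmem : ∀ q q' : Fin (t - 2), Sum.inr q' ∈ pathEd t q ↔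
      (q' : ℕ) + 1 = q ∨ (q' : ℕ) = q ∨ (q' : ℕ) = q + 1 := by
    intro q q'
    simp only [pathEd, Set.mem_ofPred_eq, pathPos]
    omega
  have himg : ∀ q : Fin (t - 2), pathPos t '' pathEd t q = ({(q : ℕ), (q : ℕ) + 1, (q : ℕ) + 2} : Set ℕ) := by
    intro q
    have := q.2
    ext k
    constructor
    · rintro ⟨v, hv, rfl⟩
      exact hv
    · intro hk
      obtain ⟨v, hv⟩ := hsurj k (by
        rcases hk with rfl | rfl | hk
        · omega
        · omega
        · have : k = q + 2 := hk
          omega)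
      exact ⟨v, by subst hv; exact hk, hv⟩
  refine ⟨⟨⟨0, by omega⟩⟩, fun q => (hmem q q).2 (.inr (.inl rfl)), fun q q' h => ?_, fun q => ?_,
    fun S hS hcl => ?_, fun p => ?_, fun q => ?_, fun q => ?_⟩
  · have h1 := himg q
    rw [h, himg q'] at h1
    have h2 : (q' : ℕ) ∈ ({(q : ℕ), (q : ℕ) + 1, (q : ℕ) + 2} : Set ℕ) := h1 ▸ Set.mem_insert _ _
    have h3 : (q : ℕ) ∈ ({(q' : ℕ), (q' : ℕ) + 1, (q' : ℕ) + 2} : Set ℕ) := h1.symm ▸ Set.mem_insert _ _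
    simp only [Set.mem_insert_iff, Set.mem_singleton_iff] at h2 h3
    exact Fin.ext (by omega)
  · rw [← Set.ncard_image_of_injective _ hinj, himg]
    rw [Set.ncard_eq_toFinset_card']
    simp
  · obtain ⟨q, hq⟩ := hS
    have hup : ∀ k : ℕ, ∀ h : (q : ℕ) + k < t - 2, (⟨q + k, h⟩ : Fin (t - 2)) ∈ S := by
      intro k
      induction k with
      | zero => exact fun _ => hq
      | succ k ih =>
        intro h
        exact hcl _ (ih (by omega)) _ ((hmem _ _).2 (by simp only; omega))
    have hdown : ∀ k : ℕ, ∀ h : (q : ℕ) - k < t - 2, (⟨q - k, h⟩ : Fin (t - 2)) ∈ S := by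
      intro k
      induction k with
      | zero => exact fun _ => hq
      | succ k ih =>
        intro h
        exact hcl _ (ih (by have := q.2; omega)) _ ((hmem _ _).2 (by simp only; omega))
    refine Set.eq_univ_of_forall fun q' => ?_
    rcases le_total (q : ℕ) q' with h | h
    · have := hup (q' - q) (by have := q'.2; omega)
      convert this using 1
      exact Fin.ext (by simp only; omega)
    · have := hdown (q - q') (by have := q'.2; omega)
      convert this using 1
      exact Fin.ext (by simp only; omega)
  · by_cases hp : p = 0
    · exact ⟨⟨0, by omega⟩, by simp [pathEd, pathPos, hp]⟩
    · exact ⟨⟨t - 3, by omega⟩, by simp [pathEd, pathPos, hp]; omega⟩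
  · have h1 : Fin.val '' {q' : Fin (t - 2) | Sum.inr q ∈ pathEd t q'} ⊆
        {(q : ℕ), (q : ℕ) + 1, (q : ℕ) - 1} := by
      rintro _ ⟨q', hq', rfl⟩
      have := (hmem q' q).1 hq'
      simp only [Set.mem_insert_iff, Set.mem_singleton_iff]
      omega
    rw [← Set.ncard_image_of_injective _ Fin.val_injective]
    refine (Set.ncard_le_ncard h1 (Set.toFinite _)).trans ?_
    refine (Set.ncard_insert_le _ _).trans ?_
    have := Set.ncard_insert_le ((q : ℕ) + 1) {(q : ℕ) - 1}
    rw [Set.ncard_singleton] at this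
    omega
  · by_contra hno
    push Not at hno
    have h0 := hno 0
    have h1 := hno 1
    simp [pathEd, pathPos] at h0 h1
    omega

/-- The extensions with parameter `t` are given by an edge system. -/
lemma exists_edgeSystem (n t : ℕ) (e : ℕ → ℕ) (h4 : 4 ≤ t) (hn : n + 3 ≤ t) :
    ∃ (k : ℕ) (ed : Fin k → Set (Fin (n + 2) ⊕ Fin k)), EdgeSystem ed ∧
      ∀ E : Ext (hatLang n e), IsOmega t E ↔ HasRType E fun s => ∃ q, s = ed q := by
  rcases Nat.eq_zero_or_pos n with rfl | h0
  · refine ⟨t - 2, pathEd t, edgeSystem_pathEd h4, fun E => ?_⟩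
    simp only [IsOmega, ne_eq, not_true_eq_false, false_and, true_and, false_or, ← pathEdge_iff]
  · refine ⟨2 * t, cycleEd n t, edgeSystem_cycleEd h0 hn, fun E => ?_⟩
    have : n ≠ 0 := h0.ne'
    simp only [IsOmega, ne_eq, this, not_false_eq_true, true_and, false_and, or_false, ← cycleEdge_iff]

/-- The number of points of the extension determines `t`; for paths this needs `t ≥ 2`, as `t - 2`
is truncated. -/
lemma IsOmega.param_unique {n : ℕ} {e : ℕ → ℕ} {E : Ext (hatLang n e)} {t t' : ℕ} (ht : 4 ≤ t)
    (ht' : 4 ≤ t') (h : IsOmega t E) (h' : IsOmega t' E) : t = t' := by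
  rcases h with ⟨hn, σ, _⟩ | ⟨hn, σ, _⟩ <;> rcases h' with ⟨hn', σ', _⟩ | ⟨hn', σ', _⟩
  · have := Fintype.card_congr (σ.symm.trans σ')
    simp only [Fintype.card_sum, Fintype.card_fin] at this
    omega
  · exact absurd hn' hn
  · exact absurd hn hn'
  · have := Fintype.card_congr (σ.symm.trans σ')
    simp only [Fintype.card_sum, Fintype.card_fin] at this
    omega

end Concrete

/-! ### The concrete property `ζ`: universal axioms and free joins. -/

section HatClass

variable {n : ℕ} {e : ℕ → ℕ}

lemma relSym_ext {r s : RelSym (hatLang n e)} (h : r.2.1 = s.2.1) : r = s := by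
  obtain ⟨k, o, hk, hl⟩ := r
  obtain ⟨k', o', hk', hl'⟩ := s
  obtain rfl : o = o' := h
  obtain rfl : k = k' := hk.symm.trans hk'
  rfl

lemma hatPos_injective : Function.Injective (hatPos : RelSym (hatLang n e) → ℕ) := by
  intro r s h
  apply relSym_ext
  unfold hatPos at h
  cases hr : r.2.1 <;> cases hs : s.2.1 <;> simp only [hr, hs] at h
  · rfl
  · omega
  · omega
  · rw [Nat.succ.inj h]

lemma injective_of_hatPos {idx : RelSym (hatLang n e) → ℕ}
    (h : ∀ r s, hatPos r < hatPos s → idx r < idx s) : Function.Injective idx := by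
  intro r s hrs
  rcases lt_trichotomy (hatPos r) (hatPos s) with h' | h' | h'
  · exact absurd (h r s h') (hrs ▸ lt_irrefl _)
  · exact hatPos_injective h'
  · exact absurd (h s r h') (hrs ▸ lt_irrefl _)

lemma isUniversal_alls {L : FirstOrder.Language.{0, 0}} {α : Type*} {k : ℕ} {φ : L.BoundedFormula α k}
    (h : φ.IsUniversal) : BoundedFormula.IsUniversal φ.alls := by
  induction k with
  | zero => exact h
  | succ k ih => exact ih h.all

variable (n e) in
/-- No relation holds on a subtuple of a tuple on which another relation holds. -/
def antichainSentence (p : Σ uv : RelSym (hatLang n e) × RelSym (hatLang n e), Fin uv.2.1 → Fin uv.1.1) :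
    (hatLang n e).Sentence :=
  (p.1.1.2.boundedFormula (fun i => (Term.var (Sum.inr i) : (hatLang n e).Term (Empty ⊕ Fin p.1.1.1))) ⟹
    ∼(p.1.2.2.boundedFormula fun j => Term.var (Sum.inr (p.2 j)))).alls

variable (n e) in
/-- A relation holds only on tuples of distinct elements. -/
def distinctSentence (p : Σ u : RelSym (hatLang n e), Fin u.1 × Fin u.1) : (hatLang n e).Sentence :=
  (p.1.2.boundedFormula (fun i => (Term.var (Sum.inr i) : (hatLang n e).Term (Empty ⊕ Fin p.1.1))) ⟹
    ∼(Term.bdEqual (Term.var (Sum.inr p.2.1)) (Term.var (Sum.inr p.2.2)))).alls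

lemma universallyAxiomatizable_hatZeta : UniversallyAxiomatizable (hatZeta n e) := by
  refine ⟨antichainSentence n e '' {p | p.1.1 ≠ p.1.2} ∪ distinctSentence n e '' {p | p.2.1 ≠ p.2.2},
    ⟨?_⟩, fun V _ => ?_⟩
  · rintro _ (⟨p, _, rfl⟩ | ⟨p, _, rfl⟩)
    · exact isUniversal_alls (((BoundedFormula.IsAtomic.rel _ _).isQF.imp
        (BoundedFormula.IsAtomic.rel _ _).isQF.not).isUniversal)
    · exact isUniversal_alls (((BoundedFormula.IsAtomic.rel _ _).isQF.imp
        (BoundedFormula.IsAtomic.equal _ _).isQF.not).isUniversal)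
  · have h1 : ∀ p, V ⊨ antichainSentence n e p ↔ ∀ x : Fin p.1.1.1 → V,
        Structure.RelMap p.1.1.2 x → ¬ Structure.RelMap p.1.2.2 (x ∘ p.2) := by
      intro p
      simp only [antichainSentence, Sentence.Realize, BoundedFormula.realize_alls,
        BoundedFormula.realize_imp, BoundedFormula.realize_not, BoundedFormula.realize_rel,
        Term.realize_var, Sum.elim_inr]
      rfl
    have h2 : ∀ p, V ⊨ distinctSentence n e p ↔ ∀ x : Fin p.1.1 → V,
        Structure.RelMap p.1.2 x → ¬ x p.2.1 = x p.2.2 := by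
      intro p
      simp only [distinctSentence, Sentence.Realize, BoundedFormula.realize_alls,
        BoundedFormula.realize_imp, BoundedFormula.realize_not, BoundedFormula.realize_rel,
        BoundedFormula.realize_bdEqual, Term.realize_var, Sum.elim_inr]
    rw [Theory.model_iff]
    constructor
    · rintro ⟨h3, h4⟩ _ (⟨p, hp, rfl⟩ | ⟨p, hp, rfl⟩)
      · exact (h1 p).2 fun x hx => h3 p.1.1 p.1.2 x _ hp hx (Set.range_comp_subset_range _ _)
      · exact (h2 p).2 fun x hx h => hp (h4 p.1 x hx h)
    · intro h
      refine ⟨fun u v x y huv hx hyx hy => ?_, fun u x hx i j hij => ?_⟩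
      · choose f hf using fun j => hyx ⟨j, rfl⟩
        refine (h1 ⟨(u, v), f⟩).1 (h _ (Set.mem_union_left _ ⟨⟨(u, v), f⟩, huv, rfl⟩)) x hx ?_
        rwa [show x ∘ f = y from funext hf]
      · by_contra hne
        exact (h2 ⟨u, i, j⟩).1 (h _ (Set.mem_union_right _ ⟨⟨u, i, j⟩, hne, rfl⟩)) x hx hij

lemma hatZeta_of_subset {V : Type} [(hatLang n e).Structure V] {S : Set V} (h : hatZeta n e S)
    {u : RelSym (hatLang n e)} {x : Fin u.1 → V} (hx : Structure.RelMap u.2 x) (hS : ∀ i, x i ∈ S) :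
    Function.Injective x ∧ ∀ (v : RelSym (hatLang n e)) (y : Fin v.1 → V), u ≠ v →
      Set.range y ⊆ Set.range x → ¬ Structure.RelMap v.2 y := by
  have hx' : Structure.RelMap u.2 (fun i => (⟨x i, hS i⟩ : S)) := hx
  refine ⟨fun i j hij => h.2 u _ hx' (Subtype.ext hij), fun v y huv hyx hy => ?_⟩
  have hyS : ∀ j, y j ∈ S := fun j => by
    obtain ⟨i, hi⟩ := hyx ⟨j, rfl⟩
    exact hi ▸ hS i
  refine h.1 u v (fun i => (⟨x i, hS i⟩ : S)) (fun j => ⟨y j, hyS j⟩) huv hx' ?_ hy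
  rintro _ ⟨j, rfl⟩
  obtain ⟨i, hi⟩ := hyx ⟨j, rfl⟩
  exact ⟨i, Subtype.ext hi⟩

lemma preservedByFreeJoins_hatZeta : PreservedByFreeJoins (hatZeta n e) := by
  intro V _ _ _ B₁ B₂ _ hrel h₁ h₂
  have key : ∀ (u : RelSym (hatLang n e)) (x : Fin u.1 → V), Structure.RelMap u.2 x →
      Function.Injective x ∧ ∀ (v : RelSym (hatLang n e)) (y : Fin v.1 → V), u ≠ v →
        Set.range y ⊆ Set.range x → ¬ Structure.RelMap v.2 y := by
    intro u x hx
    rcases hrel u x hx with h | h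
    · exact hatZeta_of_subset h₁ hx h
    · exact hatZeta_of_subset h₂ hx h
  exact ⟨fun u v x y huv hx hyx => (key u x hx).2 v y huv hyx, fun u x hx => (key u x hx).1⟩

variable {idx : RelSym (hatLang n e) → ℕ} {μ : Ext (hatLang n e) → ℕ∞ → ℕ}

/-- For `n ≥ 1`, only the ternary relation on the base matters for the universal axioms of a join. -/
lemma joinDetermined_hatZeta (hn : 1 ≤ n) : JoinDetermined idx μ (hatZeta n e) := by
  intro C _ B hC hB
  refine ⟨idx (hatR n e) + 1, fun D _ hD u hu hup => ?_⟩
  have key : ∀ (s : RelSym (hatLang n e)) (x : Fin s.1 → Join u), Structure.RelMap s.2 x →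
      Function.Injective x ∧ ∀ (v : RelSym (hatLang n e)) (y : Fin v.1 → Join u), s ≠ v →
        Set.range y ⊆ Set.range x → ¬ Structure.RelMap v.2 y := by
    intro s x hx
    rcases (Join.relMap_iff u).1 hx with ⟨x', rfl, hx'⟩ | ⟨x', rfl, hxB, hx'⟩
    · refine ⟨(Join.inl_injective u).comp (hD.zeta.2 s x' hx'), fun v y hsv hyx hy => ?_⟩
      choose f hf using fun j => hyx ⟨j, rfl⟩
      obtain rfl : Join.inl u ∘ (x' ∘ f) = y := funext hf
      exact hD.zeta.1 s v x' (x' ∘ f) hsv hx' (Set.range_comp_subset_range _ _)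
        (((Join.isEmb_inl u).2 v _).2 hy)
    · have hi := hC.zeta.2 s x' hx'
      refine ⟨(Join.inr_injective hu).comp hi, fun v y hsv hyx hy => ?_⟩
      choose f hf using fun j => hyx ⟨j, rfl⟩
      obtain rfl : Join.inr u ∘ (x' ∘ f) = y := funext hf
      rcases (Join.relMap_iff u).1 hy with ⟨z, hz, hzD⟩ | ⟨z, hz, _, hzC⟩
      · have hB' : ∀ j, x' (f j) ∈ B := fun j =>
          (Join.inr_mem_range_inl u).1 ⟨z j, (congrFun hz j).symm⟩
        have hz' : z = u ∘ fun j => ⟨x' (f j), hB' j⟩ := funext fun j =>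
          Join.inl_injective u ((congrFun hz j).symm.trans (Join.inr_of_mem u (hB' j)))
        rcases hv : v.2.1 with _ | i
        · obtain rfl := eq_hatR hv
          refine hC.zeta.1 s _ x' (x' ∘ f) hsv hx' (Set.range_comp_subset_range _ _) ?_
          refine (hup (hatR n e) (Nat.lt_succ_self _) fun j => ⟨x' (f j), hB' j⟩).2 ?_
          rw [← hz']
          exact hzD
        -- Here `v` is some `R_j`, about which `u` need not agree. Its tuple lies in `B` while that
        -- of `s` does not, so `s` would have larger arity than `n + 2`; for `n ≥ 1` no symbol has.
        · have hv2 : v.1 = n + 2 := by rw [← v.2.2.1, hv]; rfl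
          have hfi : Function.Injective f := by
            intro j j' h
            refine hD.zeta.2 v z hzD ?_
            rw [hz']
            simp only [Function.comp_apply, h]
          have hcard := Fintype.card_le_of_injective f hfi
          have hns : ¬ Function.Surjective f := fun hs => hxB fun i => by
            obtain ⟨j, rfl⟩ := hs i
            exact hB' j
          have hlt : v.1 < s.1 := by
            have := Fintype.card_lt_of_injective_not_surjective f hfi hns
            rwa [Fintype.card_fin, Fintype.card_fin] at this
          have hs3 : s.1 = 3 ∨ s.1 = n + 2 := by
            rw [← s.2.2.1]
            rcases s.2.1 with _ | j
            · exact .inl rfl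
            · exact .inr rfl
          omega
      · have : z = x' ∘ f := funext fun j => (Join.inr_injective hu (congrFun hz j)).symm
        subst this
        exact hC.zeta.1 s v x' _ hsv hx' (Set.range_comp_subset_range _ _) hzC
  exact ⟨fun s v x y hsv hx hyx => (key s x hx).2 v y hsv hyx, fun s x hx => (key s x hx).1⟩

end HatClass

/-! ### The concrete function `μ`. -/

section HatMu

variable {n : ℕ} {e τ : ℕ → ℕ} {E E' : Ext (hatLang n e)}

lemma HasRType.of_sameRelType {σ : Fin E.size ≃ Fin E'.size} (h : E.SameRelType E' σ) {P Q : Type}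
    {edge : Set (P ⊕ Q) → Prop} (hE : HasRType E edge) : HasRType E' edge := by
  obtain ⟨ρ, hρ, hrel⟩ := hE
  have hb : ∀ v, v ∈ E'.base ↔ σ.symm v ∈ E.base := fun v => by rw [h.1, σ.apply_symm_apply]
  refine ⟨σ.symm.trans ρ, fun v => (hb v).trans (hρ _), fun r x hx => ?_⟩
  have hx' : ¬ ∀ i, σ.symm (x i) ∈ E.base := fun h' => hx fun i => (hb _).2 (h' i)
  have h1 := h.2 r (σ.symm ∘ x) hx'
  rw [← Function.comp_assoc, σ.self_comp_symm, Function.id_comp] at h1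
  exact h1.symm.trans ((hrel r (σ.symm ∘ x) hx').trans
    (and_congr_right fun _ => and_congr_left fun _ => σ.symm.injective.of_comp_iff x))

lemma IsOmega.of_sameRelType {σ : Fin E.size ≃ Fin E'.size} (h : E.SameRelType E' σ) {t : ℕ}
    (hE : IsOmega t E) : IsOmega t E' := by
  rcases hE with ⟨hn, hE⟩ | ⟨hn, hE⟩
  · exact .inl ⟨hn, hE.of_sameRelType h⟩
  · exact .inr ⟨hn, hE.of_sameRelType h⟩

lemma Ext.SameRelType.symm {σ : Fin E.size ≃ Fin E'.size} (h : E.SameRelType E' σ) :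
    E'.SameRelType E σ.symm := by
  have hb : ∀ v, v ∈ E'.base ↔ σ.symm v ∈ E.base := fun v => by rw [h.1, σ.apply_symm_apply]
  refine ⟨hb, fun r x hx => ?_⟩
  have h1 := h.2 r (σ.symm ∘ x) fun h' => hx fun i => (hb _).2 (h' i)
  rw [← Function.comp_assoc, σ.self_comp_symm, Function.id_comp] at h1
  exact h1.symm

lemma Ext.SameRelType.isOmega_iff {σ : Fin E.size ≃ Fin E'.size} (h : E.SameRelType E' σ) (t : ℕ) :
    IsOmega t E ↔ IsOmega t E' :=
  ⟨fun h' => h'.of_sameRelType h, fun h' => h'.of_sameRelType h.symm⟩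

lemma Ext.SameRelType.ncard_base {σ : Fin E.size ≃ Fin E'.size} (h : E.SameRelType E' σ) :
    E.base.ncard = E'.base.ncard := by
  rw [← Set.ncard_image_of_injective _ σ.injective]
  congr 1
  ext v
  constructor
  · rintro ⟨w, hw, rfl⟩
    exact (h.1 w).1 hw
  · exact fun hv => ⟨σ.symm v, (h.1 _).2 (by rwa [σ.apply_symm_apply]), σ.apply_symm_apply v⟩

lemma lt_hatMu (E : Ext (hatLang n e)) (m : ℕ∞) : E.base.ncard + 3 ≤ hatMu n e τ E m := by
  unfold hatMu
  split_ifs <;> omega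

lemma deltaBase_le_hatMu (E : Ext (hatLang n e)) (m : ℕ∞) : E.deltaBase ≤ (hatMu n e τ E m : ℤ) := by
  have h1 := predim_le_ncard (Set.univ : Set (RelSym (hatLang n e))) E.base
  have h2 := lt_hatMu (τ := τ) E m
  change delta _ E.base ≤ _
  unfold delta
  omega

/-- The relative type determines the parameter `t`, and injectivity of `τ` then leaves at most one
pair `(i, j)`. So only the symbol `R_i` on the base matters, and `m` is relevant only through its
comparison with one fixed number. -/
lemma isMu_hatMu (hτ : Function.Injective τ) (h4 : ∀ k, 4 ≤ τ k) : IsMu (hatMu n e τ) where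
  lower E _ m := deltaBase_le_hatMu E m
  uniform E₀ _ := by
    have huniq : ∀ {i j i' j'}, IsOmega (τ (Nat.pair i j)) E₀ → IsOmega (τ (Nat.pair i' j')) E₀ →
        i = i' := by
      intro i j i' j' h h'
      exact (Nat.pair_eq_pair.1 (hτ (h.param_unique (h4 _) (h4 _) h'))).1
    refine ⟨{r | ∃ i j, r.2.1 = some i ∧ IsOmega (τ (Nat.pair i j)) E₀}, ?_, ?_⟩
    · refine Set.Subsingleton.finite ?_
      rintro r ⟨i, j, hr, h⟩ s ⟨i', j', hs, h'⟩
      apply relSym_ext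
      rw [hr, hs, huniq h h']
    · intro E₁ E₂ _ _ σ₁ σ₂ h₁ h₂ hbase m
      have hri : ∀ {i j}, IsOmega (τ (Nat.pair i j)) E₁ → (RiOnBase i E₁ ↔ RiOnBase i E₂) := by
        intro i j hij
        have hij' := (h₁.isOmega_iff _).2 hij
        have key : ∀ {E E' : Ext (hatLang n e)} (σ : Fin E₀.size ≃ Fin E.size)
            (σ' : Fin E₀.size ≃ Fin E'.size), E₀.SameRelType E σ → E₀.SameRelType E' σ' →
            (∀ r : RelSym (hatLang n e), (∃ i j, r.2.1 = some i ∧ IsOmega (τ (Nat.pair i j)) E₀) →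
              ∀ x : Fin r.1 → Fin E₀.size,
              (∀ i, x i ∈ E₀.base) → (E.Rel r (σ ∘ x) ↔ E'.Rel r (σ' ∘ x))) →
            RiOnBase i E → RiOnBase i E' := by
          rintro E E' σ σ' h h' hb ⟨hi, x, hx, hR⟩
          have hx0 : ∀ k, σ.symm (x k) ∈ E₀.base := fun k => by
            rw [h.1, σ.apply_symm_apply, ← hx]
            exact ⟨k, rfl⟩
          refine ⟨hi, σ' ∘ σ.symm ∘ x, ?_, ?_⟩
          · rw [← Function.comp_assoc, Set.range_comp, hx]
            ext v
            constructor
            · rintro ⟨w, hw, rfl⟩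
              exact (h'.1 _).1 ((h.1 _).2 (by rwa [σ.apply_symm_apply]))
            · intro hv
              refine ⟨σ (σ'.symm v), (h.1 _).1 ((h'.1 _).2 (by rwa [σ'.apply_symm_apply])), ?_⟩
              simp
          · refine (hb ⟨n + 2, some i, hi⟩ ⟨i, j, rfl, hij'⟩ (σ.symm ∘ x) hx0).1 ?_
            rw [← Function.comp_assoc, σ.self_comp_symm, Function.id_comp]
            exact hR
        exact ⟨key σ₁ σ₂ h₁ h₂ hbase, key σ₂ σ₁ h₂ h₁ fun r hr x hx => (hbase r hr x hx).symm⟩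
      have hom : ∀ t, IsOmega t E₁ ↔ IsOmega t E₂ := fun t =>
        (h₁.isOmega_iff t).symm.trans (h₂.isOmega_iff t)
      unfold hatMu
      rw [← h₁.ncard_base, ← h₂.ncard_base]
      congr 1
      apply propext
      refine or_congr ?_ (or_congr ?_ ?_)
      · refine exists_congr fun i => exists_congr fun j₀ => exists_congr fun j₁ =>
          and_congr_right fun _ => ?_
        rw [← hom]
        exact and_congr_right fun h => hri h
      · refine exists_congr fun i => exists_congr fun j₀ => exists_congr fun j₁ =>
          and_congr_right fun _ => ?_
        rw [← hom]
        exact and_congr_right fun h => and_congr_left fun _ => hri h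
      · simp only [hom]
  limit E _ := by
    by_cases h : ∃ k, IsOmega (τ k) E
    · obtain ⟨k, hk⟩ := h
      filter_upwards [Filter.eventually_ge_atTop k] with m hm
      unfold hatMu
      congr 1
      apply propext
      refine or_congr Iff.rfl (or_congr ?_ Iff.rfl)
      refine exists_congr fun i => exists_congr fun j₀ => exists_congr fun j₁ =>
        and_congr_right fun _ => and_congr_right fun h => and_congr_right fun _ => ?_
      rw [hτ (h.param_unique (h4 _) (h4 _) hk)]
      exact iff_of_true (Nat.cast_le.2 hm) le_top
    · refine .of_forall fun m => ?_
      unfold hatMu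
      congr 1
      apply propext
      refine or_congr Iff.rfl (or_congr ?_ Iff.rfl)
      refine exists_congr fun i => exists_congr fun j₀ => exists_congr fun j₁ =>
        and_congr_right fun _ => and_congr_right fun h' => absurd ⟨_, h'⟩ h

lemma inC0_singleEdge {L : FirstOrder.Language.{0, 0}} [L.IsRelational] (R : L.Relations 3) :
    @InC0 L (Fin 3) (singleEdge R) := by
  let := singleEdge R
  obtain ⟨_, h2⟩ := two_le_delta_singleEdge R
  refine ⟨fun r x σ hx => ⟨hx.1, hx.2.comp σ.injective⟩, fun A _ => ?_⟩
  have hsub : ∀ S : Set (Fin 3), occ (Set.univ : Set (RelSym L)) S ⊆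
      (fun x : Fin 3 → Fin 3 => ((⟨3, R⟩ : RelSym L), Finset.univ.val.map x)) ''
        {x | Function.Injective x ∧ ∀ i, x i ∈ S} := by
    rintro S ⟨⟨k, s⟩, m⟩ ⟨_, x, ⟨hs, hx⟩, hxS, hm⟩
    cases hs
    exact ⟨x, ⟨hx, hxS⟩, Prod.ext rfl hm.symm⟩
  refine ⟨(Set.toFinite _).subset (hsub A), ?_⟩
  by_cases hA : 2 ≤ A.ncard
  · exact (by omega : (0 : ℤ) ≤ 2).trans (h2 A hA)
  · have : occ (Set.univ : Set (RelSym L)) A = ∅ := by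
      refine Set.subset_empty_iff.1 ((hsub A).trans ?_)
      rintro _ ⟨x, ⟨hx, hxA⟩, _⟩
      have h3 := Set.ncard_le_ncard (Set.range_subset_iff.2 hxA) (Set.toFinite A)
      rw [← Set.image_univ, Set.ncard_image_of_injective _ hx, Set.ncard_univ,
        Nat.card_eq_fintype_card, Fintype.card_fin] at h3
      omega
    unfold delta predim
    rw [this, Set.ncard_empty]
    omega

/-- Three points hold at most three disjoint copies of anything, which every value of `μ` permits.
-/
lemma inClass_singleEdge (idx : RelSym (hatLang n e) → ℕ) :
    @InClass _ idx (hatMu n e τ) (hatZeta n e) (Fin 3) (singleEdge (hatR n e).2) := by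
  let := singleEdge (hatR n e).2
  refine ⟨inferInstance, inC0_singleEdge _, fun E hE a r F hF => ?_, fun u v x y huv hx _ hy => ?_,
    fun u x hx => hx.2⟩
  · refine le_trans ?_ (lt_hatMu E _)
    obtain ⟨w, hw⟩ := hE.msa.1.1
    have : Function.Injective fun j => F j w := by
      intro j j' h
      by_contra hne
      exact hF.2.2.2.2.2 j j' hne w hw w hw h
    have := Fintype.card_le_of_injective _ this
    rw [Fintype.card_fin, Fintype.card_fin] at this
    omega
  · exact huv (hx.1.trans hy.1.symm)

end HatMu

/-! ### The last two elements of a column. -/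

section Columns

variable {e : ℕ → ℕ} {i : ℕ}

lemma S0_subset_S1 : S0 e i ⊆ S1 e i := by
  rintro j ⟨s, _, _, _, _, _, _, h, _⟩
  exact ⟨s, h⟩

/-- A column which is not limited away is finite, and its last two elements exist. -/
lemma exists_lastTwo (he : Function.Injective e) (h1 : (S1 e i).Nontrivial) (h : ¬ LimitedAway e i) :
    ∃ j₀ j₁, LastTwo e i j₀ j₁ := by
  obtain ⟨j, ⟨s, hs⟩, hj⟩ : ∃ j ∈ S1 e i, j ∉ S0 e i := by
    by_contra hno
    push Not at hno
    exact h (S0_subset_S1.antisymm hno)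
  have hlater : ∀ t u, s < t → t < u → (∃ j', e t = Nat.pair i j') → ¬ ∃ j'', e u = Nat.pair i j'' :=
    fun t u hst htu ⟨j', ht⟩ ⟨j'', hu⟩ => hj ⟨s, t, u, j', j'', hst, htu, hs, ht, hu⟩
  -- At most one element enters the column after `j`. If one does, it is `j₁` and `j` is `j₀`;
  -- otherwise `j` is `j₁` and `j₀` is the latest earlier element, which exists because the column
  -- has at least two elements.
  by_cases hex : ∃ t, s < t ∧ ∃ j', e t = Nat.pair i j'
  · obtain ⟨t, hst, j', ht⟩ := hex
    refine ⟨j, j', hj, ?_, s, t, hst, hs, ht⟩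
    rintro ⟨t', u, w, a, b, htu, _, ht', hu, _⟩
    obtain rfl := he (ht.trans ht'.symm)
    exact hlater t u hst htu ⟨j', ht⟩ ⟨a, hu⟩
  · push Not at hex
    have hT : {t | t < s ∧ ∃ j', e t = Nat.pair i j'}.Finite := (Set.finite_lt_nat s).subset fun t h => h.1
    obtain ⟨t, ⟨hts, j', ht⟩, hmax⟩ := hT.exists_maximal (by
      obtain ⟨j', ⟨t, ht⟩, hne⟩ := h1.exists_ne j
      refine ⟨t, ?_, j', ht⟩
      rcases lt_trichotomy t s with h | h | h
      · exact h
      · subst h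
        exact absurd (Nat.pair_eq_pair.1 (ht.symm.trans hs)).2 hne
      · exact absurd ht (hex t h j'))
    refine ⟨j', j, ?_, hj, t, s, hts, ht, hs⟩
    rintro ⟨t', u, w, a, b, htu, huw, ht', hu, hw⟩
    obtain rfl := he (ht.trans ht'.symm)
    have hws : w ≤ s := not_lt.1 fun h => hex w h _ hw
    exact absurd (hmax ⟨huw.trans_le hws, a, hu⟩ htu.le) (not_le.2 htu)

end Columns

/-! ### The edge extension over a given tuple. -/

section EdgeStructure

variable {n : ℕ} {e : ℕ → ℕ} {V : Type} [(hatLang n e).Structure V] {k : ℕ}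
  {ed : Fin k → Set (Fin (n + 2) ⊕ Fin k)} {x : Fin (n + 2) → V}

lemma edgeType_edgeStructure (ed : Fin k → Set (Fin (n + 2) ⊕ Fin k)) (x : Fin (n + 2) → V) :
    @EdgeType _ _ n e ed (edgeStructure ed x) := by
  let := edgeStructure (n := n) (e := e) ed x
  intro r z hz
  constructor
  · rintro (⟨y, rfl, _⟩ | ⟨_, h⟩)
    · exact absurd (fun i => ⟨y i, rfl⟩) hz
    · exact h
  · exact fun h => .inr ⟨hz, h⟩

lemma edgeStructure_relMap_inl {r : RelSym (hatLang n e)} (y : Fin r.1 → Fin (n + 2)) :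
    @Structure.RelMap _ _ (edgeStructure ed x) r.1 r.2 (Sum.inl ∘ y) ↔ Structure.RelMap r.2 (x ∘ y) := by
  constructor
  · rintro (⟨y', hy, h⟩ | ⟨h, _⟩)
    · rwa [show y = y' from funext fun i => Sum.inl_injective (congrFun hy i)]
    · exact absurd (fun i => ⟨y i, rfl⟩) h
  · exact fun h => .inl ⟨y, rfl, h⟩

/-- The value `x 0` on the new points is a filler; only the restriction to the base matters. -/
lemma pEmbOn_edgeStructure (hx : Function.Injective x) :
    @PEmbOn _ _ _ (edgeStructure ed x) _ (Set.univ : Set (RelSym (hatLang n e)))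
      (Sum.elim x fun _ : Fin k => x 0) (Set.range Sum.inl) := by
  let := edgeStructure (n := n) (e := e) ed x
  refine ⟨?_, fun r _ z hz => ?_⟩
  · rintro _ ⟨p, rfl⟩ _ ⟨p', rfl⟩ h
    exact congrArg _ (hx h)
  · choose y hy using hz
    obtain rfl : Sum.inl ∘ y = z := funext hy
    exact edgeStructure_relMap_inl y

lemma symmetric_edgeStructure (hV : Symmetric (hatLang n e) V) :
    @Symmetric (hatLang n e) _ (edgeStructure ed x) := by
  rintro r z σ (⟨y, rfl, h⟩ | ⟨hz, h1, h2, q, h3⟩)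
  · exact .inl ⟨y ∘ σ, rfl, hV r _ σ h⟩
  · refine .inr ⟨fun h => hz fun i => ?_, h1, h2.comp σ.injective, q, ?_⟩
    · simpa using h (σ.symm i)
    · rw [Set.range_comp, σ.range_eq_univ, Set.image_univ, h3]

lemma occFin_edgeStructure (hE : EdgeSystem ed) (hx : Function.Injective x)
    (hV : OccFin (hatLang n e) V) :
    @OccFin (hatLang n e) _ (edgeStructure ed x) := by
  let := edgeStructure (n := n) (e := e) ed x
  refine (edgeType_edgeStructure ed x).occFin hE ?_
  have h1 := hV (Sum.elim x (fun _ : Fin k => x 0) '' Set.range Sum.inl) (Set.toFinite _)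
  rw [(pEmbOn_edgeStructure hx).occ_image subset_rfl] at h1
  exact h1.of_finite_image (occMap_injOn (pEmbOn_edgeStructure (e := e) (ed := ed) hx).1
    fun p hp => mem_of_mem_occ hp)

lemma msa_edgeStructure (hE : EdgeSystem ed) (hx : Function.Injective x)
    (hV : OccFin (hatLang n e) V) :
    @MinSimplyAlgebraic (hatLang n e) _ (edgeStructure ed x) (Set.range Sum.inl) (Set.range Sum.inl)ᶜ :=
  let := edgeStructure (n := n) (e := e) ed x
  (edgeType_edgeStructure ed x).minSimplyAlgebraic hE (occFin_edgeStructure hE hx hV)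

lemma strong_edgeStructure (hE : EdgeSystem ed) (hx : Function.Injective x)
    (hV : OccFin (hatLang n e) V) :
    @Strong (hatLang n e) _ (edgeStructure ed x) (Set.range Sum.inl) := by
  let := edgeStructure (n := n) (e := e) ed x
  intro D _ hD
  exact (msa_edgeStructure hE hx hV).1.2.2.1 D hD (by rw [Set.union_compl_self]; exact Set.subset_univ _)

lemma primitive_edgeStructure (hE : EdgeSystem ed) (hx : Function.Injective x)
    (hV : OccFin (hatLang n e) V) :
    @Primitive (hatLang n e) _ (edgeStructure ed x) (Set.range Sum.inl) := by
  let := edgeStructure (n := n) (e := e) ed x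
  exact (msa_edgeStructure hE hx hV).1.2.2.2.2

lemma inC0_edgeStructure (hE : EdgeSystem ed) (hx : Function.Injective x)
    (hV : InC0 (hatLang n e) V) :
    @InC0 (hatLang n e) _ (edgeStructure ed x) := by
  let := edgeStructure (n := n) (e := e) ed x
  have ho := occFin_edgeStructure hE hx hV.occFin
  refine ⟨symmetric_edgeStructure hV.1, fun A hA => ⟨ho A hA, ?_⟩⟩
  refine le_trans ?_ ((strong_edgeStructure hE hx hV.occFin).delta_inter_le ho (Set.toFinite _) hA)
  unfold delta
  rw [← (pEmbOn_edgeStructure hx).predim_image Set.inter_subset_right]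
  exact hV.delta_nonneg (Set.toFinite _)

/-- The critical case is an `R_i` on a subtuple of a new edge. Its entries are `n + 2` distinct base
points, hence all of them, and `not_base_subset` excludes this. -/
lemma hatZeta_edgeStructure (hE : EdgeSystem ed) (hV : hatZeta n e V) :
    @hatZeta n e _ (edgeStructure ed x) := by
  refine ⟨?_, ?_⟩
  · rintro u v z y huv (⟨z', rfl, hz⟩ | ⟨hz, hu, _, q, hq⟩) hyz (⟨y', rfl, hy⟩ | ⟨hy, hv, _⟩)
    · refine hV.1 u v _ _ huv hz ?_ hy
      rintro _ ⟨i, rfl⟩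
      obtain ⟨j, hj⟩ := hyz ⟨i, rfl⟩
      exact ⟨j, congrArg x (Sum.inl_injective hj)⟩
    · refine hy fun i => ?_
      obtain ⟨j, hj⟩ := hyz ⟨i, rfl⟩
      exact ⟨z' j, hj⟩
    · rcases hv : v.2.1 with _ | i
      · exact huv (relSym_ext (hu.trans hv.symm))
      · have hi : Function.Injective y' := (hV.2 v _ hy).of_comp
        have hc : v.1 = n + 2 := by rw [← v.2.2.1, hv]; rfl
        have hs := ((Fintype.bijective_iff_injective_and_card y').2 ⟨hi, by simp [hc]⟩).2
        obtain ⟨p, hp⟩ := hE.not_base_subset q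
        obtain ⟨j, rfl⟩ := hs p
        exact hp (hq ▸ hyz ⟨j, rfl⟩)
    · exact huv (relSym_ext (hu.trans hv.symm))
  · rintro u z (⟨z', rfl, hz⟩ | ⟨_, _, h, _⟩)
    · exact Sum.inl_injective.comp (hV.2 u _ hz).of_comp
    · exact h

end EdgeStructure

/-! ### Too many copies over a tuple force `R_i`. -/

section Copies

/-- `F` is a family of disjoint copies over `x` of the extension given by the edges `ed q`, the
edges being interpreted by `T`. -/
def CopyFamily {P N : Type*} {k s : ℕ} (T : (Fin 3 → N) → Prop) (ed : Fin k → Set (P ⊕ Fin k))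
    (x : P → N) (F : Fin s → Fin k → N) : Prop :=
  (∀ j, Function.Injective (Sum.elim x (F j))) ∧
  (∀ j q (z : Fin 3 → P ⊕ Fin k), Function.Injective z → Set.range z = ed q →
    T (Sum.elim x (F j) ∘ z)) ∧
  ∀ j j', j ≠ j' → ∀ q q', F j q ≠ F j' q'

lemma CopyFamily.comp {P N : Type*} {k s s' : ℕ} {T : (Fin 3 → N) → Prop}
    {ed : Fin k → Set (P ⊕ Fin k)} {x : P → N} {F : Fin s → Fin k → N} (h : CopyFamily T ed x F)
    {f : Fin s' → Fin s} (hf : Function.Injective f) : CopyFamily T ed x fun j => F (f j) :=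
  ⟨fun _ => h.1 _, fun _ => h.2.1 _, fun _ _ hj => h.2.2 _ _ fun h' => hj (hf h')⟩

variable {n : ℕ} {e τ : ℕ → ℕ} {M : Type} [(hatLang n e).Structure M]

/-- The interpretation of the ternary relation. -/
abbrev hatRel (n : ℕ) (e : ℕ → ℕ) {N : Type*} [(hatLang n e).Structure N] (z : Fin 3 → N) : Prop :=
  Structure.RelMap (hatR n e).2 z

/-- The symbol `R_i`. -/
abbrev hatRi (n : ℕ) {e : ℕ → ℕ} {i : ℕ} (hi : ¬ LimitedAway e i) : RelSym (hatLang n e) :=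
  ⟨n + 2, some i, rfl, fun _ h => Option.some.inj h ▸ hi⟩

variable {k : ℕ} {ed : Fin k → Set (Fin (n + 2) ⊕ Fin k)}

/-- The extension given by the edges `ed q`, over a given base. -/
lemma exists_ext_edges (hE : EdgeSystem ed) (hs : InC0 (hatLang n e) M) {x : Fin (n + 2) → M}
    (hx : Function.Injective x) :
    ∃ (E : Ext (hatLang n e)) (f : Fin E.size ≃ Fin (n + 2) ⊕ Fin k), E.IsMSA ∧
      (∀ v, v ∈ E.base ↔ f v ∈ Set.range Sum.inl) ∧
      (∀ (r : RelSym (hatLang n e)) (y : Fin r.1 → Fin E.size), (¬ ∀ i, y i ∈ E.base) →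
        (E.Rel r y ↔ r.2.1 = none ∧ Function.Injective y ∧ ∃ q, Set.range (f ∘ y) = ed q)) ∧
      ∀ (r : RelSym (hatLang n e)) (y : Fin r.1 → Fin E.size) (y' : Fin r.1 → Fin (n + 2)),
        f ∘ y = Sum.inl ∘ y' → (E.Rel r y ↔ Structure.RelMap r.2 (x ∘ y')) := by
  let := edgeStructure (n := n) (e := e) ed x
  obtain ⟨E, f, hf, hb, hc⟩ := exists_ext (L := hatLang n e) (A := Set.range (Sum.inl : Fin (n + 2) → _ ⊕ Fin k))
    (B := (Set.range Sum.inl)ᶜ) (Set.toFinite _) (Set.toFinite _) disjoint_compl_right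
  have hsurj : Function.Surjective f := fun v => by
    by_cases hv : v ∈ Set.range (Sum.inl : Fin (n + 2) → _ ⊕ Fin k)
    · obtain ⟨w, _, hw⟩ := hb.superset hv
      exact ⟨w, hw⟩
    · obtain ⟨w, _, hw⟩ := hc.superset hv
      exact ⟨w, hw⟩
  have hmem : ∀ v, v ∈ E.base ↔ f v ∈ Set.range Sum.inl := fun v => by
    rw [← hb, hf.1.mem_set_image]
  refine ⟨E, Equiv.ofBijective f ⟨hf.1, hsurj⟩, ?_, hmem, fun r y hy => ?_, fun r y y' hy => ?_⟩
  · refine hf.isMSA (symmetric_edgeStructure hs.1) (occFin_edgeStructure hE hx hs.occFin) ?_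
    rw [hb, hc]
    exact msa_edgeStructure hE hx hs.occFin
  · refine (hf.2 r y).trans ((edgeType_edgeStructure ed x r (f ∘ y) fun h => hy fun i =>
      (hmem _).2 (h i)).trans ?_)
    exact and_congr_right fun _ => and_congr_left fun _ => hf.1.of_comp_iff y
  · have hy : f ∘ y = Sum.inl ∘ y' := hy
    refine (hf.2 r y).trans ?_
    rw [hy]
    exact edgeStructure_relMap_inl y'

variable {idx : RelSym (hatLang n e) → ℕ} {i j₀ j₁ : ℕ}

/-- If there are too many copies over `x`, then `R_i` holds of `x`. -/
theorem Rich.relMap_of_copyFamily (h : Rich idx (hatMu n e τ) (hatZeta n e) M)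
    (hτ : Function.Injective τ) (h4 : ∀ k, 4 ≤ τ k) (hi : ¬ LimitedAway e i) (hl : LastTwo e i j₀ j₁)
    (hE : EdgeSystem ed) (hom : ∀ E : Ext (hatLang n e), IsOmega (τ (Nat.pair i j₀)) E ↔
      HasRType E fun s => ∃ q, s = ed q)
    {x : Fin (n + 2) → M} {F : Fin (n + 6) → Fin k → M} (hF : CopyFamily (hatRel n e) ed x F) :
    Structure.RelMap (hatRi n hi).2 x := by
  have hx : Function.Injective x := fun p p' hp => Sum.inl_injective (hF.1 0 hp)
  obtain ⟨E, f, hmsa, hb, hnew, hbase⟩ := exists_ext_edges hE h.inC0 hx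
  have hform : OfForm E (Sum.elim x (F 0) ∘ f) fun j => Sum.elim x (F j) ∘ f := by
    refine ⟨((hF.1 0).comp f.injective).injOn, fun r y hy => ?_, fun j => (hF.1 j).comp f.injective,
      fun j v hv => ?_, fun j r y hy hR => ?_, fun j j' hj v hv v' hv' => ?_⟩
    · choose y' hy' using fun i => (hb _).1 (hy i)
      have h1 : f ∘ y = Sum.inl ∘ y' := funext fun i => (hy' i).symm
      rw [hbase r y y' h1, Function.comp_assoc, h1]
      rfl
    · obtain ⟨p, hp⟩ := (hb v).1 hv
      simp only [Function.comp_apply, ← hp, Sum.elim_inl]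
    · obtain ⟨h1, h2, q, h3⟩ := (hnew r y hy).1 hR
      obtain rfl := eq_hatR h1
      exact hF.2.1 j q (f ∘ y) (f.injective.comp h2) h3
    · have hq : ∀ v ∉ E.base, ∃ q, f v = Sum.inr q := fun v hv => by
        rcases hfv : f v with p | q
        · exact absurd ((hb v).2 ⟨p, hfv.symm⟩) hv
        · exact ⟨q, rfl⟩
      obtain ⟨q, hq1⟩ := hq v hv
      obtain ⟨q', hq2⟩ := hq v' hv'
      simp only [Function.comp_apply, hq1, hq2, Sum.elim_inr]
      exact hF.2.2 j j' hj q q'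
  have hbound := (Rich.strongClass idx (hatMu n e τ) (hatZeta n e)).bound h hmsa hform
  have hO : IsOmega (τ (Nat.pair i j₀)) E := (hom E).2 ⟨f, hb, hnew⟩
  have hcard : E.base.ncard = n + 2 := by
    rw [← Set.ncard_image_of_injective _ f.injective,
      show f '' E.base = Set.range Sum.inl from ?_, ← Set.image_univ,
      Set.ncard_image_of_injective _ Sum.inl_injective, Set.ncard_univ, Nat.card_eq_fintype_card,
      Fintype.card_fin]
    ext v
    constructor
    · rintro ⟨w, hw, rfl⟩
      exact (hb w).1 hw
    · exact fun hv => ⟨f.symm v, (hb _).2 (by rwa [f.apply_symm_apply]), f.apply_symm_apply v⟩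
  have hRi : ∀ {i'}, i = i' → RiOnBase i' E → Structure.RelMap (hatRi n hi).2 x := by
    rintro _ rfl ⟨hi', w, hw, hR⟩
    choose p hp using fun m => (hb (w m)).1 (hw ▸ ⟨m, rfl⟩)
    have h1 := (hbase ⟨n + 2, some i, hi'⟩ w p (funext fun m => (hp m).symm)).1 hR
    have hp1 : Function.Surjective p := fun m => by
      obtain ⟨l, hl⟩ : f.symm (Sum.inl m) ∈ Set.range w :=
        hw ▸ (hb _).2 ⟨m, (f.apply_symm_apply _).symm⟩
      refine ⟨l, Sum.inl_injective (β := Fin k) ?_⟩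
      rw [hp, hl, f.apply_symm_apply]
    let σ := Equiv.ofBijective p ⟨Finite.injective_iff_surjective.2 hp1, hp1⟩
    have h2 := h.inC0.1 ⟨n + 2, some i, hi'⟩ _ σ.symm h1
    rwa [show (x ∘ p) ∘ σ.symm = x from funext fun m => congrArg x (σ.apply_symm_apply m)] at h2
  have hpair : ∀ {i' j'}, IsOmega (τ (Nat.pair i' j')) E → i' = i ∧ j' = j₀ := fun h' =>
    Nat.pair_eq_pair.1 (hτ (h'.param_unique (h4 _) (h4 _) hO))
  -- There are `n + 6` copies over a base of `n + 2` points, so the smaller value `n + 5` is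
  -- impossible. Two of the clauses for the larger value contain `R_i` on the base, and the third
  -- would put `j₀` into `S₀`.
  unfold hatMu at hbound
  split_ifs at hbound with hc
  · rcases hc with ⟨i', _, _, _, h1, h2⟩ | ⟨i', _, _, _, h1, h2, _⟩ | ⟨i', j, hj, h1⟩
    · exact hRi (hpair h1).1.symm h2
    · exact hRi (hpair h1).1.symm h2
    · obtain ⟨rfl, rfl⟩ := hpair h1
      exact absurd hj hl.1
  · omega

lemma Rich.relMap_injective {μ : Ext (hatLang n e) → ℕ∞ → ℕ} (h : Rich idx μ (hatZeta n e) M)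
    {r : RelSym (hatLang n e)} {x : Fin r.1 → M} (hx : Structure.RelMap r.2 x) :
    Function.Injective x := by
  obtain ⟨m, _, f, hf, hfs, hsub⟩ := exists_hull h.inC0 (Set.finite_range x)
  choose x' hx' using fun p => hsub ⟨p, rfl⟩
  obtain rfl : f ∘ x' = x := funext hx'
  exact hf.1.comp ((h.mem _ f hf hfs).zeta.2 r x' ((hf.2 r x').2 hx))

/-- The violation of the bound in the join of `D` with a further copy, if the base of the violation is
not contained in `D`: the copies have distinct edges through a point outside of `D`. -/
lemma card_le_three_of_base_not_mem {D C : Type} [(hatLang n e).Structure D]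
    [(hatLang n e).Structure C] {B : Set C} {u : B → D} {ed : Fin k → Set C}
    (hS : ∀ (r : RelSym (hatLang n e)) (z : Fin r.1 → C), (¬ ∀ i, z i ∈ B) → Structure.RelMap r.2 z →
      ∃ q, Set.range z = ed q)
    (hu : Function.Injective u) (hdeg : ∀ c ∉ B, {q | c ∈ ed q}.ncard ≤ 3) {E : Ext (hatLang n e)}
    (hE : E.IsMSA) {a : Fin E.size → Join u} {r : ℕ} {F : Fin r → Fin E.size → Join u}
    (hF : OfForm E a F) {v : Fin E.size} (hv : v ∈ E.base) (hvD : a v ∉ Set.range (Join.inl u)) :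
    r ≤ 3 := by
  obtain ⟨s, y, hy, hyn, l, hl⟩ := hE.exists_rel hv
  push Not at hyn
  obtain ⟨l', hl'⟩ := hyn
  obtain ⟨c, hcB, hc⟩ := Join.exists_inr u hvD
  have hlift : ∀ j, ∃ z : Fin s.1 → C, F j ∘ y = Join.inr u ∘ z ∧ ∃ q, Set.range z = ed q := by
    intro j
    obtain ⟨z, hz, hzB, hR⟩ := Join.rel_not_inl ((hF.posCopy j).2 s y (fun h => hl' (h l')) hy)
      fun h => hvD (by rw [← hF.2.2.2.1 j v hv, ← hl]; exact h l)
    exact ⟨z, hz, hS s z hzB hR⟩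
  choose z hz q hq using hlift
  -- The edge of each copy contains a new point of that copy, and distinct copies have disjoint new
  -- points, so no edge serves two copies.
  have hinj : Function.Injective q := by
    intro j j' hjj
    by_contra hne
    obtain ⟨m, hm⟩ : z j l' ∈ Set.range (z j') := by rw [hq, ← hjj, ← hq]; exact ⟨l', rfl⟩
    have h1 : F j' (y m) = F j (y l') := by
      have h2 := congrFun (hz j') m
      have h3 := congrFun (hz j) l'
      simp only [Function.comp_apply] at h2 h3
      rw [h2, h3, hm]
    by_cases hb : y m ∈ E.base
    · rw [hF.2.2.2.1 j' _ hb, ← hF.2.2.2.1 j _ hb] at h1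
      exact hl' (hF.2.2.1 j h1 ▸ hb)
    · exact hF.2.2.2.2.2 j' j (Ne.symm hne) _ hb _ hl' h1
  have hmem : ∀ j, q j ∈ {q | c ∈ ed q} := by
    intro j
    change c ∈ ed (q j)
    rw [← hq]
    refine ⟨l, Join.inr_injective hu ?_⟩
    have h2 := congrFun (hz j) l
    simp only [Function.comp_apply] at h2
    rw [← h2, hl, hF.2.2.2.1 j v hv, hc]
  have h1 := Set.ncard_le_ncard (Set.range_subset_iff.2 hmem) (Set.toFinite _)
  rw [← Set.image_univ, Set.ncard_image_of_injective _ hinj, Set.ncard_univ, Nat.card_eq_fintype_card,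
    Fintype.card_fin] at h1
  exact h1.trans (hdeg c hcB)

end Copies

/-! ### A tuple satisfying `R_i` has enough copies. -/

section Copies

variable {n : ℕ} {e τ : ℕ → ℕ} {M : Type} [(hatLang n e).Structure M] {k : ℕ}
  {ed : Fin k → Set (Fin (n + 2) ⊕ Fin k)} {idx : RelSym (hatLang n e) → ℕ} {i j₀ j₁ : ℕ}

/-- A violation of the bound in the join of `D` with a further copy over a tuple satisfying `R_i`
yields many copies inside `D`. -/
lemma exists_copyFamily_of_violation (hi : ¬ LimitedAway e i)
    (hl : LastTwo e i j₀ j₁) (hE : EdgeSystem ed)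
    (hom : ∀ E : Ext (hatLang n e), HasRType E (fun s => ∃ q, s = ed q) →
      IsOmega (τ (Nat.pair i j₀)) E)
    {D : Type} [(hatLang n e).Structure D] (hD : InClass idx (hatMu n e τ) (hatZeta n e) D)
    {x : Fin (n + 2) → D} (hx : Function.Injective x) (hR : Structure.RelMap (hatRi n hi).2 x)
    (C : (hatLang n e).Structure (Fin (n + 2) ⊕ Fin k)) (hC : C = edgeStructure ed x)
    {u : Set.range (Sum.inl : Fin (n + 2) → Fin (n + 2) ⊕ Fin k) → D} (hu : Function.Injective u)
    (hux : ∀ p, u ⟨Sum.inl p, p, rfl⟩ = x p)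
    {E : Ext (hatLang n e)} (hmsa : E.IsMSA) {a : Fin E.size → Join u} {r : ℕ}
    {F : Fin r → Fin E.size → Join u} (hF : OfForm E a F)
    (hr : hatMu n e τ E (gfun idx (a '' E.base)) < r) :
    ∃ G : Fin (n + 6) → Fin k → D, CopyFamily (hatRel n e) ed x G := by
  have := hD.finite
  have hI : InC0 (hatLang n e) (Fin (n + 2) ⊕ Fin k) := hC ▸ inC0_edgeStructure hE hx hD.inC0
  have hS : Strong (hatLang n e) (Set.range (Sum.inl : Fin (n + 2) → Fin (n + 2) ⊕ Fin k)) :=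
    hC ▸ strong_edgeStructure hE hx hD.inC0.occFin
  have hP : Primitive (hatLang n e) (Set.range (Sum.inl : Fin (n + 2) → Fin (n + 2) ⊕ Fin k)) :=
    hC ▸ primitive_edgeStructure hE hx hD.inC0.occFin
  have hT : EdgeType n e ed := hC ▸ edgeType_edgeStructure ed x
  have hux' : ∀ p, Join.inr u (Sum.inl p) = Join.inl u (x p) := fun p => by
    rw [Join.inr_of_mem u ⟨p, rfl⟩, hux]
  have h3 := lt_hatMu (τ := τ) E (gfun idx (a '' E.base))
  -- Every value of `μ` is at least 3, so a violation has more than three copies; this excludes base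
  -- points outside `D`.
  have hbase : ∀ v ∈ E.base, a v ∈ Set.range (Join.inl u) := by
    intro v hv
    by_contra hvD
    have := card_le_three_of_base_not_mem (B := Set.range Sum.inl) (ed := ed)
      (fun r z hz hrz => ((hT r z hz).1 hrz).2.2) hu (fun c hc => by
        rcases c with p | q
        · exact absurd ⟨p, rfl⟩ hc
        · exact hE.deg q) hmsa hF hv hvD
    omega
  obtain ⟨i₀, hi₀⟩ := Join.exists_copy_avoiding (fun E _ m => deltaBase_le_hatMu E m) hD hI hu hS
    hmsa hF hr
  obtain ⟨f, hfF, hpos, hn⟩ := Join.exists_lift hmsa hu (hF.posCopy i₀) hi₀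
  have hfb : ∀ v ∈ E.base, f v ∈ Set.range Sum.inl := fun v hv => by
    rw [← Join.inr_mem_range_inl u, hfF, hF.2.2.2.1 i₀ v hv]
    exact hbase v hv
  obtain ⟨hall, _, hrel⟩ := hpos.exhausts hI.occFin hS hP hmsa hfb hn
  have hedge : ∀ (z : Fin 3 → Fin (n + 2) ⊕ Fin k) q, Function.Injective z → Set.range z = ed q →
      (¬ ∀ i, z i ∈ Set.range Sum.inl) ∧ Structure.RelMap (hatR n e).2 z := by
    intro z q hz hq
    have hzn : ¬ ∀ i, z i ∈ Set.range Sum.inl := fun h => by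
      obtain ⟨l, hl⟩ := hq.superset (hE.mem_self q)
      obtain ⟨p, hp⟩ := h l
      exact Sum.inl_ne_inr (hp.trans hl)
    exact ⟨hzn, (hT (hatR n e) z hzn).2 ⟨rfl, hz, q, hq⟩⟩
  have hsurj : Function.Surjective f := by
    rintro (p | q)
    · obtain ⟨q, hq⟩ := hE.cover p
      obtain ⟨z, hz, hzr⟩ := exists_fin_three (hE.card q)
      obtain ⟨h1, h2⟩ := hedge z q hz hzr
      obtain ⟨y, hy, _⟩ := hrel (hatR n e) z h2 h1
      obtain ⟨l, hl⟩ := hzr.superset hq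
      exact ⟨y l, by rw [← hl, hy]; rfl⟩
    · obtain ⟨v, _, hv⟩ := hall (Sum.inr q) (by rintro ⟨p, hp⟩; exact Sum.inl_ne_inr hp)
      exact ⟨v, hv⟩
  let σ : Fin E.size ≃ Fin (n + 2) ⊕ Fin k := Equiv.ofBijective f ⟨hpos.1, hsurj⟩
  have hσ : ∀ c, f (σ.symm c) = c := σ.apply_symm_apply
  have hb : ∀ v, v ∈ E.base ↔ f v ∈ Set.range Sum.inl := fun v =>
    ⟨hfb v, fun h => by by_contra hv; exact hn v hv h⟩
  -- The copy avoiding `D` exhausts the adjoined extension, so `E` is the extension with index `⟨i,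
  -- j₀⟩`, with `R_i` on its base. Hence `μ` has the value `n + 6`, and there are at least `n + 7`
  -- copies.
  have hO : IsOmega (τ (Nat.pair i j₀)) E := by
    refine hom E ⟨σ, hb, fun s y hy => ?_⟩
    have hy' : ¬ ∀ i, f (y i) ∈ Set.range Sum.inl := fun h => hy fun i => (hb _).2 (h i)
    refine Iff.trans ⟨fun h => hpos.2 s y hy h, fun h => ?_⟩ ((hT s (f ∘ y) hy').trans
      (and_congr_right fun _ => and_congr_left fun _ => hpos.1.of_comp_iff y))
    obtain ⟨y', h1, _, h2⟩ := hrel s _ h hy'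
    rwa [show y = y' from funext fun l => hpos.1 (congrFun h1 l)]
  have hwb : ∀ p, σ.symm (Sum.inl p) ∈ E.base := fun p => (hb _).2 ⟨p, (hσ _).symm⟩
  have haw : ∀ p, a (σ.symm (Sum.inl p)) = Join.inl u (x p) := fun p => by
    rw [← hF.2.2.2.1 i₀ _ (hwb p), ← hfF, hσ, hux']
  have hRi : RiOnBase i E := by
    refine ⟨(hatRi n hi).2.2, fun p => σ.symm (Sum.inl p), ?_, ?_⟩
    · ext v
      constructor
      · rintro ⟨p, rfl⟩
        exact hwb p
      · intro hv
        obtain ⟨p, hp⟩ := hfb v hv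
        exact ⟨p, hpos.1 (by rw [hσ, hp])⟩
    · refine (hF.2.1 (hatRi n hi) (fun p => σ.symm (Sum.inl p)) hwb).1 ?_
      rw [show (a ∘ fun p => σ.symm (Sum.inl p)) = Join.inl u ∘ x from funext haw]
      exact ((Join.isEmb_inl u).2 (hatRi n hi) x).1 hR
  have hcard : E.base.ncard = n + 2 := by
    rw [← Set.ncard_image_of_injective _ hpos.1,
      show f '' E.base = Set.range Sum.inl from ?_, ← Set.image_univ,
      Set.ncard_image_of_injective _ Sum.inl_injective, Set.ncard_univ, Nat.card_eq_fintype_card,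
      Fintype.card_fin]
    ext v
    constructor
    · rintro ⟨w, hw, rfl⟩
      exact (hb w).1 hw
    · exact fun hv => ⟨σ.symm v, (hb _).2 (by rwa [hσ]), hσ v⟩
  have hmu : hatMu n e τ E (gfun idx (a '' E.base)) = n + 6 := by
    unfold hatMu
    rw [if_pos (Or.inl ⟨i, j₀, j₁, hl, hO, hRi⟩), hcard]
  -- The copy `i₀` takes up all points outside `D`, so the others, at least `n + 6` of them, lie in
  -- `D`.
  obtain ⟨r, rfl⟩ : ∃ r', r = r' + 1 := ⟨r - 1, by omega⟩
  have hin : ∀ j v, j ≠ i₀ → F j v ∈ Set.range (Join.inl u) := by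
    intro j v hj
    by_cases hv : v ∈ E.base
    · rw [hF.2.2.2.1 j v hv]
      exact hbase v hv
    · by_contra hvD
      obtain ⟨c, hc, hcv⟩ := Join.exists_inr u hvD
      obtain ⟨w, hw, rfl⟩ := hall c hc
      exact hF.2.2.2.2.2 j i₀ hj v hv w hw (by rw [← hcv, hfF])
  choose G hG using fun (j : Fin r) v => hin (i₀.succAbove j) v (Fin.succAbove_ne i₀ j)
  have hGx : ∀ j p, G j (σ.symm (Sum.inl p)) = x p := fun j p => Join.inl_injective u (by
    rw [hG, hF.2.2.2.1 _ _ (hwb p), haw])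
  have hnb : ∀ q, σ.symm (Sum.inr q) ∉ E.base := fun q h => by
    obtain ⟨p, hp⟩ := (hb _).1 h
    rw [hσ] at hp
    exact Sum.inl_ne_inr hp
  have helim : ∀ j, Sum.elim x (fun q => G j (σ.symm (Sum.inr q))) = fun c => G j (σ.symm c) := by
    intro j
    funext c
    rcases c with p | q
    · exact (hGx j p).symm
    · rfl
  have hfam : CopyFamily (hatRel n e) ed x fun j q => G j (σ.symm (Sum.inr q)) := by
    refine ⟨fun j => ?_, fun j q z hz hq => ?_, fun j j' hj q q' h => ?_⟩
    · rw [helim]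
      intro c c' h
      refine σ.symm.injective (hF.2.2.1 (i₀.succAbove j) ?_)
      rw [← hG, ← hG]
      exact congrArg _ h
    · rw [helim]
      obtain ⟨h1, h2⟩ := hedge z q hz hq
      obtain ⟨y, hy, hyb, hy'⟩ := hrel (hatR n e) z h2 h1
      refine ((Join.isEmb_inl u).2 (hatR n e) _).2 ?_
      have h3 := (hF.posCopy (i₀.succAbove j)).2 (hatR n e) y hyb hy'
      convert h3 using 1
      funext l
      have : σ.symm (z l) = y l := by rw [hy]; exact σ.symm_apply_apply _
      simp only [Function.comp_apply, this, hG]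
    · refine hF.2.2.2.2.2 (i₀.succAbove j) (i₀.succAbove j')
        (fun h' => hj (Fin.succAbove_right_injective h')) _ (hnb q) _ (hnb q') ?_
      rw [← hG, ← hG]
      exact congrArg _ h
  exact ⟨_, hfam.comp (Fin.castLE_injective (by omega : n + 6 ≤ r))⟩

lemma CopyFamily.image {D : Type} [(hatLang n e).Structure D] {f : D → M} (hf : IsEmb (hatLang n e) f)
    {x : Fin (n + 2) → D} {s : ℕ} {F : Fin s → Fin k → D} (h : CopyFamily (hatRel n e) ed x F) :
    CopyFamily (hatRel n e) ed (f ∘ x) fun j q => f (F j q) := by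
  have helim : ∀ j, Sum.elim (f ∘ x) (fun q => f (F j q)) = f ∘ Sum.elim x (F j) := fun j =>
    (Sum.comp_elim f x (F j)).symm
  refine ⟨fun j => ?_, fun j q z hz hq => ?_, fun j j' hj q q' h' => h.2.2 j j' hj q q' (hf.1 h')⟩
  · rw [helim]
    exact hf.1.comp (h.1 j)
  · rw [helim]
    exact (hf.2 (hatR n e) _).1 (h.2.1 j q z hz hq)

/-- Over a tuple satisfying `R_i` there are many copies. -/
theorem Rich.exists_copyFamily (h : Rich idx (hatMu n e τ) (hatZeta n e) M)
    (hi : ¬ LimitedAway e i)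
    (hl : LastTwo e i j₀ j₁) (hE : EdgeSystem ed)
    (hom : ∀ E : Ext (hatLang n e), HasRType E (fun s => ∃ q, s = ed q) →
      IsOmega (τ (Nat.pair i j₀)) E)
    {x : Fin (n + 2) → M} (hR : Structure.RelMap (hatRi n hi).2 x) :
    ∀ s ≤ n + 6, ∃ F : Fin s → Fin k → M, CopyFamily (hatRel n e) ed x F := by
  have hx : Function.Injective x := h.relMap_injective (r := hatRi n hi) hR
  intro s
  induction s with
  | zero => exact fun _ => ⟨fun j => j.elim0, fun j => j.elim0, fun j => j.elim0, fun j => j.elim0⟩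
  | succ s ih =>
    intro hs
    obtain ⟨F, hF⟩ := ih (by omega)
    obtain ⟨m, _, f, hf, hfs, hsub⟩ := exists_hull h.inC0
      ((Set.finite_range x).union (Set.finite_iUnion fun j => Set.finite_range (F j)))
    choose x' hx' using fun p => hsub (Set.mem_union_left _ (Set.mem_range_self (f := x) p))
    choose F' hF' using fun j q =>
      hsub (Set.mem_union_right _ (Set.mem_iUnion.2 ⟨j, Set.mem_range_self (f := F j) q⟩))
    obtain rfl : f ∘ x' = x := funext hx'
    have hD := h.mem (Fin m) f hf hfs
    have hxi : Function.Injective x' := hx.of_comp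
    let C : (hatLang n e).Structure (Fin (n + 2) ⊕ Fin k) := edgeStructure ed x'
    let u : Set.range (Sum.inl : Fin (n + 2) → Fin (n + 2) ⊕ Fin k) → Fin m :=
      fun b => Sum.elim x' (fun _ => x' 0) b.1
    have hup := pEmbOn_edgeStructure (n := n) (e := e) (ed := ed) hxi
    have hu : IsEmb (hatLang n e) u :=
      ⟨fun b b' hb => Subtype.ext (hup.1 b.2 b'.2 hb),
        fun r z => hup.2 r (Set.mem_univ _) (fun i => (z i : _)) fun i => (z i).2⟩
    have hRD : Structure.RelMap (hatRi n hi).2 x' := (hf.2 (hatRi n hi) x').2 hR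
    -- A further copy is adjoined freely. If the join is in the class, richness realizes it, and the
    -- new copy is disjoint from the old ones. If it is not, only the bound can fail, and the
    -- violation exhibits `n + 6` copies at once.
    by_cases hbound : ∀ E : Ext (hatLang n e), E.IsMSA → ∀ (a : Fin E.size → Join u) (r : ℕ)
        (F : Fin r → Fin E.size → Join u), OfForm E a F → r ≤ hatMu n e τ E (gfun idx (a '' E.base))
    · have hJ : InClass idx (hatMu n e τ) (hatZeta n e) (Join u) :=
        ⟨inferInstance, Join.inC0 hD.inC0 (inC0_edgeStructure hE hxi hD.inC0) hu.1
            (strong_edgeStructure hE hxi hD.inC0.occFin), hbound,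
          Join.zeta universallyAxiomatizable_hatZeta preservedByFreeJoins_hatZeta hD.inC0.1
            (symmetric_edgeStructure hD.inC0.1) hD.zeta (hatZeta_edgeStructure hE hD.zeta) hu⟩
      obtain ⟨g, hg, _, hgf⟩ := h.extend (Fin m) (Join u) f (Join.inl u) hf hfs (Join.isEmb_inl u)
        (Join.strong_range_inl hD.inC0.occFin (occFin_edgeStructure hE hxi hD.inC0.occFin) hu.1
          (strong_edgeStructure hE hxi hD.inC0.occFin)) hJ
      let y : Fin k → M := fun q => g (Join.inr u (Sum.inr q))
      have helim : Sum.elim (f ∘ x') y = g ∘ Join.inr u := by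
        funext c
        rcases c with p | q
        · simp only [Sum.elim_inl, Function.comp_apply, Join.inr_of_mem u ⟨p, rfl⟩, hgf]
          rfl
        · rfl
      have hne : ∀ j q q', y q ≠ F j q' := by
        intro j q q' h'
        have h1 : Join.inr u (Sum.inr q) ∈ Set.range (Join.inl u) :=
          ⟨F' j q', hg.1 (by rw [hgf, hF']; exact h'.symm)⟩
        obtain ⟨p, hp⟩ := (Join.inr_mem_range_inl u).1 h1
        exact Sum.inl_ne_inr hp
      refine ⟨Fin.cons y F, fun j => ?_, fun j => ?_, fun j j' => ?_⟩
      · refine Fin.cases ?_ (fun j => ?_) j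
        · rw [Fin.cons_zero, helim]
          exact hg.1.comp (Join.inr_injective hu.1)
        · exact hF.1 j
      · refine Fin.cases ?_ (fun j => ?_) j
        · intro q z hz hq
          rw [Fin.cons_zero, helim]
          refine ((hg.comp (Join.isEmb_inr hu)).2 (hatR n e) z).1 ?_
          refine (edgeType_edgeStructure ed x' (hatR n e) z fun h => ?_).2 ⟨rfl, hz, q, hq⟩
          obtain ⟨l, hl⟩ := hq.superset (hE.mem_self q)
          obtain ⟨p, hp⟩ := h l
          exact Sum.inl_ne_inr (hp.trans hl)
        · exact hF.2.1 j
      · refine Fin.cases ?_ (fun j => ?_) j <;> refine Fin.cases ?_ (fun j' => ?_) j'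
        · exact fun h' => absurd rfl h'
        · exact fun _ q q' => hne j' q q'
        · exact fun _ q q' h' => hne j q' q h'.symm
        · exact fun hj q q' => hF.2.2 j j' (fun h' => hj (congrArg _ h')) q q'
    · push Not at hbound
      obtain ⟨E, hmsa, a, r, F₂, hF₂, hr⟩ := hbound
      obtain ⟨G, hG⟩ := exists_copyFamily_of_violation hi hl hE hom hD hxi hRD C rfl hu.1
        (fun _ => rfl) hmsa hF₂ hr
      exact ⟨_, (hG.image hf).comp (Fin.castLE_injective hs)⟩

end Copies

/-! ### Translation of formulas along definitions. -/

section Translation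

variable {L L' : FirstOrder.Language.{0, 0}} [L.IsRelational]

/-- The variable which a term in a relational language consists of. -/
def termVar {β : Type*} : L.Term β → β
  | .var s => s
  | .func f _ => isEmptyElim f

lemma realize_termVar {β N : Type*} [L.Structure N] (t : L.Term β) (v : β → N) :
    t.realize v = v (termVar t) := by
  cases t with
  | var s => rfl
  | func f _ => exact isEmptyElim f

/-- The translation of formulas which replaces each relation by a defining formula. -/
def translate (φ : ∀ r : RelSym L, L'.Formula (Fin r.1)) {α : Type*} :
    ∀ {m : ℕ}, L.BoundedFormula α m → L'.BoundedFormula α m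
  | _, .falsum => .falsum
  | _, .equal t₁ t₂ => .equal (.var (termVar t₁)) (.var (termVar t₂))
  | _, .rel R ts => BoundedFormula.relabel (fun i => termVar (ts i)) (φ ⟨_, R⟩)
  | _, .imp ψ₁ ψ₂ => .imp (translate φ ψ₁) (translate φ ψ₂)
  | _, .all ψ => .all (translate φ ψ)

variable {N : Type*} [L.Structure N] [L'.Structure N] {φ : ∀ r : RelSym L, L'.Formula (Fin r.1)}

lemma realize_translate (hφ : ∀ (r : RelSym L) (x : Fin r.1 → N), Structure.RelMap r.2 x ↔ (φ r).Realize x)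
    {α : Type*} {m : ℕ} (ψ : L.BoundedFormula α m) (v : α → N) (xs : Fin m → N) :
    (translate φ ψ).Realize v xs ↔ ψ.Realize v xs := by
  induction ψ with
  | falsum => rfl
  | equal t₁ t₂ =>
    simp only [translate, BoundedFormula.Realize, realize_termVar, Term.realize_var]
  | @rel m l R ts =>
    rw [translate, BoundedFormula.realize_relabel]
    simp only [BoundedFormula.Realize, realize_termVar]
    rw [hφ ⟨l, R⟩, Formula.Realize]
    exact iff_of_eq (congrArg₂ _ rfl (Subsingleton.elim _ _))
  | imp _ _ ih₁ ih₂ => exact imp_congr (ih₁ xs) (ih₂ xs)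
  | all _ ih => exact forall_congr' fun a => ih _

lemma acl_subset_of_definable
    (hφ : ∀ (r : RelSym L) (x : Fin r.1 → N), Structure.RelMap r.2 x ↔ (φ r).Realize x) (A : Set N) :
    acl L A ⊆ acl L' A := by
  intro x hx
  obtain ⟨m, ψ, a, ha, h1, h2⟩ := exists_formula_of_mem_acl hx
  have h3 : ∀ v : Fin m ⊕ Unit → N, Formula.Realize (translate φ ψ) v ↔ ψ.Realize v := fun v =>
    realize_translate hφ ψ v _
  refine mem_acl_of_formula (translate φ ψ) ha ((h3 _).2 h1) ?_
  simpa only [h3] using h2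

end Translation

/-! ### The existence of copies is expressible by `R` alone. -/

section Definability

variable {n : ℕ} {e τ : ℕ → ℕ}

/-- The symbol of the language `{R}`. -/
abbrev rSym : rLang.Relations 3 := ⟨rfl⟩

lemma elem_copyFamily {k s : ℕ} {P : Type} [Finite P] (ed : Fin k → Set (P ⊕ Fin k)) :
    Elem (L := rLang) fun (N : Type u) [rLang.Structure N] (x : P → N) =>
      ∃ F : Fin s → Fin k → N, CopyFamily (Structure.RelMap rSym) ed x F := by
  have hel : Elem (L := rLang) fun (N : Type u) [rLang.Structure N] (v : P ⊕ Fin s × Fin k → N) =>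
      CopyFamily (Structure.RelMap rSym) ed (v ∘ Sum.inl) fun j q => v (Sum.inr (j, q)) := by
    refine Elem.of_samePat {⟨3, rSym⟩} (Set.finite_singleton _) ?_
    intro N N' _ _ v v' hv h
    have helim : ∀ {N : Type u} (v : P ⊕ Fin s × Fin k → N) (j : Fin s),
        Sum.elim (v ∘ Sum.inl) (fun q => v (Sum.inr (j, q))) =
          v ∘ (Sum.elim Sum.inl fun q => Sum.inr (j, q)) := by
      intro N v j
      funext c
      rcases c with p | q <;> rfl
    refine ⟨fun j c c' hc => ?_, fun j q z hz hq => ?_, fun j j' hj q q' h' => ?_⟩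
    · rw [helim] at hc
      refine h.1 j ?_
      rw [helim]
      exact (hv.1 _ _).2 hc
    · have := h.2.1 j q z hz hq
      rw [helim, Function.comp_assoc] at this ⊢
      exact (hv.2 ⟨3, rSym⟩ rfl _).1 this
    · exact h.2.2 j j' hj q q' ((hv.1 _ _).2 h')
  refine hel.ex.congr fun N _ x => ⟨?_, ?_⟩
  · rintro ⟨F, hF⟩
    exact ⟨fun jq => F jq.1 jq.2, hF⟩
  · rintro ⟨w, hw⟩
    exact ⟨fun j q => w (j, q), hw⟩

end Definability

/-! ### The reduct to `R` and its theory. -/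

section Definitional

variable {n : ℕ} {e τ : ℕ → ℕ} {idx : RelSym (hatLang n e) → ℕ} {M : Type}
  [(hatLang n e).Structure M]

/-- `φ` defines `r` in the reduct of `M`, and it is the atomic formula if `r` is the ternary symbol. -/
def Defines (M : Type) [(hatLang n e).Structure M] (r : RelSym (hatLang n e))
    (φ : rLang.Formula (Fin r.1)) : Prop :=
  letI := rReduct n e M
  (∀ x : Fin r.1 → M, Structure.RelMap r.2 x ↔ φ.Realize x) ∧
    ∀ h : 3 = r.1, r.2.1 = none →
      φ = Relations.formula (show rLang.Relations r.1 from ⟨h⟩) fun i => Term.var i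

/-- `R_i` is defined by the existence of `n + 6` disjoint copies of the extension with index `⟨i,
j₀⟩`: without `R_i` the bound `μ` forbids that many, and with `R_i` richness provides them. -/
theorem IsGeneric.exists_defines (h : IsGeneric idx (hatMu n e τ) (hatZeta n e) M)
    (he : Function.Injective e) (h1 : ∀ i, (S1 e i).Nontrivial) (hτ : Function.Injective τ)
    (h4 : ∀ k, 4 ≤ τ k ∧ n + 3 ≤ τ k) (r : RelSym (hatLang n e)) :
    ∃ φ : rLang.Formula (Fin r.1), Defines M r φ := by
  let := rReduct n e M
  rcases hr : r.2.1 with _ | i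
  · obtain rfl := eq_hatR hr
    exact ⟨Relations.formula rSym fun i => Term.var i,
      fun x => (Formula.realize_rel (R := rSym) (ts := fun i => Term.var i) (v := x)).symm,
      fun _ _ => rfl⟩
  · have hi : ¬ LimitedAway e i := r.2.2.2 i hr
    obtain rfl : r = hatRi n hi := relSym_ext hr
    obtain ⟨j₀, j₁, hl⟩ := exists_lastTwo he (h1 i) hi
    obtain ⟨k, ed, hE, hom⟩ := exists_edgeSystem n (τ (Nat.pair i j₀)) e (h4 _).1 (h4 _).2
    obtain ⟨φ, hφ⟩ := elem_copyFamily.{0} (s := n + 6) ed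
    have hM := h.rich universallyAxiomatizable_hatZeta (IsoTo.refl M)
    refine ⟨φ, fun x => Iff.trans ⟨fun hR => ?_, ?_⟩ (hφ M x), fun h3 hn => ?_⟩
    · exact hM.exists_copyFamily hi hl hE (fun E => (hom E).2) hR _ le_rfl
    · rintro ⟨F, hF⟩
      exact hM.relMap_of_copyFamily hτ (fun k => (h4 k).1) hi hl hE hom hF
    · cases hn

/-- The expansion of a structure in the language `{R}` in which the symbols are interpreted by
formulas. -/
abbrev expandBy (φ : ∀ r : RelSym (hatLang n e), rLang.Formula (Fin r.1)) (N : Type u)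
    [rLang.Structure N] : (hatLang n e).Structure N where
  funMap f := isEmptyElim f
  RelMap r x := (φ ⟨_, r⟩).Realize x

/-- The atomic formula for the ternary symbol. -/
def ternaryFormula (n : ℕ) (e : ℕ → ℕ) (r : RelSym rLang) : (hatLang n e).Formula (Fin r.1) :=
  Relations.formula ((rIncl n e).onRelation r.2) fun i => Term.var i

variable {φ : ∀ r : RelSym (hatLang n e), rLang.Formula (Fin r.1)}

lemma acl_rLang_eq {N : Type u} [(hatLang n e).Structure N] [rLang.Structure N]
    (h1 : ∀ (r : RelSym (hatLang n e)) (x : Fin r.1 → N), Structure.RelMap r.2 x ↔ (φ r).Realize x)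
    (h2 : ∀ (r : RelSym rLang) (x : Fin r.1 → N), Structure.RelMap r.2 x ↔
      Structure.RelMap ((rIncl n e).onRelation r.2) x) :
    acl rLang (N := N) = acl (hatLang n e) := by
  funext A
  exact (acl_subset_of_definable (φ := ternaryFormula n e) (fun r x => (h2 r x).trans
    (Formula.realize_rel (R := (rIncl n e).onRelation r.2) (ts := fun i => Term.var i)).symm) A).antisymm (acl_subset_of_definable h1 A)

/-- The translation of a sentence true in `M` belongs to the theory of the reduct; read in `N`, it
says that the sentence holds in the expansion. -/
lemma expandBy_models (hφ : ∀ r, Defines M r (φ r)) {N : Type u} [rLang.Structure N]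
    (hN : N ⊨ theoryReduct n e M) :
    letI := expandBy φ N
    N ⊨ (hatLang n e).completeTheory M := by
  let := rReduct n e M
  let := expandBy φ N
  rw [Theory.model_iff]
  intro ψ hψ
  have h1 : M ⊨ ψ := hψ
  have h2 : M ⊨ (translate φ ψ : rLang.Sentence) :=
    (realize_translate (fun r x => (hφ r).1 x) ψ default default).2 h1
  have h3 : N ⊨ (translate φ ψ : rLang.Sentence) := hN.realize_of_mem _ h2
  exact (realize_translate (N := N) (fun r x => Iff.rfl) ψ default default).1 h3

lemma acl_expandBy (hφ : ∀ r, Defines M r (φ r)) (N : Type u) [rLang.Structure N] :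
    letI := expandBy φ N
    acl rLang (N := N) = acl (hatLang n e) := by
  let := expandBy φ N
  refine acl_rLang_eq (φ := φ) (fun r x => Iff.rfl) fun r x => ?_
  obtain ⟨k, ⟨rfl⟩⟩ := r
  change _ ↔ (φ (hatR n e)).Realize x
  -- A formula equivalent to `R` in `M` would not do directly for an arbitrary `N`. As the chosen
  -- one is atomic, `N` is literally the reduct of its expansion.
  rw [(hφ (hatR n e)).2 rfl rfl]
  exact (Formula.realize_rel (R := rSym) (ts := fun i => Term.var i) (v := x)).symm

lemma aclReduct_eq (hφ : ∀ r, Defines M r (φ r)) : aclReduct n e M = acl (hatLang n e) := by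
  let := rReduct n e M
  exact acl_rLang_eq (φ := φ) (fun r x => (hφ r).1 x) fun r x => Iff.rfl

/-- The expansion of the model `ULift M` of the theory of the reduct is isomorphic to `M`. -/
lemma isoTo_expandBy (hφ : ∀ r, Defines M r (φ r)) :
    letI := rReduct n e M
    letI := expandBy φ (ULift.{u} M)
    IsoTo (L := hatLang n e) M (ULift.{u} M) := by
  let := rReduct n e M
  let := expandBy φ (ULift.{u} M)
  refine ⟨ULift.up, ⟨ULift.up_injective, fun r x => ((hφ r).1 x).trans ?_⟩, ULift.up_surjective⟩
  let f : M ≃[rLang] ULift.{u} M := ⟨Equiv.ulift.symm, fun f => isEmptyElim f, fun _ _ => Iff.rfl⟩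
  exact (StrongHomClass.realize_formula f (φ r)).symm

lemma IsGeneric.not_disintegrated_reduct (h : IsGeneric idx (hatMu n e τ) (hatZeta n e) M)
    (hτ : Function.Injective τ) (h4 : ∀ k, 4 ≤ τ k ∧ n + 3 ≤ τ k) (hφ : ∀ r, Defines M r (φ r)) :
    ¬ DisintegratedTheory.{u} (theoryReduct n e M) := by
  intro hdis
  let := rReduct n e M
  have h1 := hdis (ULift.{u} M) (ulift_models M)
  rw [acl_expandBy hφ] at h1
  let := expandBy φ (ULift.{u} M)
  exact h.not_disintegrated (isMu_hatMu hτ fun k => (h4 k).1) universallyAxiomatizable_hatZeta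
    preservedByFreeJoins_hatZeta (inClass_singleEdge idx) (isoTo_expandBy hφ) h1

lemma IsGeneric.flatTheory_reduct (h : IsGeneric idx (hatMu n e τ) (hatZeta n e) M)
    (hτ : Function.Injective τ) (h4 : ∀ k, 4 ≤ τ k ∧ n + 3 ≤ τ k) (hφ : ∀ r, Defines M r (φ r))
    (hidx : Function.Injective idx) (hn : 1 ≤ n ∨ Finite (RelSym (hatLang n e))) :
    FlatTheory.{u} (theoryReduct n e M) := by
  intro N _ hN
  rw [acl_expandBy hφ]
  have hN' := expandBy_models hφ hN
  let := expandBy φ N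
  refine h.flatTheory hidx (isMu_hatMu hτ fun k => (h4 k).1) universallyAxiomatizable_hatZeta
    preservedByFreeJoins_hatZeta ?_ N hN'
  rcases hn with hn | hn
  · exact joinDetermined_hatZeta hn
  · exact joinDetermined_of_finite universallyAxiomatizable_hatZeta preservedByFreeJoins_hatZeta
      (.inl hn)

end Definitional

end HrushovskiGeneric

theorem mainTheorem5 :
    -- the generic model of an arbitrary class
    (∀ (L : FirstOrder.Language.{0, 0}) [L.IsRelational] (idx : HrushovskiGeneric.RelSym L → ℕ),
      Function.Injective idx →
      ∀ μ : HrushovskiGeneric.Ext L → ℕ∞ → ℕ, HrushovskiGeneric.IsMu μ →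
      ∀ Z : HrushovskiGeneric.StrProp L, HrushovskiGeneric.UniversallyAxiomatizable Z →
        HrushovskiGeneric.PreservedByFreeJoins Z →
      ∀ (M : Type) [L.Structure M], HrushovskiGeneric.IsGeneric idx μ Z M →
        HrushovskiGeneric.GeometryGivenByD L (HrushovskiGeneric.acl L (N := M)) ∧
        HrushovskiGeneric.Flat (HrushovskiGeneric.acl L (N := M)) ∧
        (Finite (HrushovskiGeneric.RelSym L) ∨ HrushovskiGeneric.UniversalSentence Z →
          HrushovskiGeneric.FlatTheory.{w} (L.completeTheory M)) ∧
        (∀ R : L.Relations 3,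
          @HrushovskiGeneric.InClass L idx μ Z (Fin 3) (HrushovskiGeneric.singleEdge R) →
            ¬ HrushovskiGeneric.Disintegrated (HrushovskiGeneric.acl L (N := M)) ∧
            ¬ HrushovskiGeneric.DisintegratedTheory.{w} (L.completeTheory M))) ∧
    -- the particular theory in the language of one ternary relation
    (∀ (n : ℕ) (e : ℕ → ℕ), Computable e → Function.Injective e →
      (∀ i, (HrushovskiGeneric.S1 e i).Nontrivial) →
      ∀ τ : ℕ → ℕ, Function.Injective τ → (∀ k, 4 ≤ τ k ∧ n + 3 ≤ τ k) →
      ∀ idx : HrushovskiGeneric.RelSym (HrushovskiGeneric.hatLang n e) → ℕ,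
        (∀ r s, HrushovskiGeneric.hatPos r < HrushovskiGeneric.hatPos s → idx r < idx s) →
      ∀ (M : Type) [(HrushovskiGeneric.hatLang n e).Structure M],
        HrushovskiGeneric.IsGeneric idx (HrushovskiGeneric.hatMu n e τ)
          (HrushovskiGeneric.hatZeta n e) M →
        HrushovskiGeneric.DefinitionalExpansion n e M ∧
        HrushovskiGeneric.GeometryGivenByD (HrushovskiGeneric.hatLang n e)
          (HrushovskiGeneric.aclReduct n e M) ∧
        HrushovskiGeneric.Flat (HrushovskiGeneric.aclReduct n e M) ∧
        ¬ HrushovskiGeneric.Disintegrated (HrushovskiGeneric.aclReduct n e M) ∧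
        ¬ HrushovskiGeneric.DisintegratedTheory.{w} (HrushovskiGeneric.theoryReduct n e M) ∧
        (1 ≤ n ∨ Finite (HrushovskiGeneric.RelSym (HrushovskiGeneric.hatLang n e)) →
          HrushovskiGeneric.FlatTheory.{w} (HrushovskiGeneric.theoryReduct n e M))) := by
  open HrushovskiGeneric in
  refine ⟨?_, ?_⟩
  · intro L _ idx hidx μ hμ Z hZ hZ' M _ h
    have hd := h.givenByD hμ hZ hZ'
    refine ⟨hd.geometryGivenByD h.inC0, hd.flat h.inC0, fun hf =>
      h.flatTheory hidx hμ hZ hZ' (joinDetermined_of_finite hZ hZ' hf), fun R hR => ⟨?_, fun hdis => ?_⟩⟩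
    · exact h.not_disintegrated hμ hZ hZ' hR (IsoTo.refl M)
    · exact h.not_disintegrated hμ hZ hZ' hR (isoTo_ulift.{w} M) (hdis _ (ulift_models M))
  · intro n e _ he h1 τ hτ h4 idx hidx M _ h
    choose φ hφ using h.exists_defines he h1 hτ h4
    have hμ := isMu_hatMu (n := n) (e := e) hτ fun k => (h4 k).1
    have hd := h.givenByD hμ universallyAxiomatizable_hatZeta preservedByFreeJoins_hatZeta
    rw [aclReduct_eq hφ]
    exact ⟨fun r => ⟨φ r, (hφ r).1⟩, hd.geometryGivenByD h.inC0, hd.flat h.inC0,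
      h.not_disintegrated hμ universallyAxiomatizable_hatZeta preservedByFreeJoins_hatZeta
        (inClass_singleEdge idx) (IsoTo.refl M), h.not_disintegrated_reduct hτ h4 hφ,
      h.flatTheory_reduct hτ h4 hφ (injective_of_hatPos hidx)⟩
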